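/- Let $n,m\ge 1$, write $\mathbb{R}^{1+n}_+=\{(t,x):t>0,\ x\in\mathbb{R}^n\}$, and let $A=(A_{i,j}^{\alpha,\beta})$, $0\le i,j\le n$, $1\le\alpha,\beta\le m$, be a bounded measurable complex matrix function on $\mathbb{R}^{1+n}_+$. Put $A\xi\cdot\overline{\eta}=\sum A_{i,j}^{\alpha,\beta}\xi_j^\beta\overline{\eta_i^\alpha}$. Consider the Gårding inequality $$\int_{\mathbb{R}^{1+n}_+}\mathrm{Re}\,(A\nabla g\cdot\overline{\nabla g})\ \ge\ \lambda\sum_{i,\alpha}\int_{\mathbb{R}^{1+n}_+}|\partial_i g^\alpha|^2 \qquad (\lambda>0).\tag{G}$$ An energy solution of $\mathrm{div}\,A\nabla u=0$ is a weak solution $u\in L^2_{loc}(\mathbb{R}^{1+n}_+;\mathbb{C}^m)$ with $\nabla u\in L^2(\mathbb{R}^{1+n}_+)$. Its trace $u_0$ is the limit of $u(t,\cdot)$ in $L^2_{loc}(\mathbb{R}^n)$ as $t\to0^+$, its regularity data is the distributional gradient $\nabla u_0$ on $\mathbb{R}^n$, and its Neumann data is the conormal derivative $\partial_{\nu_A}u_0$,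 the distribution on $\mathbb{R}^n$ with $\int_{\mathbb{R}^{1+n}_+} A\nabla u\cdot\overline{\nabla\phi}=-\langle\partial_{\nu_A}u_0,\phi_0\rangle$ for all $\phi\in L^2_{loc}$ with $\nabla \phi\in L^2(\mathbb{R}^{1+n}_+)$ and Schwartz trace $\phi_0$. Let $\frac{n}{n+1}<p\le1$, and let $H^p$ be the real Hardy space on $\mathbb{R}^n$, with the $L^p$ quasi-norm of the grand maximal function (infinite for tempered distributions outside $H^p$). $H^p_\nabla$ is the subspace of curl-free elements of $H^p(\mathbb{R}^n;(\mathbb{C}^m)^n)$, with the same quasi-norm. A smooth 2-atom for $H^p(\mathbb{R}^n;\mathbb{C}^m)$ is a function $a\in C_0^\infty$, supported in a ball of radius $r$, with $\|a\|_2\le r^{-n(1/p-1/2)}$ and $\int a=0$. A smooth 2-atom for $H^p_\nabla$ is a function $a=\nabla b$ with $b\in C^\infty(\mathbb{R}^n;\mathbb{C}^m)$, $a$ and $b$ supported in a ball of radius $r$, $\|a\|_2\le r^{-n(1/p-1/2)}$ and $\|b\|_2\le r^{1-n(1/p-1/2)}$. (i) Assume (G) for all $g\in C^1(\mathbb{R}^{1+n}_+;\mathbb{C}^m)$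 with compact support in $\mathbb{R}^{1+n}_+$. If $\|\partial_{\nu_A}u_0\|_{H^p}\le C_p$ for all energy solutions $u$ whose regularity data $\nabla u_0$ is a smooth 2-atom for $H^p_\nabla$, then there is $C'$ such that $$\|\partial_{\nu_A}u_0\|_{H^p}\le C'\,\|\nabla u_0\|_{H^p_\nabla}\quad\text{for all energy solutions } u .$$ (ii) Assume (G) for all $g\in C^1(\mathbb{R}^{1+n};\mathbb{C}^m)$ with compact support in $\mathbb{R}^{1+n}$ (the integrals remaining over $\mathbb{R}^{1+n}_+$). If $\|\nabla u_0\|_{H^p_\nabla}\le C_p$ for all energy solutions $u$ whose Neumann data $\partial_{\nu_A}u_0$ is a smooth 2-atom for $H^p(\mathbb{R}^n;\mathbb{C}^m)$, then there is $C'$ such that $$\|\nabla u_0\|_{H^p_\nabla}\le C'\,\|\partial_{\nu_A}u_0\|_{H^p}\quad\text{for all energy solutions } u .$$ In both parts $C'$ depends only on $n$, $m$, $p$, $C_p$, $\lambda$ and a bound for $\|A\|_\infty$. -/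

import Mathlib

open MeasureTheory Filter Topology SchwartzMap
open scoped ContDiff ENNReal NNReal

namespace HalfSpace

/-- Boundary space `ℝⁿ` with the Euclidean norm. -/
abbrev Rn (n : ℕ) := EuclideanSpace ℝ (Fin n)

/-- `ℂᵐ` with the Hermitian norm. -/
abbrev Cm (m : ℕ) := EuclideanSpace ℂ (Fin m)

/-- `(ℂᵐ)ⁿ` with the Hermitian norm; the entry `(j, α)` stands for `∂_j` of the component `α`. -/
abbrev Cnm (n m : ℕ) := EuclideanSpace ℂ (Fin n × Fin m)

/-- `ℝ^{1+n} = ℝ × ℝⁿ`, with points `(t, x)`. -/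
abbrev Pt (n : ℕ) := ℝ × Rn n

/-- Gradients on `ℝ^{1+n}` of `ℂᵐ`-valued functions: `ξ i α`, where `i = 0` is the `t`-derivative. -/
abbrev Grad (n m : ℕ) := Fin (n + 1) → Fin m → ℂ

/-- Coefficients `A(𝐱) i j α β`. -/
abbrev Coeff (n m : ℕ) := Pt n → Fin (n + 1) → Fin (n + 1) → Fin m → Fin m → ℂ

/-- The open upper half-space `(0, ∞) × ℝⁿ`. -/
def upper (n : ℕ) : Set (Pt n) := {z | 0 < z.1}

/-- Coordinate directions of `ℝ^{1+n}`; number `0` is the `t`-direction. -/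
noncomputable def dir {n : ℕ} : Fin (n + 1) → Pt n :=
  Fin.cases ((1 : ℝ), (0 : Rn n)) (fun j => ((0 : ℝ), EuclideanSpace.single j (1 : ℝ)))

/-- The classical gradient on `ℝ^{1+n}`. -/
noncomputable def grad {n m : ℕ} (g : Pt n → Cm m) (z : Pt n) : Grad n m :=
  fun i α => fderiv ℝ (fun y => g y α) z (dir i)

/-- `A(𝐱) ξ · conj η`. -/
noncomputable def form {n m : ℕ} (A : Coeff n m) (z : Pt n) (ξ η : Grad n m) : ℂ :=
  ∑ i, ∑ j, ∑ α, ∑ β, A z i j α β * ξ j β * (starRingEnd ℂ) (η i α)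

/-- `A` is measurable and bounded by `Λ` almost everywhere on the upper half-space. -/
def IsBoundedCoeff {n m : ℕ} (A : Coeff n m) (Λ : ℝ) : Prop :=
  ∀ i j α β,
    AEStronglyMeasurable (fun z => A z i j α β) (volume.restrict (upper n)) ∧
    ∀ᵐ z ∂(volume.restrict (upper n)), ‖A z i j α β‖ ≤ Λ

/-- The inequality `∫ Re (A ∇g · conj ∇g) ≥ lam ∑ ∫ |∂_i g^α|²` over the upper half-space. -/
def GardingAt {n m : ℕ} (A : Coeff n m) (lam : ℝ) (g : Pt n → Cm m) : Prop :=
  lam * ∑ i, ∑ α, ∫ z in upper n, ‖grad g z i α‖ ^ 2 ≤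
    ∫ z in upper n, (form A z (grad g z) (grad g z)).re

/-- Gårding inequality on `C¹` functions with compact support in the open upper half-space. -/
def Garding {n m : ℕ} (A : Coeff n m) (lam : ℝ) : Prop :=
  ∀ g : Pt n → Cm m, ContDiff ℝ 1 g → HasCompactSupport g → tsupport g ⊆ upper n →
    GardingAt A lam g

/-- The stronger Gårding inequality: `C¹` functions with compact support in `ℝ^{1+n}`, with
integrals still over the upper half-space. -/
def StrongGarding {n m : ℕ} (A : Coeff n m) (lam : ℝ) : Prop :=
  ∀ g : Pt n → Cm m, ContDiff ℝ 1 g → HasCompactSupport g → GardingAt A lam g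

/-- `u` belongs to the homogeneous energy space on the upper half-space (it is locally square
integrable there, with square integrable weak gradient), and `G` is its weak gradient. -/
structure IsEnergy {n m : ℕ} (u : Pt n → Cm m) (G : Pt n → Grad n m) : Prop where
  locL2 : ∀ K : Set (Pt n), IsCompact K → K ⊆ upper n → MemLp u 2 (volume.restrict K)
  gradL2 : ∀ i α, MemLp (fun z => G z i α) 2 (volume.restrict (upper n))
  weakGrad : ∀ i α, ∀ φ : Pt n → ℝ, ContDiff ℝ ∞ φ → HasCompactSupport φ →
    tsupport φ ⊆ upper n →
    ∫ z in upper n, u z α * (fderiv ℝ φ z (dir i) : ℂ) = -∫ z in upper n, G z i α * (φ z : ℂ)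

/-- `f` is the trace of `u` at `t = 0`: `u(t, ·) → f` in `L²_loc(ℝⁿ)` as `t → 0+`. The limit is an
essential one in `t` (along `t` outside null sets), so that it does not depend on the choice of `u`
in its class modulo null sets; for the representative in `C([0, ∞); L²_loc)` it is the usual
limit. -/
def IsTrace {n m : ℕ} (u : Pt n → Cm m) (f : Rn n → Cm m) : Prop :=
  (∀ K : Set (Rn n), IsCompact K → MemLp f 2 (volume.restrict K)) ∧
  ∀ K : Set (Rn n), IsCompact K →
    Tendsto (fun t : ℝ => eLpNorm (fun x => u (t, x) - f x) 2 (volume.restrict K))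
      (𝓝[>] 0 ⊓ ae volume) (𝓝 0)

/-- `u`, with weak gradient `G`, is an energy solution of `div A ∇ u = 0` in the upper
half-space. -/
def IsEnergySolution {n m : ℕ} (A : Coeff n m) (u : Pt n → Cm m) (G : Pt n → Grad n m) : Prop :=
  IsEnergy u G ∧
  ∀ φ : Pt n → Cm m, ContDiff ℝ ∞ φ → HasCompactSupport φ → tsupport φ ⊆ upper n →
    ∫ z in upper n, form A z (G z) (grad φ z) = 0

/-- The distribution `R` is the tangential gradient at the boundary `∇_x u|_{t=0}` (the regularity
data) of `u`: the distributional gradient on `ℝⁿ` of the trace of `u`. -/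
def IsRegularityData {n m : ℕ} (u : Pt n → Cm m) (R : 𝓢'(Rn n, Cnm n m)) : Prop :=
  ∃ f : Rn n → Cm m, IsTrace u f ∧
    ∀ ψ : 𝓢(Rn n, ℂ), HasCompactSupport ψ → ∀ (j : Fin n) (α : Fin m),
      (R ψ) (j, α) = -∫ x, f x α * fderiv ℝ ψ x (EuclideanSpace.single j (1 : ℝ))

/-- The distribution `T` is the conormal derivative at the boundary (the Neumann data) of the
energy solution with weak gradient `G`: `∫ A ∇u · conj ∇Φ = -⟨T, Φ₀⟩` for `Φ` in the energy
space with trace `Φ₀`. The pairing is sesquilinear, that is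
`⟨T, Φ₀⟩ = ∑ α, T^α (conj Φ₀^α)`; below, `ψ` is `conj Φ₀`. -/
def IsConormal {n m : ℕ} (A : Coeff n m) (G : Pt n → Grad n m) (T : 𝓢'(Rn n, Cm m)) : Prop :=
  ∀ (Φ : Pt n → Cm m) (H : Pt n → Grad n m) (ψ : Fin m → 𝓢(Rn n, ℂ)), IsEnergy Φ H →
    IsTrace Φ (fun x => WithLp.toLp 2 (fun α => (starRingEnd ℂ) (ψ α x))) →
    ∫ z in upper n, form A z (G z) (H z) = -∑ α, (T (ψ α)) α

/-- The distribution `T` is the (locally integrable) function `a`. -/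
def IsFunction {n : ℕ} {F : Type*} [NormedAddCommGroup F] [NormedSpace ℂ F]
    (T : 𝓢'(Rn n, F)) (a : Rn n → F) : Prop :=
  ∀ ψ : 𝓢(Rn n, ℂ), T ψ = ∫ x, ψ x • a x

/-- Normalized Schwartz functions: finitely many Schwartz seminorms are at most `1`. The order
`2n + 4` is large enough for the grand maximal function to characterize `H^p(ℝⁿ)` for all
`p > n/(n+1)`. -/
def IsNormalized {n : ℕ} (φ : 𝓢(Rn n, ℂ)) : Prop :=
  ∀ k ≤ 2 * n + 4, ∀ x, (1 + ‖x‖) ^ (2 * n + 4) * ‖iteratedFDeriv ℝ k φ x‖ ≤ 1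

/-- The grand maximal function `sup |(φ_t * T)(x)|` over `t > 0` and normalized `φ`, where
`φ_t(y) = t⁻ⁿ φ(y/t)`; below, `ψ` is `y ↦ φ_t(x - y)`. -/
noncomputable def grandMax {n : ℕ} {F : Type*} [NormedAddCommGroup F] [NormedSpace ℂ F]
    (T : 𝓢'(Rn n, F)) (x : Rn n) : ℝ≥0∞ :=
  ⨆ (ψ : 𝓢(Rn n, ℂ)) (_ : ∃ (φ : 𝓢(Rn n, ℂ)) (t : ℝ), IsNormalized φ ∧ 0 < t ∧
    ∀ y, ψ y = ((t ^ n)⁻¹ : ℝ) • φ (t⁻¹ • (x - y))), ‖T ψ‖ₑ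

/-- The quasi-norm of the real Hardy space `H^p(ℝⁿ; F)`, for `n/(n+1) < p ≤ 1`: the `L^p` norm of
the grand maximal function. It is `∞` exactly when `T` does not belong to `H^p(ℝⁿ; F)`. The space
`H^p_∇` of curl-free elements carries the same quasi-norm. -/
noncomputable def hardyNorm {n : ℕ} {F : Type*} [NormedAddCommGroup F] [NormedSpace ℂ F]
    (p : ℝ) (T : 𝓢'(Rn n, F)) : ℝ≥0∞ :=
  (∫⁻ x, grandMax T x ^ p) ^ (1 / p)

/-- Smooth `2`-atoms for `H^p(ℝⁿ; ℂᵐ)`. -/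
def IsSmoothAtom {n m : ℕ} (p : ℝ) (a : Rn n → Cm m) : Prop :=
  ContDiff ℝ ∞ a ∧ ∃ (x₀ : Rn n) (r : ℝ), 0 < r ∧
    tsupport a ⊆ Metric.ball x₀ r ∧
    eLpNorm a 2 volume ≤ ENNReal.ofReal (r ^ (-(n * (1 / p - 1 / 2)) : ℝ)) ∧
    ∫ x, a x = 0

/-- The classical gradient on `ℝⁿ`. -/
noncomputable def tanGrad {n m : ℕ} (b : Rn n → Cm m) (x : Rn n) : Cnm n m :=
  WithLp.toLp 2 (fun k : Fin n × Fin m =>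
    fderiv ℝ (fun y => b y k.2) x (EuclideanSpace.single k.1 (1 : ℝ)))

/-- Smooth `2`-atoms for `H^p_∇(ℝⁿ; (ℂᵐ)ⁿ)`: `a = ∇b` with `b` smooth. -/
def IsSmoothGradAtom {n m : ℕ} (p : ℝ) (a : Rn n → Cnm n m) : Prop :=
  ∃ b : Rn n → Cm m, ContDiff ℝ ∞ b ∧ a = tanGrad b ∧
    ∃ (x₀ : Rn n) (r : ℝ), 0 < r ∧
      tsupport a ⊆ Metric.ball x₀ r ∧ tsupport b ⊆ Metric.ball x₀ r ∧
      eLpNorm a 2 volume ≤ ENNReal.ofReal (r ^ (-(n * (1 / p - 1 / 2)) : ℝ)) ∧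
      eLpNorm b 2 volume ≤ ENNReal.ofReal (r ^ (1 - n * (1 / p - 1 / 2) : ℝ))

end HalfSpace

open HalfSpace

/-! Write V for the closure, in L² of the half-space, of the gradients of test functions on all of
space, and V₀ for the closure of those supported in the open half-space. V consists of the gradients
of functions of finite energy, and V₀ of those whose trace is constant (`exists_energy_of_mem`,
`mem_energySpace_univ`, `mem_energySpace_upper`, `mem_energySpace_upper_of_reg_eq_zero`). A field F
in V belongs to an energy solution exactly when AF is orthogonal to V₀. The Gårding inequality makes
A coercive on V₀ in part (i) and on V in part (ii), so Lax–Milgram gives bounded solution operators.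

Both kinds of data come from one boundary pairing, `surf`, which tests a field against the gradient
of an extension of a boundary function. The Neumann data is `surf (-AF)`. The regularity data has
components `surf (rot q F)`, where `rot q` exchanges the vertical and the q-th component up to sign;
rotated gradients are divergence free. Both data are therefore continuous in the field as
distributions.

Convergence of an atomic decomposition in H^p would say nothing about solutions, so the atoms have
to be compatible with the energy topology. They are built from a Calderón formula. With `phi = eta *
eta`, `psi = eta_1 - eta` and `theta = eta_1 + eta`, where the subscript denotes the dilate, one has
`psi * theta = phi_1 - phi`. Summing over scales -N ≤ j < N thus replaces the data by its average at
scale 2^(-N) minus its average at scale 2^N. On the level of fields this is a horizontal average,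
and it converges weakly to the field (`tendsto_havg_sub`).

Let M be the grand maximal function of the data. At each scale the function `F_j`, which is `theta_j
* T` in part (ii), is dominated by M and lies in L² (`memLp_two_of_le`). A Whitney partition of the
level sets of M splits it into pieces which sum to it in L² (`tendsto_sum_piece`). For one Whitney
cube of size 2^(-l) at level 2^k, the sum over all scales of the convolved pieces is smooth, is
supported in a fixed multiple of the cube and is bounded by a constant times 2^k, uniformly in the
range of scales, because the main terms telescope (`norm_sum_conv_piece_le`). It is a multiple of an
atom, and the p-th powers of the multiples add up to at most a constant times the integral of M^p
(`exists_sum_whitney_le`). The hypothesis on atoms, the subadditivity of the p-th power of the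
quasi-norm and its lower semicontinuity (`hardyPow_le_of_tendsto`) give the theorem;
`hardyPow_le_of_piece` combines them.

The pieces must also be data of fields. In part (ii) `psi` is the divergence of a compactly
supported field `kap`, so convolution with `psi_j` lifts to a divergence free field (`divExt`). In
part (i) the atoms must be gradients: the convolution kernel is the gradient of `theta_j`, and `F_j`
is the sum over s of `kap_s * R_s` at scale j. Since the regularity data R is curl free, the same
telescoping holds for every component (`conv_fluxSmear`). -/

namespace HalfSpace

noncomputable section

open scoped InnerProductSpace
open ENNReal (ofReal ofReal_mul ofReal_ne_top ofReal_le_ofReal ofReal_pow mul_ne_top mul_lt_top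
  ofReal_one ofReal_ofNat mul_rpow_of_nonneg pow_lt_top ofReal_rpow_of_pos ofReal_add ofReal_toReal
  ofReal_pos rpow_le_rpow)
open Finset (sum_congr sum_le_sum mem_filter mul_sum Iic sum_insert smul_sum sum_mul sum_eq_single
  sum_nonneg sum_eq_zero sum_comm sum_add_distrib single_le_sum prod_le_one sum_const sum_filter
  abs_prod prod_nonneg)
open Metric (ball closedBall ball_subset_closedBall measure_ball_pos isOpen_ball
  isClosed_closedBall)
open EuclideanSpace (single proj)
open Set (univ Ioc indicator_of_mem indicator_of_notMem indicator Ioi)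
open Real (norm_of_nonneg norm_eq_abs)
open Complex (continuous_ofReal)
open ContinuousLinearMap (lsmul inr)
open PiLp (continuous_toLp norm_apply_le)

/-- `ℂ^{(1+n)m}` with the Hermitian norm: the values of gradients. -/
abbrev Evec (n m : ℕ) := EuclideanSpace ℂ (Fin (n + 1) × Fin m)

/-- Lebesgue measure on the upper half-space. -/
abbrev upperMeasure (n : ℕ) : Measure (Pt n) := volume.restrict (upper n)

/-- The Hilbert space of square integrable fields on the upper half-space. -/
abbrev L2up (n m : ℕ) := Lp (Evec n m) 2 (upperMeasure n)

variable {n m : ℕ} {F : L2up n m} {φ h ρ θ : Rn n → ℝ} {f : Rn n → Cm m} {g u : Pt n → Cm m}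
  {G : Pt n → Grad n m} {M : Rn n → ℝ≥0∞} {A : Coeff n m} {Λ p B : ℝ} {x y : Rn n} {j : ℤ}
  {E : Type*} [NormedAddCommGroup E] [NormedSpace ℂ E] {T : 𝓢'(Rn n, E)}

/-! ### Coercive operators on Hilbert spaces -/

section LaxMilgram

variable {H : Type*} [NormedAddCommGroup H] [InnerProductSpace ℂ H] [CompleteSpace H]

/-- A coercive bounded operator on a complex Hilbert space is bijective. -/
theorem bijective_of_coercive (L : H →L[ℂ] H) {c : ℝ} (hc : 0 < c)
    (h : ∀ v, c * ‖v‖ ^ 2 ≤ (⟪v, L v⟫_ℂ).re) : Function.Bijective L := by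
  have hb : ∀ v, c * ‖v‖ ≤ ‖L v‖ := by
    intro v
    rcases eq_or_ne v 0 with rfl | hv
    · simp
    have hv' : 0 < ‖v‖ := norm_pos_iff.2 hv
    have h1 : (⟪v, L v⟫_ℂ).re ≤ ‖v‖ * ‖L v‖ := (Complex.re_le_norm _).trans (norm_inner_le_norm _ _)
    have h2 := (h v).trans h1
    nlinarith
  have ha : AntilipschitzWith (c⁻¹.toNNReal) L := by
    refine ContinuousLinearMap.antilipschitz_of_bound L fun v => ?_
    rw [Real.coe_toNNReal _ (inv_pos.2 hc).le, ← div_eq_inv_mul, le_div_iff₀ hc]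
    linarith [hb v]
  refine ⟨ha.injective, ?_⟩
  have hcl : IsClosed (L.range : Set H) := by exact ha.isClosed_range L.uniformContinuous
  have := hcl.completeSpace_coe
  have htop : L.range = ⊤ := by
    rw [← L.range.orthogonal_orthogonal, Submodule.eq_top_iff']
    intro v w hw
    obtain rfl : w = 0 := by
      have h0 : ⟪L w, w⟫_ℂ = 0 := hw _ ⟨w, rfl⟩
      have h1 : ⟪w, L w⟫_ℂ = 0 := by rw [← inner_conj_symm, h0, map_zero]
      have h2 := h w
      rw [h1] at h2
      have : ‖w‖ ^ 2 ≤ 0 := by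
        by_contra hcon
        push Not at hcon
        have := mul_pos hc hcon
        simp at h2
        linarith
      simpa using this
    exact inner_zero_left _
  intro y
  have : y ∈ L.range := htop ▸ Submodule.mem_top
  simpa using this

/-- Lax–Milgram on a closed subspace, with a bounded solution operator. -/
theorem exists_solution_operator (V : Submodule ℂ H) (hV : IsClosed (V : Set H))
    (T : H →L[ℂ] H) {c : ℝ} (hc : 0 < c) (h : ∀ v ∈ V, c * ‖v‖ ^ 2 ≤ (⟪v, T v⟫_ℂ).re) :
    ∃ S : H →L[ℂ] H, (∀ W, S W ∈ V) ∧ ∀ W, ∀ v ∈ V, ⟪v, T (S W)⟫_ℂ = ⟪v, W⟫_ℂ := by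
  have : CompleteSpace V := hV.completeSpace_coe
  let L : V →L[ℂ] V := V.orthogonalProjectionOnto ∘L T ∘L V.subtypeL
  have hin : ∀ (v : V) (w : H), ⟪v, V.orthogonalProjectionOnto w⟫_ℂ = ⟪(v : H), w⟫_ℂ := by
    intro v w
    rw [Submodule.inner_orthogonalProjectionOnto_eq_of_mem_left]
  have hbij : Function.Bijective L := by
    refine bijective_of_coercive L hc fun v => ?_
    have := h v v.2
    simpa [L, hin] using this
  let e : V ≃L[ℂ] V := ContinuousLinearEquiv.ofBijective L
    (LinearMap.ker_eq_bot.2 hbij.1) (LinearMap.range_eq_top.2 hbij.2)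
  have he : ∀ w, L (e.symm w) = w := fun w => e.apply_symm_apply w
  refine ⟨V.subtypeL ∘L (e.symm : V →L[ℂ] V) ∘L V.orthogonalProjectionOnto, fun W => ?_, ?_⟩
  · simp
  · intro W v hv
    have h1 := he (V.orthogonalProjectionOnto W)
    have h2 := congrArg (fun w => ⟪(⟨v, hv⟩ : V), w⟫_ℂ) h1
    simp only [L, ContinuousLinearMap.comp_apply, hin] at h2
    simpa using h2

/-- Uniqueness for coercive problems. -/
theorem eq_of_coercive {V : Submodule ℂ H} {T : H →L[ℂ] H} {c : ℝ} (hc : 0 < c)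
    (h : ∀ v ∈ V, c * ‖v‖ ^ 2 ≤ (⟪v, T v⟫_ℂ).re) {F G : H} (hFG : F - G ∈ V)
    (hs : ∀ v ∈ V, ⟪v, T F⟫_ℂ = ⟪v, T G⟫_ℂ) : F = G := by
  have h1 := h _ hFG
  have h2 : ⟪F - G, T (F - G)⟫_ℂ = 0 := by rw [map_sub, inner_sub_right, hs _ hFG, sub_self]
  rw [h2] at h1
  have : ‖F - G‖ ^ 2 ≤ 0 := by
    by_contra hcon
    push Not at hcon
    have := mul_pos hc hcon
    simp at h1
    linarith
  have h3 : ‖F - G‖ = 0 := by simpa using this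
  exact sub_eq_zero.1 (norm_eq_zero.1 h3)

end LaxMilgram

/-! ### The coefficients as an operator on square integrable fields -/

/-- A gradient as a vector. -/
def vec (ξ : Grad n m) : Evec n m := WithLp.toLp 2 fun k => ξ k.1 k.2

@[simp] theorem vec_apply (ξ : Grad n m) (k : Fin (n + 1) × Fin m) : vec ξ k = ξ k.1 k.2 := rfl

theorem isOpen_upper (n : ℕ) : IsOpen (upper n) := isOpen_lt continuous_const continuous_fst

theorem measurableSet_upper (n : ℕ) : MeasurableSet (upper n) := (isOpen_upper n).measurableSet


theorem memLp_vec {μ : Measure (Pt n)}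
    (h : ∀ i α, MemLp (fun z => G z i α) 2 μ) : MemLp (fun z => vec (G z)) 2 μ :=
  MemLp.of_eval_piLp fun k => h k.1 k.2

/-- Application of the coefficients to a vector. -/
def coeffApply (A : Coeff n m) (z : Pt n) (ξ : Evec n m) : Evec n m :=
  WithLp.toLp 2 fun k => ∑ j, ∑ β, A z k.1 j k.2 β * ξ (j, β)

theorem form_eq_inner (A : Coeff n m) (z : Pt n) (ξ η : Grad n m) :
    form A z ξ η = ⟪vec η, coeffApply A z (vec ξ)⟫_ℂ := by
  simp only [form, coeffApply, PiLp.inner_apply, vec_apply, Fintype.sum_prod_type,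
    RCLike.inner_apply, sum_mul]
  refine sum_congr rfl fun i _ => ?_
  rw [sum_comm]

theorem norm_coeffApply_le (A : Coeff n m) (z : Pt n) (ξ : Evec n m)
    (hA : ∀ i j α β, ‖A z i j α β‖ ≤ Λ) :
    ‖coeffApply A z ξ‖ ≤ ((n + 1) * m : ℝ) * ((n + 1) * m) * |Λ| * ‖ξ‖ := by
  have hcomp : ∀ k, ‖coeffApply A z ξ k‖ ≤ ((n + 1) * m : ℝ) * |Λ| * ‖ξ‖ := by
    intro k
    simp only [coeffApply]
    calc _ ≤ ∑ j : Fin (n + 1), ∑ β : Fin m, |Λ| * ‖ξ‖ := by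
            refine (norm_sum_le _ _).trans (sum_le_sum fun j _ => ?_)
            refine (norm_sum_le _ _).trans (sum_le_sum fun β _ => ?_)
            rw [norm_mul]
            gcongr
            · exact (hA _ _ _ _).trans (le_abs_self _)
            · exact norm_apply_le ξ (j, β)
      _ = _ := by simp; ring
  have h1 : ‖coeffApply A z ξ‖ ≤ ∑ k, ‖coeffApply A z ξ k‖ := by
    have : coeffApply A z ξ = ∑ k, single k (coeffApply A z ξ k) := by
      ext i
      simp [Finset.sum_apply, Pi.single_apply]
    calc _ = ‖∑ k, single k (coeffApply A z ξ k)‖ := by rw [← this]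
      _ ≤ _ := (norm_sum_le _ _).trans (by simp)
  refine h1.trans ((sum_le_sum fun k _ => hcomp k).trans ?_)
  simp
  ring_nf
  rfl

theorem IsBoundedCoeff.ae_le (hA : IsBoundedCoeff A Λ) :
    ∀ᵐ z ∂(upperMeasure n), ∀ i j α β, ‖A z i j α β‖ ≤ Λ := by
  simp only [ae_all_iff]
  exact fun i j α β => (hA i j α β).2

theorem aestronglyMeasurable_coeffApply (hA : IsBoundedCoeff A Λ)
    {F : Pt n → Evec n m} (hF : AEStronglyMeasurable F (upperMeasure n)) :
    AEStronglyMeasurable (fun z => coeffApply A z (F z)) (upperMeasure n) := by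
  have : AEStronglyMeasurable (fun z => (fun k : Fin (n + 1) × Fin m =>
      ∑ j, ∑ β, A z k.1 j k.2 β * F z (j, β))) (upperMeasure n) := by
    refine (aemeasurable_pi_iff.2 fun k => AEStronglyMeasurable.aemeasurable ?_).aestronglyMeasurable
    refine Finset.aestronglyMeasurable_fun_sum _ fun j _ =>
      Finset.aestronglyMeasurable_fun_sum _ fun β _ => ?_
    exact (hA _ _ _ _).1.mul ((PiLp.continuous_apply 2 _ (j, β)).comp_aestronglyMeasurable hF)
  exact (continuous_toLp 2 _).comp_aestronglyMeasurable this

theorem memLp_coeffApply (hA : IsBoundedCoeff A Λ)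
    {F : Pt n → Evec n m} (hF : MemLp F 2 (upperMeasure n)) :
    MemLp (fun z => coeffApply A z (F z)) 2 (upperMeasure n) := by
  refine hF.of_le_mul (c := ((n + 1) * m : ℝ) * ((n + 1) * m) * |Λ|)
    (aestronglyMeasurable_coeffApply hA hF.1) ?_
  filter_upwards [hA.ae_le] with z hz
  exact norm_coeffApply_le A z _ hz

/-- Multiplication by bounded coefficients, as an operator on square integrable fields. -/
def coeffOp (A : Coeff n m) (hA : IsBoundedCoeff A Λ) : L2up n m →L[ℂ] L2up n m :=
  LinearMap.mkContinuous
    { toFun := fun F => (memLp_coeffApply hA (Lp.memLp F)).toLp _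
      map_add' := by
        intro F G
        rw [← MemLp.toLp_add]
        refine MemLp.toLp_congr _ _ ?_
        filter_upwards [Lp.coeFn_add F G] with z hz
        rw [hz]
        ext k
        simp [coeffApply, mul_add, sum_add_distrib]
      map_smul' := by
        intro c F
        rw [← MemLp.toLp_const_smul]
        refine MemLp.toLp_congr _ _ ?_
        filter_upwards [Lp.coeFn_smul c F] with z hz
        rw [hz]
        ext k
        simp only [coeffApply, Pi.smul_apply, PiLp.smul_apply, smul_eq_mul, mul_sum,
          RingHom.id_apply]
        exact sum_congr rfl fun j _ => sum_congr rfl fun β _ => by ring }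
    (((n + 1) * m : ℝ) * ((n + 1) * m) * |Λ|) (by
      intro F
      refine Lp.norm_le_mul_norm_of_ae_le_mul ?_
      filter_upwards [hA.ae_le, (memLp_coeffApply hA (Lp.memLp F)).coeFn_toLp] with z hz hz'
      have := norm_coeffApply_le A z (F z) hz
      simpa only [LinearMap.coe_mk, AddHom.coe_mk, hz'] using this)

theorem coeFn_coeffOp (hA : IsBoundedCoeff A Λ) (F : L2up n m) :
    coeffOp A hA F =ᵐ[upperMeasure n] fun z => coeffApply A z (F z) :=
  (memLp_coeffApply hA (Lp.memLp F)).coeFn_toLp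

theorem inner_coeffOp (hA : IsBoundedCoeff A Λ) {F F' : L2up n m}
    {G H : Pt n → Grad n m} (hF : F =ᵐ[upperMeasure n] fun z => vec (G z))
    (hF' : F' =ᵐ[upperMeasure n] fun z => vec (H z)) :
    ⟪F', coeffOp A hA F⟫_ℂ = ∫ z in upper n, form A z (G z) (H z) := by
  rw [L2.inner_def]
  refine integral_congr_ae ?_
  filter_upwards [hF, hF', coeFn_coeffOp hA F] with z h1 h2 h3
  rw [h3, h2, h1, form_eq_inner]

/-! ### Closures of test gradients and coercivity -/

theorem contDiff_comp_apply {X ι : Type*} [NormedAddCommGroup X] [NormedSpace ℝ X] [Fintype ι]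
    {g : X → EuclideanSpace ℂ ι} {k : WithTop ℕ∞} (hg : ContDiff ℝ k g) (α : ι) :
    ContDiff ℝ k fun y => g y α :=
  ((proj α : EuclideanSpace ℂ ι →L[ℂ] ℂ).restrictScalars ℝ).contDiff.comp hg

theorem continuous_fderiv_apply {X E : Type*} [NormedAddCommGroup X] [NormedSpace ℝ X]
    [NormedAddCommGroup E] [NormedSpace ℝ E] {f : X → E} (hf : ContDiff ℝ ∞ f) (v : X) :
    Continuous fun x => fderiv ℝ f x v :=
  (hf.continuous_fderiv (by simp)).clm_apply continuous_const

instance (x : Rn n) (r : ℝ) : IsFiniteMeasure (volume.restrict (ball x r)) :=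
  isFiniteMeasure_restrict.2 measure_ball_lt_top.ne

/-- Gradients of test functions with support in `U`. -/
def testGrads (n m : ℕ) (U : Set (Pt n)) : Submodule ℂ (L2up n m) where
  carrier := {F | ∃ g : Pt n → Cm m, ContDiff ℝ ∞ g ∧ HasCompactSupport g ∧ tsupport g ⊆ U ∧
    F =ᵐ[upperMeasure n] fun z => vec (grad g z)}
  zero_mem' := ⟨fun _ => 0, contDiff_const, HasCompactSupport.zero, by simp [tsupport], by
    filter_upwards [Lp.coeFn_zero (Evec n m) 2 (upperMeasure n)] with z hz
    rw [hz]
    ext k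
    simp [grad]⟩
  add_mem' := by
    rintro F F' ⟨g, hg1, hg2, hg3, hg4⟩ ⟨g', hg1', hg2', hg3', hg4'⟩
    refine ⟨g + g', hg1.add hg1', hg2.add hg2', (tsupport_add g g').trans (Set.union_subset hg3 hg3'), ?_⟩
    filter_upwards [Lp.coeFn_add F F', hg4, hg4'] with z h1 h2 h3
    rw [h1, Pi.add_apply, h2, h3]
    ext k
    have e1 : DifferentiableAt ℝ (fun y => g y k.2) z :=
      ((contDiff_comp_apply hg1 k.2).differentiable (by simp)) z
    have e2 : DifferentiableAt ℝ (fun y => g' y k.2) z :=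
      ((contDiff_comp_apply hg1' k.2).differentiable (by simp)) z
    simp [grad, fderiv_fun_add e1 e2]
  smul_mem' := by
    rintro c F ⟨g, hg1, hg2, hg3, hg4⟩
    refine ⟨c • g, contDiff_const.smul hg1, hg2.smul_left (f := fun _ => c),
      (tsupport_smul_subset_right (fun _ => c) g).trans hg3, ?_⟩
    filter_upwards [Lp.coeFn_smul c F, hg4] with z h1 h2
    rw [h1, Pi.smul_apply, h2]
    ext k
    have e1 : DifferentiableAt ℝ (fun y => g y k.2) z :=
      ((contDiff_comp_apply hg1 k.2).differentiable (by simp)) z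
    simp [grad, fderiv_const_mul e1]

/-- The closure of the gradients of test functions with support in `U`. -/
def energySpace (n m : ℕ) (U : Set (Pt n)) : Submodule ℂ (L2up n m) :=
  (testGrads n m U).topologicalClosure

theorem isClosed_energySpace (U : Set (Pt n)) : IsClosed (energySpace n m U : Set (L2up n m)) :=
  Submodule.isClosed_topologicalClosure _

theorem energySpace_mono {U U' : Set (Pt n)} (h : U ⊆ U') :
    energySpace n m U ≤ energySpace n m U' := by
  refine Submodule.topologicalClosure_mono ?_
  rintro F ⟨g, h1, h2, h3, h4⟩
  exact ⟨g, h1, h2, h3.trans h, h4⟩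

theorem continuous_grad_apply (hg : ContDiff ℝ ∞ g) (i : Fin (n + 1))
    (α : Fin m) : Continuous fun z => grad g z i α := by
  have := (contDiff_comp_apply hg α).continuous_fderiv (by simp)
  exact this.clm_apply continuous_const

theorem hasCompactSupport_grad_apply (hg : HasCompactSupport g)
    (i : Fin (n + 1)) (α : Fin m) : HasCompactSupport fun z => grad g z i α := by
  have h1 : HasCompactSupport fun y => g y α := hg.comp_left (g := fun v : Cm m => v α) (by simp)
  exact h1.fderiv_apply ℝ (dir i)

theorem memLp_grad (hg : ContDiff ℝ ∞ g) (hc : HasCompactSupport g)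
    (i : Fin (n + 1)) (α : Fin m) : MemLp (fun z => grad g z i α) 2 (upperMeasure n) :=
  ((continuous_grad_apply hg i α).memLp_of_hasCompactSupport
    (hasCompactSupport_grad_apply hc i α)).restrict _

/-- The class of the gradient of a test function. -/
def gradClass (g : Pt n → Cm m) (hg : ContDiff ℝ ∞ g) (hc : HasCompactSupport g) : L2up n m :=
  (memLp_vec fun i α => memLp_grad hg hc i α).toLp

theorem coeFn_gradClass (hg : ContDiff ℝ ∞ g) (hc : HasCompactSupport g) :
    gradClass g hg hc =ᵐ[upperMeasure n] fun z => vec (grad g z) :=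
  MemLp.coeFn_toLp _

theorem gradClass_mem (hg : ContDiff ℝ ∞ g) (hc : HasCompactSupport g)
    {U : Set (Pt n)} (hU : tsupport g ⊆ U) : gradClass g hg hc ∈ testGrads n m U :=
  ⟨g, hg, hc, hU, coeFn_gradClass hg hc⟩

theorem norm_sq_eq_sum
    (hG : ∀ i α, MemLp (fun z => G z i α) 2 (upperMeasure n))
    (hF : F =ᵐ[upperMeasure n] fun z => vec (G z)) :
    ‖F‖ ^ 2 = ∑ i, ∑ α, ∫ z in upper n, ‖G z i α‖ ^ 2 := by
  have h1 : (‖F‖ ^ 2 : ℝ) = ∫ z in upper n, ‖F z‖ ^ 2 := by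
    have := @inner_self_eq_norm_sq ℂ _ _ _ _ F
    rw [← this, L2.inner_def]
    rw [← integral_re (L2.integrable_inner F F)]
    refine integral_congr_ae (ae_of_all _ fun z => ?_)
    exact inner_self_eq_norm_sq (𝕜 := ℂ) (F z)
  rw [h1]
  have h2 : ∫ z in upper n, ‖F z‖ ^ 2 = ∫ z in upper n, ∑ i, ∑ α, ‖G z i α‖ ^ 2 := by
    refine integral_congr_ae ?_
    filter_upwards [hF] with z hz
    rw [hz, EuclideanSpace.norm_sq_eq, Fintype.sum_prod_type]
    rfl
  rw [h2, integral_finsetSum]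
  · refine sum_congr rfl fun i _ => ?_
    rw [integral_finsetSum]
    exact fun α _ => (hG i α).integrable_norm_pow (by simp)
  · exact fun i _ => integrable_finsetSum _ fun α _ => (hG i α).integrable_norm_pow (by simp)

/-- The Gårding inequality extends to the closure. -/
theorem coercive_of_garding {Λ lam : ℝ} (hA : IsBoundedCoeff A Λ)
    {U : Set (Pt n)}
    (h : ∀ g : Pt n → Cm m, ContDiff ℝ 1 g → HasCompactSupport g → tsupport g ⊆ U →
      GardingAt A lam g) :
    ∀ F ∈ energySpace n m U, lam * ‖F‖ ^ 2 ≤ (⟪F, coeffOp A hA F⟫_ℂ).re := by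
  have hcl : IsClosed {F : L2up n m | lam * ‖F‖ ^ 2 ≤ (⟪F, coeffOp A hA F⟫_ℂ).re} := by
    refine isClosed_le (by fun_prop) ?_
    exact Complex.continuous_re.comp (continuous_id.inner (coeffOp A hA).continuous)
  intro F hF
  refine closure_minimal (s := (testGrads n m U : Set (L2up n m))) ?_ hcl hF
  rintro F ⟨g, h1, h2, h3, h4⟩
  have hg := h g (h1.of_le (by simp)) h2 h3
  rw [GardingAt] at hg
  simp only [Set.mem_ofPred_eq]
  rw [norm_sq_eq_sum (fun i α => memLp_grad h1 h2 i α) h4, inner_coeffOp hA h4 h4]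
  refine hg.trans (le_of_eq ?_)
  have hint : Integrable (fun z => form A z (grad g z) (grad g z)) (upperMeasure n) := by
    refine (L2.integrable_inner F (coeffOp A hA F)).congr ?_
    filter_upwards [h4, coeFn_coeffOp hA F] with z h5 h6
    rw [h6, h5, form_eq_inner]
  exact integral_re hint

/-! ### Horizontal translations and averages of fields -/

/-- The horizontal translation `(t, x) ↦ (t, x - y)`. -/
def hshift (y : Rn n) : C(Pt n, Pt n) := ⟨fun z => (z.1, z.2 - y), by fun_prop⟩

@[simp] theorem hshift_apply (y : Rn n) (z : Pt n) : hshift y z = (z.1, z.2 - y) := rfl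

theorem measurePreserving_hshift (y : Rn n) :
    MeasurePreserving (hshift y) (upperMeasure n) (upperMeasure n) := by
  have h1 : MeasurePreserving (fun z : Pt n => (z.1, z.2 - y)) volume volume :=
    (MeasurePreserving.id volume).prod (measurePreserving_sub_right volume y)
  have := h1.restrict_preimage (s := upper n) (measurableSet_upper n)
  exact this

/-- Horizontal translation of fields. -/
def translate (y : Rn n) : L2up n m →ₗᵢ[ℂ] L2up n m :=
  Lp.compMeasurePreservingₗᵢ ℂ (hshift y) (measurePreserving_hshift y)

theorem coeFn_translate (y : Rn n) (F : L2up n m) :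
    translate y F =ᵐ[upperMeasure n] fun z => F (z.1, z.2 - y) :=
  Lp.coeFn_compMeasurePreserving F (measurePreserving_hshift y)

theorem coeFn_translate_of {G : Pt n → Evec n m}
    (h : F =ᵐ[upperMeasure n] G) :
    translate y F =ᵐ[upperMeasure n] fun z => G (z.1, z.2 - y) :=
  (coeFn_translate y F).trans ((measurePreserving_hshift y).quasiMeasurePreserving.ae_eq_comp h)

theorem translate_zero (F : L2up n m) : translate 0 F = F := by
  ext1
  filter_upwards [coeFn_translate 0 F] with z hz
  simpa using hz

theorem continuous_translate (F : L2up n m) : Continuous fun y : Rn n => translate y F := by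
  have hg : Continuous fun y : Rn n => hshift y :=
    ContinuousMap.continuous_of_continuous_uncurry _ (by
      simp only [Function.uncurry_def, hshift_apply]; fun_prop)
  exact Continuous.compMeasurePreservingLp (f := fun _ => F) continuous_const hg
    measurePreserving_hshift (by simp)

theorem translate_mem_testGrads {U : Set (Pt n)} (hF : F ∈ testGrads n m U)
    (hU : ∀ z : Pt n, (z.1, z.2 - y) ∈ U → z ∈ U) : translate y F ∈ testGrads n m U := by
  obtain ⟨g, h1, h2, h3, h4⟩ := hF
  refine ⟨fun z => g (z.1, z.2 - y), h1.comp (by fun_prop), ?_, fun z hz => hU z (h3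
    (tsupport_comp_subset_preimage g (f := fun z : Pt n => (z.1, z.2 - y)) (by fun_prop) hz)), ?_⟩
  · have : (fun z : Pt n => g (z.1, z.2 - y)) = g ∘ (Homeomorph.subRight ((0 : ℝ), y)) := by
      ext1 z; simp [Prod.sub_def]
    rw [this]
    exact h2.comp_homeomorph _
  · filter_upwards [coeFn_translate_of (y := y) h4] with z hz
    rw [hz]
    ext k
    have : (fun w : Pt n => g (w.1, w.2 - y) k.2) = fun w => (fun v => g v k.2) (w - (0, y)) := by
      ext1 w; simp [Prod.sub_def]
    simp only [vec_apply, grad, this]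
    rw [fderiv_comp_sub (f := fun v => g v k.2)]
    simp [Prod.sub_def]

theorem translate_mem_energySpace {U : Set (Pt n)} (hF : F ∈ energySpace n m U)
    (hU : ∀ z : Pt n, (z.1, z.2 - y) ∈ U → z ∈ U) : translate y F ∈ energySpace n m U :=
  map_mem_closure (translate y).continuous hF fun _ h => translate_mem_testGrads h hU

/-- Translation is isometric, so both fields may be replaced by compactly supported ones with an
error uniform in `y`. A far horizontal translate of one compact set misses the other. -/
theorem tendsto_inner_translate_cocompact (X F : L2up n m) :
    Tendsto (fun y : Rn n => ⟪X, translate y F⟫_ℂ) (cocompact (Rn n)) (𝓝 0) := by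
  have key : ∀ (F : L2up n m) (ε : ℝ), 0 < ε → ∃ (F' : L2up n m) (g : Pt n → Evec n m),
      HasCompactSupport g ∧ F' =ᵐ[upperMeasure n] g ∧ ‖F - F'‖ ≤ ε := by
    intro F ε hε
    obtain ⟨g, hg1, hg2, -, hg4⟩ := (Lp.memLp F).exists_hasCompactSupport_eLpNorm_sub_le
      (by simp) (ε := ofReal ε) (by simpa using hε)
    refine ⟨hg4.toLp, g, hg1, hg4.coeFn_toLp, ?_⟩
    rw [Lp.norm_def]
    refine ENNReal.toReal_le_of_le_ofReal hε.le (le_trans (le_of_eq ?_) hg2)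
    refine eLpNorm_congr_ae ?_
    filter_upwards [Lp.coeFn_sub F hg4.toLp, hg4.coeFn_toLp] with z h1 h2
    rw [h1, Pi.sub_apply, h2, Pi.sub_apply]
  rw [Metric.tendsto_nhds]
  intro ε hε
  obtain ⟨F', g, hg, hFg, hF⟩ := key F (ε / (3 * (‖X‖ + 1))) (by positivity)
  -- `X` is approximated after `F`, since the tolerance depends on the norm of `F'`.
  obtain ⟨X', h, hh, hXh, hX⟩ := key X (ε / (3 * (‖F'‖ + 1))) (by positivity)
  have hK : IsCompact ((fun p : Pt n × Pt n => p.1.2 - p.2.2) '' (tsupport h ×ˢ tsupport g)) :=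
    (hh.isCompact.prod hg.isCompact).image (by fun_prop)
  filter_upwards [hK.compl_mem_cocompact] with y hy
  have h0 : ⟪X', translate y F'⟫_ℂ = 0 := by
    rw [L2.inner_def]
    refine integral_eq_zero_of_ae ?_
    filter_upwards [hXh, coeFn_translate_of (y := y) hFg] with z h1 h2
    rw [h1, h2, Pi.zero_apply]
    by_cases hz : z ∈ tsupport h
    · have : (z.1, z.2 - y) ∉ tsupport g := by
        intro hcon
        exact hy ⟨(z, (z.1, z.2 - y)), ⟨hz, hcon⟩, by simp⟩
      rw [image_eq_zero_of_notMem_tsupport this, inner_zero_right]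
    · rw [image_eq_zero_of_notMem_tsupport hz, inner_zero_left]
  have h1 : ⟪X, translate y F⟫_ℂ = ⟪X, translate y (F - F')⟫_ℂ + ⟪X - X', translate y F'⟫_ℂ := by
    rw [map_sub, inner_sub_right, inner_sub_left, h0]; ring
  rw [dist_zero_right, h1]
  have e1 : ‖⟪X, translate y (F - F')⟫_ℂ‖ ≤ ‖X‖ * (ε / (3 * (‖X‖ + 1))) := by
    refine (norm_inner_le_norm _ _).trans ?_
    rw [LinearIsometry.norm_map]
    gcongr
  have e2 : ‖⟪X - X', translate y F'⟫_ℂ‖ ≤ ε / (3 * (‖F'‖ + 1)) * ‖F'‖ := by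
    refine (norm_inner_le_norm _ _).trans ?_
    rw [LinearIsometry.norm_map]
    gcongr
  have e3 : ‖X‖ * (ε / (3 * (‖X‖ + 1))) ≤ ε / 3 := by
    rw [mul_div_assoc', div_le_div_iff₀ (by positivity) (by positivity)]
    nlinarith [norm_nonneg X]
  have e4 : ε / (3 * (‖F'‖ + 1)) * ‖F'‖ ≤ ε / 3 := by
    rw [div_mul_eq_mul_div, div_le_div_iff₀ (by positivity) (by positivity)]
    nlinarith [norm_nonneg F']
  calc _ ≤ _ := norm_add_le _ _
    _ < ε := by linarith

/-- The `L¹`-normalized dilate `2^{jn} φ(2^j x)`. -/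
def dilate (j : ℤ) (φ : Rn n → ℝ) (x : Rn n) : ℝ := ((2 : ℝ) ^ j) ^ n * φ ((2 : ℝ) ^ j • x)

theorem two_zpow_pos (j : ℤ) : (0 : ℝ) < 2 ^ j := zpow_pos two_pos j

theorem continuous_dilate (h : Continuous φ) (j : ℤ) : Continuous (dilate j φ) := by
  unfold dilate; fun_prop

theorem contDiff_dilate (h : ContDiff ℝ ∞ φ) (j : ℤ) : ContDiff ℝ ∞ (dilate j φ) := by
  unfold dilate
  exact contDiff_const.mul (h.comp (by fun_prop))

theorem hasCompactSupport_dilate (h : HasCompactSupport φ) (j : ℤ) :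
    HasCompactSupport (dilate j φ) := by
  have : HasCompactSupport fun x => φ ((2 : ℝ) ^ j • x) := h.comp_smul (two_zpow_pos j).ne'
  exact this.mul_left

theorem integrable_smul_of_compactSupport {X E : Type*} [TopologicalSpace X] [MeasurableSpace X]
    [OpensMeasurableSpace X] [T2Space X] [NormedAddCommGroup E] [NormedSpace ℝ E] {μ : Measure X}
    [IsFiniteMeasureOnCompacts μ] {g : X → ℝ} {f : X → E} (hc : HasCompactSupport g)
    (hg : Continuous g) (hf : Continuous f) : Integrable (fun x => g x • f x) μ :=
  (hg.smul hf).integrable_of_hasCompactSupport hc.smul_right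

theorem integral_dilate_smul {F : Type*} [NormedAddCommGroup F] [NormedSpace ℝ F]
    (j : ℤ) (φ : Rn n → ℝ) (c : Rn n → F) :
    ∫ y, dilate j φ y • c y = ∫ v, φ v • c ((2 : ℝ) ^ (-j) • v) := by
  have h := Measure.integral_comp_smul (volume : Measure (Rn n))
    (fun v => φ v • c ((2 : ℝ) ^ (-j) • v)) ((2 : ℝ) ^ j)
  have hc : ∀ x : Rn n, (2 : ℝ) ^ (-j) • (2 : ℝ) ^ j • x = x := by
    intro x
    rw [smul_smul, ← zpow_add₀ two_ne_zero]; simp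
  simp only [hc, finrank_euclideanSpace, Fintype.card_fin] at h
  have h2 : ∀ y, dilate j φ y • c y = (((2 : ℝ) ^ j) ^ n) • (φ ((2 : ℝ) ^ j • y) • c y) := by
    intro y; rw [dilate, mul_smul]
  simp_rw [h2]
  rw [integral_smul, h, smul_smul, abs_inv, abs_of_pos (pow_pos (two_zpow_pos j) n),
    mul_inv_cancel₀ (pow_pos (two_zpow_pos j) n).ne', one_smul]

/-- After rescaling, the fine kernel samples `c` near the origin and yields `c 0`. The coarse kernel
samples it near infinity, where it vanishes; this uses that almost every point is nonzero, hence
that the dimension is positive. -/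
theorem tendsto_integral_dilate (hn : 1 ≤ n) (hφ : Continuous φ)
    (hφc : HasCompactSupport φ) (hφ1 : ∫ x, φ x = 1) {c : Rn n → ℂ} (hc : Continuous c)
    {K : ℝ} (hK : ∀ y, ‖c y‖ ≤ K) (h0 : Tendsto c (cocompact (Rn n)) (𝓝 0)) :
    Tendsto (fun N : ℕ => ∫ y, (dilate N φ y - dilate (-N) φ y) • c y) atTop (𝓝 (c 0)) := by
  have hint : ∀ j : ℤ, Integrable fun y => dilate j φ y • c y := fun j =>
    ((continuous_dilate hφ j).smul hc).integrable_of_hasCompactSupport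
      ((hasCompactSupport_dilate hφc j).smul_right)
  have h1 : ∀ N : ℕ, ∫ y, (dilate N φ y - dilate (-N) φ y) • c y =
      (∫ v, φ v • c ((2 : ℝ) ^ (-N : ℤ) • v)) - ∫ v, φ v • c ((2 : ℝ) ^ (N : ℤ) • v) := by
    intro N
    simp_rw [sub_smul]
    rw [integral_sub (hint _) (hint _), integral_dilate_smul, integral_dilate_smul, neg_neg]
  simp_rw [h1]
  have hbd : Integrable fun v => ‖φ v‖ * K :=
    (hφ.norm.integrable_of_hasCompactSupport hφc.norm).mul_const K
  have t1 : Tendsto (fun N : ℕ => ∫ v, φ v • c ((2 : ℝ) ^ (-N : ℤ) • v)) atTop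
      (𝓝 (∫ v, φ v • c 0)) := by
    refine tendsto_integral_of_dominated_convergence _ (fun N => ?_) hbd (fun N => ?_) ?_
    · exact (hφ.smul (hc.comp (by fun_prop))).aestronglyMeasurable
    · exact ae_of_all _ fun v => by rw [norm_smul]; gcongr; exact hK _
    · refine ae_of_all _ fun v => Tendsto.const_smul ?_ _
      have : Tendsto (fun N : ℕ => (2 : ℝ) ^ (-N : ℤ) • v) atTop (𝓝 ((0 : ℝ) • v)) := by
        refine Tendsto.smul_const ?_ v
        have := tendsto_pow_atTop_nhds_zero_of_lt_one (r := (1 / 2 : ℝ)) (by norm_num) (by norm_num)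
        refine this.congr fun N => ?_
        simp
      rw [zero_smul] at this
      exact (hc.tendsto 0).comp this
  have t2 : Tendsto (fun N : ℕ => ∫ v, φ v • c ((2 : ℝ) ^ (N : ℤ) • v)) atTop
      (𝓝 (∫ v : Rn n, (0 : ℂ))) := by
    refine tendsto_integral_of_dominated_convergence _ (fun N => ?_) hbd (fun N => ?_) ?_
    · exact (hφ.smul (hc.comp (by fun_prop))).aestronglyMeasurable
    · exact ae_of_all _ fun v => by rw [norm_smul]; gcongr; exact hK _
    · have : Nontrivial (Rn n) := by
        have : Nonempty (Fin n) := ⟨⟨0, hn⟩⟩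
        infer_instance
      filter_upwards [Measure.ae_ne volume (0 : Rn n)] with v hv
      have : Tendsto (fun N : ℕ => (2 : ℝ) ^ (N : ℤ) • v) atTop (cocompact (Rn n)) := by
        rw [← Metric.cobounded_eq_cocompact, ← tendsto_norm_atTop_iff_cobounded]
        have h2 : Tendsto (fun N : ℕ => (2 : ℝ) ^ N * ‖v‖) atTop atTop :=
          (tendsto_pow_atTop_atTop_of_one_lt one_lt_two).atTop_mul_const (norm_pos_iff.2 hv)
        refine h2.congr fun N => ?_
        rw [norm_smul]; simp
      have := (h0.comp this).const_smul (φ v)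
      simpa using this
  have := t1.sub t2
  simpa only [integral_smul_const, hφ1, one_smul, integral_zero, sub_zero] using this

/-- The average of horizontal translates. -/
def havg (φ : Rn n → ℝ) (F : L2up n m) : L2up n m := ∫ y, φ y • translate y F

theorem integrable_havg (hφ : Continuous φ) (hφc : HasCompactSupport φ)
    (F : L2up n m) : Integrable fun y => φ y • translate y F :=
  integrable_smul_of_compactSupport hφc hφ (continuous_translate F)

theorem map_havg {X : Type*} [NormedAddCommGroup X] [NormedSpace ℂ X] [CompleteSpace X]
    (l : L2up n m →L[ℂ] X) (hφ : Continuous φ) (hφc : HasCompactSupport φ)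
    (F : L2up n m) : l (havg φ F) = ∫ y, φ y • l (translate y F) := by
  rw [havg, ← ContinuousLinearMap.integral_comp_comm l (integrable_havg hφ hφc F)]
  refine integral_congr_ae (ae_of_all _ fun y => ?_)
  exact (l.restrictScalars ℝ).map_smul (φ y) (translate y F)

/-- A closed subspace equals its double orthogonal complement. Weak approximation by test gradients
is therefore enough for membership. -/
theorem mem_energySpace_of_forall_inner {U : Set (Pt n)}
    (h : ∀ W : L2up n m, (∀ X ∈ testGrads n m U, ⟪W, X⟫_ℂ = 0) → ⟪W, F⟫_ℂ = 0) :
    F ∈ energySpace n m U := by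
  have : CompleteSpace (energySpace n m U) := (isClosed_energySpace U).completeSpace_coe
  rw [← Submodule.orthogonal_orthogonal (energySpace n m U)]
  intro W hW
  refine h W fun X hX => ?_
  have := hW X (Submodule.le_topologicalClosure _ hX)
  rw [← inner_conj_symm, this, map_zero]

theorem inner_eq_zero_of_mem_energySpace {U : Set (Pt n)} {F W : L2up n m}
    (hF : F ∈ energySpace n m U) (hW : ∀ X ∈ testGrads n m U, ⟪W, X⟫_ℂ = 0) : ⟪W, F⟫_ℂ = 0 := by
  have hcl : IsClosed {F : L2up n m | ⟪W, F⟫_ℂ = 0} :=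
    isClosed_eq (continuous_const.inner continuous_id) continuous_const
  exact closure_minimal (s := (testGrads n m U : Set (L2up n m))) hW hcl hF

theorem havg_mem_energySpace (hφ : Continuous φ) (hφc : HasCompactSupport φ) (hF : F ∈ energySpace n m univ) :
    havg φ F ∈ energySpace n m univ := by
  refine mem_energySpace_of_forall_inner fun W hW => ?_
  have := map_havg (innerSL ℂ W) hφ hφc F
  simp only [innerSL_apply_apply] at this
  rw [this]
  refine integral_eq_zero_of_ae (ae_of_all _ fun y => ?_)
  simp [inner_eq_zero_of_mem_energySpace (translate_mem_energySpace hF fun _ _ => trivial) hW]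

/-- Differences of averages at small and at large scales converge weakly to the identity. -/
theorem tendsto_havg_sub (hn : 1 ≤ n) (hφ : Continuous φ)
    (hφc : HasCompactSupport φ) (hφ1 : ∫ x, φ x = 1) (l : L2up n m →L[ℂ] ℂ) (F : L2up n m) :
    Tendsto (fun N : ℕ => l (havg (fun y => dilate N φ y - dilate (-N) φ y) F)) atTop
      (𝓝 (l F)) := by
  have h := tendsto_integral_dilate hn hφ hφc hφ1 (c := fun y => l (translate y F))
    (l.continuous.comp (continuous_translate F)) (K := ‖l‖ * ‖F‖)
    (fun y => by simpa using l.le_opNorm (translate y F)) (by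
      have := tendsto_inner_translate_cocompact ((InnerProductSpace.toDual ℂ _).symm l) F
      simpa [InnerProductSpace.toDual_symm_apply] using this)
  rw [translate_zero] at h
  refine h.congr fun N => ?_
  exact (map_havg l ((continuous_dilate hφ _).sub (continuous_dilate hφ _))
    ((hasCompactSupport_dilate hφc _).sub (hasCompactSupport_dilate hφc _)) F).symm

/-! ### Poincaré and trace inequalities for smooth functions -/

theorem sq_lintegral_le {X : Type*} [MeasurableSpace X] (μ : Measure X) {f : X → ℝ≥0∞}
    (hf : AEMeasurable f μ) : (∫⁻ x, f x ∂μ) ^ 2 ≤ μ univ * ∫⁻ x, f x ^ 2 ∂μ := by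
  have h := ENNReal.lintegral_mul_le_Lp_mul_Lq μ Real.HolderConjugate.two_two
    (f := fun _ => (1 : ℝ≥0∞)) aemeasurable_const hf
  simp only [Pi.mul_apply, one_mul, ENNReal.one_rpow, lintegral_one] at h
  calc (∫⁻ x, f x ∂μ) ^ 2 ≤ (μ univ ^ (1 / 2 : ℝ) *
        (∫⁻ x, f x ^ (2 : ℝ) ∂μ) ^ (1 / 2 : ℝ)) ^ 2 := by gcongr
    _ = _ := by
      rw [mul_pow, ← ENNReal.rpow_natCast, ← ENNReal.rpow_natCast, ← ENNReal.rpow_mul,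
        ← ENNReal.rpow_mul]
      norm_num

/-- Jensen's inequality for squares. -/
theorem sq_lintegral_mul_le {X : Type*} [MeasurableSpace X] (μ : Measure X) {k f : X → ℝ≥0∞}
    (hk : Measurable k) (hf : Measurable f) :
    (∫⁻ x, k x * f x ∂μ) ^ 2 ≤ (∫⁻ x, k x ∂μ) * ∫⁻ x, k x * f x ^ 2 ∂μ := by
  have h := sq_lintegral_le (μ.withDensity k) hf.aemeasurable
  rw [lintegral_withDensity_eq_lintegral_mul _ hk hf,
    lintegral_withDensity_eq_lintegral_mul _ hk (hf.pow_const 2)] at h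
  simpa [withDensity_apply] using h

theorem enorm_add_sq_le {X : Type*} [NormedAddCommGroup X] (a b : X) :
    ‖a + b‖ₑ ^ 2 ≤ 2 * (‖a‖ₑ ^ 2 + ‖b‖ₑ ^ 2) := by
  have h : ‖a + b‖ ^ 2 ≤ 2 * (‖a‖ ^ 2 + ‖b‖ ^ 2) := by
    have := norm_add_le a b
    nlinarith [sq_nonneg (‖a‖ - ‖b‖), norm_nonneg (a + b)]
  have h2 := ofReal_le_ofReal h
  rwa [ofReal_mul (by norm_num), ofReal_add (by positivity) (by positivity),
    ofReal_pow (by positivity), ofReal_pow (by positivity),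
    ofReal_pow (by positivity), ofReal_norm, ofReal_norm,
    ofReal_norm, ofReal_ofNat] at h2

theorem enorm_sub_sq_le_lintegral {X : Type*} [NormedAddCommGroup X] [NormedSpace ℝ X]
    [CompleteSpace X] {γ γ' : ℝ → X} (h : ∀ s, HasDerivAt γ (γ' s) s) (hc : Continuous γ')
    {a b : ℝ} (hab : a ≤ b) :
    ‖γ b - γ a‖ₑ ^ 2 ≤ ofReal (b - a) * ∫⁻ s in Ioc a b, ‖γ' s‖ₑ ^ 2 := by
  have h1 : γ b - γ a = ∫ s in Ioc a b, γ' s := by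
    rw [← intervalIntegral.integral_of_le hab]
    exact (intervalIntegral.integral_eq_sub_of_hasDerivAt (fun s _ => h s)
      (hc.intervalIntegrable a b)).symm
  calc ‖γ b - γ a‖ₑ ^ 2 ≤ (∫⁻ s in Ioc a b, ‖γ' s‖ₑ) ^ 2 := by
        rw [h1]; gcongr; exact enorm_integral_le_lintegral_enorm _
    _ ≤ _ := by
        refine (sq_lintegral_le _ (by fun_prop)).trans (le_of_eq ?_)
        simp

theorem upperMeasure_eq_prod (n : ℕ) :
    upperMeasure n = (volume.restrict (Ioi (0 : ℝ))).prod (volume : Measure (Rn n)) := by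
  have : upper n = Ioi (0 : ℝ) ×ˢ (univ : Set (Rn n)) := by ext z; simp [upper]
  rw [upperMeasure, this, Measure.volume_eq_prod, ← Measure.prod_restrict, Measure.restrict_univ]

/-- The Dirichlet energy on the upper half-space. -/
def energy (g : Pt n → Cm m) : ℝ≥0∞ := ∫⁻ z in upper n, ‖vec (grad g z)‖ₑ ^ 2

theorem fderiv_comp_apply {X : Type*} [NormedAddCommGroup X] [NormedSpace ℝ X]
    {ι : Type*} [Fintype ι] {g : X → EuclideanSpace ℂ ι} {z : X} (hg : DifferentiableAt ℝ g z)
    (α : ι) (v : X) : fderiv ℝ (fun y => g y α) z v = fderiv ℝ g z v α := by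
  have := (((proj α : EuclideanSpace ℂ ι →L[ℂ] ℂ).restrictScalars
    ℝ).hasFDerivAt.comp z hg.hasFDerivAt).fderiv
  have h2 := congrArg (fun L => L v) this
  exact h2

theorem norm_fderiv_dir_le {z : Pt n} (hg : DifferentiableAt ℝ g z)
    (i : Fin (n + 1)) : ‖fderiv ℝ g z (dir i)‖ ≤ ‖vec (grad g z)‖ := by
  rw [← sq_le_sq₀ (norm_nonneg _) (norm_nonneg _), EuclideanSpace.norm_sq_eq,
    EuclideanSpace.norm_sq_eq, Fintype.sum_prod_type]
  have : ∑ α, ‖fderiv ℝ g z (dir i) α‖ ^ 2 = ∑ α, ‖vec (grad g z) (i, α)‖ ^ 2 := by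
    refine sum_congr rfl fun α _ => ?_
    rw [vec_apply, grad, fderiv_comp_apply hg]
  rw [this]
  exact single_le_sum (f := fun i => ∑ α, ‖vec (grad g z) (i, α)‖ ^ 2)
    (fun i _ => by positivity) (Finset.mem_univ i)

theorem horizontal_eq_sum (y : Rn n) : ((0 : ℝ), y) = ∑ j, y j • (dir (Fin.succ j) : Pt n) := by
  have hy : y = ∑ j, y j • single j (1 : ℝ) := by ext k; simp [Finset.sum_apply, Pi.single_apply]
  rw [Prod.ext_iff]
  constructor
  · simp [dir, Prod.fst_sum]
  · simp only [dir, Fin.cases_succ, Prod.snd_sum, Prod.smul_snd]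
    exact hy

theorem norm_fderiv_horizontal_le {z : Pt n} (hg : DifferentiableAt ℝ g z)
    (y : Rn n) : ‖fderiv ℝ g z ((0 : ℝ), y)‖ ≤ n * ‖y‖ * ‖vec (grad g z)‖ := by
  rw [horizontal_eq_sum, map_sum]
  calc _ ≤ ∑ j : Fin n, ‖y‖ * ‖vec (grad g z)‖ := by
        refine (norm_sum_le _ _).trans (sum_le_sum fun j _ => ?_)
        rw [map_smul, norm_smul]
        gcongr
        · exact norm_apply_le y j
        · exact norm_fderiv_dir_le hg _
    _ = _ := by simp; ring

theorem continuous_vec_grad (hg : ContDiff ℝ ∞ g) : Continuous fun z => vec (grad g z) := by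
  refine (continuous_toLp 2 _).comp (continuous_pi fun k => ?_)
  exact continuous_grad_apply hg k.1 k.2

theorem energy_eq_lintegral_lintegral (hg : ContDiff ℝ ∞ g) :
    energy g = ∫⁻ t in Ioi (0 : ℝ), ∫⁻ x, ‖vec (grad g (t, x))‖ₑ ^ 2 := by
  have hm : Measurable fun z => ‖vec (grad g z)‖ₑ ^ 2 :=
    (continuous_vec_grad hg).enorm.measurable.pow_const 2
  rw [energy]
  change ∫⁻ z, _ ∂(upperMeasure n) = _
  rw [upperMeasure_eq_prod, lintegral_prod _ hm.aemeasurable]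

theorem energy_eq_lintegral_lintegral_swap (hg : ContDiff ℝ ∞ g) :
    energy g = ∫⁻ x, ∫⁻ t in Ioi (0 : ℝ), ‖vec (grad g (t, x))‖ₑ ^ 2 := by
  have hm : Measurable fun z => ‖vec (grad g z)‖ₑ ^ 2 :=
    (continuous_vec_grad hg).enorm.measurable.pow_const 2
  rw [energy]
  change ∫⁻ z, _ ∂(upperMeasure n) = _
  rw [upperMeasure_eq_prod, lintegral_prod_symm _ hm.aemeasurable]

theorem lintegral_vertical_sub_le (hg : ContDiff ℝ ∞ g) {t : ℝ} (ht : 0 ≤ t) :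
    ∫⁻ x, ‖g (t, x) - g (0, x)‖ₑ ^ 2 ≤ ofReal t * energy g := by
  have hd : Differentiable ℝ g := hg.differentiable (by simp)
  rw [energy_eq_lintegral_lintegral_swap hg, ← lintegral_const_mul' _ _ ofReal_ne_top]
  refine lintegral_mono fun x => ?_
  have h1 : ∀ s : ℝ, HasDerivAt (fun s => g (s, x)) (fderiv ℝ g (s, x) (dir 0)) s := by
    intro s
    have h2 : HasDerivAt (fun s : ℝ => ((s, x) : Pt n)) (dir 0) s := by
      simpa [dir] using (hasDerivAt_id s).prodMk (hasDerivAt_const s x)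
    exact (hd (s, x)).hasFDerivAt.comp_hasDerivAt s h2
  have h3 : Continuous fun s : ℝ => fderiv ℝ g (s, x) (dir 0) :=
    ((hg.continuous_fderiv (by simp)).comp (by fun_prop)).clm_apply continuous_const
  refine (enorm_sub_sq_le_lintegral h1 h3 ht).trans ?_
  rw [sub_zero]
  gcongr with s
  · exact Set.Ioc_subset_Ioi_self
  · exact enorm_le_iff_norm_le.2 (norm_fderiv_dir_le (hd _) 0)

theorem lintegral_horizontal_sub_le (hg : ContDiff ℝ ∞ g) (t : ℝ) (y : Rn n) :
    ∫⁻ x, ‖g (t, x + y) - g (t, x)‖ₑ ^ 2 ≤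
      ofReal ((n * ‖y‖) ^ 2) * ∫⁻ x, ‖vec (grad g (t, x))‖ₑ ^ 2 := by
  have hd : Differentiable ℝ g := hg.differentiable (by simp)
  have h4 : ∀ x : Rn n, ‖g (t, x + y) - g (t, x)‖ₑ ^ 2 ≤
      ∫⁻ s in Ioc (0 : ℝ) 1, ofReal ((n * ‖y‖) ^ 2) * ‖vec (grad g (t, x + s • y))‖ₑ ^ 2 := by
    intro x
    have h1 : ∀ s : ℝ, HasDerivAt (fun s : ℝ => g (t, x + s • y))
        (fderiv ℝ g (t, x + s • y) ((0 : ℝ), y)) s := by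
      intro s
      have h2 : HasDerivAt (fun s : ℝ => ((t, x + s • y) : Pt n)) ((0 : ℝ), y) s := by
        have := ((hasDerivAt_id s).smul_const y).const_add x
        simpa using (hasDerivAt_const s t).prodMk this
      exact (hd (t, x + s • y)).hasFDerivAt.comp_hasDerivAt s h2
    have h3 : Continuous fun s : ℝ => fderiv ℝ g (t, x + s • y) ((0 : ℝ), y) :=
      ((hg.continuous_fderiv (by simp)).comp (by fun_prop)).clm_apply continuous_const
    have := enorm_sub_sq_le_lintegral h1 h3 zero_le_one
    simp only [one_smul, zero_smul, add_zero, sub_zero, ofReal_one, one_mul] at this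
    refine this.trans ?_
    refine lintegral_mono fun s => ?_
    have h5 := norm_fderiv_horizontal_le (hd (t, x + s • y)) y
    rw [ofReal_pow (by positivity), ← mul_pow, ← ofReal_norm,
      ← ofReal_norm, ← ofReal_mul (by positivity)]
    gcongr
  refine (lintegral_mono h4).trans ?_
  have hm : Measurable fun z => ‖vec (grad g z)‖ₑ ^ 2 :=
    (continuous_vec_grad hg).enorm.measurable.pow_const 2
  rw [lintegral_lintegral_swap]
  · simp_rw [lintegral_const_mul' _ _ ofReal_ne_top]
    have : ∀ s : ℝ, ∫⁻ x, ‖vec (grad g (t, x + s • y))‖ₑ ^ 2 =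
        ∫⁻ x, ‖vec (grad g (t, x))‖ₑ ^ 2 := fun s =>
      lintegral_add_right_eq_self (fun x => ‖vec (grad g (t, x))‖ₑ ^ 2) (s • y)
    simp_rw [this]
    simp
  · refine Measurable.aemeasurable (Measurable.const_mul ?_ _)
    have hc : Continuous fun p : Rn n × ℝ => ((t, p.1 + p.2 • y) : Pt n) := by fun_prop
    exact hm.comp hc.measurable

/-- Translation differences of the trace are controlled by the energy. -/
theorem lintegral_trace_sub_le (hg : ContDiff ℝ ∞ g) {s : ℝ} (hs : 0 < s)
    (y : Rn n) : ∫⁻ x, ‖g (0, x + y) - g (0, x)‖ₑ ^ 2 ≤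
      ofReal (8 * s + 4 * (n * ‖y‖) ^ 2 / s) * energy g := by
  set L := ∫⁻ x, ‖g (0, x + y) - g (0, x)‖ₑ ^ 2
  have hgc := hg.continuous
  -- Go up from the boundary to height `t`, across by `y`, and down again. Averaging over `t` in
  -- `(0, s]` then turns the slice integral into the energy divided by `s`.
  have h1 : ∀ t ∈ Ioc 0 s, L ≤ 4 * (2 * (ofReal s * energy g)) +
      4 * (ofReal ((n * ‖y‖) ^ 2) * ∫⁻ x, ‖vec (grad g (t, x))‖ₑ ^ 2) := by
    intro t ht
    have hp : ∀ x, ‖g (0, x + y) - g (0, x)‖ₑ ^ 2 ≤ 4 * ‖g (t, x + y) - g (0, x + y)‖ₑ ^ 2 +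
        4 * ‖g (t, x) - g (0, x)‖ₑ ^ 2 + 4 * ‖g (t, x + y) - g (t, x)‖ₑ ^ 2 := by
      intro x
      have e : g (0, x + y) - g (0, x) = (-(g (t, x + y) - g (0, x + y)) +
        (g (t, x) - g (0, x))) + (g (t, x + y) - g (t, x)) := by abel
      rw [e]
      refine (enorm_add_sq_le _ _).trans ?_
      refine (mul_le_mul_right (add_le_add_left (enorm_add_sq_le _ _) _) 2).trans ?_
      rw [enorm_neg]
      have : ∀ a b c : ℝ≥0∞, 2 * (2 * (a + b) + c) ≤ 4 * a + 4 * b + 4 * c := by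
        intro a b c
        calc 2 * (2 * (a + b) + c) = 4 * a + 4 * b + 2 * c := by ring
          _ ≤ _ := by gcongr; norm_num
      exact this _ _ _
    refine (lintegral_mono hp).trans ?_
    rw [lintegral_add_left (by fun_prop), lintegral_add_left (by fun_prop),
      lintegral_const_mul _ (by fun_prop), lintegral_const_mul _ (by fun_prop),
      lintegral_const_mul _ (by fun_prop)]
    have e1 : ∫⁻ x, ‖g (t, x + y) - g (0, x + y)‖ₑ ^ 2 = ∫⁻ x, ‖g (t, x) - g (0, x)‖ₑ ^ 2 :=
      lintegral_add_right_eq_self (fun x => ‖g (t, x) - g (0, x)‖ₑ ^ 2) y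
    have e2 : ∫⁻ x, ‖g (t, x) - g (0, x)‖ₑ ^ 2 ≤ ofReal s * energy g :=
      (lintegral_vertical_sub_le hg ht.1.le).trans (by gcongr; exact ht.2)
    rw [e1, ← mul_add, ← two_mul]
    gcongr
    exact lintegral_horizontal_sub_le hg t y
  have h2 : ofReal s * L ≤ ofReal s * (4 * (2 * (ofReal s * energy g))) +
      4 * (ofReal ((n * ‖y‖) ^ 2) * energy g) := by
    calc ofReal s * L = ∫⁻ t in Ioc 0 s, L := by simp [mul_comm]
      _ ≤ ∫⁻ t in Ioc 0 s, (4 * (2 * (ofReal s * energy g)) +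
        4 * (ofReal ((n * ‖y‖) ^ 2) * ∫⁻ x, ‖vec (grad g (t, x))‖ₑ ^ 2)) :=
        setLIntegral_mono' measurableSet_Ioc h1
      _ ≤ _ := by
        rw [lintegral_add_left measurable_const, lintegral_const_mul' (4 : ℝ≥0∞) (fun t =>
            ofReal ((n * ‖y‖) ^ 2) * ∫⁻ x, ‖vec (grad g (t, x))‖ₑ ^ 2) (by simp),
          lintegral_const_mul' _ _ ofReal_ne_top]
        gcongr
        · simp [mul_comm]
        · rw [energy_eq_lintegral_lintegral hg]
          gcongr
          exact Set.Ioc_subset_Ioi_self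
  have hs0 : ofReal s ≠ 0 := by simpa using hs
  rw [← ENNReal.mul_le_mul_iff_right hs0 ofReal_ne_top]
  refine h2.trans (le_of_eq ?_)
  rw [← mul_assoc (ofReal s) (ofReal _), ← ofReal_mul hs.le]
  have e : s * (8 * s + 4 * (n * ‖y‖) ^ 2 / s) = 8 * s * s + 4 * (n * ‖y‖) ^ 2 := by field_simp
  rw [e, ofReal_add (by positivity) (by positivity), ofReal_mul (by positivity),
    ofReal_mul (by positivity), ofReal_mul (by positivity),
    ofReal_ofNat, ofReal_ofNat]
  ring

theorem enorm_sub_average_sq_le (hf : Continuous f) {R : ℝ} (hR : 0 < R)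
    (x : Rn n) : ‖f x - ⨍ y in ball 0 R, f y‖ₑ ^ 2 ≤
      (volume (ball (0 : Rn n) R))⁻¹ * ∫⁻ y in ball 0 R, ‖f x - f y‖ₑ ^ 2 := by
  set B := ball (0 : Rn n) R
  have hB0 : volume B ≠ 0 := (measure_ball_pos _ _ hR).ne'
  have hBt : volume B ≠ ⊤ := measure_ball_lt_top.ne
  have hint : IntegrableOn f B :=
    (hf.continuousOn.integrableOn_compact (isCompact_closedBall 0 R)).mono_set
      ball_subset_closedBall
  have h1 : f x - ⨍ y in B, f y = ⨍ y in B, (f x - f y) := by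
    rw [setAverage_eq, setAverage_eq, integral_sub (f := fun _ => f x) (g := f) (integrableOn_const hBt (by simp)) hint, smul_sub,
      setIntegral_const, smul_smul, inv_mul_cancel₀, one_smul]
    simp [Measure.real, ENNReal.toReal_eq_zero_iff, hB0, hBt]
  have h2 : ‖⨍ y in B, (f x - f y)‖ₑ ≤ (volume B)⁻¹ * ∫⁻ y in B, ‖f x - f y‖ₑ := by
    rw [setAverage_eq, enorm_smul]
    gcongr
    · rw [Measure.real, enorm_inv (by simp [ENNReal.toReal_eq_zero_iff, hB0, hBt]),
        Real.enorm_of_nonneg ENNReal.toReal_nonneg, ofReal_toReal hBt]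
    · exact enorm_integral_le_lintegral_enorm _
  rw [h1]
  calc _ ≤ ((volume B)⁻¹ * ∫⁻ y in B, ‖f x - f y‖ₑ) ^ 2 := by gcongr
    _ = (volume B)⁻¹ ^ 2 * (∫⁻ y in B, ‖f x - f y‖ₑ) ^ 2 := mul_pow _ _ _
    _ ≤ (volume B)⁻¹ ^ 2 * (volume B * ∫⁻ y in B, ‖f x - f y‖ₑ ^ 2) := by
        gcongr
        refine (sq_lintegral_le _ (by fun_prop)).trans (le_of_eq ?_)
        simp
    _ = _ := by
        rw [← mul_assoc, sq, mul_assoc (volume B)⁻¹, ENNReal.inv_mul_cancel hB0 hBt, mul_one]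

/-- By Jensen the deviation from the mean is an average of differences `f x - f y`. The substitution
`y = x + v` and Fubini leave translation differences; since `x + v` stays in the ball, the weight
can be transferred from `x` to `v`. -/
theorem lintegral_weight_mul_sub_average_le (hf : Continuous f) {R : ℝ}
    (hR : 0 < R) {w w' : Rn n → ℝ≥0∞} (hw : Measurable w)
    (hww : ∀ x v, x + v ∈ ball (0 : Rn n) R → w x ≤ w' v) :
    ∫⁻ x, w x * ‖f x - ⨍ y in ball 0 R, f y‖ₑ ^ 2 ≤
      (volume (ball (0 : Rn n) R))⁻¹ * ∫⁻ v, w' v * ∫⁻ x, ‖f (x + v) - f x‖ₑ ^ 2 := by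
  set B := ball (0 : Rn n) R
  have hB0 : volume B ≠ 0 := (measure_ball_pos _ _ hR).ne'
  have h1 : ∀ x, w x * ‖f x - ⨍ y in B, f y‖ₑ ^ 2 ≤
      (volume B)⁻¹ * ∫⁻ v, w x * (B.indicator 1 (x + v) * ‖f (x + v) - f x‖ₑ ^ 2) := by
    intro x
    rw [lintegral_const_mul _ ?_]
    · rw [mul_left_comm]
      refine mul_le_mul_right ((enorm_sub_average_sq_le hf hR x).trans ?_) _
      refine mul_le_mul_right ?_ _
      rw [← lintegral_indicator measurableSet_ball, ← lintegral_add_left_eq_self (indicator _ _) x]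
      refine lintegral_mono fun v => ?_
      change B.indicator _ (x + v) ≤ _
      by_cases h : x + v ∈ B
      · simp only [indicator_of_mem h, Pi.one_apply, one_mul]
        rw [← enorm_neg, neg_sub]
      · rw [indicator_of_notMem h]; exact zero_le
    · have : Continuous fun v => f (x + v) - f x := by fun_prop
      refine Measurable.mul ?_ (this.enorm.measurable.pow_const 2)
      exact (measurable_one.indicator measurableSet_ball).comp (measurable_const_add x)
  refine (lintegral_mono h1).trans ?_
  rw [lintegral_const_mul' _ _ (ENNReal.inv_ne_top.2 hB0)]
  refine mul_le_mul_right ?_ _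
  rw [lintegral_lintegral_swap]
  · refine lintegral_mono fun v => ?_
    have hc : Continuous fun x => f (x + v) - f x := by fun_prop
    rw [← lintegral_const_mul _ (hc.enorm.measurable.pow_const 2)]
    refine lintegral_mono fun x => ?_
    by_cases h : x + v ∈ B
    · simp only [indicator_of_mem h, Pi.one_apply, one_mul]
      gcongr
      exact hww x v h
    · simp [indicator_of_notMem h]
  · refine Measurable.aemeasurable ?_
    refine (hw.comp measurable_fst).mul (Measurable.mul ?_ ?_)
    · exact (measurable_one.indicator measurableSet_ball).comp (measurable_fst.add measurable_snd)
    · have : Continuous fun p : Rn n × Rn n => f (p.1 + p.2) - f p.1 := by fun_prop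
      exact this.enorm.measurable.pow_const 2

theorem two_mul_ofReal_add (a b : ℝ) (ha : 0 ≤ a) (hb : 0 ≤ b) :
    2 * (ofReal a + ofReal b) = ofReal (2 * (a + b)) := by
  rw [ofReal_mul (by norm_num), ofReal_add ha hb, ofReal_ofNat]

/-- Poincaré inequality on cylinders touching the boundary. -/
theorem exists_poincare_cylinder (n m : ℕ) : ∃ K : ℝ, 0 ≤ K ∧ ∀ g : Pt n → Cm m, ContDiff ℝ ∞ g →
    ∀ R : ℝ, 0 < R → ∃ c : Cm m,
      ∫⁻ t in Ioc 0 R, ∫⁻ x in ball 0 R, ‖g (t, x) - c‖ₑ ^ 2 ≤ ofReal (K * R ^ 2) * energy g := by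
  -- `(8 + 16 * n ^ 2) * R` is the bound of `lintegral_trace_sub_le` for `s = R` and `‖y‖ ≤ 2 * R`,
  -- and `2 ^ n` is the ratio of the volumes of the balls of radius `2 * R` and `R`. The summand `1`
  -- is the vertical difference.
  refine ⟨2 * (1 + 2 ^ n * (8 + 16 * n ^ 2)), by positivity, fun g hg R hR => ?_⟩
  set f : Rn n → Cm m := fun x => g (0, x) with hfdef
  have hgc := hg.continuous
  have hf : Continuous f := by fun_prop
  set B := ball (0 : Rn n) R
  set B2 := ball (0 : Rn n) (2 * R)
  have hB0 : volume B ≠ 0 := (measure_ball_pos _ _ hR).ne'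
  have hBt : volume B ≠ ⊤ := measure_ball_lt_top.ne
  set c := ⨍ y in ball 0 R, f y
  refine ⟨c, ?_⟩
  have h1 : ∫⁻ x in B, ‖f x - c‖ₑ ^ 2 ≤ ofReal (2 ^ n * (8 + 16 * n ^ 2) * R) * energy g := by
    have h1 := lintegral_weight_mul_sub_average_le hf hR (w := B.indicator 1)
      (w' := B2.indicator 1) (measurable_one.indicator measurableSet_ball)
      (by
        intro x v hv
        by_cases hx : x ∈ B
        · have : v ∈ B2 := by
            simp only [B, B2, mem_ball_zero_iff] at hx hv ⊢
            have := norm_sub_le (x + v) x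
            rw [add_sub_cancel_left] at this
            linarith
          simp [indicator_of_mem hx, indicator_of_mem this]
        · rw [indicator_of_notMem hx]; exact zero_le)
    have e1 : ∫⁻ x in B, ‖f x - c‖ₑ ^ 2 = ∫⁻ x, B.indicator 1 x * ‖f x - c‖ₑ ^ 2 := by
      rw [← lintegral_indicator (s := B) measurableSet_ball]
      refine lintegral_congr fun x => ?_
      by_cases hx : x ∈ B
      · simp [indicator_of_mem hx]
      · simp [indicator_of_notMem hx]
    rw [e1]
    refine h1.trans ?_
    have e2 : ∫⁻ v, B2.indicator 1 v * ∫⁻ x, ‖f (x + v) - f x‖ₑ ^ 2 ≤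
        ∫⁻ v in B2, ofReal ((8 + 16 * n ^ 2) * R) * energy g := by
      rw [← lintegral_indicator (s := B2) measurableSet_ball]
      refine lintegral_mono fun v => ?_
      by_cases hv : v ∈ B2
      · simp only [indicator_of_mem hv, Pi.one_apply, one_mul]
        refine (lintegral_trace_sub_le hg hR v).trans ?_
        refine mul_le_mul_left (ofReal_le_ofReal ?_) _
        have hv' : ‖v‖ ≤ 2 * R := (mem_ball_zero_iff.1 hv).le
        have : (n * ‖v‖) ^ 2 ≤ (n * (2 * R)) ^ 2 := by gcongr
        calc 8 * R + 4 * (n * ‖v‖) ^ 2 / R ≤ 8 * R + 4 * (n * (2 * R)) ^ 2 / R := by gcongr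
          _ = _ := by field_simp; ring
      · simp [indicator_of_notMem hv]
    refine (mul_le_mul_right e2 _).trans (le_of_eq ?_)
    have e3 : volume B2 = ofReal (2 ^ n) * volume B := by
      have := Measure.addHaar_ball_mul_of_pos volume (0 : Rn n) two_pos R
      simpa using this
    rw [setLIntegral_const, e3, ofReal_mul (p := 2 ^ n * _) (by positivity),
      ofReal_mul (p := 2 ^ n) (by positivity), ofReal_mul (q := R) (by positivity)]
    calc _ = ((volume B)⁻¹ * volume B) * (ofReal (2 ^ n) * ofReal (8 + 16 * n ^ 2)
          * ofReal R * energy g) := by ring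
      _ = _ := by rw [ENNReal.inv_mul_cancel hB0 hBt, one_mul]
  have h2 : ∀ t ∈ Ioc 0 R, ∫⁻ x in B, ‖g (t, x) - c‖ₑ ^ 2 ≤
      ofReal (2 * (1 + 2 ^ n * (8 + 16 * n ^ 2)) * R) * energy g := by
    intro t ht
    calc ∫⁻ x in B, ‖g (t, x) - c‖ₑ ^ 2
        ≤ ∫⁻ x in B, 2 * (‖g (t, x) - g (0, x)‖ₑ ^ 2 + ‖f x - c‖ₑ ^ 2) := by
          refine lintegral_mono fun x => ?_
          have := enorm_add_sq_le (g (t, x) - g (0, x)) (f x - c)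
          rwa [hfdef, sub_add_sub_cancel] at this
      _ ≤ 2 * (ofReal R * energy g +
          ofReal (2 ^ n * (8 + 16 * n ^ 2) * R) * energy g) := by
          rw [lintegral_const_mul' _ _ (by simp), lintegral_add_left (by fun_prop)]
          gcongr
          refine (setLIntegral_le_lintegral _ _).trans ((lintegral_vertical_sub_le hg ht.1.le).trans ?_)
          gcongr
          exact ht.2
      _ = _ := by
          rw [← add_mul, ← mul_assoc, two_mul_ofReal_add _ _ hR.le (by positivity)]
          ring_nf
  calc _ ≤ ∫⁻ t in Ioc 0 R, ofReal (2 * (1 + 2 ^ n * (8 + 16 * n ^ 2)) * R) *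
        energy g := setLIntegral_mono' measurableSet_Ioc h2
    _ = _ := by
      rw [setLIntegral_const, Real.volume_Ioc, sub_zero, mul_right_comm,
        ← ofReal_mul (by positivity)]
      ring_nf

/-- The weight used to measure traces. -/
def weight (n : ℕ) (x : Rn n) : ℝ := ((1 + ‖x‖) ^ (n + 3))⁻¹

theorem weight_pos (x : Rn n) : 0 < weight n x := by unfold weight; positivity

theorem continuous_weight : Continuous (weight n) := by
  unfold weight
  exact (Continuous.pow (by fun_prop) _).inv₀ fun x => (pow_pos (by positivity) _).ne'

/-- Translation differences grow at most quadratically in `v` (take `s = 1`). The exponent `n + 3`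
of the weight leaves `-(n + 1)` after this loss, which is just integrable on `ℝⁿ`. -/
theorem exists_weighted_trace (n m : ℕ) : ∃ K : ℝ≥0∞, K ≠ ⊤ ∧ ∀ g : Pt n → Cm m,
    ContDiff ℝ ∞ g →
      ∫⁻ x, ofReal (weight n x) * ‖g (0, x) - ⨍ y in ball 0 1, g (0, y)‖ₑ ^ 2 ≤ K * energy g := by
  set B := ball (0 : Rn n) 1
  set I := ∫⁻ v : Rn n, ofReal (2 ^ (n + 3) * (8 + 4 * n ^ 2) * (1 + ‖v‖) ^ (-(n + 1 : ℝ)))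
  have hI : I ≠ ⊤ := by
    have : Integrable (fun v : Rn n => 2 ^ (n + 3) * (8 + 4 * n ^ 2) *
        (1 + ‖v‖) ^ (-(n + 1 : ℝ))) := (integrable_one_add_norm (by simp)).const_mul _
    exact (this.lintegral_lt_top).ne
  have hB0 : volume B ≠ 0 := (measure_ball_pos _ _ one_pos).ne'
  refine ⟨(volume B)⁻¹ * I, mul_ne_top (ENNReal.inv_ne_top.2 hB0) hI, fun g hg => ?_⟩
  have hgc := hg.continuous
  have hf : Continuous fun x => g (0, x) := by fun_prop
  refine (lintegral_weight_mul_sub_average_le hf one_pos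
    (w' := fun v => ofReal (2 ^ (n + 3) * weight n v))
    continuous_weight.measurable.ennreal_ofReal ?_).trans ?_
  · intro x v hv
    refine ofReal_le_ofReal ?_
    rw [mem_ball_zero_iff] at hv
    have h1 : ‖v‖ ≤ 1 + ‖x‖ := by
      have := norm_sub_le (x + v) x
      rw [add_sub_cancel_left] at this
      linarith
    rw [weight, weight, ← div_eq_mul_inv, inv_eq_one_div, div_le_div_iff₀ (by positivity)
      (by positivity), one_mul, ← mul_pow]
    gcongr
    linarith [norm_nonneg x]
  · rw [mul_assoc, ← lintegral_mul_const _ (by fun_prop)]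
    refine mul_le_mul_right (lintegral_mono fun v => ?_) _
    refine (mul_le_mul_right (lintegral_trace_sub_le hg one_pos v) _).trans ?_
    rw [← mul_assoc, ← ofReal_mul (mul_nonneg (by positivity) (weight_pos v).le)]
    refine mul_le_mul_left (ofReal_le_ofReal ?_) _
    have h1 : (1 + ‖v‖) ^ (-(n + 1 : ℝ)) = weight n v * (1 + ‖v‖) ^ 2 := by
      rw [Real.rpow_neg (by positivity), weight]
      have : (1 + ‖v‖) ^ ((n : ℝ) + 1) = (1 + ‖v‖) ^ (n + 1) := by
        exact_mod_cast Real.rpow_natCast (1 + ‖v‖) (n + 1)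
      rw [this]
      field_simp
      ring
    rw [h1, mul_assoc, mul_assoc]
    refine mul_le_mul_of_nonneg_left ?_ (by positivity)
    rw [mul_left_comm]
    refine mul_le_mul_of_nonneg_left ?_ (weight_pos v).le
    have := norm_nonneg v
    have hn : (0 : ℝ) ≤ n := n.cast_nonneg
    nlinarith [mul_nonneg (sq_nonneg (n : ℝ)) this]

/-! ### Limits of test gradients are gradients of functions with traces -/

theorem sq_eLpNorm_two {X E : Type*} [MeasurableSpace X] [NormedAddCommGroup E] (f : X → E)
    (μ : Measure X) : eLpNorm f 2 μ ^ 2 = ∫⁻ x, ‖f x‖ₑ ^ 2 ∂μ := by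
  have := eLpNorm_nnreal_pow_eq_lintegral (f := f) (μ := μ) (p := 2) two_ne_zero
  simpa using this

theorem eLpNorm_two_lt_top {X E : Type*} [MeasurableSpace X] [NormedAddCommGroup E] {f : X → E}
    {μ : Measure X} (h : ∫⁻ x, ‖f x‖ₑ ^ 2 ∂μ < ⊤) : eLpNorm f 2 μ < ⊤ := by
  rw [← sq_eLpNorm_two] at h
  exact (ENNReal.pow_lt_top_iff.1 h).resolve_right two_ne_zero

theorem tendsto_zero_of_sq {ι : Type*} {l : Filter ι} {a : ι → ℝ≥0∞}
    (h : Tendsto (fun k => a k ^ 2) l (𝓝 0)) : Tendsto a l (𝓝 0) := by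
  have := h.ennrpow_const (1 / 2 : ℝ)
  simp only [← ENNReal.rpow_natCast, ← ENNReal.rpow_mul] at this
  simpa using this

theorem tendsto_integral_mul {X : Type*} [MeasurableSpace X] {μ : Measure X} {ι : Type*}
    {l : Filter ι} {f : ι → X → ℂ} {f₀ ψ : X → ℂ} (hψ : MemLp ψ 2 μ) (hf : ∀ k, MemLp (f k) 2 μ)
    (hf₀ : MemLp f₀ 2 μ) (h : Tendsto (fun k => eLpNorm (f k - f₀) 2 μ) l (𝓝 0)) :
    Tendsto (fun k => ∫ x, f k x * ψ x ∂μ) l (𝓝 (∫ x, f₀ x * ψ x ∂μ)) := by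
  refine tendsto_integral_of_L1' _ (hf₀.integrable_mul hψ).aestronglyMeasurable
    (Eventually.of_forall fun k => (hf k).integrable_mul hψ) ?_
  have h1 : Tendsto (fun k => eLpNorm (f k - f₀) 2 μ * eLpNorm ψ 2 μ) l (𝓝 0) := by
    have := ENNReal.Tendsto.mul_const h (Or.inr hψ.2.ne)
    rwa [zero_mul] at this
  refine tendsto_nhds_bot_mono' h1 fun k => ?_
  have := eLpNorm_smul_le_mul_eLpNorm (p := 2) (q := 2) (r := 1) hψ.1 ((hf k).1.sub hf₀.1)
  refine le_trans (le_of_eq ?_) this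
  congr 1
  ext x
  simp [sub_mul]

/-- The primitive in the vertical direction. -/
def vprim (h : Pt n → Cm m) (z : Pt n) : Cm m := ∫ s in Ioc 0 z.1, h (s, z.2)

theorem stronglyMeasurable_vprim {h : Pt n → Cm m} (hh : StronglyMeasurable h) :
    StronglyMeasurable (vprim h) := by
  have h1 : StronglyMeasurable (fun p : Pt n × ℝ =>
      {p : Pt n × ℝ | p.2 ∈ Ioc 0 p.1.1}.indicator (fun p => h (p.2, p.1.2)) p) := by
    refine StronglyMeasurable.indicator (hh.comp_measurable (by fun_prop)) ?_
    exact (measurableSet_lt measurable_const measurable_snd).inter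
      (measurableSet_le measurable_snd (by fun_prop))
  have h2 := h1.integral_prod_right' (ν := (volume : Measure ℝ))
  have e : vprim h = fun z => ∫ s : ℝ, {p : Pt n × ℝ | p.2 ∈ Ioc 0 p.1.1}.indicator
      (fun p => h (p.2, p.1.2)) (z, s) := by
    ext1 z
    rw [vprim, ← integral_indicator measurableSet_Ioc]
    rfl
  rw [e]
  exact h2

theorem lintegral_vprim_le {h : Pt n → Cm m} (hh : StronglyMeasurable h) (t : ℝ) :
    ∫⁻ x, ‖vprim h (t, x)‖ₑ ^ 2 ≤ ofReal t * ∫⁻ z in upper n, ‖h z‖ₑ ^ 2 := by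
  have hm : Measurable fun z => ‖h z‖ₑ ^ 2 := hh.enorm.pow_const 2
  have e : ∫⁻ z in upper n, ‖h z‖ₑ ^ 2 = ∫⁻ x, ∫⁻ s in Ioi (0 : ℝ), ‖h (s, x)‖ₑ ^ 2 := by
    change ∫⁻ z, _ ∂(upperMeasure n) = _
    rw [upperMeasure_eq_prod, lintegral_prod_symm _ hm.aemeasurable]
  rw [e, ← lintegral_const_mul' _ _ ofReal_ne_top]
  refine lintegral_mono fun x => ?_
  calc ‖vprim h (t, x)‖ₑ ^ 2 ≤ (∫⁻ s in Ioc 0 t, ‖h (s, x)‖ₑ) ^ 2 := by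
        gcongr; exact enorm_integral_le_lintegral_enorm _
    _ ≤ ofReal t * ∫⁻ s in Ioc 0 t, ‖h (s, x)‖ₑ ^ 2 := by
        refine (sq_lintegral_le _ ?_).trans (le_of_eq (by simp))
        exact (hh.enorm.comp (by fun_prop : Measurable fun s : ℝ => ((s, x) : Pt n))).aemeasurable
    _ ≤ _ := by gcongr; exact Set.Ioc_subset_Ioi_self

theorem ae_integrableOn_slice {h : Pt n → Cm m} (hh : StronglyMeasurable h)
    (h2 : ∫⁻ z in upper n, ‖h z‖ₑ ^ 2 ≠ ⊤) :
    ∀ᵐ x : Rn n, ∀ t : ℝ, IntegrableOn (fun s => h (s, x)) (Ioc 0 t) := by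
  have hm : Measurable fun z => ‖h z‖ₑ ^ 2 := hh.enorm.pow_const 2
  have e : ∫⁻ z in upper n, ‖h z‖ₑ ^ 2 = ∫⁻ x, ∫⁻ s in Ioi (0 : ℝ), ‖h (s, x)‖ₑ ^ 2 := by
    change ∫⁻ z, _ ∂(upperMeasure n) = _
    rw [upperMeasure_eq_prod, lintegral_prod_symm _ hm.aemeasurable]
  rw [e] at h2
  have := ae_lt_top' (Measurable.lintegral_prod_left' hm).aemeasurable h2
  filter_upwards [this] with x hx t
  have hs : StronglyMeasurable fun s : ℝ => h (s, x) :=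
    hh.comp_measurable (by fun_prop : Measurable fun s : ℝ => ((s, x) : Pt n))
  refine ⟨hs.aestronglyMeasurable, ?_⟩
  rw [hasFiniteIntegral_iff_enorm]
  have h3 : (∫⁻ s in Ioc 0 t, ‖h (s, x)‖ₑ) ^ 2 < ⊤ := by
    refine (sq_lintegral_le _ hs.enorm.aemeasurable).trans_lt ?_
    refine mul_lt_top (by simp) (lt_of_le_of_lt ?_ hx)
    exact lintegral_mono_set Set.Ioc_subset_Ioi_self
  exact lt_top_iff_ne_top.2 fun hcon => by simp [hcon] at h3

theorem sub_eq_vprim (hg : ContDiff ℝ ∞ g) {t : ℝ} (ht : 0 ≤ t) (x : Rn n) :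
    g (t, x) - g (0, x) = vprim (fun z => fderiv ℝ g z (dir 0)) (t, x) := by
  have hd : Differentiable ℝ g := hg.differentiable (by simp)
  have h1 : ∀ s : ℝ, HasDerivAt (fun s => g (s, x)) (fderiv ℝ g (s, x) (dir 0)) s := by
    intro s
    have h2 : HasDerivAt (fun s : ℝ => ((s, x) : Pt n)) (dir 0) s := by
      simpa [dir] using (hasDerivAt_id s).prodMk (hasDerivAt_const s x)
    exact (hd (s, x)).hasFDerivAt.comp_hasDerivAt s h2
  have h3 : Continuous fun s : ℝ => fderiv ℝ g (s, x) (dir 0) :=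
    ((hg.continuous_fderiv (by simp)).comp (by fun_prop)).clm_apply continuous_const
  rw [vprim, ← intervalIntegral.integral_of_le ht]
  exact (intervalIntegral.integral_eq_sub_of_hasDerivAt (fun s _ => h1 s)
    (h3.intervalIntegrable _ _)).symm

theorem energy_eq_enorm_sq
    (h : F =ᵐ[upperMeasure n] fun z => vec (grad g z)) : energy g = ‖F‖ₑ ^ 2 := by
  rw [Lp.enorm_def, sq_eLpNorm_two, energy]
  exact lintegral_congr_ae (h.mono fun z hz => by simp only [hz])

theorem grad_sub_const {g g' : Pt n → Cm m} (hg : ContDiff ℝ ∞ g) (hg' : ContDiff ℝ ∞ g')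
    (z : Pt n) : vec (grad (fun z => g z - g' z) z) = vec (grad g z) - vec (grad g' z) := by
  ext k
  have e1 : DifferentiableAt ℝ (fun y => g y k.2) z :=
    ((contDiff_comp_apply hg k.2).differentiable (by simp)) z
  have e2 : DifferentiableAt ℝ (fun y => g' y k.2) z :=
    ((contDiff_comp_apply hg' k.2).differentiable (by simp)) z
  simp [grad, fderiv_fun_sub e1 e2]

theorem energy_sub_eq {g g' : Pt n → Cm m} (hg : ContDiff ℝ ∞ g) (hg' : ContDiff ℝ ∞ g')
    {F F' : L2up n m} (h : F =ᵐ[upperMeasure n] fun z => vec (grad g z))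
    (h' : F' =ᵐ[upperMeasure n] fun z => vec (grad g' z)) :
    energy (fun z => g z - g' z) = ‖F - F'‖ₑ ^ 2 := by
  refine energy_eq_enorm_sq ?_
  filter_upwards [Lp.coeFn_sub F F', h, h'] with z h1 h2 h3
  rw [h1, Pi.sub_apply, h2, h3, grad_sub_const hg hg']

instance : (volume : Measure (Pt n)).IsAddHaarMeasure := by
  rw [Measure.volume_eq_prod]; infer_instance

/-- Integration by parts on the upper half-space for smooth functions. -/
theorem integral_smooth_by_parts {u : Pt n → ℂ} (hu : ContDiff ℝ ∞ u) {φ : Pt n → ℝ}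
    (hφ : ContDiff ℝ ∞ φ) (hφc : HasCompactSupport φ) (hφs : tsupport φ ⊆ upper n)
    (v : Pt n) :
    ∫ z in upper n, u z * (fderiv ℝ φ z v : ℂ) = -∫ z in upper n, fderiv ℝ u z v * (φ z : ℂ) := by
  have hud := hu.continuous_fderiv (by simp)
  have hφd := hφ.continuous_fderiv (by simp)
  have huc := hu.continuous
  have hφcont := hφ.continuous
  have hdc : HasCompactSupport fun z => fderiv ℝ φ z v := hφc.fderiv_apply ℝ v
  have e1 : ∫ z in upper n, u z * (fderiv ℝ φ z v : ℂ) = ∫ z, u z * (fderiv ℝ φ z v : ℂ) := by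
    refine setIntegral_eq_integral_of_forall_compl_eq_zero fun z hz => ?_
    simp [image_eq_zero_of_notMem_tsupport fun h => hz (hφs (tsupport_fderiv_apply_subset ℝ v h))]
  have e2 : ∫ z in upper n, fderiv ℝ u z v * (φ z : ℂ) = ∫ z, fderiv ℝ u z v * (φ z : ℂ) := by
    refine setIntegral_eq_integral_of_forall_compl_eq_zero fun z hz => ?_
    simp [image_eq_zero_of_notMem_tsupport fun h => hz (hφs h)]
  rw [e1, e2]
  have h := integral_bilinear_fderiv_right_eq_neg_left_of_integrable (μ := (volume : Measure (Pt n)))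
    (f := u) (g := φ) (v := v) (B := (lsmul ℝ ℝ).flip) ?_ ?_ ?_
    (fun x _ => hu.differentiable (by simp) x) (fun x _ => hφ.differentiable (by simp) x)
  · simpa [mul_comm] using h
  · refine Continuous.integrable_of_hasCompactSupport ?_ ?_
    · simp only [ContinuousLinearMap.flip_apply, ContinuousLinearMap.lsmul_apply]
      exact hφcont.smul (hud.clm_apply continuous_const)
    · exact hφc.smul_right (f' := fun x => fderiv ℝ u x v)
  · refine Continuous.integrable_of_hasCompactSupport ?_ ?_
    · simp only [ContinuousLinearMap.flip_apply, ContinuousLinearMap.lsmul_apply]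
      exact (hφd.clm_apply continuous_const).smul huc
    · exact hdc.smul_right (f' := u)
  · refine Continuous.integrable_of_hasCompactSupport ?_ ?_
    · simp only [ContinuousLinearMap.flip_apply, ContinuousLinearMap.lsmul_apply]
      exact hφcont.smul huc
    · exact hφc.smul_right (f' := u)

/-- The restriction of Lebesgue measure to a cylinder touching the boundary. -/
abbrev cylMeasure (n : ℕ) (S ρ : ℝ) : Measure (Pt n) :=
  (volume.restrict (Ioc 0 S)).prod (volume.restrict (ball (0 : Rn n) ρ))

theorem cylMeasure_eq (S ρ : ℝ) :
    cylMeasure n S ρ = volume.restrict (Ioc 0 S ×ˢ ball (0 : Rn n) ρ) := by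
  rw [cylMeasure, Measure.prod_restrict]; rfl

theorem cyl_subset_upper (S ρ : ℝ) : Ioc 0 S ×ˢ ball (0 : Rn n) ρ ⊆ upper n := fun _ hz => hz.1.1

theorem cylMeasure_le (S ρ : ℝ) : cylMeasure n S ρ ≤ upperMeasure n := by
  rw [cylMeasure_eq]
  exact Measure.restrict_mono (cyl_subset_upper S ρ) le_rfl

theorem exists_cyl_supset {K : Set (Pt n)} (hK : IsCompact K) :
    ∃ S ρ : ℝ, 0 < S ∧ 0 < ρ ∧ K ∩ upper n ⊆ Ioc 0 S ×ˢ ball (0 : Rn n) ρ := by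
  obtain ⟨r, hr⟩ := hK.isBounded.subset_closedBall 0
  refine ⟨|r| + 1, |r| + 1, by positivity, by positivity, fun z hz => ?_⟩
  have h := hr hz.1
  rw [mem_closedBall_zero_iff, Prod.norm_def, max_le_iff] at h
  refine ⟨⟨hz.2, ?_⟩, ?_⟩
  · linarith [le_abs_self r, (le_abs_self z.1).trans h.1]
  · rw [mem_ball_zero_iff]; linarith [le_abs_self r]

theorem setIntegral_upper_eq_cyl {K : Set (Pt n)} {S ρ : ℝ}
    (hK : K ∩ upper n ⊆ Ioc 0 S ×ˢ ball (0 : Rn n) ρ) {E : Type*}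
    [NormedAddCommGroup E] [NormedSpace ℝ E] {f : Pt n → E} (hf : ∀ z ∉ K, f z = 0) :
    ∫ z in upper n, f z = ∫ z, f z ∂(cylMeasure n S ρ) := by
  rw [cylMeasure_eq]
  refine setIntegral_eq_of_subset_of_forall_sdiff_eq_zero (measurableSet_upper n)
    (cyl_subset_upper S ρ) fun z hz => hf z fun hzK => hz.2 (hK ⟨hzK, hz.1⟩)

/-- Vertical primitives of square integrable fields, cut to cylinders. -/
theorem lintegral_cyl_vprim_le {h : Pt n → Cm m} (hh : StronglyMeasurable h) {S : ℝ} (hS : 0 ≤ S)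
    (ρ : ℝ) : ∫⁻ z, ‖vprim h z‖ₑ ^ 2 ∂(cylMeasure n S ρ) ≤
      ofReal (S * S) * ∫⁻ z in upper n, ‖h z‖ₑ ^ 2 := by
  rw [cylMeasure, lintegral_prod _ ((stronglyMeasurable_vprim hh).enorm.pow_const 2).aemeasurable]
  calc _ ≤ ∫⁻ t in Ioc 0 S, ofReal S * ∫⁻ z in upper n, ‖h z‖ₑ ^ 2 := by
        refine setLIntegral_mono' measurableSet_Ioc fun t ht => ?_
        refine (setLIntegral_le_lintegral _ _).trans ((lintegral_vprim_le hh t).trans ?_)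
        gcongr
        exact ht.2
    _ = _ := by rw [setLIntegral_const, Real.volume_Ioc, sub_zero, mul_right_comm, ← ofReal_mul hS]

/-- The vertical component of a field. -/
def vert (v : Evec n m) : Cm m := WithLp.toLp 2 fun α => v (0, α)

theorem continuous_vert : Continuous (vert : Evec n m → Cm m) :=
  (continuous_toLp 2 _).comp (continuous_pi fun α => PiLp.continuous_apply 2 _ (0, α))

theorem norm_vert_le (v : Evec n m) : ‖vert v‖ ≤ ‖v‖ := by
  rw [← sq_le_sq₀ (norm_nonneg _) (norm_nonneg _), EuclideanSpace.norm_sq_eq,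
    EuclideanSpace.norm_sq_eq, Fintype.sum_prod_type]
  exact single_le_sum (f := fun i => ∑ α, ‖v (i, α)‖ ^ 2)
    (fun i _ => by positivity) (Finset.mem_univ (0 : Fin (n + 1)))

theorem vert_sub (v w : Evec n m) : vert (v - w) = vert v - vert w := rfl

theorem vert_vec_grad {z : Pt n} (hg : DifferentiableAt ℝ g z) :
    vert (vec (grad g z)) = fderiv ℝ g z (dir 0) := by
  ext α
  exact fderiv_comp_apply hg α (dir 0)

/-- By Cauchy–Schwarz the primitive up to height `t` has squared norm at most `t` times that of `h`,
hence disappears at the boundary. -/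
theorem isTrace_add_vprim (hf : ∀ K, IsCompact K → MemLp f 2 (volume.restrict K))
    {h : Pt n → Cm m} (hh : StronglyMeasurable h) (h2 : ∫⁻ z in upper n, ‖h z‖ₑ ^ 2 ≠ ⊤) :
    IsTrace (fun z => f z.2 + vprim h z) f := by
  refine ⟨hf, fun K _ => ?_⟩
  refine Tendsto.mono_left ?_ inf_le_left
  refine tendsto_zero_of_sq ?_
  have h0 : Tendsto (fun t : ℝ => ofReal t * ∫⁻ z in upper n, ‖h z‖ₑ ^ 2) (𝓝[>] 0) (𝓝 0) := by
    have h1 : Tendsto (fun t : ℝ => ofReal t) (𝓝[>] 0) (𝓝 0) := by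
      have := (ENNReal.continuous_ofReal.tendsto 0).mono_left (nhdsWithin_le_nhds (s := Ioi 0))
      simpa using this
    have := ENNReal.Tendsto.mul_const h1 (Or.inr h2)
    rwa [zero_mul] at this
  refine tendsto_nhds_bot_mono' h0 fun t => ?_
  simp only [add_sub_cancel_left]
  rw [sq_eLpNorm_two]
  exact (setLIntegral_le_lintegral _ _).trans (lintegral_vprim_le hh t)

theorem lintegral_cyl_snd (S ρ : ℝ) {a : Rn n → ℝ≥0∞} (ha : Measurable a) :
    ∫⁻ z, a z.2 ∂(cylMeasure n S ρ) = ofReal S * ∫⁻ x in ball 0 ρ, a x := by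
  rw [cylMeasure, lintegral_prod (fun z : Pt n => a z.2) (ha.comp measurable_snd).aemeasurable]
  simp [mul_comm]

theorem ae_cyl_of_ae {P : Rn n → Prop} (h : ∀ᵐ x, P x) (S ρ : ℝ) :
    ∀ᵐ z ∂(cylMeasure n S ρ), 0 < z.1 ∧ P z.2 := by
  have h1 : ∀ᵐ z ∂(cylMeasure n S ρ), 0 < z.1 := by
    rw [cylMeasure_eq]
    filter_upwards [ae_restrict_mem (measurableSet_Ioc.prod measurableSet_ball)] with z hz
    exact hz.1.1
  have h2 : ∀ᵐ z ∂(cylMeasure n S ρ), P z.2 :=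
    Measure.quasiMeasurePreserving_snd.ae (ae_restrict_of_ae h)
  exact h1.and h2

/-- Elements of the closure of test gradients are gradients of functions with traces. -/
theorem exists_energy_of_mem (hF : F ∈ energySpace n m univ) :
    ∃ (u : Pt n → Cm m) (f : Rn n → Cm m), IsEnergy u (fun z i α => F z (i, α)) ∧ IsTrace u f := by
  obtain ⟨Fk, hFk, hlim⟩ := mem_closure_iff_seq_limit.1 hF
  choose g hg hgc _ hgF using hFk
  obtain ⟨K, hK, hw⟩ := exists_weighted_trace n m
  -- Gradients determine the approximants only up to constants. Subtracting the mean over the unit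
  -- ball fixes them so that the weighted traces form a Cauchy sequence.
  let c : ℕ → Cm m := fun k => ⨍ y in ball 0 1, g k (0, y)
  have hgcont := fun k => (hg k).continuous
  have hint : ∀ k, IntegrableOn (fun y => g k (0, y)) (ball (0 : Rn n) 1) := fun k => by
    have h1 : Continuous fun y => g k (0, y) := (hgcont k).comp (by fun_prop)
    exact (h1.continuousOn.integrableOn_compact (isCompact_closedBall 0 1)).mono_set
      ball_subset_closedBall
  let a : ℕ → Rn n → Cm m := fun k x => √(weight n x) • (g k (0, x) - c k)
  have hacont : ∀ k, Continuous (a k) := fun k =>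
    (continuous_weight.sqrt).smul (((hgcont k).comp (by fun_prop)).sub continuous_const)
  have hsq : ∀ (x : Rn n) (v : Cm m), ‖√(weight n x) • v‖ₑ ^ 2 =
      ofReal (weight n x) * ‖v‖ₑ ^ 2 := by
    intro x v
    rw [enorm_smul, mul_pow, Real.enorm_of_nonneg (Real.sqrt_nonneg _),
      ← ofReal_pow (Real.sqrt_nonneg _), Real.sq_sqrt (weight_pos x).le]
  have ha : ∀ k, MemLp (a k) 2 volume := fun k => by
    refine ⟨(hacont k).aestronglyMeasurable, eLpNorm_two_lt_top ?_⟩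
    simp_rw [a, hsq]
    refine (hw (g k) (hg k)).trans_lt ?_
    rw [energy_eq_enorm_sq (hgF k)]
    exact mul_lt_top hK.lt_top (by simp)
  have hdiff : ∀ k l, eLpNorm (a k - a l) 2 volume ^ 2 ≤ K * ‖Fk k - Fk l‖ₑ ^ 2 := by
    intro k l
    rw [← energy_sub_eq (hg k) (hg l) (hgF k) (hgF l), sq_eLpNorm_two]
    refine le_trans (le_of_eq (lintegral_congr fun x => ?_)) (hw _ ((hg k).sub (hg l)))
    have : (⨍ y in ball 0 1, (g k (0, y) - g l (0, y))) = c k - c l := by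
      simp only [c, setAverage_eq]
      rw [integral_sub (hint k) (hint l), smul_sub]
    rw [this, ← hsq, Pi.sub_apply]
    simp only [a]
    rw [← smul_sub]
    congr 3
    abel
  let Q : ℕ → Lp (Cm m) 2 (volume : Measure (Rn n)) := fun k => (ha k).toLp
  have hQn : ∀ k l, ‖Q k - Q l‖ₑ = eLpNorm (a k - a l) 2 volume := by
    intro k l
    rw [← MemLp.toLp_sub, Lp.enorm_def]
    exact eLpNorm_congr_ae (MemLp.coeFn_toLp _)
  have hQ : CauchySeq Q := by
    rw [EMetric.cauchySeq_iff]
    intro ε hε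
    have hFc := EMetric.cauchySeq_iff.1 hlim.cauchySeq
    have h1 : Tendsto (fun δ : ℝ≥0∞ => K * δ ^ 2) (𝓝 0) (𝓝 0) := by
      have h2 : Tendsto (fun δ : ℝ≥0∞ => δ ^ 2) (𝓝 0) (𝓝 0) := by
        simpa using ENNReal.Tendsto.pow (n := 2) (tendsto_id (x := 𝓝 (0 : ℝ≥0∞)))
      simpa using ENNReal.Tendsto.const_mul h2 (Or.inr hK)
    have hε2 : (0 : ℝ≥0∞) < ε ^ 2 := by positivity
    obtain ⟨δ, hδ, hδ'⟩ := ENNReal.nhds_zero_basis.mem_iff.1 (h1 (gt_mem_nhds hε2))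
    obtain ⟨δ', hδ'0, hδ'1⟩ := exists_between hδ
    obtain ⟨N, hN⟩ := hFc δ' hδ'0
    refine ⟨N, fun k hk l hl => ?_⟩
    rw [edist_eq_enorm_sub, hQn]
    have h3 := hN k hk l hl
    rw [edist_eq_enorm_sub] at h3
    have h4 : K * ‖Fk k - Fk l‖ₑ ^ 2 < ε ^ 2 := hδ' (h3.trans hδ'1)
    have h5 := (hdiff k l).trans_lt h4
    exact lt_of_not_ge fun h => h5.not_ge (pow_le_pow_left' h 2)
  obtain ⟨q, hq⟩ := cauchySeq_tendsto_of_complete hQ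
  let f : Rn n → Cm m := fun x => (√(weight n x))⁻¹ • q x
  have hfm : StronglyMeasurable f := by
    have hs : StronglyMeasurable fun x : Rn n => (√(weight n x))⁻¹ := (continuous_weight.sqrt.inv₀ fun x =>
      (Real.sqrt_pos.2 (weight_pos x)).ne').stronglyMeasurable
    exact hs.smul (Lp.stronglyMeasurable q)
  have hfk : ∀ k (ρ : ℝ), 0 < ρ → ∫⁻ x in ball 0 ρ, ‖g k (0, x) - c k - f x‖ₑ ^ 2 ≤
      ofReal ((1 + ρ) ^ (n + 3)) * ‖Q k - q‖ₑ ^ 2 := by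
    intro k ρ hρ
    have e1 : ‖Q k - q‖ₑ ^ 2 = ∫⁻ x, ‖a k x - q x‖ₑ ^ 2 := by
      rw [Lp.enorm_def, sq_eLpNorm_two]
      refine lintegral_congr_ae ?_
      filter_upwards [Lp.coeFn_sub (Q k) q, (ha k).coeFn_toLp] with x h1 h2
      rw [h1, Pi.sub_apply, h2]
    rw [e1, ← lintegral_const_mul' _ _ ofReal_ne_top]
    refine (setLIntegral_mono' measurableSet_ball fun x hx => ?_).trans
      (setLIntegral_le_lintegral _ _)
    have hx' : ‖x‖ < ρ := mem_ball_zero_iff.1 hx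
    have e2 : g k (0, x) - c k - f x = (√(weight n x))⁻¹ • (a k x - q x) := by
      simp only [a, f]
      rw [smul_sub, smul_smul, inv_mul_cancel₀ (Real.sqrt_pos.2 (weight_pos x)).ne', one_smul]
    rw [e2, enorm_smul, mul_pow, Real.enorm_of_nonneg (by positivity),
      ← ofReal_pow (by positivity), inv_pow, Real.sq_sqrt (weight_pos x).le, weight, inv_inv]
    gcongr
  let F0 : Pt n → Cm m := fun z => vert (F z)
  have hF0m : StronglyMeasurable F0 := continuous_vert.comp_stronglyMeasurable (Lp.stronglyMeasurable F)
  have hen : ∀ F : L2up n m, ‖F‖ₑ ^ 2 = ∫⁻ z in upper n, ‖F z‖ₑ ^ 2 := fun F => by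
    rw [Lp.enorm_def, sq_eLpNorm_two]
  have hvle : ∀ v : Evec n m, ‖vert v‖ₑ ≤ ‖v‖ₑ := fun v => enorm_le_iff_norm_le.2 (norm_vert_le v)
  have hF0 : ∫⁻ z in upper n, ‖F0 z‖ₑ ^ 2 ≠ ⊤ := by
    have h1 : ∫⁻ z in upper n, ‖F0 z‖ₑ ^ 2 ≤ ‖F‖ₑ ^ 2 := by
      rw [hen]
      exact lintegral_mono fun z => pow_le_pow_left₀ zero_le (hvle (F z)) 2
    exact (h1.trans_lt (by simp)).ne
  -- The limit is rebuilt from its boundary values and its vertical derivative. It then has trace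
  -- `f` by construction, and its full weak gradient is obtained by passing to the limit in `g k - c
  -- k`.
  let u : Pt n → Cm m := fun z => f z.2 + vprim F0 z
  have hum : StronglyMeasurable u :=
    (hfm.comp_measurable measurable_snd).add (stronglyMeasurable_vprim hF0m)
  let d : ℕ → Pt n → Cm m := fun k z => (g k z - c k) - u z
  have hdm : ∀ k, StronglyMeasurable (d k) := fun k =>
    ((hgcont k).stronglyMeasurable.sub stronglyMeasurable_const).sub hum
  have hd : ∀ (k : ℕ) (S ρ : ℝ), 0 < S → 0 < ρ → ∫⁻ z, ‖d k z‖ₑ ^ 2 ∂(cylMeasure n S ρ) ≤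
      2 * (ofReal S * (ofReal ((1 + ρ) ^ (n + 3)) * ‖Q k - q‖ₑ ^ 2) +
        ofReal (S * S) * ‖Fk k - F‖ₑ ^ 2) := by
    intro k S ρ hS hρ
    let h : Pt n → Cm m := fun z => fderiv ℝ (g k) z (dir 0) - F0 z
    have hgd : Continuous fun z => fderiv ℝ (g k) z (dir 0) := continuous_fderiv_apply (hg k) _
    have hhm : StronglyMeasurable h := hgd.stronglyMeasurable.sub hF0m
    have hh2 : ∫⁻ z in upper n, ‖h z‖ₑ ^ 2 ≤ ‖Fk k - F‖ₑ ^ 2 := by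
      rw [hen]
      refine lintegral_mono_ae ?_
      filter_upwards [Lp.coeFn_sub (Fk k) F, hgF k] with z h1 h2
      rw [h1, Pi.sub_apply, h2]
      simp only [h, F0]
      rw [← vert_vec_grad ((hg k).differentiable (by simp) z), ← vert_sub]
      exact pow_le_pow_left₀ zero_le (hvle _) 2
    have hgfin : ∫⁻ z in upper n, ‖fderiv ℝ (g k) z (dir 0)‖ₑ ^ 2 ≠ ⊤ := by
      have h1 : ∫⁻ z in upper n, ‖fderiv ℝ (g k) z (dir 0)‖ₑ ^ 2 ≤ ‖Fk k‖ₑ ^ 2 := by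
        rw [hen]
        refine lintegral_mono_ae ?_
        filter_upwards [hgF k] with z h2
        rw [h2, ← vert_vec_grad ((hg k).differentiable (by simp) z)]
        exact pow_le_pow_left₀ zero_le (hvle _) 2
      exact (h1.trans_lt (by simp)).ne
    have hae : ∀ᵐ z ∂(cylMeasure n S ρ), d k z = (g k (0, z.2) - c k - f z.2) + vprim h z := by
      filter_upwards [ae_cyl_of_ae ((ae_integrableOn_slice hgd.stronglyMeasurable hgfin).and
        (ae_integrableOn_slice hF0m hF0)) S ρ] with z hz
      have h1 := sub_eq_vprim (hg k) hz.1.le z.2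
      have h2 : vprim h z = vprim (fun z => fderiv ℝ (g k) z (dir 0)) z - vprim F0 z := by
        rw [vprim, vprim, vprim, ← integral_sub (hz.2.1 _) (hz.2.2 _)]
      rw [h2]
      simp only [d, u]
      change _ = vprim (fun z => fderiv ℝ (g k) z (dir 0)) z at h1
      rw [← h1]
      abel
    have hfc : Measurable fun x => ‖g k (0, x) - c k - f x‖ₑ ^ 2 := by
      have h1 : Continuous fun x => g k (0, x) - c k :=
        ((hgcont k).comp (by fun_prop)).sub continuous_const
      exact (h1.stronglyMeasurable.sub hfm).enorm.pow_const 2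
    calc ∫⁻ z, ‖d k z‖ₑ ^ 2 ∂(cylMeasure n S ρ)
        ≤ ∫⁻ z, 2 * (‖g k (0, z.2) - c k - f z.2‖ₑ ^ 2 + ‖vprim h z‖ₑ ^ 2) ∂(cylMeasure n S ρ) := by
          refine lintegral_mono_ae (hae.mono fun z hz => ?_)
          rw [hz]
          exact enorm_add_sq_le _ _
      _ = 2 * (ofReal S * (∫⁻ x in ball 0 ρ, ‖g k (0, x) - c k - f x‖ₑ ^ 2) +
          ∫⁻ z, ‖vprim h z‖ₑ ^ 2 ∂(cylMeasure n S ρ)) := by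
          rw [lintegral_const_mul' _ _ (by simp),
            lintegral_add_left (f := fun z : Pt n => ‖g k (0, z.2) - c k - f z.2‖ₑ ^ 2)
              (hfc.comp measurable_snd), ← lintegral_cyl_snd S ρ hfc]
      _ ≤ _ := by
          gcongr
          · exact hfk k ρ hρ
          · exact (lintegral_cyl_vprim_le hhm hS.le ρ).trans (by gcongr)
  have hQ0 : Tendsto (fun k => ‖Q k - q‖ₑ ^ 2) atTop (𝓝 0) := by
    have h1 : Tendsto (fun k => ‖Q k - q‖ₑ) atTop (𝓝 0) := by simpa using (hq.sub_const q).enorm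
    simpa using ENNReal.Tendsto.pow (n := 2) h1
  have hF1 : Tendsto (fun k => ‖Fk k - F‖ₑ) atTop (𝓝 0) := by simpa using (hlim.sub_const F).enorm
  have hF2 : Tendsto (fun k => ‖Fk k - F‖ₑ ^ 2) atTop (𝓝 0) := by
    simpa using ENNReal.Tendsto.pow (n := 2) hF1
  have hdlim : ∀ S ρ : ℝ, 0 < S → 0 < ρ →
      Tendsto (fun k => eLpNorm (d k) 2 (cylMeasure n S ρ)) atTop (𝓝 0) := by
    intro S ρ hS hρ
    refine tendsto_zero_of_sq ?_
    simp_rw [sq_eLpNorm_two]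
    refine tendsto_nhds_bot_mono' ?_ fun k => hd k S ρ hS hρ
    have h1 := ENNReal.Tendsto.const_mul (ENNReal.Tendsto.const_mul hQ0
      (Or.inr (ofReal_ne_top (r := (1 + ρ) ^ (n + 3)))))
      (Or.inr (ofReal_ne_top (r := S)))
    have h2 := ENNReal.Tendsto.const_mul hF2 (Or.inr (ofReal_ne_top (r := S * S)))
    have h3 := ENNReal.Tendsto.const_mul (h1.add h2) (Or.inr (ENNReal.ofNat_ne_top (n := 2)))
    simpa using h3
  have hgb : ∀ k, ∃ C, ∀ z, ‖g k z - c k‖ ≤ C := fun k => by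
    obtain ⟨C, hC⟩ := (hgc k).exists_bound_of_continuous (hgcont k)
    exact ⟨C + ‖c k‖, fun z => (norm_sub_le _ _).trans (by gcongr; exact hC z)⟩
  have hgL : ∀ (k : ℕ) (S ρ : ℝ), MemLp (fun z => g k z - c k) 2 (cylMeasure n S ρ) := fun k S ρ =>
    let ⟨C, hC⟩ := hgb k
    MemLp.of_bound ((hgcont k).sub continuous_const).aestronglyMeasurable C (ae_of_all _ hC)
  have huL : ∀ S ρ : ℝ, 0 < S → 0 < ρ → MemLp u 2 (cylMeasure n S ρ) := by
    intro S ρ hS hρ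
    obtain ⟨k, hk⟩ := ((hdlim S ρ hS hρ).eventually (gt_mem_nhds one_pos)).exists
    have h1 : MemLp (d k) 2 (cylMeasure n S ρ) :=
      ⟨(hdm k).aestronglyMeasurable, hk.trans ENNReal.one_lt_top⟩
    refine ((hgL k S ρ).sub h1).ae_eq (ae_of_all _ fun z => ?_)
    simp [d]
  refine ⟨u, f, ⟨?_, ?_, ?_⟩, isTrace_add_vprim ?_ hF0m hF0⟩
  · intro K' hK' hKu
    obtain ⟨S, ρ, hS, hρ, hsub⟩ := exists_cyl_supset hK'
    refine (huL S ρ hS hρ).mono_measure ?_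
    rw [cylMeasure_eq]
    exact Measure.restrict_mono (fun z hz => hsub ⟨hz, hKu hz⟩) le_rfl
  · intro i α
    exact (Lp.memLp F).eval_piLp (i, α)
  · intro i α φ hφ hφc hφs
    obtain ⟨S, ρ, hS, hρ, hsub⟩ := exists_cyl_supset hφc.isCompact
    have hdφ : Continuous fun z => (fderiv ℝ φ z (dir i) : ℂ) :=
      continuous_ofReal.comp (continuous_fderiv_apply hφ _)
    have hdφc : HasCompactSupport fun z => (fderiv ℝ φ z (dir i) : ℂ) :=
      (hφc.fderiv_apply ℝ (dir i)).comp_left Complex.ofReal_zero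
    have hφC : Continuous fun z => (φ z : ℂ) := continuous_ofReal.comp hφ.continuous
    have hφCc : HasCompactSupport fun z => (φ z : ℂ) := hφc.comp_left Complex.ofReal_zero
    have hz1 : ∀ z ∉ tsupport φ, (fderiv ℝ φ z (dir i) : ℂ) = 0 := fun z hz => by
      simp [image_eq_zero_of_notMem_tsupport fun h => hz (tsupport_fderiv_apply_subset ℝ (dir i) h)]
    have t1 : Tendsto (fun k => ∫ z in upper n, (g k z - c k) α * (fderiv ℝ φ z (dir i) : ℂ)) atTop
        (𝓝 (∫ z in upper n, u z α * (fderiv ℝ φ z (dir i) : ℂ))) := by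
      rw [setIntegral_upper_eq_cyl hsub (fun z hz => by rw [hz1 z hz, mul_zero])]
      have e1 : ∀ k, ∫ z in upper n, (g k z - c k) α * (fderiv ℝ φ z (dir i) : ℂ) =
          ∫ z, (g k z - c k) α * (fderiv ℝ φ z (dir i) : ℂ) ∂(cylMeasure n S ρ) := fun k =>
        setIntegral_upper_eq_cyl hsub (fun z hz => by rw [hz1 z hz, mul_zero])
      simp_rw [e1]
      refine tendsto_integral_mul (f := fun k z => (g k z - c k) α) (f₀ := fun z => u z α)
        ((hdφ.memLp_of_hasCompactSupport (p := 2) hdφc (μ := volume)).mono_measure ?_)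
        (fun k => (hgL k S ρ).eval_piLp α) ((huL S ρ hS hρ).eval_piLp α) ?_
      · rw [cylMeasure_eq]; exact Measure.restrict_le_self
      · refine tendsto_nhds_bot_mono' (hdlim S ρ hS hρ) fun k => eLpNorm_mono fun z => ?_
        exact norm_apply_le (d k z) α
    have t2 : Tendsto (fun k => ∫ z in upper n, grad (g k) z i α * (φ z : ℂ)) atTop
        (𝓝 (∫ z in upper n, F z (i, α) * (φ z : ℂ))) := by
      refine tendsto_integral_mul (f := fun k z => grad (g k) z i α) (f₀ := fun z => F z (i, α))
        ((hφC.memLp_of_hasCompactSupport hφCc).restrict _)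
        (fun k => memLp_grad (hg k) (hgc k) i α) ((Lp.memLp F).eval_piLp (i, α)) ?_
      refine tendsto_nhds_bot_mono' hF1 fun k => ?_
      rw [Lp.enorm_def]
      refine eLpNorm_mono_ae ?_
      filter_upwards [Lp.coeFn_sub (Fk k) F, hgF k] with z h2 h3
      have h4 : (Fk k - F : L2up n m) z = vec (grad (g k) z) - F z := by rw [h2, Pi.sub_apply, h3]
      rw [h4]
      exact norm_apply_le (vec (grad (g k) z) - F z) (i, α)
    refine tendsto_nhds_unique t1 (t2.neg.congr fun k => ?_)
    have hga : ContDiff ℝ ∞ fun z => (g k z - c k) α :=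
      contDiff_comp_apply ((hg k).sub contDiff_const) α
    rw [integral_smooth_by_parts hga hφ hφc hφs (dir i)]
    congr 2
    ext z
    have : (fun z => (g k z - c k) α) = fun z => g k z α - c k α := rfl
    rw [this, fderiv_sub_const]
    rfl
  · intro K' hK'
    obtain ⟨r, hr⟩ := hK'.isBounded.subset_ball 0
    have hr' : K' ⊆ ball 0 (|r| + 1) := hr.trans (Metric.ball_subset_ball (by
      linarith [le_abs_self r]))
    have hρ : 0 < |r| + 1 := by positivity
    have hc : Continuous fun x => g 0 (0, x) - c 0 :=
      ((hgcont 0).comp (by fun_prop)).sub continuous_const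
    have h0 : MemLp (fun x => g 0 (0, x) - c 0 - f x) 2
        (volume.restrict (ball (0 : Rn n) (|r| + 1))) :=
      ⟨(hc.stronglyMeasurable.sub hfm).aestronglyMeasurable, eLpNorm_two_lt_top
        ((hfk 0 _ hρ).trans_lt (mul_lt_top (by simp) (by simp)))⟩
    obtain ⟨C, hC⟩ := hgb 0
    have h1 : MemLp (fun x => g 0 (0, x) - c 0) 2 (volume.restrict (ball (0 : Rn n) (|r| + 1))) :=
      MemLp.of_bound hc.aestronglyMeasurable C (ae_of_all _ fun x => hC _)
    refine ((h1.sub h0).ae_eq (ae_of_all _ fun x => ?_)).mono_measure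
      (Measure.restrict_mono hr' le_rfl)
    simp

/-! ### Green's formula up to the boundary -/

theorem IsEnergy.aestronglyMeasurable (h : IsEnergy u G) :
    AEStronglyMeasurable u (upperMeasure n) := by
  have e : upper n = ⋃ k : ℕ, Set.Icc (1 / ((k : ℝ) + 1)) k ×ˢ closedBall (0 : Rn n) k := by
    ext z
    simp only [upper, Set.mem_ofPred_eq, Set.mem_iUnion, Set.mem_prod, Set.mem_Icc,
      Metric.mem_closedBall, dist_zero_right]
    constructor
    · intro hz
      obtain ⟨k, hk⟩ := exists_nat_ge (max (max z.1 ‖z.2‖) (1 / z.1))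
      simp only [max_le_iff] at hk
      refine ⟨k, ⟨?_, hk.1.1⟩, hk.1.2⟩
      rw [div_le_iff₀ (by positivity)]
      have := hk.2
      rw [div_le_iff₀ hz] at this
      nlinarith
    · rintro ⟨k, ⟨h1, -⟩, -⟩
      exact lt_of_lt_of_le (by positivity) h1
  rw [upperMeasure, e, aestronglyMeasurable_iUnion_iff]
  refine fun k => (h.locL2 _ (isCompact_Icc.prod (isCompact_closedBall _ _)) ?_).1
  intro z hz
  exact lt_of_lt_of_le (by positivity) hz.1.1

theorem eventually_of_trace {P : ℝ → Prop} (h : ∀ᶠ t in 𝓝[>] (0 : ℝ) ⊓ ae volume, P t) :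
    ∃ τ : ℝ, 0 < τ ∧ ∀ᵐ t : ℝ, t ∈ Ioc 0 τ → P t := by
  obtain ⟨s, hs, s', hs', hP⟩ := Filter.eventually_inf.1 h
  obtain ⟨τ, hτ, hsub⟩ := mem_nhdsGT_iff_exists_Ioc_subset.1 hs
  refine ⟨τ, hτ, ?_⟩
  filter_upwards [hs'] with t ht ht'
  exact hP t ⟨hsub ht', ht⟩

theorem IsTrace.memLp_ball (hf : IsTrace u f) (ρ : ℝ) :
    MemLp f 2 (volume.restrict (ball (0 : Rn n) ρ)) :=
  (hf.1 _ (isCompact_closedBall 0 ρ)).mono_measure (Measure.restrict_mono ball_subset_closedBall le_rfl)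

/-- Finite energy is only assumed to give local square integrability inside. Near `t = 0` the bound
comes from the convergence of the slices to the trace, and above a fixed height from the interior.
-/
theorem memLp_cyl_of_trace
    (h : IsEnergy u G) (hf : IsTrace u f) (S ρ : ℝ) : MemLp u 2 (cylMeasure n S ρ) := by
  have hm : AEStronglyMeasurable u (cylMeasure n S ρ) :=
    h.aestronglyMeasurable.mono_measure (cylMeasure_le S ρ)
  have hball := hf.memLp_ball ρ
  obtain ⟨τ, hτ, hτ'⟩ := eventually_of_trace
    (((hf.2 _ (isCompact_closedBall 0 ρ)).eventually (ge_mem_nhds one_pos)))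
  have h1 : MemLp u 2 (cylMeasure n τ ρ) := by
    have hm1 : AEStronglyMeasurable u (cylMeasure n τ ρ) :=
      h.aestronglyMeasurable.mono_measure (cylMeasure_le τ ρ)
    refine ⟨hm1, eLpNorm_two_lt_top ?_⟩
    · rw [cylMeasure, lintegral_prod _ (hm1.enorm.pow_const 2)]
      calc _ ≤ ∫⁻ t in Ioc 0 τ, 2 * (1 + eLpNorm f 2 (volume.restrict (ball 0 ρ)) ^ 2) := by
            refine lintegral_mono_ae ?_
            filter_upwards [ae_restrict_of_ae hτ', ae_restrict_mem measurableSet_Ioc] with t ht ht'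
            calc ∫⁻ x in ball 0 ρ, ‖u (t, x)‖ₑ ^ 2
                ≤ ∫⁻ x in ball 0 ρ, 2 * (‖u (t, x) - f x‖ₑ ^ 2 + ‖f x‖ₑ ^ 2) := by
                  refine lintegral_mono fun x => ?_
                  simpa using enorm_add_sq_le (u (t, x) - f x) (f x)
              _ = 2 * ((∫⁻ x in ball 0 ρ, ‖u (t, x) - f x‖ₑ ^ 2) +
                    ∫⁻ x in ball 0 ρ, ‖f x‖ₑ ^ 2) := by
                  rw [lintegral_const_mul' _ _ (by simp),
                    lintegral_add_right' _ (hball.1.enorm.pow_const 2)]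
              _ ≤ _ := by
                  rw [sq_eLpNorm_two]
                  gcongr
                  rw [← sq_eLpNorm_two (fun x => u (t, x) - f x)]
                  refine pow_le_one₀ zero_le (le_trans ?_ (ht ht'))
                  exact eLpNorm_mono_measure _ (Measure.restrict_mono ball_subset_closedBall le_rfl)
        _ < ⊤ := by
            rw [setLIntegral_const]
            refine mul_lt_top (mul_lt_top (by simp) ?_) (by simp)
            exact ENNReal.add_lt_top.2 ⟨by simp, pow_lt_top hball.2⟩
  have h2 : MemLp u 2 (volume.restrict (Set.Icc τ S ×ˢ closedBall (0 : Rn n) ρ)) :=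
    h.locL2 _ (isCompact_Icc.prod (isCompact_closedBall _ _)) fun z hz => hτ.trans_le hz.1.1
  have h1' : MemLp u 2 (volume.restrict (Ioc 0 τ ×ˢ ball (0 : Rn n) ρ)) := by
    rwa [cylMeasure_eq] at h1
  have h3 : MemLp u 2 ((volume.restrict (Ioc 0 τ ×ˢ ball (0 : Rn n) ρ)) +
      volume.restrict (Set.Icc τ S ×ˢ closedBall (0 : Rn n) ρ)) := by
    refine ⟨h1'.1.add_measure h2.1, eLpNorm_two_lt_top ?_⟩
    rw [lintegral_add_measure, ← sq_eLpNorm_two, ← sq_eLpNorm_two]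
    exact ENNReal.add_lt_top.2 ⟨pow_lt_top h1'.2, pow_lt_top h2.2⟩
  refine h3.mono_measure ?_
  rw [cylMeasure_eq]
  refine le_trans (Measure.restrict_mono (s' := Ioc 0 τ ×ˢ ball (0 : Rn n) ρ ∪
    Set.Icc τ S ×ˢ closedBall (0 : Rn n) ρ) ?_ le_rfl) (Measure.restrict_union_le _ _)
  rintro z ⟨⟨hz1, hz2⟩, hz3⟩
  rcases le_total z.1 τ with hz | hz
  · exact Or.inl ⟨⟨hz1, hz⟩, hz3⟩
  · exact Or.inr ⟨⟨hz, hz2⟩, ball_subset_closedBall hz3⟩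

/-- A smooth cut-off vanishing for `t ≤ δ` and equal to `1` for `t ≥ 2δ`. -/
def vcut (δ t : ℝ) : ℝ := Real.smoothTransition (t / δ - 1)

theorem contDiff_vcut (δ : ℝ) : ContDiff ℝ ∞ (vcut δ) :=
  Real.smoothTransition.contDiff.comp ((contDiff_id.div_const δ).sub contDiff_const)

theorem vcut_eq_zero {δ t : ℝ} (hδ : 0 < δ) (h : t ≤ δ) : vcut δ t = 0 :=
  Real.smoothTransition.zero_of_nonpos (by rw [sub_nonpos, div_le_one hδ]; exact h)

theorem vcut_eq_one {δ t : ℝ} (hδ : 0 < δ) (h : 2 * δ ≤ t) : vcut δ t = 1 :=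
  Real.smoothTransition.one_of_one_le (by rw [le_sub_iff_add_le, le_div_iff₀ hδ]; linarith)

theorem norm_vcut_le (δ t : ℝ) : ‖vcut δ t‖ ≤ 1 := by
  rw [vcut, norm_of_nonneg (Real.smoothTransition.nonneg _)]
  exact Real.smoothTransition.le_one _

theorem deriv_vcut_nonneg {δ : ℝ} (hδ : 0 < δ) (t : ℝ) : 0 ≤ deriv (vcut δ) t := by
  refine Monotone.deriv_nonneg (fun a b hab => Real.smoothTransition.monotone ?_)
  gcongr

theorem deriv_vcut_eq_zero {δ t : ℝ} (hδ : 0 < δ) (h : 2 * δ < t) : deriv (vcut δ) t = 0 := by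
  have : vcut δ =ᶠ[𝓝 t] fun _ => 1 := by
    filter_upwards [lt_mem_nhds h] with s hs using vcut_eq_one hδ hs.le
  rw [this.deriv_eq]; simp

theorem integral_deriv_vcut {δ S : ℝ} (hδ : 0 < δ) (hS : 2 * δ ≤ S) :
    ∫ t in Ioc 0 S, deriv (vcut δ) t = 1 := by
  rw [← intervalIntegral.integral_of_le (by linarith), intervalIntegral.integral_deriv_eq_sub (f := vcut δ)]
  · rw [vcut_eq_one hδ hS, vcut_eq_zero hδ hδ.le, sub_zero]
  · exact fun t _ => ((contDiff_vcut δ).differentiable (by simp)).differentiableAt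
  · exact ((contDiff_vcut δ).continuous_deriv (by simp)).intervalIntegrable _ _

/-- The derivatives of the cut-offs are nonnegative, have integral `1` and vanish for `t > 2 * δ`:
they form a one-sided approximate identity. Null sets of `t` do not matter to it, which fits the
essential limit in the notion of trace. -/
theorem tendsto_integral_deriv_vcut {a : ℝ → ℂ} {a₀ : ℂ} {S : ℝ} (hS : 0 < S)
    (ha : IntegrableOn a (Ioc 0 S)) (h : Tendsto a (𝓝[>] 0 ⊓ ae volume) (𝓝 a₀)) :
    Tendsto (fun δ => ∫ t in Ioc 0 S, ((deriv (vcut δ) t : ℝ) : ℂ) * a t) (𝓝[>] 0) (𝓝 a₀) := by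
  rw [Metric.tendsto_nhds]
  intro ε hε
  obtain ⟨τ, hτ, hτ'⟩ := eventually_of_trace
    (h.eventually (Metric.closedBall_mem_nhds a₀ (half_pos hε)))
  have h1 : Set.Ioo 0 (min τ S / 2) ∈ 𝓝[>] (0 : ℝ) := Ioo_mem_nhdsGT (half_pos (lt_min hτ hS))
  filter_upwards [h1] with δ ⟨hδ, hδ'⟩
  have hδτ : 2 * δ < τ := by linarith [min_le_left τ S]
  have hδS : 2 * δ < S := by linarith [min_le_right τ S]
  have hc : Continuous (deriv (vcut δ)) := (contDiff_vcut δ).continuous_deriv (by simp)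
  have hcC : Continuous fun t => ((deriv (vcut δ) t : ℝ) : ℂ) := continuous_ofReal.comp hc
  have hi1 : IntegrableOn (fun t => ((deriv (vcut δ) t : ℝ) : ℂ)) (Ioc 0 S) :=
    (hcC.integrableOn_Icc).mono_set Set.Ioc_subset_Icc_self
  have hi2 : IntegrableOn (fun t => ((deriv (vcut δ) t : ℝ) : ℂ) * a t) (Ioc 0 S) := by
    obtain ⟨K, hK⟩ := (isCompact_Icc (a := (0 : ℝ)) (b := S)).exists_bound_of_continuousOn
      hcC.continuousOn
    refine Integrable.bdd_mul ha hcC.aestronglyMeasurable (c := K) ?_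
    filter_upwards [ae_restrict_mem measurableSet_Ioc] with t ht
      using hK t (Set.Ioc_subset_Icc_self ht)
  have e : (∫ t in Ioc 0 S, ((deriv (vcut δ) t : ℝ) : ℂ) * a t) - a₀ =
      ∫ t in Ioc 0 S, ((deriv (vcut δ) t : ℝ) : ℂ) * (a t - a₀) := by
    simp_rw [mul_sub]
    rw [integral_sub hi2 (hi1.mul_const a₀), integral_mul_const, integral_complex_ofReal,
      integral_deriv_vcut hδ hδS.le]
    simp
  rw [dist_eq_norm, e]
  calc ‖∫ t in Ioc 0 S, ((deriv (vcut δ) t : ℝ) : ℂ) * (a t - a₀)‖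
      ≤ ∫ t in Ioc 0 S, deriv (vcut δ) t * (ε / 2) := by
        refine norm_integral_le_of_norm_le ?_ ?_
        · exact ((hc.integrableOn_Icc).mono_set Set.Ioc_subset_Icc_self).mul_const _
        · filter_upwards [ae_restrict_of_ae hτ', ae_restrict_mem measurableSet_Ioc] with t ht ht'
          rw [norm_mul, Complex.norm_real, norm_of_nonneg (deriv_vcut_nonneg hδ t)]
          rcases le_or_gt t τ with htτ | htτ
          · have := ht ⟨ht'.1, htτ⟩
            rw [dist_eq_norm] at this
            exact mul_le_mul_of_nonneg_left this (deriv_vcut_nonneg hδ t)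
          · rw [deriv_vcut_eq_zero hδ (by linarith)]; simp
    _ = ε / 2 := by rw [integral_mul_const, integral_deriv_vcut hδ hδS.le, one_mul]
    _ < ε := half_lt_self hε

theorem eventually_aestronglyMeasurable_slice (hu : AEStronglyMeasurable u (upperMeasure n))
    (s : Set (Rn n)) : ∀ᶠ t in 𝓝[>] (0 : ℝ) ⊓ ae volume,
      AEStronglyMeasurable (fun x => u (t, x)) (volume.restrict s) := by
  rw [upperMeasure_eq_prod] at hu
  have := (ae_restrict_iff' measurableSet_Ioi).1 hu.prodMk_left
  refine Filter.eventually_inf.2 ⟨_, self_mem_nhdsWithin, _, this, fun t ht => ?_⟩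
  exact (ht.2 ht.1).mono_measure Measure.restrict_le_self

theorem hasFDerivAt_comp_fst {c : ℝ → ℝ} (hc : ContDiff ℝ ∞ c) (z : Pt n) :
    HasFDerivAt (fun z : Pt n => c z.1) (deriv c z.1 • ContinuousLinearMap.fst ℝ ℝ (Rn n)) z :=
  HasDerivAt.comp_hasFDerivAt (f := fun z : Pt n => z.1) z
    (hc.differentiable (by simp)).differentiableAt.hasDerivAt hasFDerivAt_fst

theorem tendsto_trace_pairing (hu : AEStronglyMeasurable u
    (upperMeasure n)) (hf : IsTrace u f) (ρ : ℝ) {φ : Pt n → ℂ} (hφ : Continuous φ)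
    (hφc : HasCompactSupport φ) (α : Fin m) :
    Tendsto (fun t => ∫ x in ball 0 ρ, u (t, x) α * φ (t, x)) (𝓝[>] 0 ⊓ ae volume)
      (𝓝 (∫ x in ball 0 ρ, f x α * φ (0, x))) := by
  set ν := volume.restrict (ball (0 : Rn n) ρ)
  have hball : MemLp f 2 ν := hf.memLp_ball ρ
  obtain ⟨C, hC⟩ := hφc.exists_bound_of_continuous hφ
  have hfα : Integrable (fun x => f x α) ν := (hball.eval_piLp α).integrable one_le_two
  have hslice : ∀ t, Continuous fun x : Rn n => φ (t, x) := fun t => hφ.comp (by fun_prop)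
  have h1 : Tendsto (fun t => ∫ x, f x α * φ (t, x) ∂ν) (𝓝[>] 0 ⊓ ae volume)
      (𝓝 (∫ x, f x α * φ (0, x) ∂ν)) := by
    have hc : Continuous fun t : ℝ => ∫ x, f x α * φ (t, x) ∂ν := by
      refine continuous_of_dominated (bound := fun x => ‖f x α‖ * C)
        (fun t => hfα.1.mul (hslice t).aestronglyMeasurable)
        (fun t => ae_of_all _ fun x => ?_) (hfα.norm.mul_const C)
        (ae_of_all _ fun x => continuous_const.mul (hφ.comp (by fun_prop)))
      rw [norm_mul]
      exact mul_le_mul_of_nonneg_left (hC _) (norm_nonneg _)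
    exact (hc.tendsto 0).mono_left (inf_le_left.trans nhdsWithin_le_nhds)
  have h0 : Tendsto (fun t => eLpNorm (fun x => u (t, x) - f x) 2 ν) (𝓝[>] 0 ⊓ ae volume) (𝓝 0) :=
    tendsto_nhds_bot_mono' (hf.2 _ (isCompact_closedBall 0 ρ)) fun t =>
      eLpNorm_mono_measure _ (Measure.restrict_mono ball_subset_closedBall le_rfl)
  have h2 : Tendsto (fun t => ofReal C * (ν univ ^ (1 / 2 : ℝ) *
      eLpNorm (fun x => u (t, x) - f x) 2 ν)) (𝓝[>] 0 ⊓ ae volume) (𝓝 0) := by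
    have h4 := ENNReal.Tendsto.const_mul (ENNReal.Tendsto.const_mul h0
      (a := ν univ ^ (1 / 2 : ℝ)) (Or.inr (by finiteness)))
      (a := ofReal C) (Or.inr ofReal_ne_top)
    simpa using h4
  have h3 : Tendsto (fun t => (∫ x, u (t, x) α * φ (t, x) ∂ν) - ∫ x, f x α * φ (t, x) ∂ν)
      (𝓝[>] 0 ⊓ ae volume) (𝓝 0) := by
    rw [tendsto_zero_iff_enorm_tendsto_zero]
    refine tendsto_of_tendsto_of_tendsto_of_le_of_le' tendsto_const_nhds h2
      (Eventually.of_forall fun _ => zero_le) ?_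
    have hb3 := h0.eventually (gt_mem_nhds ENNReal.zero_lt_top)
    filter_upwards [eventually_aestronglyMeasurable_slice hu _, hb3] with t ht ht3
    have hd : MemLp (fun x => u (t, x) - f x) 2 ν := ⟨ht.sub hball.1, ht3⟩
    have hu2 : Integrable (fun x => u (t, x) α) ν := by
      have : MemLp (fun x => u (t, x)) 2 ν :=
        (hd.add hball).ae_eq (ae_of_all _ fun x => sub_add_cancel _ _)
      exact (this.eval_piLp α).integrable one_le_two
    rw [← integral_sub
      (hu2.mul_bdd (c := C) (hslice t).aestronglyMeasurable (ae_of_all _ fun x => hC _))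
      (hfα.mul_bdd (c := C) (hslice t).aestronglyMeasurable (ae_of_all _ fun x => hC _))]
    calc ‖∫ x, u (t, x) α * φ (t, x) - f x α * φ (t, x) ∂ν‖ₑ
        ≤ ∫⁻ x, ofReal C * ‖u (t, x) - f x‖ₑ ∂ν := by
          refine (enorm_integral_le_lintegral_enorm _).trans (lintegral_mono fun x => ?_)
          rw [← sub_mul, enorm_mul, mul_comm]
          gcongr
          · rw [← ofReal_norm]; exact ofReal_le_ofReal (hC _)
          · rw [← ofReal_norm, ← ofReal_norm]
            exact ofReal_le_ofReal (norm_apply_le (u (t, x) - f x) α)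
      _ ≤ _ := by
          rw [lintegral_const_mul' _ _ ofReal_ne_top, ← eLpNorm_one_eq_lintegral_enorm]
          gcongr
          have := eLpNorm_le_eLpNorm_mul_rpow_measure_univ (p := 1) (q := 2) (μ := ν)
            (by norm_num) hd.1
          rw [mul_comm]
          refine this.trans (le_of_eq ?_)
          norm_num
  simpa using h3.add h1

/-- Green's formula with the trace at the boundary. -/
theorem green (h : IsEnergy u G)
    (hf : IsTrace u f) {φ : Pt n → ℝ} (hφ : ContDiff ℝ ∞ φ) (hφc : HasCompactSupport φ)
    (i : Fin (n + 1)) (α : Fin m) :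
    ∫ z in upper n, u z α * (fderiv ℝ φ z (dir i) : ℂ) =
      -(∫ z in upper n, G z i α * (φ z : ℂ)) -
        ((dir i : Pt n).1 : ℂ) * ∫ x, f x α * (φ (0, x) : ℂ) := by
  obtain ⟨S, ρ, hS, hρ, hsub⟩ := exists_cyl_supset hφc.isCompact
  have hdφ : Continuous fun z => (fderiv ℝ φ z (dir i) : ℂ) :=
    continuous_ofReal.comp (continuous_fderiv_apply hφ _)
  have hdφc : HasCompactSupport fun z => (fderiv ℝ φ z (dir i) : ℂ) :=
    (hφc.fderiv_apply ℝ (dir i)).comp_left Complex.ofReal_zero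
  have hφC : Continuous fun z => (φ z : ℂ) := continuous_ofReal.comp hφ.continuous
  have hφCc : HasCompactSupport fun z => (φ z : ℂ) := hφc.comp_left Complex.ofReal_zero
  have hz0 : ∀ z ∉ tsupport φ, (φ z : ℂ) = 0 := fun z hz => by
    rw [image_eq_zero_of_notMem_tsupport hz]; simp
  have hz1 : ∀ z ∉ tsupport φ, (fderiv ℝ φ z (dir i) : ℂ) = 0 := fun z hz => by
    simp [image_eq_zero_of_notMem_tsupport fun h => hz (tsupport_fderiv_apply_subset ℝ (dir i) h)]
  have hu2 := memLp_cyl_of_trace h hf S ρ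
  have huα : Integrable (fun z => u z α) (cylMeasure n S ρ) :=
    (hu2.eval_piLp α).integrable one_le_two
  have iφ : Integrable (fun z => u z α * (φ z : ℂ)) (cylMeasure n S ρ) := by
    obtain ⟨C, hC⟩ := hφCc.exists_bound_of_continuous hφC
    exact huα.mul_bdd (c := C) hφC.aestronglyMeasurable (ae_of_all _ hC)
  have idφ : Integrable (fun z => u z α * (fderiv ℝ φ z (dir i) : ℂ)) (cylMeasure n S ρ) := by
    obtain ⟨C, hC⟩ := hdφc.exists_bound_of_continuous hdφ
    exact huα.mul_bdd (c := C) hdφ.aestronglyMeasurable (ae_of_all _ hC)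
  have iG : Integrable (fun z => G z i α * (φ z : ℂ)) (upperMeasure n) :=
    (h.gradL2 i α).integrable_mul ((hφC.memLp_of_hasCompactSupport (p := 2) hφCc).restrict _)
  have idη : ∀ δ, Integrable (fun z => u z α * (φ z : ℂ) * ((deriv (vcut δ) z.1 : ℝ) : ℂ))
      (cylMeasure n S ρ) := by
    intro δ
    have hc : Continuous fun t => ((deriv (vcut δ) t : ℝ) : ℂ) :=
      continuous_ofReal.comp ((contDiff_vcut δ).continuous_deriv (by simp))
    obtain ⟨K, hK⟩ := (isCompact_Icc (a := (0 : ℝ)) (b := S)).exists_bound_of_continuousOn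
      hc.continuousOn
    have hae : ∀ᵐ z ∂(cylMeasure n S ρ), ‖((deriv (vcut δ) z.1 : ℝ) : ℂ)‖ ≤ K := by
      rw [cylMeasure_eq]
      filter_upwards [ae_restrict_mem (measurableSet_Ioc.prod isOpen_ball.measurableSet)]
        with z hz using hK _ (Set.Ioc_subset_Icc_self hz.1)
    exact iφ.mul_bdd (c := K) (hc.comp continuous_fst).aestronglyMeasurable hae
  have hcut : ∀ δ, Continuous fun z : Pt n => (vcut δ z.1 : ℂ) := fun δ =>
    continuous_ofReal.comp ((contDiff_vcut δ).continuous.comp continuous_fst)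
  have hcb : ∀ δ (z : Pt n), ‖(vcut δ z.1 : ℂ)‖ ≤ 1 := fun δ z => by
    rw [Complex.norm_real]; exact norm_vcut_le _ _
  have hpt : ∀ z : Pt n, z ∈ upper n →
      Tendsto (fun δ => (vcut δ z.1 : ℂ)) (𝓝[>] 0) (𝓝 1) := fun z hz => by
    refine tendsto_const_nhds.congr' ?_
    filter_upwards [Ioo_mem_nhdsGT (half_pos hz)] with δ hδ
    rw [vcut_eq_one hδ.1 (by linarith [hδ.2])]; simp
  have key : ∀ {μ : Measure (Pt n)} {w : Pt n → ℂ}, μ ≤ upperMeasure n → Integrable w μ →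
      Tendsto (fun δ => ∫ z, w z * (vcut δ z.1 : ℂ) ∂μ) (𝓝[>] 0) (𝓝 (∫ z, w z ∂μ)) := by
    intro μ w hμ hw
    refine tendsto_integral_filter_of_dominated_convergence (fun z => ‖w z‖)
      (Eventually.of_forall fun δ => hw.1.mul (hcut δ).aestronglyMeasurable)
      (Eventually.of_forall fun δ => ae_of_all _ fun z => ?_) hw.norm ?_
    · rw [norm_mul]
      exact mul_le_of_le_one_right (norm_nonneg _) (hcb δ z)
    · have : ∀ᵐ z ∂μ, z ∈ upper n :=
        (Measure.absolutelyContinuous_of_le hμ).ae_le (ae_restrict_mem (measurableSet_upper n))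
      filter_upwards [this] with z hz
      simpa using (hpt z hz).const_mul (w z)
  have t1 := key (cylMeasure_le S ρ) idφ
  have t2 := key le_rfl iG
  have t3 : Tendsto (fun δ => ∫ z, u z α * (φ z : ℂ) * ((deriv (vcut δ) z.1 : ℝ) : ℂ)
      ∂(cylMeasure n S ρ)) (𝓝[>] 0) (𝓝 (∫ x in ball 0 ρ, f x α * (φ (0, x) : ℂ))) := by
    have ha := tendsto_integral_deriv_vcut hS
      (a := fun t => ∫ x in ball 0 ρ, u (t, x) α * (φ (t, x) : ℂ)) iφ.integral_prod_left
      (tendsto_trace_pairing h.aestronglyMeasurable hf ρ hφC hφCc α)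
    refine ha.congr' ?_
    filter_upwards with δ
    rw [integral_prod]
    · refine integral_congr_ae (ae_of_all _ fun t => ?_)
      simp only
      rw [← integral_const_mul]
      congr 1
      ext x
      ring
    · exact idη δ
  -- Test the weak gradient with `φ` times the cut-off. The derivative of the cut-off is purely
  -- vertical and produces the last integral, which concentrates on the boundary as `δ → 0`.
  have id : ∀ δ ∈ Ioi (0 : ℝ),
      (∫ z, u z α * (fderiv ℝ φ z (dir i) : ℂ) * (vcut δ z.1 : ℂ) ∂(cylMeasure n S ρ)) =
      -(∫ z, G z i α * (φ z : ℂ) * (vcut δ z.1 : ℂ) ∂(upperMeasure n)) - ((dir i : Pt n).1 : ℂ) *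
        ∫ z, u z α * (φ z : ℂ) * ((deriv (vcut δ) z.1 : ℝ) : ℂ) ∂(cylMeasure n S ρ) := by
    intro δ hδ
    have hη : ContDiff ℝ ∞ fun z : Pt n => vcut δ z.1 := (contDiff_vcut δ).comp contDiff_fst
    have hw := h.weakGrad i α (fun z => φ z * vcut δ z.1) (hφ.mul hη) hφc.mul_right ?_
    swap
    · have h1 : tsupport (fun z : Pt n => φ z * vcut δ z.1) ⊆ {z | δ ≤ z.1} := by
        refine closure_minimal (fun z hz => ?_) (isClosed_le continuous_const continuous_fst)
        by_contra hlt
        exact hz (by simp only; rw [vcut_eq_zero hδ (not_le.1 hlt).le, mul_zero])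
      exact h1.trans fun z (hz : δ ≤ z.1) => show 0 < z.1 from lt_of_lt_of_le hδ hz
    have hder : ∀ z, fderiv ℝ (fun z : Pt n => φ z * vcut δ z.1) z (dir i) =
        fderiv ℝ φ z (dir i) * vcut δ z.1 + φ z * (deriv (vcut δ) z.1 * (dir i : Pt n).1) := by
      intro z
      have h2 : HasFDerivAt (fun z : Pt n => φ z * vcut δ z.1) _ z :=
        ((hφ.differentiable (by simp)) z).hasFDerivAt.mul (hasFDerivAt_comp_fst (contDiff_vcut δ) z)
      rw [h2.fderiv]
      simp
      ring
    simp_rw [hder] at hw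
    rw [setIntegral_upper_eq_cyl hsub (fun z hz => by
      have := hz1 z hz; have h0 := hz0 z hz
      push_cast
      rw [this, h0]; simp)] at hw
    have e1 : ∀ z : Pt n, u z α * ((fderiv ℝ φ z (dir i) * vcut δ z.1 +
        φ z * (deriv (vcut δ) z.1 * (dir i : Pt n).1) : ℝ) : ℂ) =
        u z α * (fderiv ℝ φ z (dir i) : ℂ) * (vcut δ z.1 : ℂ) +
        ((dir i : Pt n).1 : ℂ) * (u z α * (φ z : ℂ) * ((deriv (vcut δ) z.1 : ℝ) : ℂ)) := by
      intro z; push_cast; ring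
    simp_rw [e1] at hw
    rw [integral_add, integral_const_mul] at hw
    · rw [eq_sub_iff_add_eq, hw]
      congr 2
      ext z
      push_cast
      ring
    · exact idφ.mul_bdd (c := 1) (hcut δ).aestronglyMeasurable (ae_of_all _ (hcb δ))
    · exact (idη δ).const_mul _
  -- `hsub` only locates points of the support with `t > 0`. A boundary point where `φ` does not
  -- vanish has such points directly above it, so it lies over the same ball.
  have hball : ∫ x, f x α * (φ (0, x) : ℂ) = ∫ x in ball 0 ρ, f x α * (φ (0, x) : ℂ) := by
    rw [setIntegral_eq_integral_of_forall_compl_eq_zero]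
    intro x hx
    by_contra h0
    have hne : φ (0, x) ≠ 0 := fun h => h0 (by rw [h]; simp)
    have h1 : ∀ᶠ t in 𝓝[>] (0 : ℝ), φ (t, x) ≠ 0 := by
      have hc : Continuous fun t : ℝ => φ (t, x) := hφ.continuous.comp (by fun_prop)
      exact ((hc.tendsto 0).eventually (isOpen_ne.mem_nhds hne)).filter_mono nhdsWithin_le_nhds
    obtain ⟨t, ht, ht0⟩ := (h1.and self_mem_nhdsWithin).exists
    exact hx (hsub ⟨subset_tsupport φ ht, ht0⟩).2
  rw [setIntegral_upper_eq_cyl hsub (fun z hz => by rw [hz1 z hz, mul_zero]), hball]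
  refine tendsto_nhds_unique t1 ((t2.neg.sub (t3.const_mul _)).congr' ?_)
  filter_upwards [self_mem_nhdsWithin] with δ hδ using (id δ hδ).symm

/-! ### Mollification, cut-off and density of test gradients -/

section Convolution

variable {X E : Type*} [NormedAddCommGroup X] [NormedSpace ℝ X] [FiniteDimensional ℝ X]
  [MeasureSpace X] [BorelSpace X] [(volume : Measure X).IsAddHaarMeasure]
  [NormedAddCommGroup E] [NormedSpace ℝ E]

/-- Convolution of a real kernel with a vector-valued function. -/
def conv (ρ : X → ℝ) (f : X → E) (x : X) : E := ∫ y, ρ y • f (x - y)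

theorem conv_eq (ρ : X → ℝ) (f : X → E) : conv ρ f = convolution ρ f (lsmul ℝ ℝ) volume := rfl

theorem conv_eq_integral_sub (ρ : X → ℝ) (f : X → E) (x : X) :
    conv ρ f x = ∫ w, ρ (x - w) • f w := by
  rw [conv, ← integral_sub_left_eq_self _ _ x]
  simp

theorem integrable_conv {ρ : X → ℝ} (hρ : Continuous ρ) (hc : HasCompactSupport ρ) {f : X → E}
    (hf : LocallyIntegrable f) (x : X) : Integrable fun y => ρ y • f (x - y) :=
  hc.convolutionExists_left (lsmul ℝ ℝ) hρ hf x

theorem contDiff_conv {ρ : X → ℝ} (hρ : ContDiff ℝ ∞ ρ) (hc : HasCompactSupport ρ) {f : X → E}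
    (hf : LocallyIntegrable f) : ContDiff ℝ ∞ (conv ρ f) := by
  rw [conv_eq]
  exact hc.contDiff_convolution_left (n := ⊤) _ hρ hf

theorem fderiv_conv_apply [CompleteSpace E] {ρ : X → ℝ} (hρ : ContDiff ℝ ∞ ρ)
    (hc : HasCompactSupport ρ) {f : X → E}
    (hf : LocallyIntegrable f) (x v : X) :
    fderiv ℝ (conv ρ f) x v = conv (fun y => fderiv ℝ ρ y v) f x := by
  have h := hc.hasFDerivAt_convolution_left (lsmul ℝ ℝ : ℝ →L[ℝ] E →L[ℝ] E)
    (hρ.of_le (by simp)) hf x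
  rw [conv_eq, h.fderiv, convolution_def]
  have hi : ConvolutionExistsAt (fderiv ℝ ρ) f x
      ((lsmul ℝ ℝ : ℝ →L[ℝ] E →L[ℝ] E).precompL X) volume :=
    (hc.fderiv (𝕜 := ℝ)).convolutionExists_left _ (hρ.continuous_fderiv (by simp)) hf x
  rw [ContinuousLinearMap.integral_apply hi]
  simp [conv]

end Convolution

theorem tendsto_lintegral_translate {E : Type*} [NormedAddCommGroup E] {f : Pt n → E}
    (hf : MemLp f 2 volume) :
    Tendsto (fun y => ∫⁻ z, ‖f (z - y) - f z‖ₑ ^ 2) (𝓝 (0 : Pt n)) (𝓝 0) := by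
  let s : Pt n → C(Pt n, Pt n) := fun y => ⟨fun z => z - y, by fun_prop⟩
  have hs : Continuous s := ContinuousMap.continuous_of_continuous_uncurry _ (by
      simp only [Function.uncurry_def, s, ContinuousMap.coe_mk]; fun_prop)
  have hmp : ∀ y, MeasurePreserving (s y) := fun y => measurePreserving_sub_right _ y
  have hc := Continuous.compMeasurePreservingLp (E := E) (p := 2) (μ := (volume : Measure (Pt n)))
    (f := fun _ : Pt n => hf.toLp f) continuous_const hs hmp (by simp)
  have h0 := (hc.tendsto 0).sub_const (hf.toLp f)
  have e0 : Lp.compMeasurePreserving (s 0) (hmp 0) (hf.toLp f) = hf.toLp f := by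
    rw [Lp.toLp_compMeasurePreserving]
    exact MemLp.toLp_congr _ _ (ae_of_all _ fun z => by simp [s])
  rw [e0, sub_self] at h0
  have h1 := h0.enorm
  simp only [enorm_zero] at h1
  have h2 := ENNReal.Tendsto.pow (n := 2) h1
  simp only [ne_eq, OfNat.ofNat_ne_zero, not_false_eq_true, zero_pow] at h2
  refine h2.congr fun y => ?_
  rw [Lp.toLp_compMeasurePreserving, ← MemLp.toLp_sub, Lp.enorm_def, eLpNorm_congr_ae
    (MemLp.coeFn_toLp _), sq_eLpNorm_two]
  rfl

theorem lintegral_conv_sub_le {E : Type*} [NormedAddCommGroup E] [NormedSpace ℝ E]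
    [CompleteSpace E] {ρ : Pt n → ℝ}
    (hρ : Continuous ρ) (hc : HasCompactSupport ρ) (hρ0 : ∀ y, 0 ≤ ρ y) (hρ1 : ∫ y, ρ y = 1)
    {f : Pt n → E} (hf : StronglyMeasurable f) (hf2 : MemLp f 2 volume) {η : ℝ≥0∞}
    (h : ∀ y, ρ y ≠ 0 → ∫⁻ z, ‖f (z - y) - f z‖ₑ ^ 2 ≤ η) :
    ∫⁻ z, ‖conv ρ f z - f z‖ₑ ^ 2 ≤ η := by
  have hloc : LocallyIntegrable f := hf2.locallyIntegrable one_le_two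
  have hint : Integrable ρ := hρ.integrable_of_hasCompactSupport hc
  have hone : ∫⁻ y, ‖ρ y‖ₑ = 1 := by
    have := ofReal_integral_eq_lintegral_ofReal hint (ae_of_all _ hρ0)
    rw [hρ1, ofReal_one] at this
    rw [this]
    exact lintegral_congr fun y => Real.enorm_of_nonneg (hρ0 y)
  have hm : Measurable fun p : Pt n × Pt n => ‖ρ p.2‖ₑ * ‖f (p.1 - p.2) - f p.1‖ₑ ^ 2 := by
    refine (hρ.measurable.comp measurable_snd).enorm.mul ?_
    exact ((hf.comp_measurable (by fun_prop)).sub (hf.comp_measurable measurable_fst)).enorm.pow_const 2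
  calc ∫⁻ z, ‖conv ρ f z - f z‖ₑ ^ 2
      ≤ ∫⁻ z, ∫⁻ y, ‖ρ y‖ₑ * ‖f (z - y) - f z‖ₑ ^ 2 := by
        refine lintegral_mono fun z => ?_
        have e : conv ρ f z - f z = ∫ y, ρ y • (f (z - y) - f z) := by
          simp_rw [smul_sub]
          rw [integral_sub (integrable_conv hρ hc hloc z) (hint.smul_const _),
            integral_smul_const, hρ1, one_smul]
          rfl
        rw [e]
        calc _ ≤ (∫⁻ y, ‖ρ y‖ₑ * ‖f (z - y) - f z‖ₑ) ^ 2 := by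
              gcongr
              refine (enorm_integral_le_lintegral_enorm _).trans (le_of_eq ?_)
              simp_rw [enorm_smul]
          _ ≤ _ := by
              refine (sq_lintegral_mul_le _ hρ.measurable.enorm ?_).trans (by rw [hone, one_mul])
              exact ((hf.comp_measurable (by fun_prop)).sub stronglyMeasurable_const).enorm
    _ = ∫⁻ y, ∫⁻ z, ‖ρ y‖ₑ * ‖f (z - y) - f z‖ₑ ^ 2 := lintegral_lintegral_swap hm.aemeasurable
    _ ≤ ∫⁻ y, ‖ρ y‖ₑ * η := by
        refine lintegral_mono fun y => ?_
        simp only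
        rw [lintegral_const_mul' _ _ enorm_ne_top]
        by_cases hy : ρ y = 0
        · simp [hy]
        · gcongr; exact h y hy
    _ = η := by rw [lintegral_mul_const _ hρ.measurable.enorm, hone, one_mul]

theorem norm_le_sum_apply {ι : Type*} [Fintype ι] (v : EuclideanSpace ℂ ι) : ‖v‖ ≤ ∑ k, ‖v k‖ := by
  classical
  have : v = ∑ k, single k (v k) := by
    ext i
    simp [Finset.sum_apply, Pi.single_apply]
  calc ‖v‖ = ‖∑ k, single k (v k)‖ := by rw [← this]
    _ ≤ _ := (norm_sum_le _ _).trans (by simp)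

theorem vec_grad_smul_sub {χ : Pt n → ℝ} {v : Pt n → Cm m} {z : Pt n} (hχ : DifferentiableAt ℝ χ z)
    (hv : DifferentiableAt ℝ v z) (c : Cm m) :
    vec (grad (fun z => χ z • (v z - c)) z) = χ z • vec (grad v z) +
      vec (fun i α => (fderiv ℝ χ z (dir i) : ℂ) * (v z - c) α) := by
  have h1 : DifferentiableAt ℝ (fun z => χ z • (v z - c)) z := hχ.smul (hv.sub_const c)
  ext ⟨i, α⟩
  simp only [vec_apply, PiLp.add_apply, PiLp.smul_apply, grad]
  change fderiv ℝ (fun y => (χ y • (v y - c)) α) z (dir i) = _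
  rw [fderiv_comp_apply h1, fderiv_comp_apply hv, fderiv_fun_smul hχ (hv.sub_const c),
    fderiv_sub_const]
  simp

/-- Multiply `v - c` by a cut-off at radius `R`. Its derivative is of order `1 / R` and the local
norm of `v - c` of order `R`, so the error made in the gradient is bounded in `L²`, though it need
not be small. It lives in `‖z‖ ≥ R`, so its pairing with a fixed field `W` tends to zero, and weak
approximation suffices. -/
theorem mem_energySpace_of_cutoff {U : Set (Pt n)} {v : Pt n → Cm m} (hv : ContDiff ℝ ∞ v)
    (hF : F =ᵐ[upperMeasure n] fun z => vec (grad v z)) {K : ℝ} (hK : 0 ≤ K)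
    (c : ℝ → Cm m)
    (hc : ∀ R, 0 < R → ∫⁻ t in Ioc 0 R, ∫⁻ x in ball 0 R, ‖v (t, x) - c R‖ₑ ^ 2 ≤
      ofReal (K * R ^ 2))
    (hU : ∀ R, tsupport (fun z => v z - c R) ⊆ U) : F ∈ energySpace n m U := by
  let b : ContDiffBump (0 : Pt n) := ⟨1, 2, one_pos, one_lt_two⟩
  obtain ⟨B, hB⟩ : ∃ B, ∀ z, ‖fderiv ℝ b z‖ ≤ B :=
    (b.hasCompactSupport.fderiv (𝕜 := ℝ)).exists_bound_of_continuous
      (b.contDiff (n := 1).continuous_fderiv (by simp))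
  have hB0 : 0 ≤ B := (norm_nonneg _).trans (hB 0)
  refine mem_energySpace_of_forall_inner fun W hW => ?_
  let χ : ℝ → Pt n → ℝ := fun R z => b (R⁻¹ • z)
  have hχ : ∀ R, ContDiff ℝ ∞ (χ R) := fun R => b.contDiff.comp (contDiff_id.const_smul R⁻¹)
  have hχ1 : ∀ R, 0 < R → ∀ z, ‖z‖ ≤ R → χ R z = 1 := fun R hR z hz => by
    refine b.one_of_mem_closedBall ?_
    rw [mem_closedBall_zero_iff, norm_smul, norm_inv, norm_of_nonneg hR.le]
    exact (inv_mul_le_one₀ hR).2 hz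
  have hχ0 : ∀ R, 0 < R → ∀ z, 2 * R < ‖z‖ → χ R z = 0 := fun R hR z hz => by
    refine b.zero_of_le_dist ?_
    rw [dist_zero_right, norm_smul, norm_inv, norm_of_nonneg hR.le, le_inv_mul_iff₀ hR]
    change R * 2 ≤ _
    linarith
  have hχc : ∀ R, 0 < R → HasCompactSupport (χ R) := fun R hR =>
    HasCompactSupport.intro (isCompact_closedBall 0 (2 * R)) fun z hz =>
      hχ0 R hR z (by rwa [mem_closedBall_zero_iff, not_le] at hz)
  have hdχ : ∀ R, 0 < R → ∀ z i, ‖fderiv ℝ (χ R) z (dir i)‖ ≤ R⁻¹ * B := by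
    intro R hR z i
    have e : fderiv ℝ (χ R) z = R⁻¹ • fderiv ℝ b (R⁻¹ • z) := fderiv_comp_smul (f := b) R⁻¹
    rw [e]
    refine (ContinuousLinearMap.le_opNorm _ _).trans ?_
    rw [norm_smul, norm_inv, norm_of_nonneg hR.le]
    have hdir : ‖(dir i : Pt n)‖ ≤ 1 := by
      refine Fin.cases ?_ (fun j => ?_) i <;> simp [dir, Prod.norm_def]
    calc R⁻¹ * ‖fderiv ℝ b (R⁻¹ • z)‖ * ‖(dir i : Pt n)‖ ≤ R⁻¹ * B * 1 := by
          gcongr; exact hB _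
      _ = _ := mul_one _
  -- The constant belongs to the cylinder of size `2 * R + 1`, which contains the part of the
  -- support of the cut-off in the half-space.
  let g : ℝ → Pt n → Cm m := fun R z => χ R z • (v z - c (2 * R + 1))
  have hg : ∀ R, ContDiff ℝ ∞ (g R) := fun R => (hχ R).smul (hv.sub contDiff_const)
  have hgc : ∀ R, 0 < R → HasCompactSupport (g R) := fun R hR => (hχc R hR).smul_right
  have hgU : ∀ R, tsupport (g R) ⊆ U := fun R => (tsupport_smul_subset_right _ _).trans (hU _)
  let M : ℝ := (((n : ℝ) + 1) * m * B)
  have hM0 : 0 ≤ M := by positivity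
  have hbound : ∀ R, 0 < R → ∀ z : Pt n, z ∈ upper n →
      ‖vec (grad v z) - vec (grad (g R) z)‖ₑ ≤
      indicator {z : Pt n | R ≤ ‖z‖} 1 z * (‖vec (grad v z)‖ₑ + ofReal (R⁻¹ * M) *
        indicator (Ioc 0 (2 * R + 1) ×ˢ ball (0 : Rn n) (2 * R + 1))
          (fun z => ‖v z - c (2 * R + 1)‖ₑ) z) := by
    intro R hR z hz
    have hdv := hv.differentiable (by simp) z
    by_cases hzR : R ≤ ‖z‖
    · have hmemR : z ∈ {z : Pt n | R ≤ ‖z‖} := hzR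
      rw [indicator_of_mem hmemR, Pi.one_apply, one_mul,
        vec_grad_smul_sub ((hχ R).differentiable (by simp) z) hdv, ← sub_sub]
      refine (enorm_sub_le).trans (add_le_add ?_ ?_)
      · have : vec (grad v z) - χ R z • vec (grad v z) = (1 - χ R z) • vec (grad v z) := by
          rw [sub_smul, one_smul]
        rw [this, enorm_smul]
        refine mul_le_of_le_one_left zero_le ?_
        rw [← ofReal_norm, ← ofReal_one]
        refine ofReal_le_ofReal ?_
        have h0 : 0 ≤ χ R z := b.nonneg
        have h1 : χ R z ≤ 1 := b.le_one
        rw [norm_of_nonneg (by linarith)]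
        linarith
      · by_cases hz2 : 2 * R + 1 ≤ ‖z‖
        · have hd0 : fderiv ℝ (χ R) z = 0 := by
            have : χ R =ᶠ[𝓝 z] fun _ => 0 := by
              filter_upwards [(isOpen_lt continuous_const continuous_norm).mem_nhds
                (show 2 * R < ‖z‖ by linarith)] with w hw using hχ0 R hR w hw
            rw [this.fderiv_eq]; simp
          have : vec (fun i α => ((fderiv ℝ (χ R) z (dir i) : ℝ) : ℂ) *
              (v z - c (2 * R + 1)) α) = (0 : Evec n m) := by
            ext k
            simp [vec_apply, hd0]
          rw [this]; simp
        · have hmem : z ∈ Ioc 0 (2 * R + 1) ×ˢ ball (0 : Rn n) (2 * R + 1) := by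
            rw [not_le, Prod.norm_def, max_lt_iff] at hz2
            exact ⟨⟨hz, (le_abs_self _).trans hz2.1.le⟩, mem_ball_zero_iff.2 hz2.2⟩
          rw [indicator_of_mem hmem, ← ofReal_norm, ← ofReal_norm, ← ofReal_mul (by positivity)]
          refine ofReal_le_ofReal ((norm_le_sum_apply _).trans ?_)
          calc _ ≤ ∑ k : Fin (n + 1) × Fin m, R⁻¹ * B * ‖v z - c (2 * R + 1)‖ := by
                refine sum_le_sum fun k _ => ?_
                rw [vec_apply, norm_mul, Complex.norm_real]
                exact mul_le_mul (hdχ R hR z k.1) (norm_apply_le _ _) (norm_nonneg _)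
                  (by positivity)
            _ = _ := by simp [M]; ring
    · have : g R =ᶠ[𝓝 z] fun z => v z - c (2 * R + 1) := by
        filter_upwards [(isOpen_lt continuous_norm continuous_const).mem_nhds
          (not_le.1 hzR)] with w hw
        simp only [g]
        rw [hχ1 R hR w (le_of_lt hw), one_smul]
      have e : vec (grad (g R) z) = vec (grad v z) := by
        ext ⟨i, α⟩
        simp only [vec_apply, grad]
        rw [fderiv_comp_apply ((hg R).differentiable (by simp) z), this.fderiv_eq,
          fderiv_sub_const, fderiv_comp_apply hdv]
      rw [e, sub_self]; simp
  have hcont : Continuous fun z => vec (grad v z) := continuous_vec_grad hv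
  have hFfin : ∫⁻ z in upper n, ‖vec (grad v z)‖ₑ ^ 2 = ‖F‖ₑ ^ 2 := by
    rw [Lp.enorm_def, sq_eLpNorm_two]
    exact lintegral_congr_ae (hF.mono fun z hz => by simp only [hz])
  let Q : ℝ → Pt n → ℝ≥0∞ := fun R z => ‖vec (grad v z)‖ₑ + ofReal (R⁻¹ * M) *
        indicator (Ioc 0 (2 * R + 1) ×ˢ ball (0 : Rn n) (2 * R + 1))
          (fun z => ‖v z - c (2 * R + 1)‖ₑ) z
  have hcyl : ∀ R : ℝ, MeasurableSet (Ioc 0 R ×ˢ ball (0 : Rn n) R) := fun R =>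
    measurableSet_Ioc.prod isOpen_ball.measurableSet
  have hQm : ∀ R, Measurable (Q R) := fun R =>
    hcont.measurable.enorm.add (Measurable.const_mul
      (((hv.continuous.sub continuous_const).measurable.enorm).indicator (hcyl _)) _)
  have hQ : ∀ R, 1 ≤ R → ∫⁻ z in upper n, Q R z ^ 2 ≤ 2 * (‖F‖ₑ ^ 2 + ofReal (9 * M ^ 2 * K)) := by
    intro R hR
    have hR0 : 0 < R := by linarith
    have h1 : ∀ a b : ℝ≥0∞, (a + b) ^ 2 ≤ 2 * (a ^ 2 + b ^ 2) := fun a b => by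
      have := ENNReal.rpow_add_le_mul_rpow_add_rpow a b (p := 2) one_le_two
      norm_num at this
      exact this
    calc ∫⁻ z in upper n, Q R z ^ 2
        ≤ ∫⁻ z in upper n, 2 * (‖vec (grad v z)‖ₑ ^ 2 + ofReal ((R⁻¹ * M) ^ 2) *
          indicator (Ioc 0 (2 * R + 1) ×ˢ ball (0 : Rn n) (2 * R + 1))
          (fun z => ‖v z - c (2 * R + 1)‖ₑ ^ 2) z) := by
          refine lintegral_mono fun z => (h1 _ _).trans (le_of_eq ?_)
          rw [mul_pow, ofReal_pow (by positivity)]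
          congr 3
          by_cases hz : z ∈ Ioc 0 (2 * R + 1) ×ˢ ball (0 : Rn n) (2 * R + 1) <;> simp [hz]
      _ = 2 * (‖F‖ₑ ^ 2 + ofReal ((R⁻¹ * M) ^ 2) *
          ∫⁻ t in Ioc 0 (2 * R + 1), ∫⁻ x in ball 0 (2 * R + 1),
            ‖v (t, x) - c (2 * R + 1)‖ₑ ^ 2) := by
          rw [lintegral_const_mul' _ _ (by simp),
            lintegral_add_left (hcont.measurable.enorm.pow_const 2),
            lintegral_const_mul' _ _ ofReal_ne_top, hFfin,
            lintegral_indicator (hcyl _), Measure.restrict_restrict (hcyl _),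
            Set.inter_eq_left.2 (cyl_subset_upper _ _), ← cylMeasure_eq, cylMeasure,
            lintegral_prod]
          exact ((hv.continuous.sub continuous_const).measurable.enorm.pow_const 2).aemeasurable
      _ ≤ _ := by
          gcongr
          refine (mul_le_mul_right (hc (2 * R + 1) (by linarith)) _).trans ?_
          rw [← ofReal_mul (by positivity)]
          refine ofReal_le_ofReal ?_
          have : (2 * R + 1) ^ 2 ≤ 9 * R ^ 2 := by nlinarith
          calc (R⁻¹ * M) ^ 2 * (K * (2 * R + 1) ^ 2) ≤ (R⁻¹ * M) ^ 2 * (K * (9 * R ^ 2)) := by gcongr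
            _ = _ := by field_simp
  have hlim : Tendsto (fun k : ℕ => ∫⁻ z in upper n,
      indicator {z : Pt n | (k : ℝ) + 1 ≤ ‖z‖} (fun z => ‖W z‖ₑ ^ 2) z) atTop (𝓝 0) := by
    have hWm : Measurable fun z => ‖W z‖ₑ ^ 2 := (Lp.stronglyMeasurable W).enorm.pow_const 2
    have := tendsto_lintegral_of_dominated_convergence (μ := upperMeasure n)
      (F := fun (k : ℕ) z => indicator {z : Pt n | (k : ℝ) + 1 ≤ ‖z‖} (fun z => ‖W z‖ₑ ^ 2) z)
      (f := fun _ => 0) (fun z => ‖W z‖ₑ ^ 2)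
      (fun k => hWm.indicator (isClosed_le continuous_const continuous_norm).measurableSet)
      (fun k => ae_of_all _ fun z => Set.indicator_le_self _ _ _) ?_ (ae_of_all _ fun z => ?_)
    · simpa using this
    · rw [← sq_eLpNorm_two, ← Lp.enorm_def]
      finiteness
    · obtain ⟨k₀, hk₀⟩ := exists_nat_gt ‖z‖
      refine tendsto_const_nhds.congr' ?_
      filter_upwards [eventually_ge_atTop k₀] with k hk
      rw [indicator_of_notMem]
      have : (k₀ : ℝ) ≤ k := by exact_mod_cast hk
      simp only [Set.mem_ofPred_eq, not_le]
      linarith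
  have hzero : ‖⟪W, F⟫_ℂ‖ₑ ^ 2 = 0 := by
    have hB' := ENNReal.Tendsto.mul_const hlim (b := 2 * (‖F‖ₑ ^ 2 + ofReal (9 * M ^ 2 * K)))
      (Or.inr (by finiteness))
    rw [zero_mul] at hB'
    refine le_antisymm (ge_of_tendsto' hB' fun k => ?_) zero_le
    have hR : (1 : ℝ) ≤ (k : ℝ) + 1 := by linarith [k.cast_nonneg (α := ℝ)]
    have hR0 : (0 : ℝ) < (k : ℝ) + 1 := by linarith
    have hX := hW _ (gradClass_mem (hg (k + 1)) (hgc _ hR0) (hgU _))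
    have e : ⟪W, F⟫_ℂ = ∫ z in upper n, ⟪W z, vec (grad v z) - vec (grad (g (k + 1)) z)⟫_ℂ := by
      rw [← sub_zero ⟪W, F⟫_ℂ, ← hX, ← inner_sub_right, L2.inner_def]
      refine integral_congr_ae ?_
      filter_upwards [Lp.coeFn_sub F (gradClass _ (hg (k + 1)) (hgc _ hR0)), hF,
        coeFn_gradClass (hg (k + 1)) (hgc _ hR0)] with z h1 h2 h3
      rw [h1, Pi.sub_apply, h2, h3]
    rw [e]
    calc _ ≤ (∫⁻ z in upper n, indicator {z : Pt n | (k : ℝ) + 1 ≤ ‖z‖} (fun z => ‖W z‖ₑ) z *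
          Q (k + 1) z) ^ 2 := by
          gcongr
          refine (enorm_integral_le_lintegral_enorm _).trans (lintegral_mono_ae ?_)
          filter_upwards [ae_restrict_mem (measurableSet_upper n)] with z hz
          have h1 : ‖⟪W z, vec (grad v z) - vec (grad (g (k + 1)) z)⟫_ℂ‖ₑ ≤
              ‖W z‖ₑ * ‖vec (grad v z) - vec (grad (g (k + 1)) z)‖ₑ := by
            rw [← ofReal_norm, ← ofReal_norm, ← ofReal_norm, ← ofReal_mul (norm_nonneg _)]
            exact ofReal_le_ofReal (norm_inner_le_norm _ _)
          refine h1.trans ((mul_le_mul_right (hbound (k + 1) hR0 z hz) _).trans (le_of_eq ?_))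
          by_cases hzk : z ∈ {z : Pt n | (k : ℝ) + 1 ≤ ‖z‖} <;> simp [hzk, Q]
      _ ≤ (∫⁻ z in upper n, indicator {z : Pt n | (k : ℝ) + 1 ≤ ‖z‖} (fun z => ‖W z‖ₑ ^ 2) z) *
          ∫⁻ z in upper n, Q (k + 1) z ^ 2 := by
          have := ENNReal.lintegral_mul_le_Lp_mul_Lq (upperMeasure n) Real.HolderConjugate.two_two
            (f := indicator {z : Pt n | (k : ℝ) + 1 ≤ ‖z‖} (fun z => ‖W z‖ₑ)) (g := Q (k + 1))
            (((Lp.stronglyMeasurable W).enorm.indicator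
              (isClosed_le continuous_const continuous_norm).measurableSet).aemeasurable)
            (hQm _).aemeasurable
          refine (pow_le_pow_left₀ zero_le this 2).trans (le_of_eq ?_)
          rw [mul_pow, ← ENNReal.rpow_natCast, ← ENNReal.rpow_natCast, ← ENNReal.rpow_mul,
            ← ENNReal.rpow_mul]
          norm_num
          congr 1
          refine lintegral_congr fun z => ?_
          by_cases hzk : z ∈ {z : Pt n | (k : ℝ) + 1 ≤ ‖z‖} <;> simp [hzk]
      _ ≤ _ := by gcongr; exact hQ _ hR
  simpa using hzero

/-- Extension of a field on the half-space by zero. -/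
def zeroExt (F : L2up n m) : Pt n → Evec n m := (upper n).indicator F

theorem stronglyMeasurable_zeroExt (F : L2up n m) : StronglyMeasurable (zeroExt F) :=
  (Lp.stronglyMeasurable F).indicator (measurableSet_upper n)

theorem memLp_zeroExt (F : L2up n m) : MemLp (zeroExt F) 2 volume :=
  (memLp_indicator_iff_restrict (measurableSet_upper n)).2 (Lp.memLp F)

/-- The space is closed, and mollifications of the extension by zero converge in `L²` as the kernels
shrink to the origin. The kernels need not be centred there. -/
theorem mem_energySpace_of_mollified {V : Set (Pt n)}
    (h : ∀ δ : ℝ, 0 < δ → ∃ ρ : Pt n → ℝ, ContDiff ℝ ∞ ρ ∧ HasCompactSupport ρ ∧ (∀ y, 0 ≤ ρ y) ∧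
      ∫ y, ρ y = 1 ∧ (∀ y, ρ y ≠ 0 → ‖y‖ < δ) ∧
      ∀ X : L2up n m, X =ᵐ[upperMeasure n] conv ρ (zeroExt F) → X ∈ energySpace n m V) :
    F ∈ energySpace n m V := by
  have hcl := isClosed_energySpace (n := n) (m := m) V
  rw [← SetLike.mem_coe, ← hcl.closure_eq, EMetric.mem_closure_iff]
  intro ε hε
  have hη : 0 < min (ε / 2) 1 ^ 2 := by
    have : 0 < min (ε / 2) 1 := lt_min (ENNReal.half_pos hε.ne') one_pos
    positivity
  obtain ⟨δ, hδ, hδ'⟩ := Metric.eventually_nhds_iff.1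
    ((tendsto_lintegral_translate (memLp_zeroExt F)).eventually (ge_mem_nhds hη))
  obtain ⟨ρ, h1, h2, h3, h4, h5, h6⟩ := h δ hδ
  have hb := lintegral_conv_sub_le h1.continuous h2 h3 h4 (stronglyMeasurable_zeroExt F)
    (memLp_zeroExt F) fun y hy => hδ' (by simpa using h5 y hy)
  have hloc : LocallyIntegrable (zeroExt F) := (memLp_zeroExt F).locallyIntegrable one_le_two
  have hcm : AEStronglyMeasurable (conv ρ (zeroExt F)) volume :=
    (contDiff_conv h1 h2 hloc).continuous.aestronglyMeasurable
  have hle : eLpNorm (fun z => conv ρ (zeroExt F) z - zeroExt F z) 2 volume ≤ min (ε / 2) 1 := by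
    rw [← sq_eLpNorm_two] at hb
    exact (ENNReal.pow_le_pow_left_iff two_ne_zero).1 hb
  have hd : MemLp (fun z => conv ρ (zeroExt F) z - zeroExt F z) 2 volume :=
    ⟨hcm.sub (memLp_zeroExt F).1, hle.trans_lt ((min_le_right _ _).trans_lt ENNReal.one_lt_top)⟩
  have hm : MemLp (conv ρ (zeroExt F)) 2 (upperMeasure n) := by
    have := (hd.add (memLp_zeroExt F)).restrict (upper n)
    exact this.ae_eq (ae_of_all _ fun z => sub_add_cancel _ _)
  refine ⟨hm.toLp _, h6 _ hm.coeFn_toLp, ?_⟩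
  rw [edist_comm, Lp.edist_def]
  calc _ = eLpNorm (fun z => conv ρ (zeroExt F) z - zeroExt F z) 2 (upperMeasure n) := by
        refine eLpNorm_congr_ae ?_
        filter_upwards [hm.coeFn_toLp, ae_restrict_mem (measurableSet_upper n)] with z hz hz'
        rw [Pi.sub_apply, hz, zeroExt, indicator_of_mem hz']
    _ ≤ min (ε / 2) 1 := (eLpNorm_mono_measure _ Measure.restrict_le_self).trans hle
    _ < ε := by
      rcases eq_or_ne ε ⊤ with rfl | hε'
      · exact (min_le_right _ _).trans_lt ENNReal.one_lt_top
      · exact (min_le_left _ _).trans_lt (ENNReal.half_lt_self hε.ne' hε')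

/-- The centre is free so that mollification can look only upwards (`a < 0`) or only downwards (`a >
0`), which avoids or exploits the boundary. -/
theorem exists_bump (n : ℕ) (a : ℝ) {δ : ℝ} (hδ : 0 < δ) : ∃ ρ : Pt n → ℝ, ContDiff ℝ ∞ ρ ∧
    HasCompactSupport ρ ∧ (∀ y, 0 ≤ ρ y) ∧ ∫ y, ρ y = 1 ∧
    ∀ y, ρ y ≠ 0 → |y.1 - a| < δ ∧ ‖y.2‖ < δ := by
  let b : ContDiffBump ((a, 0) : Pt n) := ⟨δ / 2, δ, by positivity, by linarith⟩
  refine ⟨b.normed volume, b.contDiff_normed, b.hasCompactSupport_normed, b.nonneg_normed,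
    b.integral_normed, fun y hy => ?_⟩
  have : y ∈ ball ((a, 0) : Pt n) δ := by rw [← b.support_normed_eq (μ := volume)]; exact hy
  rw [Metric.mem_ball, Prod.dist_eq, max_lt_iff, dist_zero_right, Real.dist_eq] at this
  exact this

theorem vec_grad_conv {ρ : Pt n → ℝ} (hρ : ContDiff ℝ ∞ ρ) (hc : HasCompactSupport ρ)
    {U : Pt n → Cm m} (hU : LocallyIntegrable U) {z : Pt n}
    (hw : ∀ i α, ∫ w, U w α * (fderiv ℝ (fun w => ρ (z - w)) w (dir i) : ℂ) =
      -∫ w, zeroExt F w (i, α) * (ρ (z - w) : ℂ)) :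
    vec (grad (conv ρ U) z) = conv ρ (zeroExt F) z := by
  have hloc : LocallyIntegrable (zeroExt F) := (memLp_zeroExt F).locallyIntegrable one_le_two
  ext ⟨i, α⟩
  rw [vec_apply, grad, fderiv_comp_apply ((contDiff_conv hρ hc hU).differentiable (by simp) z),
    fderiv_conv_apply hρ hc hU, conv, conv]
  have hd : Continuous fun y => fderiv ℝ ρ y (dir i) := continuous_fderiv_apply hρ _
  have hdc : HasCompactSupport fun y => fderiv ℝ ρ y (dir i) := hc.fderiv_apply ℝ (dir i)
  have e1 := (proj α : Cm m →L[ℂ] ℂ).integral_comp_comm (integrable_conv hd hdc hU z)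
  have e2 := (proj (i, α) : Evec n m →L[ℂ] ℂ).integral_comp_comm
    (integrable_conv hρ.continuous hc hloc z)
  rw [← integral_sub_left_eq_self _ _ z] at e1 e2
  simp only [sub_sub_cancel] at e1 e2
  change _ = (∫ y, fderiv ℝ ρ y (dir i) • U (z - y)) α at e1
  change _ = (∫ y, ρ y • zeroExt F (z - y)) (i, α) at e2
  have := hw i α
  rw [← e1, ← e2, ← neg_inj]
  convert this using 1
  · rw [← integral_neg]
    congr 1
    ext w
    have e : fderiv ℝ (fun w => ρ (z - w)) w (dir i) = -(fderiv ℝ ρ (z - w) (dir i)) := by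
      have h1 : HasFDerivAt (fun w => ρ (z - w)) _ w :=
        ((hρ.differentiable (by simp) (z - w)).hasFDerivAt).comp w (hasFDerivAt_id w |>.const_sub z)
      rw [h1.fderiv]; simp
    rw [e]
    simp [mul_comm]
  · congr 2
    ext w
    simp [mul_comm]

theorem tsupport_comp_sub_subset {ρ : Pt n → ℝ} {a δ : ℝ}
    (h : ∀ y, ρ y ≠ 0 → |y.1 - a| < δ ∧ ‖y.2‖ < δ) (z : Pt n) :
    tsupport (fun w => ρ (z - w)) ⊆ {w | z.1 - a - δ ≤ w.1} := by
  refine closure_minimal (fun w hw => ?_) (isClosed_le continuous_const continuous_fst)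
  have := abs_lt.1 (h _ hw).1
  simp only [Prod.fst_sub] at this
  change z.1 - a - δ ≤ w.1
  linarith [this.2]

theorem fderiv_eq_zero_of_notMem_tsupport {φ : Pt n → ℝ} {z : Pt n} (h : z ∉ tsupport φ) :
    fderiv ℝ φ z = 0 :=
  image_eq_zero_of_notMem_tsupport fun h' => h (tsupport_fderiv_subset ℝ h')

theorem energy_eq_of_ae {v : Pt n → Cm m} {X : L2up n m}
    (h : X =ᵐ[upperMeasure n] fun z => vec (grad v z)) : energy v = ofReal (‖X‖ ^ 2) := by
  rw [energy_eq_enorm_sq h, ofReal_pow (norm_nonneg _), ofReal_norm]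

/-- Gradients of functions in the homogeneous energy space are limits of gradients of test
functions. -/
theorem mem_energySpace_univ
    (h : IsEnergy u fun z i α => F z (i, α)) : F ∈ energySpace n m univ := by
  refine mem_energySpace_of_mollified fun δ hδ => ?_
  set e := δ / 4 with he
  have he0 : 0 < e := by positivity
  -- The kernel lives in `-4 * e < t < -2 * e`. At a point of the half-space the mollification then
  -- uses `u` only above height `2 * e`, where truncation at height `e` is not seen.
  obtain ⟨ρ, h1, h2, h3, h4, h5⟩ := exists_bump n (-3 * e) he0
  refine ⟨ρ, h1, h2, h3, h4, fun y hy => ?_, fun X hX => ?_⟩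
  · obtain ⟨hy1, hy2⟩ := h5 y hy
    rw [abs_lt] at hy1
    rw [Prod.norm_def, max_lt_iff, norm_eq_abs, abs_lt]
    refine ⟨⟨?_, ?_⟩, ?_⟩ <;> linarith
  set S : Set (Pt n) := {z | e ≤ z.1}
  have hScl : IsClosed S := isClosed_le continuous_const continuous_fst
  set U : Pt n → Cm m := S.indicator u
  have hU : LocallyIntegrable U := by
    rw [locallyIntegrable_iff]
    intro K hK
    rw [IntegrableOn, integrable_indicator_iff hScl.measurableSet, IntegrableOn,
      Measure.restrict_restrict hScl.measurableSet]
    have : IsFiniteMeasure (volume.restrict (S ∩ K)) :=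
      isFiniteMeasure_restrict.2 (hK.inter_left hScl).measure_lt_top.ne
    exact (h.locL2 _ (hK.inter_left hScl) fun z hz => he0.trans_le hz.1).integrable one_le_two
  have hgrad : ∀ z ∈ upper n, vec (grad (conv ρ U) z) = conv ρ (zeroExt F) z := by
    intro z hz
    refine vec_grad_conv h1 h2 hU fun i α => ?_
    have hz0 : 0 < z.1 := hz
    have hsup := tsupport_comp_sub_subset h5 z
    have hsup2 : tsupport (fun w => ρ (z - w)) ⊆ S := hsup.trans fun w hw => by
      change _ ≤ w.1 at hw
      change e ≤ w.1
      linarith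
    have hsup3 : tsupport (fun w => ρ (z - w)) ⊆ upper n := hsup2.trans fun w hw =>
      show 0 < w.1 from he0.trans_le hw
    have hw := h.weakGrad i α (fun w => ρ (z - w)) (h1.comp (contDiff_const.sub contDiff_id))
      (h2.comp_homeomorph (Homeomorph.subLeft z)) hsup3
    have eF : ∫ w, zeroExt F w (i, α) * (ρ (z - w) : ℂ) =
        ∫ w in upper n, zeroExt F w (i, α) * (ρ (z - w) : ℂ) :=
      (setIntegral_eq_integral_of_forall_compl_eq_zero fun w hw => by simp [zeroExt, hw]).symm
    rw [eF, ← setIntegral_eq_integral_of_forall_compl_eq_zero (s := upper n)]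
    · convert hw using 1
      · refine setIntegral_congr_fun (measurableSet_upper n) fun w _ => ?_
        by_cases hwS : w ∈ S
        · simp only [U, indicator_of_mem hwS]
        · simp only [fderiv_eq_zero_of_notMem_tsupport fun h => hwS (hsup2 h)]
          simp
      · congr 1
        refine setIntegral_congr_fun (measurableSet_upper n) fun w hw => ?_
        simp only [zeroExt, indicator_of_mem hw]
    · intro w hw
      rw [fderiv_eq_zero_of_notMem_tsupport fun h => hw (hsup3 h)]
      simp
  have hsm := contDiff_conv h1 h2 hU
  have hX' : X =ᵐ[upperMeasure n] fun z => vec (grad (conv ρ U) z) := by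
    filter_upwards [hX, ae_restrict_mem (measurableSet_upper n)] with z hz hz'
    rw [hz, hgrad z hz']
  obtain ⟨K, hK, hKc⟩ := exists_poincare_cylinder n m
  choose! c hc using fun R => hKc (conv ρ U) hsm R
  refine mem_energySpace_of_cutoff hsm hX' (K := K * ‖X‖ ^ 2) (by positivity) c (fun R hR => ?_)
    fun _ => Set.subset_univ _
  refine (hc R hR).trans (le_of_eq ?_)
  rw [energy_eq_of_ae hX', ← ofReal_mul (by positivity)]
  ring_nf

/-- Gradients of functions in the homogeneous energy space with vanishing trace are limits of
gradients of test functions supported in the open half-space. -/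
theorem mem_energySpace_upper
    (h : IsEnergy u fun z i α => F z (i, α)) (hf : IsTrace u f) (hf0 : f =ᵐ[volume] 0) :
    F ∈ energySpace n m (upper n) := by
  refine mem_energySpace_of_mollified fun δ hδ => ?_
  set e := δ / 4 with he
  have he0 : 0 < e := by positivity
  -- The kernel lives in `2 * e < t < 4 * e`, so that the mollified extension by zero vanishes for
  -- `t ≤ 2 * e` and stays supported in the open half-space.
  obtain ⟨ρ, h1, h2, h3, h4, h5⟩ := exists_bump n (3 * e) he0
  refine ⟨ρ, h1, h2, h3, h4, fun y hy => ?_, fun X hX => ?_⟩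
  · obtain ⟨hy1, hy2⟩ := h5 y hy
    rw [abs_lt] at hy1
    rw [Prod.norm_def, max_lt_iff, norm_eq_abs, abs_lt]
    refine ⟨⟨?_, ?_⟩, ?_⟩ <;> linarith
  set U : Pt n → Cm m := (upper n).indicator u
  have hU : LocallyIntegrable U := by
    rw [locallyIntegrable_iff]
    intro K hK
    obtain ⟨S, r, hS, hr, hsub⟩ := exists_cyl_supset hK
    rw [IntegrableOn, integrable_indicator_iff (measurableSet_upper n), IntegrableOn,
      Measure.restrict_restrict (measurableSet_upper n)]
    have := (memLp_cyl_of_trace h hf S r).integrable one_le_two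
    rw [cylMeasure_eq] at this
    exact this.mono_measure (Measure.restrict_mono (by rwa [Set.inter_comm]) le_rfl)
  have hgrad : ∀ z, vec (grad (conv ρ U) z) = conv ρ (zeroExt F) z := by
    intro z
    refine vec_grad_conv h1 h2 hU fun i α => ?_
    -- Since the trace vanishes, Green's formula has no boundary term: the extension of `u` by zero
    -- has the extension of its gradient by zero as weak gradient on the whole space.
    have hw := green h hf (φ := fun w => ρ (z - w)) (h1.comp (contDiff_const.sub contDiff_id))
      (h2.comp_homeomorph (Homeomorph.subLeft z)) i α
    have hz : ∫ x, f x α * (ρ (z - (0, x)) : ℂ) = 0 := by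
      rw [← integral_zero (Rn n) ℂ (μ := volume)]
      refine integral_congr_ae (hf0.mono fun x hx => ?_)
      simp [hx]
    rw [hz, mul_zero, sub_zero] at hw
    have eF : ∫ w, zeroExt F w (i, α) * (ρ (z - w) : ℂ) =
        ∫ w in upper n, zeroExt F w (i, α) * (ρ (z - w) : ℂ) :=
      (setIntegral_eq_integral_of_forall_compl_eq_zero fun w hw => by simp [zeroExt, hw]).symm
    rw [eF, ← setIntegral_eq_integral_of_forall_compl_eq_zero (s := upper n)]
    · convert hw using 1
      · refine setIntegral_congr_fun (measurableSet_upper n) fun w hw => ?_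
        simp only [U, indicator_of_mem hw]
      · congr 1
        refine setIntegral_congr_fun (measurableSet_upper n) fun w hw => ?_
        simp only [zeroExt, indicator_of_mem hw]
    · intro w hw
      simp [U, hw]
  have hsm := contDiff_conv h1 h2 hU
  have hX' : X =ᵐ[upperMeasure n] fun z => vec (grad (conv ρ U) z) := by
    filter_upwards [hX] with z hz
    rw [hz, hgrad z]
  have hv0 : ∀ z : Pt n, z.1 ≤ 2 * e → conv ρ U z = 0 := by
    intro z hz
    refine integral_eq_zero_of_ae (ae_of_all _ fun y => ?_)
    by_cases hy : ρ y = 0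
    · simp [hy]
    · have := abs_lt.1 (h5 y hy).1
      have hn : z - y ∉ upper n := by
        simp only [upper, Set.mem_ofPred_eq, Prod.fst_sub, not_lt]
        linarith [this.1]
      simp [U, hn]
  refine mem_energySpace_of_cutoff hsm hX' (K := ‖X‖ ^ 2) (by positivity) (fun _ => 0)
    (fun R hR => ?_) fun _ => ?_
  · calc ∫⁻ t in Ioc 0 R, ∫⁻ x in ball 0 R, ‖conv ρ U (t, x) - 0‖ₑ ^ 2
        ≤ ∫⁻ t in Ioc 0 R, ofReal R * energy (conv ρ U) := by
          refine setLIntegral_mono' measurableSet_Ioc fun t ht => ?_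
          refine (setLIntegral_le_lintegral _ _).trans ?_
          have := lintegral_vertical_sub_le hsm ht.1.le
          simp_rw [hv0 (0, _) (by simp [he0.le])] at this
          exact this.trans (by gcongr; exact ht.2)
      _ = _ := by
          rw [setLIntegral_const, Real.volume_Ioc, sub_zero, energy_eq_of_ae hX',
            ← ofReal_mul hR.le, ← ofReal_mul (by positivity)]
          ring_nf
  · simp only [sub_zero]
    have : tsupport (conv ρ U) ⊆ {z | 2 * e ≤ z.1} := by
      refine closure_minimal (fun z hz => ?_) (isClosed_le continuous_const continuous_fst)
      by_contra hlt
      exact hz (hv0 z (not_le.1 hlt).le)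
    exact this.trans fun z (hz : 2 * e ≤ z.1) => show 0 < z.1 by linarith

/-! ### Boundary distributions of fields and Neumann data -/

/-- A smooth compactly supported function on the line with value `1` at the origin. -/
def chi : ℝ → ℝ := (⟨1, 2, one_pos, one_lt_two⟩ : ContDiffBump (0 : ℝ))

theorem contDiff_chi : ContDiff ℝ ∞ chi := ContDiffBump.contDiff _

theorem hasCompactSupport_chi : HasCompactSupport chi := ContDiffBump.hasCompactSupport _

theorem chi_zero : chi 0 = 1 := ContDiffBump.one_of_mem_closedBall _ (by simp)

theorem continuous_deriv_chi : Continuous (deriv chi) := contDiff_chi.continuous_deriv (by simp)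

/-- The derivatives of `(t, x) ↦ chi t • h x`. -/
def bd {E : Type*} [NormedAddCommGroup E] [NormedSpace ℝ E] (h : Rn n → E) :
    Fin (n + 1) → Pt n → E :=
  Fin.cases (fun z => deriv chi z.1 • h z.2) (fun j z => chi z.1 • fderiv ℝ h z.2 (single j 1))

section bd

variable {E : Type*} [NormedAddCommGroup E] [NormedSpace ℝ E]

theorem bd_zero (h : Rn n → E) (z : Pt n) : bd h 0 z = deriv chi z.1 • h z.2 := rfl

theorem bd_succ (h : Rn n → E) (j : Fin n) (z : Pt n) :
    bd h j.succ z = chi z.1 • fderiv ℝ h z.2 (single j 1) := rfl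

theorem fderiv_chi_smul {h : Rn n → E} (hh : Differentiable ℝ h) (z : Pt n) (i : Fin (n + 1)) :
    fderiv ℝ (fun z : Pt n => chi z.1 • h z.2) z (dir i) = bd h i z := by
  have h2 : HasFDerivAt (fun z : Pt n => h z.2)
      ((fderiv ℝ h z.2).comp (ContinuousLinearMap.snd ℝ ℝ (Rn n))) z :=
    (hh z.2).hasFDerivAt.comp z hasFDerivAt_snd
  rw [((hasFDerivAt_comp_fst contDiff_chi z).fun_smul h2).fderiv]
  refine Fin.cases ?_ (fun j => ?_) i
  · simp [bd_zero, dir]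
  · simp [bd_succ, dir]

theorem continuous_bd {h : Rn n → E} (hh : ContDiff ℝ ∞ h) (i : Fin (n + 1)) :
    Continuous (bd h i) := by
  refine Fin.cases ?_ (fun j => ?_) i
  · exact (continuous_deriv_chi.comp continuous_fst).smul (hh.continuous.comp continuous_snd)
  · exact (contDiff_chi.continuous.comp continuous_fst).smul
      ((continuous_fderiv_apply hh _).comp continuous_snd)

theorem bd_comp_sub {h : Rn n → E} (y : Rn n) (i : Fin (n + 1)) (z : Pt n) :
    bd (fun x => h (x - y)) i z = bd h i (z.1, z.2 - y) := by
  refine Fin.cases ?_ (fun j => ?_) i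
  · rfl
  · simp only [bd_succ]
    rw [fderiv_comp_sub]

end bd

/-- The gradient of the function with components `conj (chi t * ψ α x)`. -/
def bvec (ψ : Fin m → Rn n → ℂ) (z : Pt n) : Evec n m :=
  vec fun i α => (starRingEnd ℂ) (bd (ψ α) i z)

/-- A common majorant, up to a Schwartz seminorm, of the gradients of all lifts. Its square is
integrable because `2 * (n + 1) > n`; this makes the boundary pairing continuous on Schwartz
functions. -/
def decay (z : Pt n) : ℝ := (|deriv chi z.1| + |chi z.1|) * (1 + ‖z.2‖) ^ (-(n + 1 : ℝ))

theorem memLp_decay : MemLp (decay : Pt n → ℝ) 2 volume := by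
  have hc : Continuous fun t => |deriv chi t| + |chi t| :=
    continuous_deriv_chi.abs.add contDiff_chi.continuous.abs
  have hcs : HasCompactSupport fun t => |deriv chi t| + |chi t| :=
    HasCompactSupport.add (hasCompactSupport_chi.deriv.comp_left abs_zero)
      (hasCompactSupport_chi.comp_left abs_zero)
  have hm : Measurable (decay : Pt n → ℝ) :=
    (hc.measurable.comp measurable_fst).mul ((measurable_snd.norm.const_add 1).pow_const _)
  rw [memLp_two_iff_integrable_sq hm.aestronglyMeasurable]
  have h1 : Integrable fun t => (|deriv chi t| + |chi t|) ^ 2 := by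
    refine (hc.pow 2).integrable_of_hasCompactSupport ?_
    simp_rw [sq]
    exact hcs.mul_right
  have h2 : Integrable fun x : Rn n => (1 + ‖x‖) ^ (-(2 * (n + 1) : ℝ)) :=
    by
      have hr : (Module.finrank ℝ (Rn n) : ℝ) < 2 * (n + 1) := by
        rw [finrank_euclideanSpace, Fintype.card_fin]
        have : (0 : ℝ) ≤ n := n.cast_nonneg
        linarith
      exact integrable_one_add_norm (E := Rn n) (μ := volume) (r := 2 * (n + 1)) hr
  have h3 : Integrable (fun z : Pt n => (|deriv chi z.1| + |chi z.1|) ^ 2 *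
      (1 + ‖z.2‖) ^ (-(2 * (n + 1) : ℝ))) (volume.prod volume) := Integrable.mul_prod h1 h2
  have e : (fun z : Pt n => decay z ^ 2) = fun z => (|deriv chi z.1| + |chi z.1|) ^ 2 *
      (1 + ‖z.2‖) ^ (-(2 * (n + 1) : ℝ)) := by
    ext z
    rw [decay, mul_pow, ← Real.rpow_natCast ((1 + ‖z.2‖) ^ _), ← Real.rpow_mul (by positivity)]
    congr 2
    push_cast
    ring
  rw [e]
  exact h3

theorem norm_bd_le (ψ : 𝓢(Rn n, ℂ)) (i : Fin (n + 1)) (z : Pt n) :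
    ‖bd ψ i z‖ ≤ (2 ^ (n + 1) * (Iic (n + 1, 1)).sup (schwartzSeminormFamily ℂ (Rn n) ℂ) ψ) *
      decay z := by
  set P := 2 ^ (n + 1) * (Iic (n + 1, 1)).sup (schwartzSeminormFamily ℂ (Rn n) ℂ) ψ
  have key : ∀ k ≤ 1, ‖iteratedFDeriv ℝ k ψ z.2‖ ≤ P * (1 + ‖z.2‖) ^ (-(n + 1 : ℝ)) := by
    intro k hk
    have h1 := one_add_le_sup_seminorm_apply (𝕜 := ℂ) (m := (n + 1, 1)) (k := n + 1) (n := k)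
      le_rfl hk ψ z.2
    have h2 : (1 + ‖z.2‖) ^ (-(n + 1 : ℝ)) = ((1 + ‖z.2‖) ^ (n + 1))⁻¹ := by
      rw [Real.rpow_neg (by positivity), ← Nat.cast_succ, Real.rpow_natCast]
    rw [h2, ← div_eq_mul_inv, le_div_iff₀ (by positivity), mul_comm]
    exact h1
  have hP : 0 ≤ P * (1 + ‖z.2‖) ^ (-(n + 1 : ℝ)) := (norm_nonneg _).trans (key 0 zero_le_one)
  have e : P * decay z = (|deriv chi z.1| + |chi z.1|) * (P * (1 + ‖z.2‖) ^ (-(n + 1 : ℝ))) := by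
    rw [decay]; ring
  rw [e]
  refine Fin.cases ?_ (fun j => ?_) i
  · rw [bd_zero, norm_smul, norm_eq_abs]
    have := key 0 zero_le_one
    rw [norm_iteratedFDeriv_zero] at this
    exact mul_le_mul (le_add_of_nonneg_right (abs_nonneg _)) this (norm_nonneg _) (by positivity)
  · rw [bd_succ, norm_smul, norm_eq_abs]
    have := key 1 le_rfl
    rw [norm_iteratedFDeriv_one] at this
    refine mul_le_mul (le_add_of_nonneg_left (abs_nonneg _)) ?_ (norm_nonneg _) (by positivity)
    refine (ContinuousLinearMap.le_opNorm _ _).trans ?_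
    simpa using this

theorem memLp_bd (ψ : 𝓢(Rn n, ℂ)) (i : Fin (n + 1)) : MemLp (bd ψ i) 2 (upperMeasure n) := by
  refine (MemLp.of_le_mul (c := 2 ^ (n + 1) * (Iic (n + 1, 1)).sup
    (schwartzSeminormFamily ℂ (Rn n) ℂ) ψ) memLp_decay
    (continuous_bd (ψ.smooth ⊤) i).aestronglyMeasurable (ae_of_all _ fun z => ?_)).restrict _
  refine (norm_bd_le ψ i z).trans ?_
  gcongr
  exact le_abs_self _

theorem memLp_bvec (ψ : Fin m → 𝓢(Rn n, ℂ)) : MemLp (bvec fun α => ψ α) 2 (upperMeasure n) :=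
  memLp_vec fun i α => (memLp_bd (ψ α) i).star

/-- The class of `bvec`. -/
def bcls (ψ : Fin m → 𝓢(Rn n, ℂ)) : L2up n m := (memLp_bvec ψ).toLp _

theorem coeFn_bcls (ψ : Fin m → 𝓢(Rn n, ℂ)) :
    bcls ψ =ᵐ[upperMeasure n] bvec fun α => ψ α := (memLp_bvec ψ).coeFn_toLp

theorem bd_add (ψ φ : 𝓢(Rn n, ℂ)) (i : Fin (n + 1)) (z : Pt n) :
    bd (ψ + φ : 𝓢(Rn n, ℂ)) i z = bd ψ i z + bd φ i z := by
  refine Fin.cases ?_ (fun j => ?_) i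
  · simp [bd_zero]
  · simp only [bd_succ, FunLike.coe_add]
    rw [fderiv_add ψ.differentiableAt φ.differentiableAt]
    simp

theorem bd_smul (c : ℂ) (ψ : 𝓢(Rn n, ℂ)) (i : Fin (n + 1)) (z : Pt n) :
    bd (c • ψ : 𝓢(Rn n, ℂ)) i z = c • bd ψ i z := by
  refine Fin.cases ?_ (fun j => ?_) i
  · simp [bd_zero]; ring
  · simp only [bd_succ, FunLike.coe_smul]
    rw [fderiv_const_smul ψ.differentiableAt]
    simp; ring

theorem bcls_add (ψ φ : Fin m → 𝓢(Rn n, ℂ)) : bcls (ψ + φ) = bcls ψ + bcls φ := by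
  rw [bcls, bcls, bcls, ← MemLp.toLp_add]
  refine MemLp.toLp_congr _ _ (ae_of_all _ fun z => ?_)
  ext k
  change (starRingEnd ℂ) (bd (ψ k.2 + φ k.2 : 𝓢(Rn n, ℂ)) k.1 z) = _
  rw [bd_add, map_add]
  rfl

theorem bcls_smul (c : ℂ) (ψ : Fin m → 𝓢(Rn n, ℂ)) : bcls (c • ψ) = (starRingEnd ℂ) c • bcls ψ := by
  rw [bcls, bcls, ← MemLp.toLp_const_smul]
  refine MemLp.toLp_congr _ _ (ae_of_all _ fun z => ?_)
  ext k
  change (starRingEnd ℂ) (bd (c • ψ k.2 : 𝓢(Rn n, ℂ)) k.1 z) = _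
  rw [bd_smul, smul_eq_mul, map_mul]
  rfl

theorem norm_bcls_single_le : ∃ C : ℝ, 0 ≤ C ∧ ∀ (ψ : 𝓢(Rn n, ℂ)) (α : Fin m),
    ‖bcls (Pi.single α ψ)‖ ≤ C * (Iic (n + 1, 1)).sup (schwartzSeminormFamily ℂ (Rn n) ℂ) ψ := by
  have hd := memLp_decay.restrict (upper n)
  refine ⟨(n + 1) * 2 ^ (n + 1) * ‖hd.toLp _‖, by positivity, fun ψ α => ?_⟩
  set P := (Iic (n + 1, 1)).sup (schwartzSeminormFamily ℂ (Rn n) ℂ) ψ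
  have h : ‖bcls (Pi.single α ψ)‖ ≤ ((n + 1) * (2 ^ (n + 1) * P)) * ‖hd.toLp _‖ := by
    refine Lp.norm_le_mul_norm_of_ae_le_mul ?_
    filter_upwards [coeFn_bcls (Pi.single α ψ), hd.coeFn_toLp] with z h1 h2
    rw [h1, h2]
    refine (norm_le_sum_apply _).trans ?_
    have h0 : 0 ≤ decay z := by unfold decay; positivity
    rw [Fintype.sum_prod_type, norm_of_nonneg h0]
    calc _ ≤ ∑ i : Fin (n + 1), 2 ^ (n + 1) * P * decay z := by
          refine sum_le_sum fun i _ => ?_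
          rw [sum_eq_single α]
          · simp only [bvec, vec_apply, Pi.single_eq_same, RCLike.norm_conj]
            exact norm_bd_le ψ i z
          · intro β _ hβ
            have : bd (((Pi.single α ψ : Fin m → 𝓢(Rn n, ℂ)) β)) i z = 0 := by
              rw [Pi.single_eq_of_ne hβ]
              have := bd_smul 0 ψ i z
              simpa using this
            simp only [bvec, vec_apply, this]
            simp
          · simp
      _ = _ := by simp; ring
  refine h.trans (le_of_eq (by ring))

/-- The boundary distribution `ψ ↦ ∑ i, ∫ ∂_i (chi t * ψ x) W_i`. -/
def surf (W : L2up n m) : 𝓢'(Rn n, Cm m) :=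
  ContinuousLinearMap.toPointwiseConvergenceCLM _ _ _ _
    (mkCLMtoNormedSpace (𝕜 := ℂ) (σ := RingHom.id ℂ)
      (fun ψ : 𝓢(Rn n, ℂ) => (WithLp.toLp 2 fun α => ⟪bcls (Pi.single α ψ), W⟫_ℂ : Cm m))
      (fun f g => by
        ext α
        simp only [PiLp.add_apply]
        rw [Pi.single_add, bcls_add, inner_add_left])
      (fun a f => by
        ext α
        simp only [PiLp.smul_apply, RingHom.id_apply]
        rw [Pi.single_smul', bcls_smul, inner_smul_left]
        simp)
      (by
        obtain ⟨C, hC, h⟩ := norm_bcls_single_le (n := n) (m := m)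
        refine ⟨Iic (n + 1, 1), m * C * ‖W‖, by positivity, fun ψ => ?_⟩
        refine (norm_le_sum_apply _).trans ?_
        calc _ ≤ ∑ α : Fin m, C * (Iic (n + 1, 1)).sup
              (schwartzSeminormFamily ℂ (Rn n) ℂ) ψ * ‖W‖ := by
              refine sum_le_sum fun α _ => (norm_inner_le_norm _ _).trans ?_
              gcongr
              exact h ψ α
          _ = _ := by simp; ring))

theorem surf_apply (W : L2up n m) (ψ : 𝓢(Rn n, ℂ)) (α : Fin m) :
    (surf W ψ) α = ⟪bcls (Pi.single α ψ), W⟫_ℂ := rfl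

theorem inner_bcls (W : L2up n m) (ψ : Fin m → 𝓢(Rn n, ℂ)) :
    ⟪bcls ψ, W⟫_ℂ = ∑ α, (surf W (ψ α)) α := by
  have h : bcls ψ = ∑ α, bcls (Pi.single α (ψ α)) := by
    have : ∀ s : Finset (Fin m), bcls (∑ α ∈ s, Pi.single α (ψ α)) =
        ∑ α ∈ s, bcls (Pi.single α (ψ α)) := by
      intro s
      classical
      induction s using Finset.induction_on with
      | empty =>
        have := bcls_smul 0 ψ
        simpa using this
      | insert a s ha ih => rw [sum_insert ha, sum_insert ha, bcls_add, ih]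
    rw [← this, Finset.univ_sum_single]
  rw [h, sum_inner]
  rfl

/-- The Schwartz function given by a real test function. -/
def tst (h : Rn n → ℝ) : 𝓢(Rn n, ℂ) :=
  open Classical in
  if hh : HasCompactSupport (fun x => (h x : ℂ)) ∧ ContDiff ℝ ∞ (fun x => (h x : ℂ)) then
    hh.1.toSchwartzMap hh.2 else 0

theorem tst_apply (hc : HasCompactSupport h) (hs : ContDiff ℝ ∞ h) (x : Rn n) :
    tst h x = (h x : ℂ) := by
  rw [tst, dif_pos ⟨hc.comp_left Complex.ofReal_zero, Complex.ofRealCLM.contDiff.comp hs⟩]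
  rfl

theorem coe_tst (hc : HasCompactSupport h) (hs : ContDiff ℝ ∞ h) :
    ⇑(tst h) = fun x => (h x : ℂ) := funext (tst_apply hc hs)

/-- Compactly supported Schwartz functions are dense. -/
theorem exists_tendsto_compactSupport (ψ : 𝓢(Rn n, ℂ)) :
    ∃ ψ' : ℕ → 𝓢(Rn n, ℂ), (∀ k, HasCompactSupport (ψ' k)) ∧ Tendsto ψ' atTop (𝓝 ψ) := by
  let b : ContDiffBump (0 : Rn n) := ⟨1, 2, one_pos, one_lt_two⟩
  let L : ℕ → Rn n →L[ℝ] Rn n := fun k => ((k : ℝ) + 1)⁻¹ • ContinuousLinearMap.id ℝ (Rn n)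
  have hL : ∀ k, ‖L k‖ ≤ 1 := fun k => by
    refine (norm_smul_le (((k : ℝ) + 1)⁻¹) (ContinuousLinearMap.id ℝ (Rn n))).trans ?_
    rw [norm_inv, norm_of_nonneg (by positivity)]
    calc ((k : ℝ) + 1)⁻¹ * ‖ContinuousLinearMap.id ℝ (Rn n)‖ ≤ 1 * 1 := by
          gcongr
          · exact inv_le_one_of_one_le₀ (by linarith [k.cast_nonneg (α := ℝ)])
          · exact ContinuousLinearMap.norm_id_le
      _ = 1 := one_mul 1
  let χ : ℕ → Rn n → ℝ := fun k x => b (L k x)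
  have hχs : ∀ k, ContDiff ℝ ∞ (χ k) := fun k => b.contDiff.comp (L k).contDiff
  have hχc : ∀ k, HasCompactSupport (χ k) := fun k =>
    HasCompactSupport.intro (isCompact_closedBall 0 (2 * ((k : ℝ) + 1))) fun x hx => by
      refine b.zero_of_le_dist ?_
      rw [mem_closedBall_zero_iff, not_le] at hx
      simp only [L, FunLike.coe_smul, Pi.smul_apply, ContinuousLinearMap.id_apply, dist_zero_right]
      rw [norm_smul, norm_inv, norm_of_nonneg (by positivity), le_inv_mul_iff₀ (by positivity)]
      change ((k : ℝ) + 1) * 2 ≤ _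
      linarith
  have hχ1 : ∀ (k : ℕ) x, ‖x‖ < (k : ℝ) + 1 → χ k x = 1 := fun k x hx => by
    refine b.one_of_mem_closedBall ?_
    rw [mem_closedBall_zero_iff]
    simp only [L, FunLike.coe_smul, Pi.smul_apply, ContinuousLinearMap.id_apply]
    rw [norm_smul, norm_inv, norm_of_nonneg (by positivity)]
    exact (inv_mul_le_one₀ (by positivity)).2 hx.le
  obtain ⟨B, hB⟩ : ∃ B : ℕ → ℝ, ∀ i k x, ‖iteratedFDeriv ℝ i (fun x => χ k x - 1) x‖ ≤ B i := by
    have h1 : ∀ i, ∃ B, ∀ x, ‖iteratedFDeriv ℝ i (fun x => b x - 1) x‖ ≤ B := by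
      intro i
      rcases Nat.eq_zero_or_pos i with rfl | hi
      · refine ⟨1, fun x => ?_⟩
        rw [norm_iteratedFDeriv_zero, norm_eq_abs, abs_le]
        exact ⟨by linarith [b.nonneg (x := x)], by linarith [b.le_one (x := x)]⟩
      · obtain ⟨B, hB⟩ := (b.hasCompactSupport.iteratedFDeriv (𝕜 := ℝ) i).exists_bound_of_continuous
          ((b.contDiff (n := i)).continuous_iteratedFDeriv le_rfl)
        refine ⟨B, fun x => ?_⟩
        have : iteratedFDeriv ℝ i (fun x => b x - 1) x = iteratedFDeriv ℝ i b x := by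
          have := iteratedFDeriv_sub (𝕜 := ℝ) (i := i) (f := b) (g := fun _ : Rn n => (1 : ℝ))
            (b.contDiff (n := i)) contDiff_const
          have h2 := congrFun this x
          rw [Pi.sub_apply, iteratedFDeriv_const_of_ne hi.ne', Pi.zero_apply, sub_zero] at h2
          exact h2
        rw [this]
        exact hB x
    choose B hB using h1
    refine ⟨B, fun i k x => ?_⟩
    have : (fun x => χ k x - 1) = (fun x => b x - 1) ∘ (L k) := rfl
    have hbs : ContDiff ℝ i (fun x => b x - 1) := b.contDiff.sub contDiff_const
    rw [this, (L k).iteratedFDeriv_comp_right hbs x le_rfl]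
    refine (ContinuousMultilinearMap.norm_compContinuousLinearMap_le _ _).trans ?_
    calc _ ≤ B i * ∏ _j : Fin i, (1 : ℝ) := by
          refine mul_le_mul (hB _ _) (Finset.prod_le_prod (fun _ _ => norm_nonneg _)
            fun _ _ => hL k) (prod_nonneg fun _ _ => norm_nonneg _)
            ((norm_nonneg _).trans (hB i 0))
      _ = B i := by simp
  have hc : ∀ k, HasCompactSupport fun x => χ k x • ψ x := fun k => (hχc k).smul_right
  have hs : ∀ k, ContDiff ℝ ∞ fun x => χ k x • ψ x := fun k => (hχs k).smul (ψ.smooth ⊤)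
  refine ⟨fun k => (hc k).toSchwartzMap (hs k), fun k => hc k, ?_⟩
  rw [(schwartz_withSeminorms ℂ (Rn n) ℂ).tendsto_nhds _ ψ]
  rintro ⟨a, d⟩ ε hε
  -- One more power of `‖x‖` is used than the seminorm contains. Where the cut-off differs from `1`,
  -- one has `‖x‖ ≥ k + 1`, so the extra power yields the factor `1 / (k + 1)`.
  choose D hD using fun i : ℕ => ψ.decay (a + 1) (d - i)
  let M := ∑ i ∈ Finset.range (d + 1), (d.choose i : ℝ) * B i * D i
  have hBn : ∀ i, 0 ≤ B i := fun i => (norm_nonneg _).trans (hB i 0 0)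
  have hM : 0 ≤ M := sum_nonneg fun i _ =>
    mul_nonneg (mul_nonneg (Nat.cast_nonneg _) (hBn i)) (hD i).1.le
  obtain ⟨k₀, hk₀⟩ := exists_nat_gt (M / ε)
  filter_upwards [eventually_ge_atTop k₀] with k hk
  refine lt_of_le_of_lt (SchwartzMap.seminorm_le_bound ℂ a d _ (M := M / (k + 1)) (by positivity)
    fun x => ?_) ?_
  · have e : ⇑((hc k).toSchwartzMap (hs k) - ψ) = fun x => (χ k x - 1) • ψ x := by
      ext x
      rw [sub_smul, one_smul]
      rfl
    rw [e]
    rcases lt_or_ge ‖x‖ ((k : ℝ) + 1) with hx | hx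
    · have : (fun x => (χ k x - 1) • ψ x) =ᶠ[𝓝 x] fun _ => 0 := by
        filter_upwards [(isOpen_lt continuous_norm continuous_const).mem_nhds hx] with y hy
        rw [hχ1 k y hy, sub_self, zero_smul]
      rw [(this.iteratedFDeriv ℝ d).eq_of_nhds]
      have h0 : iteratedFDeriv ℝ d (fun _ : Rn n => (0 : ℂ)) x = 0 := by simp
      rw [h0, norm_zero, mul_zero]
      positivity
    · have h1 := norm_iteratedFDeriv_smul_le (𝕜 := ℝ) (n := d) (N := ∞)
        (f := fun x => χ k x - 1) (g := ψ)
        ((hχs k).sub contDiff_const) (ψ.smooth ⊤) x (by exact_mod_cast le_top)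
      change ‖iteratedFDeriv ℝ d (fun y => (χ k y - 1) • ψ y) x‖ ≤ _ at h1
      have hx0 : 0 < ‖x‖ := lt_of_lt_of_le (by positivity) hx
      calc _ ≤ ‖x‖ ^ a * ∑ i ∈ Finset.range (d + 1), (d.choose i : ℝ) *
            ‖iteratedFDeriv ℝ i (fun x => χ k x - 1) x‖ * ‖iteratedFDeriv ℝ (d - i) ψ x‖ := by
            gcongr
        _ ≤ ‖x‖ ^ a * ∑ i ∈ Finset.range (d + 1), (d.choose i : ℝ) * B i *
            (D i / ‖x‖ ^ (a + 1)) := by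
            gcongr with i hi
            · exact mul_nonneg (Nat.cast_nonneg _) (hBn i)
            · exact hB i k x
            · rw [le_div_iff₀ (by positivity), mul_comm]
              exact (hD i).2 x
        _ = M / ‖x‖ := by
            simp only [M, mul_sum, Finset.sum_div]
            refine sum_congr rfl fun i _ => ?_
            field_simp
            ring
        _ ≤ _ := by gcongr
  · rw [div_lt_iff₀ (by positivity)]
    rw [div_lt_iff₀ hε] at hk₀
    have : (k₀ : ℝ) ≤ k := by exact_mod_cast hk
    nlinarith

/-- Regularity data is only prescribed on compactly supported test functions; by density it is still
unique as a tempered distribution. -/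
theorem eq_of_forall_compactSupport {F : Type*} [NormedAddCommGroup F] [NormedSpace ℂ F]
    {T T' : 𝓢'(Rn n, F)} (h : ∀ ψ : 𝓢(Rn n, ℂ), HasCompactSupport ψ → T ψ = T' ψ) : T = T' := by
  ext ψ
  obtain ⟨ψ', hc, hlim⟩ := exists_tendsto_compactSupport ψ
  have h1 : Continuous T := ContinuousLinearMap.continuous (T : 𝓢(Rn n, ℂ) →L[ℂ] F)
  have h2 : Continuous T' := ContinuousLinearMap.continuous (T' : 𝓢(Rn n, ℂ) →L[ℂ] F)
  refine tendsto_nhds_unique ((h1.tendsto ψ).comp hlim) (((h2.tendsto ψ).comp hlim).congr fun k => ?_)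
  exact (h _ (hc k)).symm

theorem exists_tst_add (ψ : 𝓢(Rn n, ℂ)) (hψ : HasCompactSupport ψ) : ∃ a b : Rn n → ℝ,
    HasCompactSupport a ∧ ContDiff ℝ ∞ a ∧ HasCompactSupport b ∧ ContDiff ℝ ∞ b ∧
    ψ = tst a + Complex.I • tst b := by
  have ha : HasCompactSupport fun x => (ψ x).re := hψ.comp_left (g := Complex.re) rfl
  have hb : HasCompactSupport fun x => (ψ x).im := hψ.comp_left (g := Complex.im) rfl
  have ha' : ContDiff ℝ ∞ fun x => (ψ x).re := Complex.reCLM.contDiff.comp (ψ.smooth ⊤)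
  have hb' : ContDiff ℝ ∞ fun x => (ψ x).im := Complex.imCLM.contDiff.comp (ψ.smooth ⊤)
  refine ⟨_, _, ha, ha', hb, hb', ?_⟩
  ext x
  simp only [add_apply, smul_apply, tst_apply ha ha', tst_apply hb hb']
  rw [smul_eq_mul, mul_comm, Complex.re_add_im]

theorem eq_of_forall_tst {F : Type*} [NormedAddCommGroup F] [NormedSpace ℂ F]
    {T T' : 𝓢'(Rn n, F)}
    (h : ∀ g : Rn n → ℝ, HasCompactSupport g → ContDiff ℝ ∞ g → T (tst g) = T' (tst g)) :
    T = T' := by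
  refine eq_of_forall_compactSupport fun ψ hψ => ?_
  obtain ⟨a, b, ha, ha', hb, hb', rfl⟩ := exists_tst_add ψ hψ
  rw [map_add, map_add, map_smul, map_smul, h a ha ha', h b hb hb']

theorem integrable_mul_of_compactSupport {X : Type*} [MeasurableSpace X] [TopologicalSpace X]
    [OpensMeasurableSpace X] [T2Space X] {μ : Measure X} [IsFiniteMeasureOnCompacts μ] {f ψ : X → ℂ}
    (hf : MemLp f 2 (μ.restrict (tsupport ψ))) (hψ : Continuous ψ) (hc : HasCompactSupport ψ) :
    Integrable (fun x => f x * ψ x) μ := by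
  rw [← integrableOn_iff_integrable_of_support_subset (s := tsupport ψ)]
  · exact hf.integrable_mul ((hψ.memLp_of_hasCompactSupport (p := 2) hc).restrict _)
  · exact fun x hx => subset_tsupport _ fun h => hx (by simp [h])

theorem IsEnergy.sub {u u' : Pt n → Cm m} {G G' : Pt n → Grad n m} (h : IsEnergy u G)
    (h' : IsEnergy u' G') : IsEnergy (fun z => u z - u' z) (fun z i α => G z i α - G' z i α) := by
  refine ⟨fun K hK hKu => (h.locL2 K hK hKu).sub (h'.locL2 K hK hKu),
    fun i α => (h.gradL2 i α).sub (h'.gradL2 i α), fun i α φ hφ hφc hφs => ?_⟩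
  have hdφ : Continuous fun z => (fderiv ℝ φ z (dir i) : ℂ) :=
    continuous_ofReal.comp (continuous_fderiv_apply hφ _)
  have hdφc : HasCompactSupport fun z => (fderiv ℝ φ z (dir i) : ℂ) :=
    (hφc.fderiv_apply ℝ (dir i)).comp_left Complex.ofReal_zero
  have hφC : Continuous fun z => (φ z : ℂ) := continuous_ofReal.comp hφ.continuous
  have hφCc : HasCompactSupport fun z => (φ z : ℂ) := hφc.comp_left Complex.ofReal_zero
  have hi : ∀ {v : Pt n → Cm m} {H : Pt n → Grad n m}, IsEnergy v H →
      Integrable (fun z => v z α * (fderiv ℝ φ z (dir i) : ℂ)) (upperMeasure n) := by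
    intro v H hv
    refine integrable_mul_of_compactSupport
      (((hv.locL2 _ hφc.isCompact hφs).eval_piLp α).mono_measure ?_) hdφ hdφc
    exact Measure.restrict_mono ((closure_mono (Function.support_comp_subset Complex.ofReal_zero _
      )).trans (tsupport_fderiv_apply_subset ℝ (dir i))) Measure.restrict_le_self
  have hi2 : ∀ {H : Pt n → Grad n m}, MemLp (fun z => H z i α) 2 (upperMeasure n) →
      Integrable (fun z => H z i α * (φ z : ℂ)) (upperMeasure n) := fun hH =>
    hH.integrable_mul ((hφC.memLp_of_hasCompactSupport (p := 2) hφCc).restrict _)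
  have h1 := h.weakGrad i α φ hφ hφc hφs
  have h2 := h'.weakGrad i α φ hφ hφc hφs
  simp only [PiLp.sub_apply, sub_mul]
  rw [integral_sub (hi h) (hi h'), integral_sub (hi2 (h.gradL2 i α)) (hi2 (h'.gradL2 i α)), h1, h2]
  ring

theorem IsTrace.sub {u u' : Pt n → Cm m} {f f' : Rn n → Cm m} (h : IsTrace u f)
    (h' : IsTrace u' f') (hu : AEStronglyMeasurable u (upperMeasure n))
    (hu' : AEStronglyMeasurable u' (upperMeasure n)) :
    IsTrace (fun z => u z - u' z) (fun x => f x - f' x) := by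
  refine ⟨fun K hK => (h.1 K hK).sub (h'.1 K hK), fun K hK => ?_⟩
  have hlim := (h.2 K hK).add (h'.2 K hK)
  rw [add_zero] at hlim
  refine tendsto_of_tendsto_of_tendsto_of_le_of_le' tendsto_const_nhds hlim
    (Eventually.of_forall fun _ => zero_le) ?_
  filter_upwards [eventually_aestronglyMeasurable_slice hu K,
    eventually_aestronglyMeasurable_slice hu' K] with t h1 h2
  have := eLpNorm_sub_le (h1.sub (h.1 K hK).1) (h2.sub (h'.1 K hK).1) (p := 2) (by norm_num)
  refine le_trans (le_of_eq ?_) this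
  congr 1
  ext1 x
  simp only [Pi.sub_apply]
  abel

/-- The class of the gradient of an energy function. -/
def IsEnergy.cls (h : IsEnergy u G) : L2up n m := (memLp_vec h.gradL2).toLp _

theorem IsEnergy.coeFn_cls (h : IsEnergy u G) :
    h.cls =ᵐ[upperMeasure n] fun z => vec (G z) := (memLp_vec h.gradL2).coeFn_toLp

theorem IsEnergy.congr (h : IsEnergy u G) (hF : F =ᵐ[upperMeasure n] fun z => vec (G z)) :
    IsEnergy u fun z i α => F z (i, α) := by
  refine ⟨h.locL2, fun i α => (Lp.memLp F).eval_piLp (i, α), fun i α φ h1 h2 h3 => ?_⟩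
  rw [h.weakGrad i α φ h1 h2 h3]
  congr 1
  refine integral_congr_ae (hF.mono fun z hz => ?_)
  simp only [hz, vec_apply]

/-- The lift of boundary values to the half-space. -/
def lift (ψ : Fin m → 𝓢(Rn n, ℂ)) (z : Pt n) : Cm m :=
  WithLp.toLp 2 fun α => (starRingEnd ℂ) (chi z.1 • ψ α z.2)

theorem contDiff_lift (ψ : Fin m → 𝓢(Rn n, ℂ)) : ContDiff ℝ ∞ (lift ψ) := by
  rw [contDiff_piLp]
  intro α
  have h : ContDiff ℝ ∞ fun z : Pt n => chi z.1 • ψ α z.2 :=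
    (contDiff_chi.comp contDiff_fst).smul (((ψ α).smooth ⊤).comp contDiff_snd)
  exact Complex.conjCLE.contDiff.comp h

theorem grad_lift (ψ : Fin m → 𝓢(Rn n, ℂ)) (z : Pt n) :
    vec (grad (lift ψ) z) = bvec (fun α => ψ α) z := by
  ext ⟨i, α⟩
  have h : ContDiff ℝ ∞ fun z : Pt n => chi z.1 • ψ α z.2 :=
    (contDiff_chi.comp contDiff_fst).smul (((ψ α).smooth ⊤).comp contDiff_snd)
  have h1 : HasFDerivAt (fun z : Pt n => (starRingEnd ℂ) (chi z.1 • ψ α z.2))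
      ((Complex.conjCLE : ℂ →L[ℝ] ℂ).comp (fderiv ℝ (fun z : Pt n => chi z.1 • ψ α z.2) z)) z :=
    (Complex.conjCLE : ℂ →L[ℝ] ℂ).hasFDerivAt.comp z (h.differentiable (by simp) z).hasFDerivAt
  change fderiv ℝ (fun z : Pt n => (starRingEnd ℂ) (chi z.1 • ψ α z.2)) z (dir i) =
    (starRingEnd ℂ) (bd (ψ α) i z)
  rw [h1.fderiv, ← fderiv_chi_smul (ψ α).differentiable]
  rfl

theorem memLp_restrict_of_continuous {X E : Type*} [MeasurableSpace X] [TopologicalSpace X]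
    [OpensMeasurableSpace X] [T2Space X] [NormedAddCommGroup E]
    [SecondCountableTopologyEither X E] {μ : Measure X} [IsFiniteMeasureOnCompacts μ] {f : X → E} (hf : Continuous f)
    {K : Set X} (hK : IsCompact K) : MemLp f 2 (μ.restrict K) := by
  have : IsFiniteMeasure (μ.restrict K) := isFiniteMeasure_restrict.2 hK.measure_lt_top.ne
  obtain ⟨C, hC⟩ := hK.exists_bound_of_continuousOn hf.continuousOn
  exact MemLp.of_bound hf.aestronglyMeasurable C
    ((ae_restrict_iff' hK.measurableSet).2 (ae_of_all _ hC))

theorem isEnergy_of_contDiff (hg : ContDiff ℝ ∞ g)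
    (hF : F =ᵐ[upperMeasure n] fun z => vec (grad g z)) : IsEnergy g fun z i α => F z (i, α) := by
  refine ⟨fun K hK _ => memLp_restrict_of_continuous hg.continuous hK,
    fun i α => (Lp.memLp F).eval_piLp (i, α), fun i α φ h1 h2 h3 => ?_⟩
  rw [integral_smooth_by_parts (contDiff_comp_apply hg α) h1 h2 h3]
  congr 1
  refine integral_congr_ae (hF.mono fun z hz => ?_)
  simp only [hz, vec_apply]
  rfl

theorem isTrace_chi_smul (hf : Continuous f) : IsTrace (fun z => chi z.1 • f z.2) f := by
  refine ⟨fun K hK => memLp_restrict_of_continuous hf hK, fun K hK => ?_⟩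
  have e2 : ∀ t, eLpNorm (fun x => chi t • f x - f x) 2 (volume.restrict K) =
      ‖chi t - 1‖ₑ * eLpNorm f 2 (volume.restrict K) := fun t => by
    rw [← eLpNorm_const_smul]
    congr 1
    ext1 x
    rw [Pi.smul_apply, sub_smul, one_smul]
  simp_rw [e2]
  have h1 : Tendsto (fun t => ‖chi t - 1‖ₑ) (𝓝 0) (𝓝 0) := by
    have := ((contDiff_chi.continuous.tendsto 0).sub_const 1).enorm
    simpa [chi_zero] using this
  have h2 := ENNReal.Tendsto.mul_const h1 (b := eLpNorm f 2 (volume.restrict K))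
    (Or.inr (memLp_restrict_of_continuous hf hK).2.ne)
  rw [zero_mul] at h2
  exact h2.mono_left (inf_le_left.trans nhdsWithin_le_nhds)

theorem isEnergy_lift (ψ : Fin m → 𝓢(Rn n, ℂ)) : IsEnergy (lift ψ) fun z i α => bcls ψ z (i, α) :=
  isEnergy_of_contDiff (contDiff_lift ψ) ((coeFn_bcls ψ).mono fun z hz => hz.trans (grad_lift ψ z).symm)

theorem isTrace_lift (ψ : Fin m → 𝓢(Rn n, ℂ)) :
    IsTrace (lift ψ) fun x => WithLp.toLp 2 fun α => (starRingEnd ℂ) (ψ α x) := by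
  have hf : Continuous fun x => (WithLp.toLp 2 fun α => (starRingEnd ℂ) (ψ α x) : Cm m) :=
    (continuous_toLp 2 _).comp (continuous_pi fun α =>
      Complex.continuous_conj.comp (ψ α).continuous)
  convert isTrace_chi_smul hf using 1
  ext z α
  simp [lift]

theorem surf_add (W W' : L2up n m) : surf (W + W') = surf W + surf W' := by
  ext ψ α
  change ⟪_, _⟫_ℂ = ⟪_, W⟫_ℂ + ⟪_, W'⟫_ℂ
  rw [inner_add_right]

theorem surf_sub (W W' : L2up n m) : surf (W - W') = surf W - surf W' := by
  ext ψ α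
  change ⟪_, _⟫_ℂ = ⟪_, W⟫_ℂ - ⟪_, W'⟫_ℂ
  rw [inner_sub_right]

theorem surf_neg (W : L2up n m) : surf (-W) = -surf W := by
  ext ψ α
  change ⟪_, _⟫_ℂ = -⟪_, W⟫_ℂ
  rw [inner_neg_right]

theorem surf_smul (c : ℂ) (W : L2up n m) : surf (c • W) = c • surf W := by
  ext ψ α
  change ⟪_, _⟫_ℂ = c * ⟪_, W⟫_ℂ
  rw [inner_smul_right]

theorem ae_eq_vec (F : L2up n m) : F =ᵐ[upperMeasure n] fun z => vec fun i α => F z (i, α) :=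
  ae_of_all _ fun _ => rfl

theorem bcls_mem_energySpace (ψ : Fin m → 𝓢(Rn n, ℂ)) : bcls ψ ∈ energySpace n m univ :=
  mem_energySpace_univ (isEnergy_lift ψ)

theorem IsEnergySolution.inner_eq_zero (hA : IsBoundedCoeff A Λ) (h : IsEnergySolution A u G)
    (hF : F =ᵐ[upperMeasure n] fun z => vec (G z)) :
    ∀ v ∈ energySpace n m (upper n), ⟪v, coeffOp A hA F⟫_ℂ = 0 := by
  intro v hv
  rw [← inner_conj_symm, inner_eq_zero_of_mem_energySpace hv, map_zero]
  rintro X ⟨g, h1, h2, h3, h4⟩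
  rw [← inner_conj_symm, inner_coeffOp hA hF h4, h.2 g h1 h2 h3, map_zero]

theorem isEnergySolution_of_inner (hA : IsBoundedCoeff A Λ) (h : IsEnergy u fun z i α => F z (i, α))
    (hF : ∀ v ∈ energySpace n m (upper n), ⟪v, coeffOp A hA F⟫_ℂ = 0) :
    IsEnergySolution A u fun z i α => F z (i, α) := by
  refine ⟨h, fun φ h1 h2 h3 => ?_⟩
  rw [← inner_coeffOp hA (ae_eq_vec F) (coeFn_gradClass h1 h2)]
  exact hF _ (Submodule.le_topologicalClosure _ (gradClass_mem h1 h2 h3))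

/-- An energy function and the lift of its boundary values differ by a function with zero trace,
whose gradient is orthogonal to `A` applied to the solution. Every admissible extension therefore
gives the same pairing as the lift. -/
theorem isConormal_neg_surf (hA : IsBoundedCoeff A Λ) (hF : F =ᵐ[upperMeasure n] fun z => vec (G z))
    (hs : ∀ v ∈ energySpace n m (upper n), ⟪v, coeffOp A hA F⟫_ℂ = 0) :
    IsConormal A G (-surf (coeffOp A hA F)) := by
  intro Φ H ψ hΦ htr
  have hE := hΦ.sub (isEnergy_lift ψ)
  have hcl : hΦ.cls - bcls ψ =ᵐ[upperMeasure n]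
      fun z => vec fun i α => H z i α - bcls ψ z (i, α) := by
    filter_upwards [Lp.coeFn_sub hΦ.cls (bcls ψ), hΦ.coeFn_cls] with z h1 h2
    rw [h1, Pi.sub_apply, h2]
    rfl
  have h0 := mem_energySpace_upper (hE.congr hcl)
    (htr.sub (isTrace_lift ψ) hΦ.aestronglyMeasurable (isEnergy_lift ψ).aestronglyMeasurable)
    (ae_of_all _ fun x => sub_self _)
  have h1 := hs _ h0
  rw [inner_sub_left, sub_eq_zero] at h1
  rw [← inner_coeffOp hA hF hΦ.coeFn_cls, h1, inner_bcls, ← Finset.sum_neg_distrib]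
  refine sum_congr rfl fun α _ => ?_
  exact (neg_neg _).symm

/-- The lifts are admissible test functions with arbitrary Schwartz boundary values, so they alone
determine the Neumann data. -/
theorem IsConormal.eq_neg_surf (hA : IsBoundedCoeff A Λ) (hF : F =ᵐ[upperMeasure n] fun z => vec (G z))
    {T : 𝓢'(Rn n, Cm m)} (h : IsConormal A G T) : T = -surf (coeffOp A hA F) := by
  ext ψ α
  have h1 := h (lift (Pi.single α ψ)) _ _ (isEnergy_lift _) (isTrace_lift _)
  rw [← inner_coeffOp hA hF (ae_eq_vec (bcls (Pi.single α ψ)))] at h1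
  rw [sum_eq_single α] at h1
  · rw [Pi.single_eq_same] at h1
    change (T ψ) α = -(surf (coeffOp A hA F) ψ) α
    rw [surf_apply, h1, neg_neg]
  · intro β _ hβ
    rw [Pi.single_eq_of_ne hβ, map_zero]
    rfl
  · simp

/-! ### Regularity data as boundary distributions of rotated fields -/

/-- The coefficients interchanging the vertical and the `j`-th derivative. -/
def rotCoeff (n m : ℕ) (j : Fin n) : Coeff n m := fun _ i k α β =>
  if α = β then (if i = 0 ∧ k = j.succ then -1 else if i = j.succ ∧ k = 0 then 1 else 0) else 0

theorem isBoundedCoeff_rotCoeff (j : Fin n) : IsBoundedCoeff (rotCoeff n m j) 1 := by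
  refine fun i k α β => ⟨aestronglyMeasurable_const, ae_of_all _ fun z => ?_⟩
  unfold rotCoeff
  split_ifs <;> simp

/-- For a gradient the rotated field is divergence free in the half-space, and its normal component
at the boundary is, up to sign, a tangential derivative. Regularity data thus becomes accessible
through the same pairing as Neumann data. -/
def rot (j : Fin n) : L2up n m →L[ℂ] L2up n m :=
  coeffOp (rotCoeff n m j) (isBoundedCoeff_rotCoeff j)

theorem coeffApply_rotCoeff (j : Fin n) (z : Pt n) (ξ : Evec n m) (i : Fin (n + 1)) (α : Fin m) :
    coeffApply (rotCoeff n m j) z ξ (i, α) =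
      if i = 0 then -ξ (j.succ, α) else if i = j.succ then ξ (0, α) else 0 := by
  simp only [coeffApply, rotCoeff]
  rw [sum_comm, sum_eq_single α]
  · rcases eq_or_ne i 0 with rfl | hi
    · simp [(Fin.succ_ne_zero j).symm]
    · rcases eq_or_ne i j.succ with rfl | hj
      · simp
      · simp [hi, hj]
  · intro β _ hβ
    simp [hβ.symm]
  · simp

/-- The regularity data of a field: the tangential derivatives of its trace. -/
def reg (F : L2up n m) : 𝓢'(Rn n, Cnm n m) :=
  ContinuousLinearMap.toPointwiseConvergenceCLM _ _ _ _
    (((PiLp.continuousLinearEquiv 2 ℂ (fun _ : Fin n × Fin m => ℂ)).symm :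
      (Fin n × Fin m → ℂ) →L[ℂ] Cnm n m).comp
      (ContinuousLinearMap.pi fun k =>
        (proj k.2 : Cm m →L[ℂ] ℂ).comp (surf (rot k.1 F) : 𝓢(Rn n, ℂ) →L[ℂ] Cm m)))

theorem reg_apply (F : L2up n m) (ψ : 𝓢(Rn n, ℂ)) (j : Fin n) (α : Fin m) :
    (reg F ψ) (j, α) = (surf (rot j F) ψ) α := rfl

theorem reg_sub (F F' : L2up n m) : reg (F - F') = reg F - reg F' := by
  ext ψ ⟨j, α⟩
  change (surf (rot j (F - F')) ψ) α = (surf (rot j F) ψ) α - (surf (rot j F') ψ) α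
  rw [map_sub, surf_sub]
  rfl

theorem surf_apply_integral (W : L2up n m) (ψ : 𝓢(Rn n, ℂ)) (α : Fin m) :
    (surf W ψ) α = ∑ i, ∫ z in upper n, W z (i, α) * bd ψ i z := by
  have hint : ∀ i, Integrable (fun z => W z (i, α) * bd ψ i z) (upperMeasure n) := fun i =>
    ((Lp.memLp W).eval_piLp (i, α)).integrable_mul (memLp_bd ψ i)
  rw [surf_apply, L2.inner_def, ← integral_finsetSum _ fun i _ => hint i]
  refine integral_congr_ae ((coeFn_bcls (Pi.single α ψ)).mono fun z hz => ?_)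
  simp only [hz]
  rw [PiLp.inner_apply, Fintype.sum_prod_type]
  refine sum_congr rfl fun i _ => ?_
  rw [sum_eq_single α]
  · simp [bvec]
  · intro β _ hβ
    have : bd (((Pi.single α ψ : Fin m → 𝓢(Rn n, ℂ)) β)) i z = 0 := by
      rw [Pi.single_eq_of_ne hβ]
      have := bd_smul 0 ψ i z
      simpa using this
    simp [bvec, this]
  · simp

theorem bd_ofReal (hh : ContDiff ℝ ∞ h) (i : Fin (n + 1)) (z : Pt n) :
    bd (fun x => (h x : ℂ)) i z = ((bd h i z : ℝ) : ℂ) := by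
  refine Fin.cases ?_ (fun j => ?_) i
  · simp [bd_zero]
  · have h1 : HasFDerivAt (fun x => (h x : ℂ)) (Complex.ofRealCLM.comp (fderiv ℝ h z.2)) z.2 :=
      Complex.ofRealCLM.hasFDerivAt.comp z.2 (hh.differentiable (by simp) z.2).hasFDerivAt
    simp only [bd_succ]
    rw [h1.fderiv]
    simp

theorem surf_tst_apply (W : L2up n m) (hc : HasCompactSupport h)
    (hs : ContDiff ℝ ∞ h) (α : Fin m) :
    (surf W (tst h)) α = ∑ i, ∫ z in upper n, W z (i, α) * ((bd h i z : ℝ) : ℂ) := by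
  rw [surf_apply_integral, coe_tst hc hs]
  simp_rw [bd_ofReal hs]

theorem hasCompactSupport_bd {E : Type*} [NormedAddCommGroup E] [NormedSpace ℝ E] {h : Rn n → E}
    (hc : HasCompactSupport h) (i : Fin (n + 1)) : HasCompactSupport (bd h i) := by
  refine HasCompactSupport.intro (hasCompactSupport_chi.isCompact.prod hc.isCompact) fun z hz => ?_
  rw [Set.mem_prod, not_and_or] at hz
  refine Fin.cases ?_ (fun j => ?_) i
  · rw [bd_zero]
    rcases hz with hz | hz
    · have : deriv chi z.1 = 0 := image_eq_zero_of_notMem_tsupport fun h =>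
        hz (closure_minimal (support_deriv_subset) (isClosed_tsupport _) h)
      rw [this, zero_smul]
    · rw [image_eq_zero_of_notMem_tsupport hz, smul_zero]
  · rw [bd_succ]
    rcases hz with hz | hz
    · rw [image_eq_zero_of_notMem_tsupport hz, zero_smul]
    · have : fderiv ℝ h z.2 = 0 :=
        image_eq_zero_of_notMem_tsupport fun h' => hz (tsupport_fderiv_subset ℝ h')
      rw [this]; simp

theorem sum_rot_bd (F : L2up n m) (j : Fin n) (α : Fin m) (b : Fin (n + 1) → Pt n → ℂ) :
    ∑ i, ∫ z in upper n, rot j F z (i, α) * b i z =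
      (∫ z in upper n, F z (0, α) * b j.succ z) - ∫ z in upper n, F z (j.succ, α) * b 0 z := by
  have e : ∀ i, ∫ z in upper n, rot j F z (i, α) * b i z =
      ∫ z in upper n, (if i = 0 then -F z (j.succ, α) else if i = j.succ then F z (0, α) else 0) *
        b i z := fun i => by
    refine integral_congr_ae ((coeFn_coeffOp (isBoundedCoeff_rotCoeff j) F).mono fun z hz => ?_)
    simp only [rot, hz, coeffApply_rotCoeff]
  rw [Fin.sum_univ_succ, sum_eq_single j, e, e]
  · simp only [if_true, if_neg (Fin.succ_ne_zero j), neg_mul]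
    rw [integral_neg]
    ring
  · intro k _ hk
    rw [e]
    simp [Fin.succ_ne_zero, Fin.succ_inj, hk]
  · simp

/-- Apply Green's formula to `chi t * ∂_j g x` in the vertical direction and to `chi' t * g x` in
the direction `j`. The two left-hand sides coincide, only the first has a boundary term, and the
difference is the claim. -/
theorem reg_tst
    (h : IsEnergy u fun z i α => F z (i, α)) (hf : IsTrace u f) {g : Rn n → ℝ}
    (hc : HasCompactSupport g) (hs : ContDiff ℝ ∞ g) (j : Fin n) (α : Fin m) :
    (reg F (tst g)) (j, α) = -∫ x, f x α * (fderiv ℝ g x (single j 1) : ℂ) := by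
  rw [reg_apply, surf_tst_apply _ hc hs, sum_rot_bd]
  set g' : Rn n → ℝ := fun x => fderiv ℝ g x (single j 1)
  have hs' : ContDiff ℝ ∞ g' := (hs.fderiv_right (by simp)).clm_apply contDiff_const
  have hc' : HasCompactSupport g' := hc.fderiv_apply ℝ (single j 1)
  have hchi : ContDiff ℝ ∞ (deriv chi) := contDiff_chi.deriv'
  have s0 : ContDiff ℝ ∞ fun z : Pt n => deriv chi z.1 * g z.2 := by
    exact (hchi.comp contDiff_fst).mul (hs.comp contDiff_snd)
  have c0 : HasCompactSupport fun z : Pt n => deriv chi z.1 * g z.2 := hasCompactSupport_bd hc 0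
  have s1 : ContDiff ℝ ∞ fun z : Pt n => chi z.1 * g' z.2 :=
    (contDiff_chi.comp contDiff_fst).mul (hs'.comp contDiff_snd)
  have c1 : HasCompactSupport fun z : Pt n => chi z.1 * g' z.2 := hasCompactSupport_bd hc j.succ
  have g0 := green h hf s0 c0 j.succ α
  have g1 := green h hf s1 c1 0 α
  have d0 : ∀ z : Pt n, fderiv ℝ (fun z : Pt n => deriv chi z.1 * g z.2) z (dir j.succ) =
      deriv chi z.1 * g' z.2 := by
    intro z
    have h2 : HasFDerivAt (fun z : Pt n => g z.2)
        ((fderiv ℝ g z.2).comp (ContinuousLinearMap.snd ℝ ℝ (Rn n))) z :=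
      (hs.differentiable (by simp) z.2).hasFDerivAt.comp z hasFDerivAt_snd
    rw [((hasFDerivAt_comp_fst hchi z).fun_mul h2).fderiv]
    simp [dir, g']
  have d1 : ∀ z : Pt n, fderiv ℝ (fun z : Pt n => chi z.1 * g' z.2) z (dir 0) =
      deriv chi z.1 * g' z.2 := fun z =>
    fderiv_chi_smul (hs'.differentiable (by simp)) z 0
  simp_rw [d0] at g0
  simp_rw [d1] at g1
  have e0 : ((dir j.succ : Pt n).1 : ℂ) = 0 := by simp [dir]
  have e1 : ((dir 0 : Pt n).1 : ℂ) = 1 := by simp [dir]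
  rw [e0, zero_mul, sub_zero] at g0
  rw [e1, one_mul, g0] at g1
  simp only [chi_zero, one_mul] at g1
  have b0 : ∀ z : Pt n, bd g 0 z = deriv chi z.1 * g z.2 := fun z => rfl
  have b1 : ∀ z : Pt n, bd g j.succ z = chi z.1 * g' z.2 := fun z => rfl
  simp_rw [b0, b1]
  linear_combination g1

theorem reg_apply_of_compactSupport
    (h : IsEnergy u fun z i α => F z (i, α)) (hf : IsTrace u f) {ψ : 𝓢(Rn n, ℂ)}
    (hc : HasCompactSupport ψ) (j : Fin n) (α : Fin m) :
    (reg F ψ) (j, α) = -∫ x, f x α * fderiv ℝ ψ x (single j 1) := by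
  obtain ⟨a, b, ha, ha', hb, hb', rfl⟩ := exists_tst_add ψ hc
  have hder : ∀ {g : Rn n → ℝ}, HasCompactSupport g → ContDiff ℝ ∞ g → ∀ x,
      fderiv ℝ (tst g) x (single j 1) = (fderiv ℝ g x (single j 1) : ℂ) := by
    intro g hg hg' x
    have h1 : HasFDerivAt (fun x => (g x : ℂ)) (Complex.ofRealCLM.comp (fderiv ℝ g x)) x :=
      Complex.ofRealCLM.hasFDerivAt.comp x (hg'.differentiable (by simp) x).hasFDerivAt
    rw [coe_tst hg hg', h1.fderiv]
    rfl
  have hint : ∀ {g : Rn n → ℝ}, HasCompactSupport g → ContDiff ℝ ∞ g →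
      Integrable fun x => f x α * (fderiv ℝ g x (single j 1) : ℂ) := by
    intro g hg hg'
    have hcs : HasCompactSupport fun x => (fderiv ℝ g x (single j 1) : ℂ) :=
      (hg.fderiv_apply ℝ (single j 1)).comp_left Complex.ofReal_zero
    exact integrable_mul_of_compactSupport ((hf.1 _ hcs.isCompact).eval_piLp α)
      (continuous_ofReal.comp (continuous_fderiv_apply hg' _)) hcs
  have e : ∀ x, f x α * fderiv ℝ (tst a + Complex.I • tst b : 𝓢(Rn n, ℂ)) x
      (single j 1) =
      f x α * (fderiv ℝ a x (single j 1) : ℂ) +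
      Complex.I * (f x α * (fderiv ℝ b x (single j 1) : ℂ)) := by
    intro x
    simp only [FunLike.coe_add, FunLike.coe_smul]
    rw [fderiv_add (tst a).differentiableAt ((tst b).differentiableAt.const_smul _),
      fderiv_const_smul (tst b).differentiableAt]
    simp only [add_apply, smul_apply, hder ha ha', hder hb hb', smul_eq_mul]
    ring
  simp_rw [e]
  rw [integral_add (hint ha ha') ((hint hb hb').const_mul _), integral_const_mul, map_add, map_smul,
    PiLp.add_apply, PiLp.smul_apply, reg_tst h hf ha ha', reg_tst h hf hb hb', smul_eq_mul]
  ring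

theorem isRegularityData_reg
    (h : IsEnergy u fun z i α => F z (i, α)) (hf : IsTrace u f) : IsRegularityData u (reg F) :=
  ⟨f, hf, fun _ hψ j α => reg_apply_of_compactSupport h hf hψ j α⟩

theorem IsRegularityData.eq_reg {R : 𝓢'(Rn n, Cnm n m)}
    (h : IsEnergy u fun z i α => F z (i, α)) (hR : IsRegularityData u R) : R = reg F := by
  obtain ⟨f, hf, hRf⟩ := hR
  refine eq_of_forall_compactSupport fun ψ hψ => ?_
  ext ⟨j, α⟩
  rw [hRf ψ hψ, reg_apply_of_compactSupport h hf hψ]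

theorem locallyIntegrable_of_memLp_compact
    (hf : ∀ K, IsCompact K → MemLp f 2 (volume.restrict K)) : LocallyIntegrable f := by
  rw [locallyIntegrable_iff]
  intro K hK
  have : IsFiniteMeasure (volume.restrict K) := isFiniteMeasure_restrict.2 hK.measure_lt_top.ne
  exact (hf K hK).integrable one_le_two

/-- A function whose distributional gradient vanishes is constant. -/
theorem ae_const_of_weak_grad_eq_zero (hf : LocallyIntegrable f)
    (h : ∀ g : Rn n → ℝ, HasCompactSupport g → ContDiff ℝ ∞ g → ∀ j α,
      ∫ x, f x α * (fderiv ℝ g x (single j 1) : ℂ) = 0) :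
    ∃ c : Cm m, f =ᵐ[volume] fun _ => c := by
  let b : ℕ → ContDiffBump (0 : Rn n) := fun k =>
    ⟨1 / ((k : ℝ) + 1) / 2, 1 / ((k : ℝ) + 1), by positivity, half_lt_self (by positivity)⟩
  -- The mollifications have zero gradient and are therefore constant. They converge to `f` almost
  -- everywhere, so `f` equals the limit of these constants.
  have hconst : ∀ k, ∃ c, ∀ x, conv ((b k).normed volume) f x = c := by
    intro k
    set ρ := (b k).normed volume
    have hρ : ContDiff ℝ ∞ ρ := (b k).contDiff_normed
    have hc : HasCompactSupport ρ := (b k).hasCompactSupport_normed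
    have hsm := contDiff_conv hρ hc hf
    have hd : ∀ x, fderiv ℝ (conv ρ f) x = 0 := by
      intro x
      have hdir : ∀ j, fderiv ℝ (conv ρ f) x (single j 1) = 0 := by
        intro j
        rw [fderiv_conv_apply hρ hc hf, conv_eq_integral_sub]
        have hint : Integrable fun w => fderiv ℝ ρ (x - w) (single j 1) • f w := by
          simpa using (integrable_conv (continuous_fderiv_apply hρ (single j 1))
            (hc.fderiv_apply ℝ (single j 1)) hf x).comp_sub_left x
        ext α
        have e1 := (proj α : Cm m →L[ℂ] ℂ).integral_comp_comm hint
        change _ = (∫ w, fderiv ℝ ρ (x - w) (single j 1) • f w) α at e1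
        rw [← e1, PiLp.zero_apply, ← neg_eq_zero, ← integral_neg,
          ← h (fun w => ρ (x - w)) (hc.comp_homeomorph (Homeomorph.subLeft x))
            (hρ.comp (contDiff_const.sub contDiff_id)) j α]
        congr 1
        ext w
        have h1 : HasFDerivAt (fun w => ρ (x - w)) _ w :=
          ((hρ.differentiable (by simp) (x - w)).hasFDerivAt).comp w (hasFDerivAt_id w |>.const_sub x)
        rw [h1.fderiv]
        simp [mul_comm]
      ext1 y
      have : y = ∑ j, y j • single j (1 : ℝ) := by
        ext i
        simp [Finset.sum_apply, Pi.single_apply]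
      rw [this, map_sum]
      simp [hdir]
    exact ⟨conv ρ f 0, fun x => is_const_of_fderiv_eq_zero (hsm.differentiable (by simp)) hd x 0⟩
  choose c hc using hconst
  have hlim := ContDiffBump.ae_convolution_tendsto_right_of_locallyIntegrable (φ := b) (K := 2)
    (l := atTop) (μ := volume) (g := f)
    (tendsto_one_div_add_atTop_nhds_zero_nat (𝕜 := ℝ)) (Eventually.of_forall fun k => by
      simp only [b]; linarith) hf
  have hlim' : ∀ᵐ x, Tendsto c atTop (𝓝 (f x)) := by
    filter_upwards [hlim] with x hx
    refine hx.congr fun k => ?_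
    rw [← hc k x, conv_eq]
  obtain ⟨x₀, hx₀⟩ := hlim'.exists
  exact ⟨f x₀, hlim'.mono fun x hx => tendsto_nhds_unique hx hx₀⟩

theorem isEnergy_const (c : Cm m) : IsEnergy (fun _ : Pt n => c) fun _ _ _ => 0 := by
  refine ⟨fun K hK _ => memLp_restrict_of_continuous continuous_const hK, fun i α => MemLp.zero',
    fun i α φ h1 h2 h3 => ?_⟩
  rw [integral_smooth_by_parts (u := fun _ => c α) contDiff_const h1 h2 h3]
  simp

theorem isTrace_const (c : Cm m) : IsTrace (fun _ : Pt n => c) fun _ => c :=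
  ⟨fun K hK => memLp_restrict_of_continuous continuous_const hK, fun K hK => by simpa using tendsto_const_nhds⟩

/-- A field in the energy space with vanishing tangential trace is a limit of gradients of test
functions supported in the open half-space. -/
theorem mem_energySpace_upper_of_reg_eq_zero (hF : F ∈ energySpace n m univ)
    (h : reg F = 0) : F ∈ energySpace n m (upper n) := by
  obtain ⟨u, f, hu, hf⟩ := exists_energy_of_mem hF
  obtain ⟨c, hc⟩ := ae_const_of_weak_grad_eq_zero (locallyIntegrable_of_memLp_compact hf.1)
    fun g hg hg' j α => by
      have := reg_tst hu hf hg hg' j α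
      rw [h] at this
      rw [← neg_eq_zero, ← this]
      rfl
  -- Vanishing regularity data only makes the trace constant. Subtracting that constant from `u`
  -- leaves the gradient unchanged and removes the trace.
  have h1 := hu.sub (isEnergy_const c)
  simp only [sub_zero] at h1
  exact mem_energySpace_upper h1
    (hf.sub (isTrace_const c) hu.aestronglyMeasurable (isEnergy_const c).aestronglyMeasurable)
    (hc.mono fun x hx => by simp [hx])

/-! ### Convolution of boundary distributions with test functions -/

theorem hasCompactSupport_comp_sub (hc : HasCompactSupport h) (y : Rn n) :
    HasCompactSupport fun x => h (x - y) :=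
  hc.comp_homeomorph (Homeomorph.subRight y)

theorem contDiff_comp_sub (hs : ContDiff ℝ ∞ h) (y : Rn n) : ContDiff ℝ ∞ fun x => h (x - y) :=
  hs.comp (contDiff_id.sub contDiff_const)

theorem hasCompactSupport_sub_comp (hc : HasCompactSupport h) (y : Rn n) :
    HasCompactSupport fun x => h (y - x) :=
  hc.comp_homeomorph (Homeomorph.subLeft y)

theorem contDiff_sub_comp (hs : ContDiff ℝ ∞ h) (y : Rn n) : ContDiff ℝ ∞ fun x => h (y - x) :=
  hs.comp (contDiff_const.sub contDiff_id)

theorem translate_bcls (hc : HasCompactSupport h) (hs : ContDiff ℝ ∞ h) (y : Rn n)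
    (α : Fin m) : translate y (bcls (Pi.single α (tst h))) =
      bcls (Pi.single α (tst fun x => h (x - y))) := by
  ext1
  filter_upwards [coeFn_translate_of (y := y) (coeFn_bcls (Pi.single α (tst h))),
    coeFn_bcls (Pi.single α (tst fun x => h (x - y)))] with z h1 h2
  rw [h1, h2]
  ext ⟨i, β⟩
  simp only [bvec, vec_apply]
  congr 1
  rcases eq_or_ne β α with rfl | hβ
  · rw [Pi.single_eq_same, Pi.single_eq_same, coe_tst hc hs,
      coe_tst (hasCompactSupport_comp_sub hc y) (contDiff_comp_sub hs y)]
    exact (bd_comp_sub (h := fun x => (h x : ℂ)) y i z).symm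
  · rw [Pi.single_eq_of_ne hβ, Pi.single_eq_of_ne hβ]
    have h0 : ∀ z : Pt n, bd (0 : 𝓢(Rn n, ℂ)) i z = 0 := fun z => by
      have := bd_smul 0 (0 : 𝓢(Rn n, ℂ)) i z
      simpa using this
    rw [h0, h0]

theorem translate_neg_translate (y : Rn n) (F : L2up n m) : translate y (translate (-y) F) = F := by
  ext1
  filter_upwards [coeFn_translate_of (y := y) (coeFn_translate (-y) F)] with z hz
  rw [hz]
  simp

theorem surf_tst_sub (W : L2up n m) (hc : HasCompactSupport h)
    (hs : ContDiff ℝ ∞ h) (y : Rn n) :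
    surf W (tst fun x => h (x - y)) = surf (translate (-y) W) (tst h) := by
  ext α
  rw [surf_apply, surf_apply, ← translate_bcls hc hs y α]
  conv_lhs => rw [← translate_neg_translate y W]
  exact LinearIsometry.inner_map_map _ _ _

theorem continuous_surf_tst_sub (W : L2up n m) (hc : HasCompactSupport h)
    (hs : ContDiff ℝ ∞ h) : Continuous fun y => surf W (tst fun x => h (x - y)) := by
  simp_rw [surf_tst_sub W hc hs]
  refine (continuous_toLp 2 _).comp (continuous_pi fun α => ?_)
  exact continuous_const.inner ((continuous_translate W).comp continuous_neg)

theorem bd_conv {θ h : Rn n → ℝ} (hθc : HasCompactSupport θ) (hθ : ContDiff ℝ ∞ θ)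
    (hh : Continuous h) (i : Fin (n + 1)) (z : Pt n) :
    bd (conv θ h) i z = ∫ v, h v * bd θ i (z.1, z.2 - v) := by
  have hloc : LocallyIntegrable h := hh.locallyIntegrable
  refine Fin.cases ?_ (fun j => ?_) i
  · simp only [bd_zero, smul_eq_mul]
    rw [conv_eq_integral_sub, ← integral_const_mul]
    congr 1
    ext v
    simp only [smul_eq_mul]
    ring
  · simp only [bd_succ, smul_eq_mul]
    rw [fderiv_conv_apply hθ hθc hloc, conv_eq_integral_sub, ← integral_const_mul]
    congr 1
    ext v
    simp only [smul_eq_mul]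
    ring

theorem hasCompactSupport_conv {E : Type*} [NormedAddCommGroup E] [NormedSpace ℝ E]
    {h : Rn n → E} (hθ : HasCompactSupport θ)
    (hh : HasCompactSupport h) : HasCompactSupport (conv θ h) := by
  rw [conv_eq]
  exact HasCompactSupport.convolution _ hθ hh

/-- This is Fubini. The field is merely square integrable, but the compact supports of `θ` and `h`
make the double integrand integrable. -/
theorem surf_conv (W : L2up n m) {θ h : Rn n → ℝ} (hθc : HasCompactSupport θ)
    (hθ : ContDiff ℝ ∞ θ) (hh : Continuous h) (hhc : HasCompactSupport h) :
    surf W (tst (conv θ h)) = ∫ v, h v • surf W (tst fun x => θ (x - v)) := by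
  have hcont := continuous_surf_tst_sub W hθc hθ
  have hint : Integrable fun v => h v • surf W (tst fun x => θ (x - v)) :=
    integrable_smul_of_compactSupport hhc hh hcont
  ext α
  have e1 := (proj α : Cm m →L[ℂ] ℂ).integral_comp_comm hint
  change _ = (∫ v, h v • surf W (tst fun x => θ (x - v))) α at e1
  rw [← e1, surf_tst_apply W (hasCompactSupport_conv hθc hhc)
    (contDiff_conv hθ hθc hh.locallyIntegrable)]
  have hK : ∀ i, ∃ R C : ℝ, ∀ (v : Rn n) (z : Pt n), ‖h v * bd θ i (z.1, z.2 - v)‖ ≤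
      C * ((tsupport h).indicator (fun _ => (1 : ℝ)) v *
        (closedBall (0 : Pt n) R).indicator (fun _ => (1 : ℝ)) z) := by
    intro i
    obtain ⟨r1, hr1⟩ := hhc.isCompact.isBounded.subset_closedBall 0
    obtain ⟨r2, hr2⟩ := (hasCompactSupport_bd hθc i).isCompact.isBounded.subset_closedBall 0
    obtain ⟨C1, hC1⟩ := hhc.exists_bound_of_continuous hh
    obtain ⟨C2, hC2⟩ := (hasCompactSupport_bd hθc i).exists_bound_of_continuous (continuous_bd hθ i)
    refine ⟨r1 + r2, C1 * C2, fun v z => ?_⟩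
    by_cases hv : v ∈ tsupport h
    · by_cases hz : ((z.1, z.2 - v) : Pt n) ∈ tsupport (bd θ i)
      · have hz' : z ∈ closedBall (0 : Pt n) (r1 + r2) := by
          have a1 := hr1 hv
          have a2 := hr2 hz
          rw [mem_closedBall_zero_iff] at a1 a2 ⊢
          have e : z = (z.1, z.2 - v) + (0, v) := by ext <;> simp
          rw [e]
          refine (norm_add_le _ _).trans ?_
          have : ‖((0, v) : Pt n)‖ = ‖v‖ := by simp [Prod.norm_def]
          rw [this]
          linarith
        rw [indicator_of_mem hv, indicator_of_mem hz', mul_one, mul_one, norm_mul]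
        exact mul_le_mul (hC1 v) (hC2 _) (norm_nonneg _) ((norm_nonneg _).trans (hC1 v))
      · rw [image_eq_zero_of_notMem_tsupport hz, mul_zero, norm_zero]
        have : 0 ≤ C1 * C2 := mul_nonneg ((norm_nonneg _).trans (hC1 v)) ((norm_nonneg _).trans (hC2 z))
        exact mul_nonneg this (mul_nonneg (Set.indicator_nonneg (fun _ _ => zero_le_one) _)
          (Set.indicator_nonneg (fun _ _ => zero_le_one) _))
    · rw [image_eq_zero_of_notMem_tsupport hv, zero_mul, norm_zero, indicator_of_notMem hv]
      simp
  have hprod : ∀ i, Integrable (Function.uncurry fun (z : Pt n) (v : Rn n) =>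
      W z (i, α) * ((h v * bd θ i (z.1, z.2 - v) : ℝ) : ℂ)) ((upperMeasure n).prod volume) := by
    intro i
    obtain ⟨R, C, hRC⟩ := hK i
    have a1 : Integrable (fun z => (closedBall (0 : Pt n) R).indicator (fun _ => (1 : ℝ)) z *
        ‖W z (i, α)‖) (upperMeasure n) := by
      have : MemLp ((closedBall (0 : Pt n) R).indicator (fun _ => (1 : ℝ))) 2 (upperMeasure n) := by
        refine memLp_indicator_const 2 isClosed_closedBall.measurableSet 1 (Or.inr ?_)
        exact ((Measure.restrict_apply_le _ _).trans_lt
          (isCompact_closedBall (0 : Pt n) R).measure_lt_top).ne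
      exact this.integrable_mul ((Lp.memLp W).eval_piLp (i, α)).norm
    have a2 : Integrable ((tsupport h).indicator (fun _ => (1 : ℝ))) volume :=
      (integrable_indicator_iff (isClosed_tsupport h).measurableSet).2
        (integrableOn_const hhc.isCompact.measure_lt_top.ne)
    have a3 := (a1.mul_prod a2).const_mul C
    refine a3.mono' ?_ (ae_of_all _ fun p => ?_)
    · refine AEStronglyMeasurable.mul ?_ ?_
      · exact ((Lp.memLp W).eval_piLp (i, α)).1.comp_fst
      · refine Continuous.aestronglyMeasurable ?_
        refine continuous_ofReal.comp ((hh.comp continuous_snd).mul ?_)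
        exact (continuous_bd hθ i).comp (by fun_prop)
    · simp only [Function.uncurry]
      rw [norm_mul, Complex.norm_real]
      calc _ ≤ ‖W p.1 (i, α)‖ * _ := mul_le_mul_of_nonneg_left (hRC p.2 p.1) (norm_nonneg _)
        _ = _ := by ring
  have e2 : ∀ v, (proj α : Cm m →L[ℂ] ℂ) (h v • surf W (tst fun x => θ (x - v))) =
      ∑ i, ∫ z in upper n, W z (i, α) * ((h v * bd θ i (z.1, z.2 - v) : ℝ) : ℂ) := by
    intro v
    change h v • (surf W (tst fun x => θ (x - v))) α = _
    rw [surf_tst_apply W (hasCompactSupport_comp_sub hθc v) (contDiff_comp_sub hθ v), smul_sum]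
    refine sum_congr rfl fun i _ => ?_
    rw [← integral_smul]
    congr 1
    ext z
    rw [bd_comp_sub]
    simp
    ring
  simp_rw [e2]
  rw [integral_finsetSum (f := fun i v => ∫ z in upper n, W z (i, α) *
    ((h v * bd θ i (z.1, z.2 - v) : ℝ) : ℂ)) _ fun i _ => (hprod i).integral_prod_right]
  refine sum_congr rfl fun i _ => ?_
  rw [integral_integral_swap (f := fun v z => W z (i, α) * ((h v * bd θ i (z.1, z.2 - v) : ℝ) : ℂ))
    (hprod i).swap]
  congr 1
  ext z
  rw [bd_conv hθc hθ hh, ← integral_complex_ofReal, ← integral_const_mul]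

theorem tst_sub {a b : Rn n → ℝ} (ha : HasCompactSupport a) (ha' : ContDiff ℝ ∞ a)
    (hb : HasCompactSupport b) (hb' : ContDiff ℝ ∞ b) :
    tst (fun x => a x - b x) = tst a - tst b := by
  ext x
  rw [tst_apply (h := fun x => a x - b x) (ha.sub hb) (ha'.sub hb'), sub_apply, tst_apply ha ha',
    tst_apply hb hb']
  push_cast
  rfl

/-- The convolution of the boundary distribution of a field with a test function. -/
def smear (W : L2up n m) (θ : Rn n → ℝ) (x : Rn n) : Cm m := surf W (tst fun y => θ (x - y))

theorem smear_sub_kernel (W : L2up n m) {a b : Rn n → ℝ} (ha : HasCompactSupport a)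
    (ha' : ContDiff ℝ ∞ a) (hb : HasCompactSupport b) (hb' : ContDiff ℝ ∞ b) (x : Rn n) :
    smear W (fun y => a y - b y) x = smear W a x - smear W b x := by
  rw [smear, tst_sub (hasCompactSupport_sub_comp ha x) (contDiff_sub_comp ha' x)
    (hasCompactSupport_sub_comp hb x) (contDiff_sub_comp hb' x), map_sub]
  rfl

theorem smear_eq (W : L2up n m) (θ : Rn n → ℝ) (x v : Rn n) :
    surf W (tst fun y => θ (x - (y - v))) = smear W θ (x + v) := by
  unfold smear
  congr 2
  ext y
  congr 1
  abel

theorem continuous_smear (W : L2up n m) (hc : HasCompactSupport θ)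
    (hs : ContDiff ℝ ∞ θ) : Continuous (smear W θ) := by
  have h := continuous_surf_tst_sub W (hasCompactSupport_sub_comp hc 0) (contDiff_sub_comp hs 0)
  simp_rw [smear_eq W θ, zero_add] at h
  exact h

theorem conv_smear (W : L2up n m) {ψ θ : Rn n → ℝ} (hψ : Continuous ψ) (hψc : HasCompactSupport ψ)
    (hθc : HasCompactSupport θ) (hθ : ContDiff ℝ ∞ θ) (x : Rn n) :
    conv ψ (smear W θ) x = smear W (conv ψ θ) x := by
  have h := surf_conv W (hasCompactSupport_sub_comp hθc x) (contDiff_sub_comp hθ x)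
    (h := fun v => ψ (-v)) (hψ.comp continuous_neg) (hψc.comp_homeomorph (Homeomorph.neg _))
  simp_rw [smear_eq W θ] at h
  have e : conv (fun y => θ (x - y)) (fun v => ψ (-v)) = fun z => conv ψ θ (x - z) := by
    ext z
    rw [conv_eq_integral_sub, conv, ← integral_neg_eq_self]
    congr 1
    ext y
    simp only [smul_eq_mul, neg_neg]
    rw [mul_comm]
    congr 2
    abel
  rw [e] at h
  rw [smear, h, ← integral_neg_eq_self, conv]
  simp [sub_eq_add_neg]

/-- Averaging a field horizontally amounts to convolving its boundary distribution. Translations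
pass from the field to the test function, and commutativity of convolution lets the roles of kernel
and test function be exchanged. -/
theorem surf_havg (W : L2up n m) {Φ h : Rn n → ℝ} (hΦc : HasCompactSupport Φ)
    (hΦ : ContDiff ℝ ∞ Φ) (hc : HasCompactSupport h) (hs : ContDiff ℝ ∞ h) :
    surf (havg Φ W) (tst h) = ∫ x, h x • smear W Φ x := by
  have h1 : surf (havg Φ W) (tst h) = ∫ y, Φ y • surf (translate y W) (tst h) := by
    ext α
    have hint : Integrable fun y => Φ y • surf (translate y W) (tst h) := by
      have := continuous_surf_tst_sub W hc hs
      simp_rw [surf_tst_sub W hc hs] at this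
      have := this.comp continuous_neg
      simp only [Function.comp_def, neg_neg] at this
      exact integrable_smul_of_compactSupport hΦc hΦ.continuous this
    have e1 := (proj α : Cm m →L[ℂ] ℂ).integral_comp_comm hint
    change _ = (∫ y, Φ y • surf (translate y W) (tst h)) α at e1
    rw [← e1, surf_apply]
    have := map_havg (innerSL ℂ (bcls (Pi.single α (tst h)) : L2up n m)) hΦ.continuous hΦc W
    refine this.trans ?_
    rfl
  have h2 := surf_conv W hc hs (h := fun v => Φ (-v)) (hΦ.continuous.comp continuous_neg)
    (hΦc.comp_homeomorph (Homeomorph.neg _))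
  have h3 := surf_conv W (θ := fun v => Φ (-v)) (hΦc.comp_homeomorph (Homeomorph.neg _))
    (hΦ.comp contDiff_neg) hs.continuous hc
  have e : conv h (fun v => Φ (-v)) = conv (fun v => Φ (-v)) h := by
    ext z
    rw [conv_eq_integral_sub, conv]
    simp only [smul_eq_mul, mul_comm]
  have h3' : surf W (tst (conv (fun v => Φ (-v)) h)) = ∫ v, h v • smear W Φ v := by
    rw [h3]
    simp only [smear, neg_sub]
  rw [e, h3'] at h2
  rw [h1, h2, ← integral_neg_eq_self fun y => Φ y • surf (translate y W) (tst h)]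
  congr 1
  ext1 v
  rw [surf_tst_sub W hc hs]

/-! ### Extension of convolved boundary functions to fields -/

/-- Young's inequality in `L²`. -/
theorem eLpNorm_conv_le (hρ : Continuous ρ)
    (hf : StronglyMeasurable f) :
    eLpNorm (conv ρ f) 2 volume ≤ (∫⁻ y, ‖ρ y‖ₑ) * eLpNorm f 2 volume := by
  rw [← ENNReal.pow_le_pow_left_iff two_ne_zero, mul_pow, sq_eLpNorm_two, sq_eLpNorm_two]
  have hm : Measurable fun p : Rn n × Rn n => ‖ρ p.2‖ₑ * ‖f (p.1 - p.2)‖ₑ ^ 2 := by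
    refine (hρ.measurable.comp measurable_snd).enorm.mul ?_
    exact (hf.comp_measurable (by fun_prop)).enorm.pow_const 2
  calc ∫⁻ z, ‖conv ρ f z‖ₑ ^ 2
      ≤ ∫⁻ z, (∫⁻ y, ‖ρ y‖ₑ) * ∫⁻ y, ‖ρ y‖ₑ * ‖f (z - y)‖ₑ ^ 2 := by
        refine lintegral_mono fun z => ?_
        calc _ ≤ (∫⁻ y, ‖ρ y‖ₑ * ‖f (z - y)‖ₑ) ^ 2 := by
              gcongr
              refine (enorm_integral_le_lintegral_enorm _).trans (le_of_eq ?_)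
              simp_rw [enorm_smul]
          _ ≤ _ := sq_lintegral_mul_le _ hρ.measurable.enorm
              (hf.comp_measurable (by fun_prop)).enorm
    _ = (∫⁻ y, ‖ρ y‖ₑ) * ∫⁻ z, ∫⁻ y, ‖ρ y‖ₑ * ‖f (z - y)‖ₑ ^ 2 :=
        lintegral_const_mul _ hm.lintegral_prod_right'
    _ = (∫⁻ y, ‖ρ y‖ₑ) * ∫⁻ y, ∫⁻ z, ‖ρ y‖ₑ * ‖f (z - y)‖ₑ ^ 2 := by
        rw [lintegral_lintegral_swap (f := fun z y => ‖ρ y‖ₑ * ‖f (z - y)‖ₑ ^ 2) hm.aemeasurable]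
    _ = (∫⁻ y, ‖ρ y‖ₑ) * ∫⁻ y, ‖ρ y‖ₑ * ∫⁻ z, ‖f z‖ₑ ^ 2 := by
        congr 1
        refine lintegral_congr fun y => ?_
        rw [lintegral_const_mul' _ _ enorm_ne_top,
          lintegral_sub_right_eq_self (fun z => ‖f z‖ₑ ^ 2) y]
    _ = _ := by rw [lintegral_mul_const _ hρ.measurable.enorm, sq, mul_assoc]

theorem eLpNorm_smul_prod_le {a : ℝ → ℝ} (ha : Continuous a) {g : Rn n → Cm m}
    (hg : Continuous g) : eLpNorm (fun z : Pt n => a z.1 • g z.2) 2 (upperMeasure n) ≤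
      eLpNorm a 2 volume * eLpNorm g 2 volume := by
  refine (eLpNorm_mono_measure _ Measure.restrict_le_self).trans ?_
  rw [← ENNReal.pow_le_pow_left_iff two_ne_zero, mul_pow, sq_eLpNorm_two, sq_eLpNorm_two,
    sq_eLpNorm_two, Measure.volume_eq_prod, ← lintegral_prod_mul]
  · refine lintegral_mono fun z => ?_
    rw [enorm_smul, mul_pow]
  · exact (ha.measurable.enorm.pow_const 2).aemeasurable
  · exact (hg.measurable.enorm.pow_const 2).aemeasurable

/-- The gradient of the extension `(t, x) ↦ chi t • f x`. -/
def extField (f : Rn n → Cm m) (z : Pt n) : Evec n m := vec fun i α => bd f i z α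

theorem continuous_extField (hf : ContDiff ℝ ∞ f) : Continuous (extField f) := by
  refine (continuous_toLp 2 _).comp (continuous_pi fun k => ?_)
  exact (PiLp.continuous_apply 2 _ _).comp (continuous_bd hf k.1)

theorem norm_extField_le (f : Rn n → Cm m) (z : Pt n) : ‖extField f z‖ ≤ m * ∑ i, ‖bd f i z‖ := by
  refine (norm_le_sum_apply _).trans ?_
  rw [Fintype.sum_prod_type, mul_sum]
  refine sum_le_sum fun i _ => ?_
  calc _ ≤ ∑ _α : Fin m, ‖bd f i z‖ := sum_le_sum fun α _ => norm_apply_le _ _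
    _ = _ := by simp

/-- The operator norm bound for `f ↦ extField (conv θ f)`. -/
theorem exists_eLpNorm_extField_conv_le (hc : HasCompactSupport θ)
    (hs : ContDiff ℝ ∞ θ) : ∃ K : ℝ≥0, ∀ f : Rn n → Cm m, StronglyMeasurable f →
      MemLp f 2 volume → eLpNorm (extField (conv θ f)) 2 (upperMeasure n) ≤
        K * eLpNorm f 2 volume := by
  have hd : ∀ j, Continuous fun y => fderiv ℝ θ y (single j 1) := fun j =>
    continuous_fderiv_apply hs _
  have hdc : ∀ j, HasCompactSupport fun y => fderiv ℝ θ y (single j 1) := fun j =>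
    hc.fderiv_apply ℝ (single j 1)
  have fin : ∀ {X : Type} [NormedAddCommGroup X] [MeasureSpace X] [BorelSpace X]
      [IsFiniteMeasureOnCompacts (volume : Measure X)] {a : X → ℝ},
      Continuous a → HasCompactSupport a → ∫⁻ y, ‖a y‖ₑ ≠ ⊤ := fun h1 h2 =>
    (h1.integrable_of_hasCompactSupport h2).2.ne
  have fin2 : ∀ {a : ℝ → ℝ}, Continuous a → HasCompactSupport a → eLpNorm a 2 volume ≠ ⊤ :=
    fun h1 h2 => (h1.memLp_of_hasCompactSupport h2).2.ne
  have key : ∀ i : Fin (n + 1), ∃ K : ℝ≥0, ∀ f : Rn n → Cm m, StronglyMeasurable f →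
      MemLp f 2 volume → eLpNorm (bd (conv θ f) i) 2 (upperMeasure n) ≤ K * eLpNorm f 2 volume := by
    refine Fin.cases ?_ fun j => ?_
    · refine ⟨(eLpNorm (deriv chi) 2 volume * ∫⁻ y, ‖θ y‖ₑ).toNNReal, fun f hf hf2 => ?_⟩
      rw [ENNReal.coe_toNNReal (mul_ne_top
        (fin2 continuous_deriv_chi hasCompactSupport_chi.deriv) (fin hs.continuous hc)), mul_assoc]
      refine (eLpNorm_smul_prod_le continuous_deriv_chi
        (contDiff_conv hs hc (hf2.locallyIntegrable one_le_two)).continuous).trans ?_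
      gcongr
      exact eLpNorm_conv_le hs.continuous hf
    · refine ⟨(eLpNorm chi 2 volume *
        ∫⁻ y, ‖fderiv ℝ θ y (single j 1)‖ₑ).toNNReal, fun f hf hf2 => ?_⟩
      rw [ENNReal.coe_toNNReal (mul_ne_top
        (fin2 contDiff_chi.continuous hasCompactSupport_chi) (fin (hd j) (hdc j))), mul_assoc]
      have hloc := hf2.locallyIntegrable one_le_two
      refine (eLpNorm_smul_prod_le contDiff_chi.continuous
        (continuous_fderiv_apply (contDiff_conv hs hc hloc) _)).trans ?_
      gcongr
      simp_rw [fderiv_conv_apply hs hc hloc]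
      exact eLpNorm_conv_le (hd j) hf
  choose K hK using key
  refine ⟨m * ∑ i, K i, fun f hf hf2 => ?_⟩
  have hsm := contDiff_conv hs hc (hf2.locallyIntegrable one_le_two)
  calc _ ≤ eLpNorm (fun z => (m : ℝ) * ∑ i, ‖bd (conv θ f) i z‖) 2 (upperMeasure n) :=
        eLpNorm_mono_real (norm_extField_le _)
    _ = m * eLpNorm (∑ i, fun z => ‖bd (conv θ f) i z‖) 2 (upperMeasure n) := by
        have := eLpNorm_const_smul (m : ℝ) (∑ i, fun z => ‖bd (conv θ f) i z‖) 2 (upperMeasure n)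
        rw [Real.enorm_natCast] at this
        rw [← this]
        congr 1
        ext z
        simp
    _ ≤ m * ∑ i, eLpNorm (bd (conv θ f) i) 2 (upperMeasure n) := by
        gcongr
        refine (eLpNorm_sum_le (fun i _ => ((continuous_bd hsm i).norm).aestronglyMeasurable)
          one_le_two).trans (le_of_eq ?_)
        simp_rw [eLpNorm_norm]
    _ ≤ m * ∑ i, K i * eLpNorm f 2 volume := by
        gcongr with i
        exact hK i f hf hf2
    _ = _ := by
        push_cast
        rw [← sum_mul, mul_assoc]

/-- The Hilbert space of square integrable functions on the boundary. -/
abbrev L2bd (n m : ℕ) := Lp (Cm m) 2 (volume : Measure (Rn n))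

theorem memLp_extField_conv (hc : HasCompactSupport θ) (hs : ContDiff ℝ ∞ θ)
    (f : L2bd n m) : MemLp (extField (conv θ f)) 2 (upperMeasure n) := by
  obtain ⟨K, hK⟩ := exists_eLpNorm_extField_conv_le (m := m) hc hs
  refine ⟨(continuous_extField (contDiff_conv hs hc
    ((Lp.memLp f).locallyIntegrable one_le_two))).aestronglyMeasurable, ?_⟩
  exact (hK f (Lp.stronglyMeasurable f) (Lp.memLp f)).trans_lt
    (mul_lt_top ENNReal.coe_lt_top (Lp.memLp f).2)

theorem conv_congr_ae {f g : Rn n → Cm m} (h : f =ᵐ[volume] g) : conv ρ f = conv ρ g := by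
  ext1 x
  rw [conv_eq_integral_sub, conv_eq_integral_sub]
  exact integral_congr_ae (h.mono fun w hw => by simp only [hw])

theorem conv_add (hρ : Continuous ρ) (hc : HasCompactSupport ρ) {f g : Rn n → Cm m}
    (hf : LocallyIntegrable f) (hg : LocallyIntegrable g) :
    conv ρ (f + g) = conv ρ f + conv ρ g := by
  ext1 x
  simp only [conv, Pi.add_apply, smul_add]
  exact integral_add (integrable_conv hρ hc hf x) (integrable_conv hρ hc hg x)

theorem conv_smul (c : ℂ) (f : Rn n → Cm m) : conv ρ (c • f) = c • conv ρ f := by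
  ext1 x
  simp only [conv, Pi.smul_apply]
  rw [← integral_smul]
  congr 1
  ext1 y
  rw [smul_comm]

theorem extField_add {f g : Rn n → Cm m} (hf : ContDiff ℝ ∞ f) (hg : ContDiff ℝ ∞ g) (z : Pt n) :
    extField (f + g) z = extField f z + extField g z := by
  ext ⟨i, α⟩
  change bd (f + g) i z α = bd f i z α + bd g i z α
  refine Fin.cases ?_ (fun j => ?_) i
  · simp [bd_zero]
  · simp only [bd_succ]
    rw [fderiv_add (hf.differentiable (by simp) _) (hg.differentiable (by simp) _)]
    simp

theorem extField_smul (c : ℂ) (hf : ContDiff ℝ ∞ f) (z : Pt n) :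
    extField (c • f) z = c • extField f z := by
  ext ⟨i, α⟩
  change bd (c • f) i z α = c * bd f i z α
  refine Fin.cases ?_ (fun j => ?_) i
  · simp [bd_zero]
    ring
  · simp only [bd_succ]
    rw [fderiv_const_smul (hf.differentiable (by simp) _)]
    simp
    ring

/-- The operator mapping `f` to the gradient of the extension of `conv θ f`. -/
def bext (hc : HasCompactSupport θ) (hs : ContDiff ℝ ∞ θ) : L2bd n m →L[ℂ] L2up n m :=
  LinearMap.mkContinuous
    { toFun := fun f => (memLp_extField_conv hc hs f).toLp _
      map_add' := fun f g => by
        rw [← MemLp.toLp_add]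
        refine MemLp.toLp_congr _ _ (ae_of_all _ fun z => ?_)
        have hf := (Lp.memLp f).locallyIntegrable one_le_two
        have hg := (Lp.memLp g).locallyIntegrable one_le_two
        rw [conv_congr_ae (Lp.coeFn_add f g), conv_add hs.continuous hc hf hg,
          extField_add (contDiff_conv hs hc hf) (contDiff_conv hs hc hg)]
        rfl
      map_smul' := fun c f => by
        rw [RingHom.id_apply, ← MemLp.toLp_const_smul]
        refine MemLp.toLp_congr _ _ (ae_of_all _ fun z => ?_)
        have hf := (Lp.memLp f).locallyIntegrable one_le_two
        rw [conv_congr_ae (Lp.coeFn_smul c f), conv_smul, extField_smul c (contDiff_conv hs hc hf)]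
        rfl }
    (exists_eLpNorm_extField_conv_le (m := m) hc hs).choose
    (fun f => by
      have h := (exists_eLpNorm_extField_conv_le (m := m) hc hs).choose_spec f
        (Lp.stronglyMeasurable f) (Lp.memLp f)
      change ‖(memLp_extField_conv hc hs f).toLp _‖ ≤ _
      rw [Lp.norm_toLp, Lp.norm_def]
      have := ENNReal.toReal_mono (mul_ne_top ENNReal.coe_ne_top (Lp.memLp f).2.ne) h
      rwa [ENNReal.toReal_mul, ENNReal.coe_toReal] at this)

theorem coeFn_bext (hc : HasCompactSupport θ) (hs : ContDiff ℝ ∞ θ)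
    (f : L2bd n m) : bext hc hs f =ᵐ[upperMeasure n] extField (conv θ f) :=
  (memLp_extField_conv hc hs f).coeFn_toLp

theorem isEnergy_chi_smul (hf : ContDiff ℝ ∞ f)
    (hF : F =ᵐ[upperMeasure n] extField f) :
    IsEnergy (fun z => chi z.1 • f z.2) fun z i α => F z (i, α) := by
  have hsm : ContDiff ℝ ∞ fun z : Pt n => chi z.1 • f z.2 :=
    (contDiff_chi.comp contDiff_fst).smul (hf.comp contDiff_snd)
  refine isEnergy_of_contDiff hsm (hF.mono fun z hz => ?_)
  ext k
  rw [hz, extField, vec_apply, vec_apply, ← fderiv_chi_smul (hf.differentiable (by simp)), grad,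
    fderiv_comp_apply (hsm.differentiable (by simp) z)]

theorem bext_mem_energySpace (hc : HasCompactSupport θ) (hs : ContDiff ℝ ∞ θ)
    (f : L2bd n m) : bext hc hs f ∈ energySpace n m univ :=
  mem_energySpace_univ (isEnergy_chi_smul
    (contDiff_conv hs hc ((Lp.memLp f).locallyIntegrable one_le_two)) (coeFn_bext hc hs f))

/-- The regularity data of `bext hc hs f` is the function `∇ (conv θ f)`. -/
theorem reg_bext_tst (hc : HasCompactSupport θ) (hs : ContDiff ℝ ∞ θ)
    (f : L2bd n m) {g : Rn n → ℝ} (hg : HasCompactSupport g) (hg' : ContDiff ℝ ∞ g) (j : Fin n)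
    (α : Fin m) : (reg (bext hc hs f) (tst g)) (j, α) =
      ∫ x, g x • conv (fun y => fderiv ℝ θ y (single j 1)) f x α := by
  have hloc := (Lp.memLp f).locallyIntegrable one_le_two
  have hsm := contDiff_conv hs hc hloc
  rw [reg_tst (isEnergy_chi_smul hsm (coeFn_bext hc hs f)) (isTrace_chi_smul hsm.continuous) hg hg']
  have hsα : ContDiff ℝ ∞ fun x => conv θ f x α :=
    ((proj α : Cm m →L[ℂ] ℂ).restrictScalars ℝ).contDiff.comp hsm
  have hder : ∀ x, fderiv ℝ (fun x => conv θ f x α) x (single j 1) =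
      conv (fun y => fderiv ℝ θ y (single j 1)) f x α := by
    intro x
    rw [← fderiv_conv_apply hs hc hloc]
    have h1 : HasFDerivAt (fun x => conv θ f x α)
        (((proj α : Cm m →L[ℂ] ℂ).restrictScalars ℝ).comp (fderiv ℝ (conv θ f) x)) x :=
      ((proj α : Cm m →L[ℂ] ℂ).restrictScalars ℝ).hasFDerivAt.comp x
        (hsm.differentiable (by simp) x).hasFDerivAt
    rw [h1.fderiv]
    rfl
  have hgd : Continuous fun x => fderiv ℝ g x (single j 1) := continuous_fderiv_apply hg' _
  have hgdc : HasCompactSupport fun x => fderiv ℝ g x (single j 1) := hg.fderiv_apply ℝ (single j 1)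
  have hfd : Continuous fun x => fderiv ℝ (fun x => conv θ f x α) x (single j 1) :=
    continuous_fderiv_apply hsα _
  simp_rw [← hder]
  have := integral_smul_fderiv_eq_neg_fderiv_smul_of_integrable (𝕜 := ℝ) (μ := (volume : Measure (Rn n)))
    (f := g) (g := fun x => conv θ f x α) (v := single j 1)
    (integrable_smul_of_compactSupport hgdc hgd hsα.continuous)
    (integrable_smul_of_compactSupport hg hg'.continuous hfd)
    (integrable_smul_of_compactSupport hg hg'.continuous hsα.continuous)
    (fun x _ => hg'.differentiable (by simp) x) (fun x _ => hsα.differentiable (by simp) x)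
  rw [this]
  congr 2
  ext1 x
  rw [Complex.real_smul, mul_comm]

/-! ### The grand maximal function and the Hardy quasi-norm -/

theorem enorm_le_grandMax (T : 𝓢'(Rn n, E)) {φ ψ : 𝓢(Rn n, ℂ)} {K t : ℝ} (hK : 0 < K)
    (ht : 0 < t) (hφ : ∀ k ≤ 2 * n + 4, ∀ x, (1 + ‖x‖) ^ (2 * n + 4) * ‖iteratedFDeriv ℝ k φ x‖ ≤ K)
    (hψ : ∀ y, ψ y = ((t ^ n)⁻¹ : ℝ) • φ (t⁻¹ • (x - y))) :
    ‖T ψ‖ₑ ≤ ofReal K * grandMax T x := by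
  have h1 : ‖T (((K⁻¹ : ℝ) : ℂ) • ψ)‖ₑ ≤ grandMax T x := by
    refine le_iSup₂_of_le (((K⁻¹ : ℝ) : ℂ) • ψ)
      ⟨((K⁻¹ : ℝ) : ℂ) • φ, t, fun k hk x => ?_, ht, fun y => ?_⟩ le_rfl
    · rw [FunLike.coe_smul, iteratedFDeriv_const_smul_apply
        ((φ.smooth k).contDiffAt), norm_smul, Complex.norm_real, norm_of_nonneg (by positivity)]
      calc _ = K⁻¹ * ((1 + ‖x‖) ^ (2 * n + 4) * ‖iteratedFDeriv ℝ k φ x‖) := by ring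
        _ ≤ K⁻¹ * K := by gcongr; exact hφ k hk x
        _ = 1 := inv_mul_cancel₀ hK.ne'
    · rw [smul_apply, smul_apply, hψ, smul_comm]
  rw [map_smul, enorm_smul] at h1
  have h2 : ‖((K⁻¹ : ℝ) : ℂ)‖ₑ = (ofReal K)⁻¹ := by
    rw [← ENNReal.ofReal_inv_of_pos hK, ← ofReal_norm, Complex.norm_real,
      norm_of_nonneg (by positivity)]
  rw [h2] at h1
  have h3 : ofReal K ≠ 0 := (ofReal_pos.2 hK).ne'
  calc ‖T ψ‖ₑ = ofReal K * ((ofReal K)⁻¹ * ‖T ψ‖ₑ) := by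
        rw [← mul_assoc, ENNReal.mul_inv_cancel h3 ofReal_ne_top, one_mul]
    _ ≤ _ := by gcongr

theorem one_add_norm_pow_le (w e : Rn n) (N : ℕ) :
    (1 + ‖w‖) ^ N ≤ (1 + ‖e‖) ^ N * (1 + ‖w + e‖) ^ N := by
  rw [← mul_pow]
  have : ‖w‖ ≤ ‖w + e‖ + ‖e‖ := by simpa using norm_sub_le (w + e) e
  gcongr
  nlinarith [norm_nonneg e, norm_nonneg (w + e)]

theorem decay_comp_add {f : Rn n → ℂ} {K : ℝ} {N : ℕ} (hf : ∀ k ≤ N, ∀ x,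
    (1 + ‖x‖) ^ N * ‖iteratedFDeriv ℝ k f x‖ ≤ K) (e : Rn n) (k : ℕ) (hk : k ≤ N) (x : Rn n) :
    (1 + ‖x‖) ^ N * ‖iteratedFDeriv ℝ k (fun y => f (y + e)) x‖ ≤ (1 + ‖e‖) ^ N * K := by
  rw [iteratedFDeriv_comp_add_right]
  calc _ ≤ ((1 + ‖e‖) ^ N * (1 + ‖x + e‖) ^ N) * ‖iteratedFDeriv ℝ k f (x + e)‖ := by
        gcongr
        exact one_add_norm_pow_le x e N
    _ = (1 + ‖e‖) ^ N * ((1 + ‖x + e‖) ^ N * ‖iteratedFDeriv ℝ k f (x + e)‖) := by ring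
    _ ≤ _ := by
        gcongr
        exact hf k hk (x + e)

/-- Moving the base point translates the profile by `(x - x') / t`, which costs a polynomial factor
in the normalization. -/
theorem enorm_le_grandMax_of_near (T : 𝓢'(Rn n, E)) {φ ψ : 𝓢(Rn n, ℂ)} {t : ℝ}
    (ht : 0 < t) (hφ : IsNormalized φ)
    (hψ : ∀ y, ψ y = ((t ^ n)⁻¹ : ℝ) • φ (t⁻¹ • (x - y))) (x' : Rn n) :
    ‖T ψ‖ₑ ≤ ofReal ((1 + ‖t⁻¹ • (x - x')‖) ^ (2 * n + 4)) * grandMax T x' := by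
  set φ' : 𝓢(Rn n, ℂ) := φ.compSubConstCLM ℂ (-(t⁻¹ • (x - x'))) with hφ'
  have hcoe : ⇑φ' = fun y => φ (y + t⁻¹ • (x - x')) := by
    ext y
    simp [φ', sub_neg_eq_add]
  refine enorm_le_grandMax T (φ := φ') (by positivity) ht (fun k hk y => ?_) fun y => ?_
  · rw [hcoe]
    refine (decay_comp_add (fun k hk x => hφ k hk x) (t⁻¹ • (x - x')) k hk y).trans ?_
    rw [mul_one]
  · rw [hψ, hcoe]
    simp only
    rw [← smul_add]
    congr 3
    abel

/-- A competitor at `x` is also a competitor at nearby points up to a factor tending to `1`, so a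
strict lower bound persists in a neighbourhood. -/
theorem lowerSemicontinuous_grandMax (T : 𝓢'(Rn n, E)) : LowerSemicontinuous (grandMax T) := by
  intro x a ha
  obtain ⟨ψ, h1⟩ := lt_iSup_iff.1 ha
  obtain ⟨⟨φ, t, hφ, ht, hψ⟩, h2⟩ := lt_iSup_iff.1 h1
  have hc : Tendsto (fun x' : Rn n => ‖T ψ‖ₑ /
      ofReal ((1 + ‖t⁻¹ • (x - x')‖) ^ (2 * n + 4))) (𝓝 x) (𝓝 (‖T ψ‖ₑ / 1)) := by
    refine ENNReal.Tendsto.const_div ?_ (Or.inl (by simp))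
    have : Continuous fun x' : Rn n => (1 + ‖t⁻¹ • (x - x')‖) ^ (2 * n + 4) := by fun_prop
    have h := (ENNReal.continuous_ofReal.comp this).tendsto x
    simpa [Function.comp_def] using h
  rw [div_one] at hc
  filter_upwards [hc.eventually (lt_mem_nhds h2)] with x' hx'
  exact hx'.trans_le (ENNReal.div_le_of_le_mul' (enorm_le_grandMax_of_near T ht hφ hψ x'))

theorem measurable_grandMax (T : 𝓢'(Rn n, E)) : Measurable (grandMax T) :=
  (lowerSemicontinuous_grandMax T).measurable

/-- Averages at scale `2⁻ʲ` are controlled by the grand maximal function nearby. -/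
theorem exists_enorm_tst_dilate_le (hc : HasCompactSupport φ)
    (hs : ContDiff ℝ ∞ φ) : ∃ K : ℝ, 0 < K ∧ ∀ (F : Type) [NormedAddCommGroup F] [NormedSpace ℂ F]
      (T : 𝓢'(Rn n, F)) (j : ℤ) (x y : Rn n), ‖x - y‖ ≤ 5 * 2 ^ (-j) →
      ‖T (tst fun z => dilate j φ (y - z))‖ₑ ≤ ofReal K * grandMax T x := by
  set N := 2 * n + 4
  have hd : ∀ k ≤ N, ∀ x, (1 + ‖x‖) ^ N * ‖iteratedFDeriv ℝ k (tst φ) x‖ ≤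
      2 ^ N * ((Iic (N, N)).sup fun m => SchwartzMap.seminorm ℝ m.1 m.2) (tst φ) :=
    fun k hk x => one_add_le_sup_seminorm_apply (m := (N, N)) le_rfl hk (tst φ) x
  set K₀ := 2 ^ N * ((Iic (N, N)).sup fun m => SchwartzMap.seminorm ℝ m.1 m.2) (tst φ)
  have hK₀ : 0 ≤ K₀ := by positivity
  -- `6 = 1 + 5`: a distance of at most `5 * 2 ^ (-j)` becomes a shift of the profile by at most
  -- `5`.
  refine ⟨6 ^ N * (K₀ + 1), by positivity, fun F _ _ T j x y hxy => ?_⟩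
  have h2 := two_zpow_pos j
  set e : Rn n := (2 : ℝ) ^ j • (y - x) with he
  have hen : ‖e‖ ≤ 5 := by
    rw [he, norm_smul, norm_of_nonneg h2.le, norm_sub_rev]
    calc _ ≤ (2 : ℝ) ^ j * (5 * 2 ^ (-j)) := by gcongr
      _ = 5 := by rw [zpow_neg]; field_simp
  have hce : HasCompactSupport fun w => φ (w + e) := hc.comp_homeomorph (Homeomorph.addRight e)
  have hse : ContDiff ℝ ∞ fun w => φ (w + e) := hs.comp (contDiff_id.add contDiff_const)
  refine enorm_le_grandMax T (φ := tst fun w => φ (w + e)) (t := 2 ^ (-j)) (by positivity)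
    (by positivity) (fun k hk w => ?_) fun z => ?_
  · have h := decay_comp_add hd e k hk w
    rw [coe_tst hc hs] at h
    rw [coe_tst hce hse]
    refine h.trans ?_
    gcongr
    · linarith
    · linarith
  · rw [tst_apply (hasCompactSupport_sub_comp (hasCompactSupport_dilate hc j) y)
      (contDiff_sub_comp (contDiff_dilate hs j) y), tst_apply hce hse, dilate, Complex.real_smul]
    rw [← Complex.ofReal_mul]
    congr 2
    · rw [zpow_neg, inv_pow, inv_inv]
    · congr 1
      rw [zpow_neg, inv_inv, he, ← smul_add]
      congr 1
      abel

/-- The `p`-th power of the Hardy quasi-norm. -/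
def hardyPow (p : ℝ) (T : 𝓢'(Rn n, E)) : ℝ≥0∞ := ∫⁻ x, grandMax T x ^ p

theorem grandMax_mono {F : Type*} [NormedAddCommGroup F] [NormedSpace ℂ F]
    {R : 𝓢'(Rn n, F)} (h : ∀ ψ, ‖T ψ‖ₑ ≤ ‖R ψ‖ₑ) (x : Rn n) : grandMax T x ≤ grandMax R x :=
  iSup₂_mono fun ψ _ => h ψ

theorem grandMax_sum_le {ι : Type*} (s : Finset ι) (T : ι → 𝓢'(Rn n, E)) (x : Rn n) :
    grandMax (∑ i ∈ s, T i) x ≤ ∑ i ∈ s, grandMax (T i) x := by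
  refine iSup₂_le fun ψ hψ => ?_
  have : (∑ i ∈ s, T i) ψ = ∑ i ∈ s, T i ψ := by
    classical
    induction s using Finset.induction_on with
    | empty => rfl
    | insert a s ha ih => rw [sum_insert ha, sum_insert ha, ← ih]; rfl
  rw [this]
  refine (enorm_sum_le _ _).trans (sum_le_sum fun i _ => ?_)
  exact le_iSup₂_of_le ψ hψ le_rfl

/-- For `p ≤ 1` the function `s ↦ s ^ p` is subadditive, so the `p`-th power obeys a triangle
inequality without a constant. All summation of atoms is done on this level. -/
theorem hardyPow_sum_le (hp : 0 < p) (hp1 : p ≤ 1) {ι : Type*} (s : Finset ι)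
    (T : ι → 𝓢'(Rn n, E)) : hardyPow p (∑ i ∈ s, T i) ≤ ∑ i ∈ s, hardyPow p (T i) := by
  unfold hardyPow
  rw [← lintegral_finsetSum _ fun i _ => (measurable_grandMax (T i)).pow_const p]
  refine lintegral_mono fun x => ?_
  refine (rpow_le_rpow (grandMax_sum_le s T x) hp.le).trans ?_
  classical
  induction s using Finset.induction_on with
  | empty => simp [hp]
  | insert a s ha ih =>
    rw [sum_insert ha, sum_insert ha]
    refine (ENNReal.rpow_add_le_add_rpow _ _ hp.le hp1).trans ?_
    gcongr

theorem hardyPow_smul_le (hp : 0 < p) (c : ℂ) (T : 𝓢'(Rn n, E)) :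
    hardyPow p (c • T) ≤ ‖c‖ₑ ^ p * hardyPow p T := by
  unfold hardyPow
  rw [← lintegral_const_mul _ ((measurable_grandMax T).pow_const p)]
  refine lintegral_mono fun x => ?_
  rw [← mul_rpow_of_nonneg _ _ hp.le]
  refine rpow_le_rpow (iSup₂_le fun ψ hψ => ?_) hp.le
  change ‖c • T ψ‖ₑ ≤ _
  rw [enorm_smul]
  gcongr
  exact le_iSup₂_of_le ψ hψ le_rfl

/-- The Hardy quasi-norm is lower semicontinuous under pointwise convergence. -/
theorem hardyPow_le_of_tendsto (hp : 0 < p) {T : ℕ → 𝓢'(Rn n, E)} {T' : 𝓢'(Rn n, E)}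
    (h : ∀ ψ, Tendsto (fun N => T N ψ) atTop (𝓝 (T' ψ))) {B : ℝ≥0∞}
    (hB : ∀ N, hardyPow p (T N) ≤ B) : hardyPow p T' ≤ B := by
  calc hardyPow p T' ≤ ∫⁻ x, liminf (fun N => grandMax (T N) x ^ p) atTop := by
        refine lintegral_mono fun x => ?_
        rw [← ENNReal.le_rpow_inv_iff hp]
        refine iSup₂_le fun ψ hψ => ?_
        rw [ENNReal.le_rpow_inv_iff hp]
        have h1 : Tendsto (fun N => ‖T N ψ‖ₑ ^ p) atTop (𝓝 (‖T' ψ‖ₑ ^ p)) :=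
          (ENNReal.continuous_rpow_const.tendsto _).comp (h ψ).enorm
        rw [← h1.liminf_eq]
        refine liminf_le_liminf (Eventually.of_forall fun N => ?_)
        exact rpow_le_rpow (le_iSup₂_of_le ψ hψ le_rfl) hp.le
    _ ≤ liminf (fun N => ∫⁻ x, grandMax (T N) x ^ p) atTop :=
        lintegral_liminf_le fun N => (measurable_grandMax (T N)).pow_const p
    _ ≤ B := liminf_le_of_le (by isBoundedDefault) fun b hb => by
        obtain ⟨N, hN⟩ := hb.exists
        exact hN.trans (hB N)

theorem hardyNorm_eq (p : ℝ) (T : 𝓢'(Rn n, E)) : hardyNorm p T = hardyPow p T ^ (1 / p) := rfl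

theorem hardyPow_le_of_hardyNorm_le (hp : 0 < p) {C : ℝ≥0∞}
    (h : hardyNorm p T ≤ C) : hardyPow p T ≤ C ^ p := by
  rw [hardyNorm_eq, one_div] at h
  exact (ENNReal.rpow_inv_le_iff hp).1 h

theorem hardyNorm_le_of_hardyPow_le {F : Type*} [NormedAddCommGroup F] [NormedSpace ℂ F]
    (hp : 0 < p) {R : 𝓢'(Rn n, F)} {C : ℝ≥0}
    (h : hardyPow p T ≤ C * hardyPow p R) :
    hardyNorm p T ≤ ((C ^ (1 / p) : ℝ≥0) : ℝ≥0∞) * hardyNorm p R := by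
  rw [hardyNorm_eq, hardyNorm_eq, ENNReal.coe_rpow_of_nonneg _ (by positivity),
    ← mul_rpow_of_nonneg _ _ (by positivity)]
  exact rpow_le_rpow h (by positivity)

/-! ### Whitney decomposition of the level sets -/

/-- Truncation to the unit interval. -/
def clamp (s : ℝ) : ℝ := max 0 (min 1 s)

theorem clamp_nonneg (s : ℝ) : 0 ≤ clamp s := le_max_left _ _

theorem clamp_le_one (s : ℝ) : clamp s ≤ 1 := max_le zero_le_one (min_le_left _ _)

theorem clamp_eq_zero {s : ℝ} (h : s ≤ 0) : clamp s = 0 := max_eq_left ((min_le_right _ _).trans h)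

theorem clamp_eq_one {s : ℝ} (h : 1 ≤ s) : clamp s = 1 := by
  rw [clamp, min_eq_left h, max_eq_right zero_le_one]

theorem clamp_mono {s t : ℝ} (h : s ≤ t) : clamp s ≤ clamp t :=
  max_le_max le_rfl (min_le_min le_rfl h)

theorem abs_clamp_sub_le (s t : ℝ) : |clamp s - clamp t| ≤ |s - t| := by
  unfold clamp
  refine (abs_max_sub_max_le_max _ _ _ _).trans (max_le (by simp) ?_)
  exact (abs_min_sub_min_le_max _ _ _ _).trans (max_le (by simp) le_rfl)

/-- A dyadic partition of unity on the half-line is given by `s ↦ shell (2 ^ l * s)`. -/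
def shell (s : ℝ) : ℝ := clamp (s - 1) - clamp (s / 2 - 1)

theorem shell_nonneg {s : ℝ} (h : 0 ≤ s) : 0 ≤ shell s := sub_nonneg.2 (clamp_mono (by linarith))

theorem abs_shell_le_one (s : ℝ) : |shell s| ≤ 1 := by
  have := clamp_nonneg (s - 1); have := clamp_nonneg (s / 2 - 1)
  have := clamp_le_one (s - 1); have := clamp_le_one (s / 2 - 1)
  rw [shell, abs_le]
  constructor <;> linarith

theorem mem_of_shell_ne_zero {s : ℝ} (h : shell s ≠ 0) : 1 < s ∧ s < 4 := by
  by_contra hs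
  rw [not_and_or, not_lt, not_lt] at hs
  rcases lt_or_ge 0 s with h0 | h0
  · rcases hs with hs | hs
    · exact h (by rw [shell, clamp_eq_zero (by linarith), clamp_eq_zero (by linarith), sub_zero])
    · exact h (by rw [shell, clamp_eq_one (by linarith), clamp_eq_one (by linarith), sub_self])
  · exact h (by rw [shell, clamp_eq_zero (by linarith), clamp_eq_zero (by linarith), sub_zero])

theorem abs_shell_sub_le (s t : ℝ) : |shell s - shell t| ≤ 2 * |s - t| := by
  have h1 := abs_clamp_sub_le (s - 1) (t - 1)
  have h2 := abs_clamp_sub_le (s / 2 - 1) (t / 2 - 1)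
  have e1 : s - 1 - (t - 1) = s - t := by ring
  have e2 : s / 2 - 1 - (t / 2 - 1) = (s - t) / 2 := by ring
  rw [e1] at h1
  rw [e2, abs_div, abs_two] at h2
  have e : shell s - shell t = (clamp (s - 1) - clamp (t - 1)) -
    (clamp (s / 2 - 1) - clamp (t / 2 - 1)) := by unfold shell; ring
  rw [e]
  refine (abs_sub _ _).trans ?_
  linarith [abs_nonneg (s - t)]

/-- A partition of unity on the line is given by the integer translates of `tent`. -/
def tent (s : ℝ) : ℝ := clamp (s + 1) - clamp s

theorem tent_nonneg (s : ℝ) : 0 ≤ tent s := sub_nonneg.2 (clamp_mono (by linarith))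

theorem tent_le_one (s : ℝ) : tent s ≤ 1 := by
  have := clamp_nonneg s; have := clamp_le_one (s + 1)
  unfold tent
  linarith

theorem abs_lt_of_tent_ne_zero {s : ℝ} (h : tent s ≠ 0) : |s| < 1 := by
  by_contra hs
  rw [not_lt, le_abs] at hs
  rcases hs with hs | hs
  · exact h (by rw [tent, clamp_eq_one hs, clamp_eq_one (by linarith), sub_self])
  · exact h (by rw [tent, clamp_eq_zero (by linarith), clamp_eq_zero (by linarith), sub_zero])

theorem abs_tent_sub_le (s t : ℝ) : |tent s - tent t| ≤ 2 * |s - t| := by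
  have h1 := abs_clamp_sub_le (s + 1) (t + 1)
  have h2 := abs_clamp_sub_le s t
  have e1 : s + 1 - (t + 1) = s - t := by ring
  rw [e1] at h1
  have e : tent s - tent t = (clamp (s + 1) - clamp (t + 1)) - (clamp s - clamp t) := by
    unfold tent; ring
  rw [e]
  refine (abs_sub _ _).trans ?_
  linarith

theorem sum_Ico_telescope {E : Type*} [AddCommGroup E] (V : ℤ → E) {a b : ℤ} (h : a ≤ b) :
    ∑ j ∈ Finset.Ico a b, (V (j + 1) - V j) = V b - V a := by
  induction b, h using Int.leInduction with
  | base => simp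
  | succ b hb ih =>
    rw [← Finset.insert_Ico_right_eq_Ico_add_one hb, sum_insert (by simp), ih]
    abel

theorem sum_Icc_telescope {E : Type*} [AddCommGroup E] (V : ℤ → E) {a b : ℤ} (h : a ≤ b + 1) :
    ∑ j ∈ Finset.Icc a b, (V (j + 1) - V j) = V (b + 1) - V a := by
  rw [← sum_Ico_telescope V h]
  rfl

theorem sum_tent (s : ℝ) (N : ℕ) :
    ∑ c ∈ Finset.Icc (-(N : ℤ)) N, tent (s - c) = clamp (s + N + 1) - clamp (s - N) := by
  have h := sum_Icc_telescope (fun c : ℤ => -clamp (s - c + 1)) (a := -(N : ℤ)) (b := N) (by omega)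
  have e : ∀ c : ℤ, -clamp (s - ((c + 1 : ℤ) : ℝ) + 1) - -clamp (s - c + 1) = tent (s - c) := by
    intro c
    unfold tent
    push_cast
    ring_nf
  simp_rw [e] at h
  rw [h]
  push_cast
  ring_nf

theorem sum_shell (s : ℝ) (N : ℕ) :
    ∑ l ∈ Finset.Icc (-(N : ℤ)) N, shell ((2 : ℝ) ^ l * s) =
      clamp ((2 : ℝ) ^ N * s - 1) - clamp ((2 : ℝ) ^ (-(N : ℤ) - 1) * s - 1) := by
  have h := sum_Icc_telescope (fun l : ℤ => clamp ((2 : ℝ) ^ (l - 1) * s - 1))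
    (a := -(N : ℤ)) (b := N) (by omega)
  have e : ∀ l : ℤ, clamp ((2 : ℝ) ^ (l + 1 - 1) * s - 1) - clamp ((2 : ℝ) ^ (l - 1) * s - 1) =
      shell ((2 : ℝ) ^ l * s) := by
    intro l
    rw [shell, add_sub_cancel_right, zpow_sub_one₀ two_ne_zero]
    congr 3
    ring
  simp_rw [e] at h
  rw [h, add_sub_cancel_right, zpow_natCast]

/-- The distance to the set where `M ≤ 2 ^ k`. -/
def levelDist (M : Rn n → ℝ≥0∞) (k : ℤ) (x : Rn n) : ℝ :=
  Metric.infDist x {x | M x ≤ ofReal (2 ^ k)}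

theorem levelDist_nonneg (k : ℤ) (x : Rn n) : 0 ≤ levelDist M k x := Metric.infDist_nonneg

theorem abs_levelDist_sub_le (k : ℤ) (x y : Rn n) :
    |levelDist M k x - levelDist M k y| ≤ ‖x - y‖ := by
  rw [abs_le]
  have h1 := Metric.infDist_le_infDist_add_dist (s := {x | M x ≤ ofReal (2 ^ k)}) (x := x) (y := y)
  have h2 := Metric.infDist_le_infDist_add_dist (s := {x | M x ≤ ofReal (2 ^ k)}) (x := y) (y := x)
  rw [dist_comm] at h2
  rw [dist_eq_norm] at h1 h2
  unfold levelDist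
  constructor <;> linarith

theorem lt_of_levelDist_pos {k : ℤ} (h : 0 < levelDist M k x) : ofReal (2 ^ k) < M x := by
  by_contra hx
  exact h.ne' (Metric.infDist_zero_of_mem (not_lt.1 hx))

theorem exists_lt_top_of_lintegral (hp : 0 < p) (hM : ∫⁻ x, M x ^ p ≠ ⊤) (y : Rn n) {r : ℝ}
    (hr : 0 < r) : ∃ x, ‖y - x‖ < r ∧ M x < ⊤ := by
  by_contra! h
  refine hM (top_le_iff.1 ?_)
  calc (⊤ : ℝ≥0∞) = ⊤ * volume (ball y r) :=
        (ENNReal.top_mul (measure_ball_pos volume y hr).ne').symm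
    _ = ∫⁻ x in ball y r, ⊤ := (setLIntegral_const _ _).symm
    _ ≤ ∫⁻ x in ball y r, M x ^ p := by
        refine setLIntegral_mono' isOpen_ball.measurableSet fun x hx => ?_
        have : M x = ⊤ := top_le_iff.1 (h x (by rwa [← dist_eq_norm, dist_comm]))
        rw [this, ENNReal.top_rpow_of_pos hp]
    _ ≤ _ := setLIntegral_le_lintegral _ _

/-- An empty sublevel set would bound `M` from below on a space of infinite measure. -/
theorem nonempty_level (hn : 1 ≤ n) (hp : 0 < p) (hM : ∫⁻ x, M x ^ p ≠ ⊤) (k : ℤ) :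
    {x | M x ≤ ofReal (2 ^ k)}.Nonempty := by
  by_contra h
  rw [Set.not_nonempty_iff_eq_empty, Set.eq_empty_iff_forall_notMem] at h
  refine hM (top_le_iff.1 ?_)
  have : Nonempty (Fin n) := ⟨⟨0, hn⟩⟩
  have : Nontrivial (Rn n) := inferInstance
  have h2 : ofReal (2 ^ k) ≠ 0 := (ofReal_pos.2 (two_zpow_pos k)).ne'
  calc (⊤ : ℝ≥0∞) = ofReal (2 ^ k) ^ p * volume (univ : Set (Rn n)) := by
        rw [measure_univ_of_isAddLeftInvariant, ENNReal.mul_top]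
        exact (ENNReal.rpow_pos (pos_iff_ne_zero.2 h2) ofReal_ne_top).ne'
    _ = ∫⁻ x : Rn n, ofReal (2 ^ k) ^ p := by rw [lintegral_const]
    _ ≤ _ := lintegral_mono fun x => rpow_le_rpow (not_le.1 (h x)).le hp.le

/-- All level sets of `M` at small heights are non-empty. -/
abbrev LowLevels (M : Rn n → ℝ≥0∞) : Prop := ∀ k : ℤ, {x | M x ≤ ofReal (2 ^ k)}.Nonempty

theorem levelDist_succ_le (hne : LowLevels M) {k k' : ℤ}
    (hk : k ≤ k') (x : Rn n) : levelDist M k' x ≤ levelDist M k x := by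
  refine Metric.infDist_le_infDist_of_subset (fun y hy => ?_) (hne k)
  refine le_trans hy (ofReal_le_ofReal ?_)
  exact zpow_le_zpow_right₀ one_le_two hk

theorem exists_le_of_levelDist_lt (hne : LowLevels M)
    {k : ℤ} {r : ℝ} (h : levelDist M k x < r) :
    ∃ x', ‖x' - x‖ < r ∧ M x' ≤ ofReal (2 ^ k) := by
  obtain ⟨x', h1, h2⟩ := (Metric.infDist_lt_iff (hne k)).1 h
  exact ⟨x', by rwa [← dist_eq_norm, dist_comm], h1⟩

/-- The part of the scale `2 ^ (-j)` belonging to the level `k`. -/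
def slab (M : Rn n → ℝ≥0∞) (j k : ℤ) (y : Rn n) : ℝ :=
  (if 3 * 2 ^ (-j) < levelDist M k y then 1 else 0) -
    (if 3 * 2 ^ (-j) < levelDist M (k + 1) y then 1 else 0)

/-- The indices of the pieces: level, scale and lattice point. -/
abbrev Ix (n : ℕ) := ℤ × ℤ × (Fin n → ℤ)

/-- The Whitney partition of unity: `(k, l, c)` stands for the cube with corner `c` and scale
`2 ^ (-l)` in the level set `{2 ^ k < M}`. -/
def wt (M : Rn n → ℝ≥0∞) (i : Ix n) (y : Rn n) : ℝ :=
  shell (2 ^ i.2.1 * levelDist M i.1 y) * ∏ q, tent (4 * n * 2 ^ i.2.1 * y q - i.2.2 q)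

theorem abs_prod_sub_prod_le {ι : Type*} (s : Finset ι) {a b : ι → ℝ} (ha : ∀ i, |a i| ≤ 1)
    (hb : ∀ i, |b i| ≤ 1) : |∏ i ∈ s, a i - ∏ i ∈ s, b i| ≤ ∑ i ∈ s, |a i - b i| := by
  classical
  induction s using Finset.induction_on with
  | empty => simp
  | insert i s hi ih =>
    rw [Finset.prod_insert hi, Finset.prod_insert hi, sum_insert hi]
    have h1 : |∏ i ∈ s, a i| ≤ 1 := by
      rw [abs_prod]
      exact prod_le_one (fun i _ => abs_nonneg _) fun i _ => ha i
    have e : a i * ∏ i ∈ s, a i - b i * ∏ i ∈ s, b i =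
        (a i - b i) * ∏ i ∈ s, a i + b i * (∏ i ∈ s, a i - ∏ i ∈ s, b i) := by ring
    rw [e]
    refine (abs_add_le _ _).trans ?_
    rw [abs_mul, abs_mul]
    have h2 := hb i
    have h3 := abs_nonneg (a i - b i)
    have h4 := abs_nonneg (∏ i ∈ s, a i - ∏ i ∈ s, b i)
    nlinarith [abs_nonneg (b i), abs_nonneg (∏ i ∈ s, a i)]

theorem abs_tent_le_one (s : ℝ) : |tent s| ≤ 1 := by
  rw [abs_of_nonneg (tent_nonneg s)]
  exact tent_le_one s

theorem abs_wt_le_one (i : Ix n) (y : Rn n) : |wt M i y| ≤ 1 := by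
  rw [wt, abs_mul, abs_prod]
  exact mul_le_one₀ (abs_shell_le_one _) (prod_nonneg fun _ _ => abs_nonneg _)
    (prod_le_one (fun _ _ => abs_nonneg _) fun _ _ => abs_tent_le_one _)

theorem wt_nonneg (i : Ix n) (y : Rn n) : 0 ≤ wt M i y :=
  mul_nonneg (shell_nonneg (mul_nonneg (two_zpow_pos _).le (levelDist_nonneg _ _)))
    (prod_nonneg fun _ _ => tent_nonneg _)

/-- The weights vary at the rate `2 ^ l`, the inverse size of the cube. The summand `2` is the
Lipschitz constant of `shell` with a distance function inside, and `8 * n ^ 2` collects `n` tents of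
slope `2 * (4 * n)`. -/
theorem abs_wt_sub_le (i : Ix n) (x y : Rn n) :
    |wt M i x - wt M i y| ≤ (2 + 8 * n ^ 2) * 2 ^ i.2.1 * ‖x - y‖ := by
  obtain ⟨k, l, c⟩ := i
  have hl := two_zpow_pos l
  have h1 : |shell (2 ^ l * levelDist M k x) - shell (2 ^ l * levelDist M k y)| ≤
      2 * (2 ^ l * ‖x - y‖) := by
    refine (abs_shell_sub_le _ _).trans ?_
    rw [← mul_sub, abs_mul, abs_of_pos hl]
    gcongr
    exact abs_levelDist_sub_le k x y
  have h2 : |∏ q, tent (4 * n * 2 ^ l * x q - c q) - ∏ q, tent (4 * n * 2 ^ l * y q - c q)| ≤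
      8 * n ^ 2 * 2 ^ l * ‖x - y‖ := by
    refine (abs_prod_sub_prod_le _ (fun _ => abs_tent_le_one _) fun _ => abs_tent_le_one _).trans ?_
    calc _ ≤ ∑ _q : Fin n, 8 * n * 2 ^ l * ‖x - y‖ := by
          refine sum_le_sum fun q _ => (abs_tent_sub_le _ _).trans ?_
          have e : 4 * n * 2 ^ l * x q - c q - (4 * n * 2 ^ l * y q - c q) =
            4 * n * 2 ^ l * (x - y) q := by simp; ring
          rw [e, abs_mul, abs_of_nonneg (by positivity)]
          have := norm_apply_le (x - y) q
          rw [norm_eq_abs] at this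
          calc _ ≤ 2 * (4 * n * 2 ^ l * ‖x - y‖) := by gcongr
            _ = _ := by ring
      _ = _ := by simp; ring
  have e : wt M (k, l, c) x - wt M (k, l, c) y =
      (shell (2 ^ l * levelDist M k x) - shell (2 ^ l * levelDist M k y)) *
        ∏ q, tent (4 * n * 2 ^ l * x q - c q) + shell (2 ^ l * levelDist M k y) *
        (∏ q, tent (4 * n * 2 ^ l * x q - c q) - ∏ q, tent (4 * n * 2 ^ l * y q - c q)) := by
    unfold wt; ring
  rw [e]
  have h3 : |∏ q, tent (4 * n * 2 ^ l * x q - c q)| ≤ 1 := by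
    rw [abs_prod]
    exact prod_le_one (fun _ _ => abs_nonneg _) fun _ _ => abs_tent_le_one _
  refine (abs_add_le _ _).trans ?_
  rw [abs_mul, abs_mul]
  have h4 := abs_shell_le_one (2 ^ l * levelDist M k y)
  calc _ ≤ 2 * (2 ^ l * ‖x - y‖) * 1 + 1 * (8 * n ^ 2 * 2 ^ l * ‖x - y‖) := by gcongr
    _ = _ := by ring

/-- The centre of a Whitney cube. -/
def ctr (l : ℤ) (c : Fin n → ℤ) : Rn n := WithLp.toLp 2 fun q => c q / (4 * n * 2 ^ l)

/-- The lattice has mesh `2 ^ (-l) / (4 * n)`. The factor `n` absorbs the sum over coordinates and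
the `4` keeps the cubes small compared with their distance to the sublevel set. -/
theorem norm_le_of_forall_abs_le (hn : 1 ≤ n) {l : ℤ} {a : ℝ}
    (h : ∀ q, |4 * n * 2 ^ l * x q| ≤ a) : ‖x‖ ≤ a / 4 * 2 ^ (-l) := by
  have hl := two_zpow_pos l
  have hn' : (0 : ℝ) < n := by exact_mod_cast hn
  have h1 : ∀ q, |x q| ≤ a / (4 * n * 2 ^ l) := fun q => by
    have h3 := h q
    rw [abs_mul, abs_of_pos (by positivity)] at h3
    rwa [le_div_iff₀ (by positivity), mul_comm]
  have h2 : ‖x‖ ≤ ∑ q, |x q| := by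
    have e : x = ∑ q, single q (x q) := by
      ext i
      simp [Finset.sum_apply, Pi.single_apply]
    calc ‖x‖ = ‖∑ q, single q (x q)‖ := by rw [← e]
      _ ≤ _ := (norm_sum_le _ _).trans (by simp)
  calc ‖x‖ ≤ ∑ _q : Fin n, a / (4 * n * 2 ^ l) := h2.trans (sum_le_sum fun q _ => h1 q)
    _ = _ := by
        rw [sum_const, Finset.card_univ, Fintype.card_fin, nsmul_eq_mul, zpow_neg]
        field_simp

theorem of_wt_ne_zero {i : Ix n} (h : wt M i y ≠ 0) :
    (1 < 2 ^ i.2.1 * levelDist M i.1 y ∧ 2 ^ i.2.1 * levelDist M i.1 y < 4) ∧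
      ∀ q, |4 * n * 2 ^ i.2.1 * y q - i.2.2 q| < 1 := by
  obtain ⟨h1, h2⟩ := mul_ne_zero_iff.1 h
  exact ⟨mem_of_shell_ne_zero h1, fun q =>
    abs_lt_of_tent_ne_zero (Finset.prod_ne_zero_iff.1 h2 q (Finset.mem_univ q))⟩

theorem norm_sub_ctr_le (hn : 1 ≤ n) {i : Ix n} (h : wt M i y ≠ 0) :
    ‖y - ctr i.2.1 i.2.2‖ ≤ 2 ^ (-i.2.1) := by
  have hn' : (0 : ℝ) < n := by exact_mod_cast hn
  have h1 := norm_le_of_forall_abs_le hn (x := y - ctr i.2.1 i.2.2) (l := i.2.1) (a := 1)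
    fun q => by
      refine le_of_eq_of_le ?_ ((of_wt_ne_zero h).2 q).le
      congr 1
      have := two_zpow_pos i.2.1
      simp only [ctr, PiLp.sub_apply]
      field_simp
  linarith [two_zpow_pos (-i.2.1)]

theorem slab_nonneg (hne : LowLevels M) (j k : ℤ) (y : Rn n) : 0 ≤ slab M j k y := by
  have := levelDist_succ_le hne (k := k) (k' := k + 1) (by omega) y
  unfold slab
  split_ifs <;> linarith

theorem sum_slab (j : ℤ) (y : Rn n) (N : ℕ) : ∑ k ∈ Finset.Icc (-(N : ℤ)) N, slab M j k y =
    (if 3 * 2 ^ (-j) < levelDist M (-(N : ℤ)) y then 1 else 0) -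
      (if 3 * 2 ^ (-j) < levelDist M (N + 1) y then 1 else 0) := by
  have h := sum_Icc_telescope (fun k : ℤ => -(if 3 * 2 ^ (-j) < levelDist M k y then (1 : ℝ) else 0))
    (a := -(N : ℤ)) (b := N) (by omega)
  simp only [sub_neg_eq_add, neg_add_eq_sub] at h
  exact h

/-- Finite families of indices exhausting all of them. -/
def box (n N : ℕ) : Finset (Ix n) :=
  Finset.Icc (-(N : ℤ)) N ×ˢ Finset.Icc (-(N : ℤ)) N ×ˢ
    Fintype.piFinset fun _ => Finset.Icc (-((4 * n * N * 2 ^ N : ℕ) : ℤ)) (4 * n * N * 2 ^ N : ℕ)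

/-- The part of the partition of unity with indices in a box. -/
def boxWt (M : Rn n → ℝ≥0∞) (N : ℕ) (j : ℤ) (y : Rn n) : ℝ :=
  ∑ i ∈ box n N, wt M i y * slab M j i.1 y

/-- The lattice points in a box form a product, so the sum over them factors into one-dimensional
sums of tents, each of which telescopes. -/
theorem boxWt_eq (N : ℕ) (j : ℤ) (y : Rn n) : boxWt M N j y =
    ∑ k ∈ Finset.Icc (-(N : ℤ)) N, slab M j k y * ∑ l ∈ Finset.Icc (-(N : ℤ)) N,
      shell (2 ^ l * levelDist M k y) * ∏ q, (clamp (4 * n * 2 ^ l * y q + (4 * n * N * 2 ^ N : ℕ) + 1) -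
        clamp (4 * n * 2 ^ l * y q - (4 * n * N * 2 ^ N : ℕ))) := by
  rw [boxWt, box, Finset.sum_product]
  refine sum_congr rfl fun k _ => ?_
  rw [Finset.sum_product, mul_sum]
  refine sum_congr rfl fun l _ => ?_
  simp_rw [← sum_tent]
  rw [Finset.prod_univ_sum, mul_sum, mul_sum]
  refine sum_congr rfl fun c _ => ?_
  simp only [wt]
  ring

theorem boxWt_nonneg (hne : LowLevels M) (N : ℕ) (j : ℤ) (y : Rn n) : 0 ≤ boxWt M N j y :=
  sum_nonneg fun i _ => mul_nonneg (wt_nonneg i y) (slab_nonneg hne j _ y)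

theorem boxWt_le_one (hne : LowLevels M) (N : ℕ) (j : ℤ) (y : Rn n) : boxWt M N j y ≤ 1 := by
  rw [boxWt_eq]
  have hp : ∀ l : ℤ, ∏ q, (clamp (4 * n * 2 ^ l * y q + (4 * n * N * 2 ^ N : ℕ) + 1) -
      clamp (4 * n * 2 ^ l * y q - (4 * n * N * 2 ^ N : ℕ))) ≤ 1 := fun l => by
    refine prod_le_one (fun q _ => sub_nonneg.2 (clamp_mono ?_)) fun q _ => ?_
    · have : (0 : ℝ) ≤ (4 * n * N * 2 ^ N : ℕ) := Nat.cast_nonneg _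
      linarith
    · exact (sub_le_self _ (clamp_nonneg _)).trans (clamp_le_one _)
  calc _ ≤ ∑ k ∈ Finset.Icc (-(N : ℤ)) N, slab M j k y * 1 := by
        gcongr with k _
        · exact slab_nonneg hne j k y
        calc _ ≤ ∑ l ∈ Finset.Icc (-(N : ℤ)) N, shell (2 ^ l * levelDist M k y) * 1 := by
              gcongr with l _
              · exact shell_nonneg (mul_nonneg (two_zpow_pos _).le (levelDist_nonneg _ _))
              · exact hp l
          _ ≤ 1 := by
              simp_rw [mul_one]
              rw [sum_shell]
              exact (sub_le_self _ (clamp_nonneg _)).trans (clamp_le_one _)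
    _ ≤ 1 := by
        simp_rw [mul_one]
        rw [sum_slab]
        split_ifs <;> norm_num

/-- The weights sum to one where the maximal function is bounded below nearby. -/
theorem eventually_boxWt_eq_one (hn : 1 ≤ n)
    (hne : LowLevels M) {k₀ k₁ : ℤ}
    (h0 : 3 * 2 ^ (-j) < levelDist M k₀ y) (h1 : levelDist M k₁ y ≤ 3 * 2 ^ (-j)) :
    ∀ᶠ N : ℕ in atTop, boxWt M N j y = 1 := by
  have hbig : ∀ a : ℝ, ∀ᶠ N : ℕ in atTop, a ≤ (2 : ℝ) ^ N := fun a =>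
    (tendsto_pow_atTop_atTop_of_one_lt one_lt_two).eventually (eventually_ge_atTop a)
  filter_upwards [tendsto_natCast_atTop_atTop.eventually (eventually_ge_atTop ‖y‖),
    eventually_ge_atTop k₀.natAbs, eventually_ge_atTop k₁.natAbs, hbig (2 ^ j),
    hbig (levelDist M k₀ y)] with N hN hN0 hN1 hN2 hN3
  rw [boxWt_eq]
  have hp : ∀ l ∈ Finset.Icc (-(N : ℤ)) N,
      ∏ q, (clamp (4 * n * 2 ^ l * y q + (4 * n * N * 2 ^ N : ℕ) + 1) -
      clamp (4 * n * 2 ^ l * y q - (4 * n * N * 2 ^ N : ℕ))) = 1 := fun l hl => by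
    refine Finset.prod_eq_one fun q _ => ?_
    -- The range of lattice points in the box is chosen for this bound: it covers all points with
    -- `‖y‖ ≤ N` at all scales `l ≤ N`.
    have h4 : |4 * n * 2 ^ l * y q| ≤ 4 * n * N * 2 ^ N := by
      have hyq : |y q| ≤ N := (norm_apply_le y q).trans hN
      have h5 : (2 : ℝ) ^ l ≤ 2 ^ N := by
        rw [← zpow_natCast]
        exact zpow_le_zpow_right₀ one_le_two (Finset.mem_Icc.1 hl).2
      rw [abs_mul, abs_of_nonneg (by positivity)]
      calc _ ≤ 4 * n * (2 : ℝ) ^ N * N := by gcongr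
        _ = _ := by ring
    obtain ⟨h5, h6⟩ := abs_le.1 h4
    push_cast
    rw [clamp_eq_one (by linarith), clamp_eq_zero (by linarith), sub_zero]
  have hk : ∀ k ∈ Finset.Icc (-(N : ℤ)) N, slab M j k y * ∑ l ∈ Finset.Icc (-(N : ℤ)) N,
      shell (2 ^ l * levelDist M k y) * ∏ q, (clamp (4 * n * 2 ^ l * y q +
        (4 * n * N * 2 ^ N : ℕ) + 1) - clamp (4 * n * 2 ^ l * y q - (4 * n * N * 2 ^ N : ℕ))) =
      slab M j k y := by
    intro k _
    by_cases hs : slab M j k y = 0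
    · rw [hs, zero_mul]
    -- Where the slab is nonzero, the distance at level `k` lies between `3 * 2 ^ (-j)` and its
    -- value at level `k₀`. For large `N` the sum over `l` then reaches beyond both ends and equals
    -- `1`.
    have hk0 : k₀ ≤ k := by
      by_contra hlt
      refine hs ?_
      have a1 := levelDist_succ_le hne (M := M) (k := k + 1) (k' := k₀) (by omega) y
      have a2 := levelDist_succ_le hne (M := M) (k := k) (k' := k₀) (by omega) y
      rw [slab, if_pos (by linarith), if_pos (by linarith), sub_self]
    have hd : 3 * 2 ^ (-j) < levelDist M k y := by
      by_contra hlt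
      refine hs ?_
      have a1 := levelDist_succ_le hne (M := M) (k := k) (k' := k + 1) (by omega) y
      rw [slab, if_neg hlt, if_neg (by linarith), sub_self]
    have hd' := levelDist_succ_le hne hk0 y
    rw [sum_congr rfl fun l hl => by rw [hp l hl, mul_one], sum_shell, clamp_eq_one,
      clamp_eq_zero, sub_zero, mul_one]
    · have : (2 : ℝ) ^ (-(N : ℤ) - 1) * levelDist M k y ≤ (2 : ℝ) ^ (-(N : ℤ) - 1) * 2 ^ N := by
        gcongr
        linarith
      have e : (2 : ℝ) ^ (-(N : ℤ) - 1) * 2 ^ N = 2⁻¹ := by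
        rw [zpow_sub_one₀ two_ne_zero, zpow_neg, zpow_natCast]
        field_simp
      rw [e] at this
      linarith
    · have h2 : (2 : ℝ) ^ j * (3 * 2 ^ (-j)) ≤ 2 ^ N * levelDist M k y := by gcongr
      have e : (2 : ℝ) ^ j * (3 * 2 ^ (-j)) = 3 := by
        rw [zpow_neg]
        have := (two_zpow_pos j).ne'
        field_simp
      linarith
  rw [sum_congr rfl hk, sum_slab]
  have a1 := levelDist_succ_le hne (M := M) (k := -(N : ℤ)) (k' := k₀) (by omega) y
  have a2 := levelDist_succ_le hne (M := M) (k := k₁) (k' := N + 1) (by omega) y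
  rw [if_pos (by linarith), if_neg (by linarith), sub_zero]

theorem ofReal_two_zpow_sub (p : ℝ) (hp : 0 < p) (k : ℤ) (i : ℕ) :
    ofReal (2 ^ (k - i)) ^ p = ofReal (2 ^ k) ^ p * (ofReal (1 / 2) ^ p) ^ i := by
  rw [zpow_sub₀ two_ne_zero, zpow_natCast, div_eq_mul_one_div, ← one_div_pow,
    ofReal_mul (two_zpow_pos k).le, mul_rpow_of_nonneg _ _ hp.le,
    ofReal_pow (by norm_num), ← ENNReal.rpow_natCast, ← ENNReal.rpow_natCast,
    ← ENNReal.rpow_mul, ← ENNReal.rpow_mul, mul_comm p]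

/-- A geometric sum over levels below a given value. -/
theorem sum_two_zpow_rpow_le (hp : 0 < p) (K : Finset ℤ) {a : ℝ≥0∞}
    (h : ∀ k ∈ K, ofReal (2 ^ k) < a) :
    ∑ k ∈ K, ofReal (2 ^ k) ^ p ≤ (1 - ofReal (1 / 2) ^ p)⁻¹ * a ^ p := by
  rcases K.eq_empty_or_nonempty with rfl | hK
  · simp
  set k₀ := K.max' hK
  have hle : ∀ k ∈ K, k ≤ k₀ := fun k hk => Finset.le_max' K k hk
  have e : ∀ k ∈ K, ofReal (2 ^ k) ^ p =
      ofReal (2 ^ k₀) ^ p * (ofReal (1 / 2) ^ p) ^ (k₀ - k).toNat := by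
    intro k hk
    rw [← ofReal_two_zpow_sub p hp]
    congr 3
    have := hle k hk
    omega
  rw [sum_congr rfl e, ← mul_sum, mul_comm]
  gcongr
  · rw [← ENNReal.tsum_geometric]
    have hinj : Set.InjOn (fun k : ℤ => (k₀ - k).toNat) K := by
      intro k hk k' hk' hkk
      have h1 := hle k hk
      have h2 := hle k' hk'
      simp only at hkk
      omega
    rw [← Finset.sum_image (f := fun i : ℕ => (ofReal (1 / 2) ^ p) ^ i) hinj]
    exact ENNReal.sum_le_tsum _
  · exact (h k₀ (Finset.max'_mem K hK)).le

/-- The Whitney cubes. -/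
def cube (n : ℕ) (l : ℤ) (c : Fin n → ℤ) : Set (Rn n) :=
  {x | ∀ q, (c q : ℝ) ≤ 4 * n * 2 ^ l * x q ∧ 4 * n * 2 ^ l * x q < c q + 1}

theorem cube_eq (hn : 1 ≤ n) (l : ℤ) (c : Fin n → ℤ) : cube n l c =
    (MeasurableEquiv.toLp 2 (Fin n → ℝ)).symm ⁻¹' Set.pi univ fun q =>
      Set.Ico (c q / (4 * n * 2 ^ l) : ℝ) ((c q + 1) / (4 * n * 2 ^ l)) := by
  have hl := two_zpow_pos l
  have hn' : (0 : ℝ) < n := by exact_mod_cast hn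
  ext x
  simp only [cube, Set.mem_preimage, Set.mem_pi, Set.mem_univ, true_imp_iff, Set.mem_Ico]
  refine forall_congr' fun q => ?_
  rw [div_le_iff₀ (by positivity), lt_div_iff₀ (by positivity), mul_comm (4 * (n : ℝ) * 2 ^ l)]
  rfl

theorem measurableSet_cube (hn : 1 ≤ n) (l : ℤ) (c : Fin n → ℤ) : MeasurableSet (cube n l c) := by
  rw [cube_eq hn]
  exact (MeasurableEquiv.measurable _) (MeasurableSet.univ_pi fun _ => measurableSet_Ico)

theorem volume_cube (hn : 1 ≤ n) (l : ℤ) (c : Fin n → ℤ) :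
    volume (cube n l c) = ofReal (1 / (4 * n)) ^ n * ofReal (2 ^ (-l)) ^ n := by
  have hl := two_zpow_pos l
  have hn' : (0 : ℝ) < n := by exact_mod_cast hn
  rw [cube_eq hn, (EuclideanSpace.volume_preserving_symm_measurableEquiv_toLp (Fin n)).measure_preimage
    (MeasurableSet.univ_pi fun _ => measurableSet_Ico).nullMeasurableSet, Real.volume_pi_Ico]
  have e : ∀ q, ((c q : ℝ) + 1) / (4 * n * 2 ^ l) - c q / (4 * n * 2 ^ l) =
      1 / (4 * n) * 2 ^ (-l) := fun q => by
    rw [zpow_neg]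
    field_simp
    ring
  simp_rw [e]
  rw [Finset.prod_const, Finset.card_univ, Fintype.card_fin, ofReal_mul (by positivity), mul_pow]

/-- The total size of the Whitney cubes meeting a given point at a given level. -/
theorem sum_indicator_cube_le (hn : 1 ≤ n) (hp : 0 < p) (M : Rn n → ℝ≥0∞)
    (s : Finset (Ix n)) (hs : ∀ i ∈ s, ∃ y, wt M i y ≠ 0) (x : Rn n) :
    ∑ i ∈ s, (cube n i.2.1 i.2.2).indicator (fun _ => ofReal (2 ^ i.1) ^ p) x ≤
      4 * (1 - ofReal (1 / 2) ^ p)⁻¹ * M x ^ p := by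
  classical
  have hn' : (0 : ℝ) < n := by exact_mod_cast hn
  set s' := s.filter fun i => x ∈ cube n i.2.1 i.2.2
  -- A point of the cube and a point where the weight is nonzero differ by at most `2 ^ (-l) / 2`.
  -- This widens the bounds `1` and `4` from the shell to `1 / 2` and `9 / 2`.
  have h1 : ∀ i ∈ s', 1 / 2 < 2 ^ i.2.1 * levelDist M i.1 x ∧
      2 ^ i.2.1 * levelDist M i.1 x < 9 / 2 := by
    intro i hi
    obtain ⟨his, hix⟩ := mem_filter.1 hi
    obtain ⟨y, hy⟩ := hs i his
    obtain ⟨⟨a1, a2⟩, a3⟩ := of_wt_ne_zero hy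
    have hl := two_zpow_pos i.2.1
    have h2 : ‖x - y‖ ≤ 2 / 4 * 2 ^ (-i.2.1) := norm_le_of_forall_abs_le hn fun q => by
      have b1 := hix q
      have b2 := abs_lt.1 (a3 q)
      have e : 4 * n * 2 ^ i.2.1 * (x - y) q =
        4 * n * 2 ^ i.2.1 * x q - 4 * n * 2 ^ i.2.1 * y q := by simp; ring
      rw [e, abs_le]
      constructor <;> linarith [b1.1, b1.2, b2.1, b2.2]
    have h3 := (abs_le.1 ((abs_levelDist_sub_le (M := M) i.1 x y).trans h2))
    have e : (2 : ℝ) ^ i.2.1 * (2 / 4 * 2 ^ (-i.2.1)) = 1 / 2 := by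
      rw [zpow_neg]; field_simp; norm_num
    have h4 := mul_le_mul_of_nonneg_left h3.1 hl.le
    have h5 := mul_le_mul_of_nonneg_left h3.2 hl.le
    rw [mul_neg, e, mul_sub] at h4
    rw [e, mul_sub] at h5
    constructor <;> linarith
  have h2 : ∀ i ∈ s', ofReal (2 ^ i.1) < M x := fun i hi => by
    refine lt_of_levelDist_pos ?_
    by_contra h
    have := levelDist_nonneg (M := M) i.1 x
    have h0 : levelDist M i.1 x = 0 := by linarith
    have := (h1 i hi).1
    rw [h0, mul_zero] at this
    linarith
  have e1 : ∑ i ∈ s, (cube n i.2.1 i.2.2).indicator (fun _ => ofReal (2 ^ i.1) ^ p) x =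
      ∑ i ∈ s', ofReal (2 ^ i.1) ^ p := by
    rw [sum_filter]
    refine sum_congr rfl fun i _ => ?_
    simp [Set.indicator_apply]
  set K := s'.image Prod.fst
  rw [e1, ← Finset.sum_fiberwise_of_maps_to (t := K) (g := Prod.fst)
    fun i hi => Finset.mem_image_of_mem _ hi]
  have h3 : ∀ k ∈ K, ∑ i ∈ s' with i.1 = k, ofReal (2 ^ i.1) ^ p ≤ 4 * ofReal (2 ^ k) ^ p := by
    intro k _
    have e2 : ∑ i ∈ s' with i.1 = k, ofReal (2 ^ i.1) ^ p =
        ∑ i ∈ s' with i.1 = k, ofReal (2 ^ k) ^ p :=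
      sum_congr rfl fun i hi => by rw [(mem_filter.1 hi).2]
    rw [e2, sum_const, nsmul_eq_mul]
    gcongr
    -- At a fixed level these bounds leave at most four values of `l`, and for each `l` the cube
    -- containing `x` is determined by integer parts.
    set l₀ := Int.log 2 (levelDist M k x)
    have hcard : (s'.filter fun i => i.1 = k).card ≤ (Finset.Icc (-l₀ - 1) (-l₀ + 2)).card := by
      refine Finset.card_le_card_of_injOn (fun i => i.2.1) (fun i hi => ?_) fun i hi i' hi' hii => ?_
      · obtain ⟨his, rfl⟩ := mem_filter.1 hi
        obtain ⟨a1, a2⟩ := h1 i his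
        have hl := two_zpow_pos i.2.1
        have hd : 0 < levelDist M i.1 x := by
          by_contra h
          nlinarith [levelDist_nonneg (M := M) i.1 x]
        have b1 := Int.zpow_log_le_self (b := 2) one_lt_two hd
        have b2 := Int.lt_zpow_succ_log_self (b := 2) one_lt_two (levelDist M i.1 x)
        push_cast at b1 b2
        have c1 : (2 : ℝ) ^ (i.2.1 + l₀) < 2 ^ (3 : ℤ) := by
          rw [zpow_add₀ two_ne_zero]
          calc _ ≤ 2 ^ i.2.1 * levelDist M i.1 x := by gcongr
            _ < 9 / 2 := a2
            _ < _ := by norm_num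
        have c2 : (2 : ℝ) ^ (-1 : ℤ) < 2 ^ (i.2.1 + (l₀ + 1)) := by
          rw [zpow_add₀ two_ne_zero]
          calc (2 : ℝ) ^ (-1 : ℤ) = 1 / 2 := by norm_num
            _ < 2 ^ i.2.1 * levelDist M i.1 x := a1
            _ ≤ _ := by gcongr
        have c3 := (zpow_lt_zpow_iff_right₀ (one_lt_two (α := ℝ))).1 c1
        have c4 := (zpow_lt_zpow_iff_right₀ (one_lt_two (α := ℝ))).1 c2
        simp only [Finset.coe_Icc, Set.mem_Icc]
        omega
      · obtain ⟨his, hk⟩ := mem_filter.1 hi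
        obtain ⟨his', hk'⟩ := mem_filter.1 hi'
        have d1 := (mem_filter.1 his).2
        have d2 := (mem_filter.1 his').2
        obtain ⟨k1, l1, c1⟩ := i
        obtain ⟨k2, l2, c2⟩ := i'
        simp only at hk hk' hii d1 d2
        subst hk hk' hii
        have : c1 = c2 := by
          ext q
          have f1 := Int.floor_eq_iff.2 (d1 q)
          have f2 := Int.floor_eq_iff.2 (d2 q)
          rw [← f1, ← f2]
        rw [this]
    have : (Finset.Icc (-l₀ - 1) (-l₀ + 2)).card = 4 := by
      rw [Int.card_Icc]
      omega
    rw [this] at hcard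
    exact_mod_cast hcard
  refine (sum_le_sum h3).trans ?_
  rw [← mul_sum, mul_assoc]
  gcongr
  refine sum_two_zpow_rpow_le hp K fun k hk => ?_
  obtain ⟨i, hi, rfl⟩ := Finset.mem_image.1 hk
  exact h2 i hi

/-- The Whitney cubes of all level sets are controlled by the `L^p` norm. -/
theorem exists_sum_whitney_le (hn : 1 ≤ n) (hp : 0 < p) : ∃ C : ℝ≥0,
    ∀ (M : Rn n → ℝ≥0∞) (s : Finset (Ix n)), (∀ i ∈ s, ∃ y, wt M i y ≠ 0) →
      ∑ i ∈ s, ofReal (2 ^ i.1) ^ p * ofReal (2 ^ (-i.2.1)) ^ n ≤ C * ∫⁻ x, M x ^ p := by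
  have hn' : (0 : ℝ) < n := by exact_mod_cast hn
  set v := ofReal (1 / (4 * n)) ^ n
  have hv0 : v ≠ 0 := pow_ne_zero _ (ofReal_pos.2 (by positivity)).ne'
  have hv1 : v ≠ ⊤ := ENNReal.pow_ne_top ofReal_ne_top
  set D := 4 * (1 - ofReal (1 / 2) ^ p)⁻¹
  have hD : D ≠ ⊤ := by
    refine mul_ne_top (by norm_num) (ENNReal.inv_ne_top.2 (tsub_pos_of_lt ?_).ne')
    exact ENNReal.rpow_lt_one (by rw [← ofReal_one]; exact
      (ENNReal.ofReal_lt_ofReal_iff one_pos).2 (by norm_num)) hp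
  have hvD : v⁻¹ * D ≠ ⊤ := mul_ne_top (ENNReal.inv_ne_top.2 hv0) hD
  refine ⟨(v⁻¹ * D).toNNReal, fun M s hs => ?_⟩
  rw [ENNReal.coe_toNNReal hvD]
  have h1 : ∑ i ∈ s, ofReal (2 ^ i.1) ^ p * volume (cube n i.2.1 i.2.2) ≤ D * ∫⁻ x, M x ^ p := by
    calc _ = ∫⁻ x, ∑ i ∈ s, (cube n i.2.1 i.2.2).indicator
          (fun _ => ofReal (2 ^ i.1) ^ p) x := by
          rw [lintegral_finsetSum _ fun i _ =>
            measurable_const.indicator (measurableSet_cube hn i.2.1 i.2.2)]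
          refine sum_congr rfl fun i _ => ?_
          rw [lintegral_indicator_const (measurableSet_cube hn i.2.1 i.2.2)]
      _ ≤ ∫⁻ x, D * M x ^ p := lintegral_mono fun x => sum_indicator_cube_le hn hp M s hs x
      _ = _ := lintegral_const_mul' _ _ hD
  calc _ = v⁻¹ * ∑ i ∈ s, ofReal (2 ^ i.1) ^ p * volume (cube n i.2.1 i.2.2) := by
        rw [mul_sum]
        refine sum_congr rfl fun i _ => ?_
        rw [volume_cube hn]
        calc _ = (v⁻¹ * v) * (ofReal (2 ^ i.1) ^ p * ofReal (2 ^ (-i.2.1)) ^ n) := by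
              rw [ENNReal.inv_mul_cancel hv0 hv1, one_mul]
          _ = _ := by ring
    _ ≤ v⁻¹ * (D * ∫⁻ x, M x ^ p) := by gcongr
    _ = _ := (mul_assoc _ _ _).symm

/-! ### Splitting functions dominated by the maximal function -/

theorem continuous_levelDist (k : ℤ) : Continuous (levelDist M k) := Metric.continuous_infDist_pt _

theorem continuous_wt (i : Ix n) : Continuous (wt M i) := by
  have hsh : Continuous shell := by unfold shell clamp; fun_prop
  have hte : Continuous tent := by unfold tent clamp; fun_prop
  unfold wt
  refine (hsh.comp (continuous_const.mul (continuous_levelDist _))).mul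
    (continuous_finsetProd _ fun q _ => hte.comp ?_)
  fun_prop

theorem measurable_slab (j k : ℤ) : Measurable (slab M j k) := by
  unfold slab
  refine Measurable.sub ?_ ?_ <;>
  exact Measurable.ite (measurableSet_lt measurable_const (continuous_levelDist _).measurable)
    measurable_const measurable_const

theorem abs_slab_le_one (j k : ℤ) (y : Rn n) : |slab M j k y| ≤ 1 := by
  unfold slab
  split_ifs <;> norm_num

theorem measurable_boxWt (N : ℕ) (j : ℤ) : Measurable (boxWt M N j) :=
  Finset.measurable_fun_sum _ fun i _ => (continuous_wt i).measurable.mul (measurable_slab j i.1)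

theorem memLp_piece {F : Rn n → Cm m} (hF : MemLp F 2 volume) (i : Ix n) (j : ℤ) :
    MemLp (fun y => (wt M i y * slab M j i.1 y) • F y) 2 volume := by
  refine hF.mono ((((continuous_wt i).measurable.mul
    (measurable_slab j i.1)).aestronglyMeasurable).smul hF.1) (ae_of_all _ fun y => ?_)
  rw [norm_smul, norm_mul]
  have h1 := abs_wt_le_one (M := M) i y
  have h2 := abs_slab_le_one (M := M) j i.1 y
  rw [← norm_eq_abs] at h1 h2
  calc _ ≤ 1 * 1 * ‖F y‖ := by gcongr
    _ = _ := by ring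

/-- Near a point where a function controlled by `M` does not vanish, `M` is bounded below. -/
theorem exists_lt_levelDist_of_ne_zero
    (hne : LowLevels M) (hB : 0 ≤ B) {v : Cm m} (hv : v ≠ 0)
    (h : ∀ x, ‖x - y‖ ≤ 5 * 2 ^ (-j) → ‖v‖ₑ ≤ ofReal B * M x) :
    ∃ k, 3 * 2 ^ (-j) < levelDist M k y := by
  have hj := two_zpow_pos (-j)
  obtain ⟨N, hN⟩ := exists_pow_lt_of_lt_one (show 0 < ‖v‖ / (B + 1) by positivity)
    (show (1 / 2 : ℝ) < 1 by norm_num)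
  refine ⟨-(N : ℤ), lt_of_lt_of_le (b := 5 * 2 ^ (-j)) (by linarith) ?_⟩
  refine (Metric.le_infDist (hne _)).2 fun x hx => ?_
  by_contra hlt
  rw [not_le, dist_comm, dist_eq_norm] at hlt
  have h1 := (h x hlt.le).trans (mul_le_mul_right hx (ofReal B))
  rw [← ofReal_mul hB, ← ofReal_norm, ENNReal.ofReal_le_ofReal_iff (by positivity),
    zpow_neg, zpow_natCast, ← inv_pow, ← one_div] at h1
  rw [lt_div_iff₀ (by positivity)] at hN
  have : (0 : ℝ) < (1 / 2) ^ N := by positivity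
  nlinarith

theorem exists_levelDist_le (hp : 0 < p) (hM : ∫⁻ x, M x ^ p ≠ ⊤) (j : ℤ) (y : Rn n) :
    ∃ k, levelDist M k y ≤ 3 * 2 ^ (-j) := by
  have hj := two_zpow_pos (-j)
  obtain ⟨x, h1, h2⟩ := exists_lt_top_of_lintegral hp hM y (show 0 < 3 * (2 : ℝ) ^ (-j) by positivity)
  obtain ⟨N, hN⟩ := pow_unbounded_of_one_lt (M x).toReal (one_lt_two (α := ℝ))
  refine ⟨N, (Metric.infDist_le_dist_of_mem (y := x) ?_).trans (by rw [dist_eq_norm]; exact h1.le)⟩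
  change M x ≤ _
  rw [← ofReal_toReal h2.ne, zpow_natCast]
  exact ofReal_le_ofReal hN.le

/-- A function controlled by `M` at a fixed scale is square integrable. -/
theorem memLp_two_of_le (hp : 0 < p) (hp1 : p ≤ 1) (hM : ∫⁻ x, M x ^ p ≠ ⊤)
    {F : Rn n → Cm m} (hF : Continuous F) {r : ℝ} (hr : 0 < r)
    (h : ∀ x y, ‖x - y‖ ≤ r → ‖F y‖ₑ ≤ ofReal B * M x) : MemLp F 2 volume := by
  refine ⟨hF.aestronglyMeasurable, ?_⟩
  set D := ofReal B ^ p * ∫⁻ x, M x ^ p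
  have hBp : ofReal B ^ p ≠ ⊤ := ENNReal.rpow_ne_top_of_nonneg hp.le ofReal_ne_top
  have hD : D ≠ ⊤ := mul_ne_top hBp hM
  have hv0 : volume (closedBall (0 : Rn n) r) ≠ 0 := (Metric.measure_closedBall_pos volume 0 hr).ne'
  have hvt : volume (closedBall (0 : Rn n) r) ≠ ⊤ :=
    (isCompact_closedBall (0 : Rn n) r).measure_lt_top.ne
  -- A uniform bound for `F`: its value at `y` is dominated by `M` on the whole ball of radius `r`
  -- about `y`, hence by an average of `M ^ p`. Interpolation through `‖F‖ ^ 2 ≤ S ^ (2 - p) * ‖F‖ ^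
  -- p` then gives square integrability.
  set S := (D / volume (closedBall (0 : Rn n) r)) ^ p⁻¹
  have hS : S ≠ ⊤ := ENNReal.rpow_ne_top_of_nonneg (by positivity) (ENNReal.div_ne_top hD hv0)
  have hle : ∀ y, ‖F y‖ₑ ≤ S := fun y => by
    rw [ENNReal.le_rpow_inv_iff hp, ENNReal.le_div_iff_mul_le (Or.inl hv0) (Or.inl hvt),
      ← Measure.addHaar_closedBall_center volume y r]
    calc _ = ∫⁻ x in closedBall y r, ‖F y‖ₑ ^ p := (setLIntegral_const _ _).symm
      _ ≤ ∫⁻ x in closedBall y r, ofReal B ^ p * M x ^ p := by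
          refine setLIntegral_mono' isClosed_closedBall.measurableSet fun x hx => ?_
          rw [← mul_rpow_of_nonneg _ _ hp.le]
          exact rpow_le_rpow (h x y (by rwa [← dist_eq_norm])) hp.le
      _ ≤ ∫⁻ x, ofReal B ^ p * M x ^ p := setLIntegral_le_lintegral _ _
      _ = D := lintegral_const_mul' _ _ hBp
  have h2 : eLpNorm F 2 volume ^ 2 < ⊤ := by
    rw [sq_eLpNorm_two]
    calc _ ≤ ∫⁻ y, (S ^ (2 - p) * ofReal B ^ p) * M y ^ p := by
          refine lintegral_mono fun y => ?_
          have h1 : ‖F y‖ₑ ^ p ≤ ofReal B ^ p * M y ^ p := by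
            rw [← mul_rpow_of_nonneg _ _ hp.le]
            exact rpow_le_rpow (h y y (by simpa using hr.le)) hp.le
          have e : ‖F y‖ₑ ^ 2 = ‖F y‖ₑ ^ (2 - p) * ‖F y‖ₑ ^ p := by
            rw [← ENNReal.rpow_add_of_nonneg _ _ (by linarith) hp.le, ← ENNReal.rpow_natCast]
            norm_num
          rw [e, mul_assoc]
          gcongr
          · linarith
          · exact hle y
      _ = (S ^ (2 - p) * ofReal B ^ p) * ∫⁻ y, M y ^ p := lintegral_const_mul' _ _
          (mul_ne_top (ENNReal.rpow_ne_top_of_nonneg (by linarith) hS) hBp)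
      _ < ⊤ := mul_lt_top (mul_ne_top
          (ENNReal.rpow_ne_top_of_nonneg (by linarith) hS) hBp).lt_top hM.lt_top
  by_contra hcon
  rw [not_lt, top_le_iff] at hcon
  rw [hcon] at h2
  simp at h2

/-- The pieces of a function controlled by `M` add up to the function in `L²`. -/
theorem tendsto_sum_piece (hn : 1 ≤ n) (hp : 0 < p) (hM : ∫⁻ x, M x ^ p ≠ ⊤)
    {F : Rn n → Cm m} (hF : MemLp F 2 volume) (hB : 0 ≤ B)
    (h : ∀ x y, ‖x - y‖ ≤ 5 * 2 ^ (-j) → ‖F y‖ₑ ≤ ofReal B * M x) :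
    Tendsto (fun N => ∑ i ∈ box n N, (memLp_piece (M := M) hF i j).toLp _) atTop
      (𝓝 (hF.toLp F)) := by
  have hne := nonempty_level hn hp hM
  rw [tendsto_iff_dist_tendsto_zero]
  have hsum : ∀ N, (∑ i ∈ box n N, (memLp_piece (M := M) hF i j).toLp _ : L2bd n m) =ᵐ[volume]
      fun y => boxWt M N j y • F y := by
    intro N
    have h1 := Lp.coeFn_finsetSum (box n N) fun i => (memLp_piece (M := M) hF i j).toLp _
    have h2 : ∀ᵐ y, ∀ i ∈ box n N, (memLp_piece (M := M) hF i j).toLp _ y =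
        (wt M i y * slab M j i.1 y) • F y :=
      (Finset.eventually_all _).2 fun i _ => (memLp_piece (M := M) hF i j).coeFn_toLp
    filter_upwards [h1, h2] with y h1 h2
    rw [h1, Finset.sum_apply, sum_congr rfl h2, ← Finset.sum_smul]
    rfl
  have e : ∀ N, dist (∑ i ∈ box n N, (memLp_piece (M := M) hF i j).toLp _ : L2bd n m) (hF.toLp F) =
      (eLpNorm (fun y => (boxWt M N j y - 1) • F y) 2 volume).toReal := by
    intro N
    rw [dist_eq_norm, Lp.norm_def]
    congr 1
    refine eLpNorm_congr_ae ?_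
    filter_upwards [Lp.coeFn_sub (∑ i ∈ box n N, (memLp_piece (M := M) hF i j).toLp _ : L2bd n m)
      (hF.toLp F), hsum N, hF.coeFn_toLp] with y h1 h2 h3
    rw [h1, Pi.sub_apply, h2, h3, sub_smul, one_smul]
  simp_rw [e]
  rw [← ENNReal.toReal_zero]
  refine (ENNReal.tendsto_toReal ENNReal.zero_ne_top).comp (tendsto_zero_of_sq ?_)
  simp_rw [sq_eLpNorm_two]
  have h0 : ∫⁻ _ : Rn n, (0 : ℝ≥0∞) = 0 := lintegral_zero
  rw [← h0]
  refine tendsto_lintegral_of_dominated_convergence' (fun y => ‖F y‖ₑ ^ 2) (fun N => ?_)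
    (fun N => ae_of_all _ fun y => ?_) ?_ (ae_of_all _ fun y => ?_)
  · exact ((((measurable_boxWt N j).sub_const 1).aestronglyMeasurable.smul hF.1).enorm).pow_const 2
  · beta_reduce
    rw [enorm_smul]
    have h1 : ‖boxWt M N j y - 1‖ₑ ≤ 1 := by
      rw [← ofReal_norm, ← ofReal_one]
      refine ofReal_le_ofReal ?_
      rw [norm_eq_abs, abs_le]
      constructor <;> linarith [boxWt_nonneg hne N j y, boxWt_le_one hne N j y]
    calc _ ≤ (1 * ‖F y‖ₑ) ^ 2 := by gcongr
      _ = _ := by rw [one_mul]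
  · rw [← sq_eLpNorm_two]
    exact (pow_lt_top hF.2).ne
  -- The weights need not sum to `1` where `F` vanishes. Elsewhere `M` is bounded below near `y`, so
  -- `y` is far from a sublevel set of small height.
  · by_cases hy : F y = 0
    · simp [hy]
    obtain ⟨k₀, hk₀⟩ := exists_lt_levelDist_of_ne_zero hne hB hy fun x hx => h x y hx
    obtain ⟨k₁, hk₁⟩ := exists_levelDist_le hp hM j y
    refine tendsto_const_nhds.congr' ?_
    filter_upwards [eventually_boxWt_eq_one hn hne hk₀ hk₁] with N hN
    simp [hN]

/-! ### Uniform bounds for sums of convolved pieces -/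

theorem norm_conv_le (hρ : Integrable ρ) {r β : ℝ} (hr : ∀ z, r < ‖z‖ → ρ z = 0) (h : ∀ y, ‖y‖ ≤ r → ‖f (x - y)‖ ≤ β) :
    ‖conv ρ f x‖ ≤ (∫ y, |ρ y|) * β := by
  rw [← integral_mul_const]
  refine norm_integral_le_of_norm_le (hρ.abs.mul_const β) (ae_of_all _ fun y => ?_)
  rw [norm_smul, norm_eq_abs]
  by_cases hy : ‖y‖ ≤ r
  · gcongr
    exact h y hy
  · rw [hr y (not_le.1 hy)]
    simp

theorem sum_half_zpow_le (S : Finset ℤ) (l : ℤ) :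
    ∑ j ∈ S, (if l ≤ j then (2 : ℝ) ^ (l - j) else 0) ≤ 2 := by
  rw [← sum_filter]
  have hinj : Set.InjOn (fun j : ℤ => (j - l).toNat) (S.filter fun j => l ≤ j) := by
    intro j hj j' hj' h
    have h1 := (mem_filter.1 hj).2
    have h2 := (mem_filter.1 hj').2
    simp only at h
    omega
  have e : ∀ j ∈ S.filter fun j => l ≤ j, (2 : ℝ) ^ (l - j) = (1 / 2) ^ (j - l).toNat := by
    intro j hj
    have h1 := (mem_filter.1 hj).2
    have h2 : l - j = -(((j - l).toNat : ℕ) : ℤ) := by omega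
    rw [h2, zpow_neg, zpow_natCast, one_div, inv_pow]
  rw [sum_congr rfl e, ← Finset.sum_image (f := fun i : ℕ => (1 / 2 : ℝ) ^ i) hinj]
  exact (summable_geometric_two.sum_le_tsum _ fun i _ => by positivity).trans_eq tsum_geometric_two

/-- The dyadic windows are pairwise disjoint, so `D` lies in at most one of them. -/
theorem sum_dyadic_window_le (S : Finset ℤ) (D : ℝ) {c : ℝ} (hc : 0 ≤ c) :
    ∑ j ∈ S, (if 2 * 2 ^ (-j) < D ∧ D ≤ 4 * 2 ^ (-j) then c else 0) ≤ c := by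
  rw [← sum_filter, sum_const, nsmul_eq_mul]
  have h : (S.filter fun j : ℤ => 2 * (2 : ℝ) ^ (-j) < D ∧ D ≤ 4 * 2 ^ (-j)).card ≤ 1 := by
    have key : ∀ j j' : ℤ, 2 * (2 : ℝ) ^ (-j) < D → D ≤ 4 * 2 ^ (-j') → j' ≤ j := by
      intro j j' h1 h2
      by_contra hlt
      have : (2 : ℝ) ^ (-j') ≤ 2 ^ (-j - 1) := zpow_le_zpow_right₀ one_le_two (by omega)
      rw [zpow_sub_one₀ two_ne_zero] at this
      linarith
    refine Finset.card_le_one.2 fun j hj j' hj' => ?_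
    obtain ⟨-, h1, h2⟩ := mem_filter.1 hj
    obtain ⟨-, h3, h4⟩ := mem_filter.1 hj'
    exact le_antisymm (key _ _ h3 h2) (key _ _ h1 h4)
  have h' : ((S.filter fun j : ℤ => 2 * (2 : ℝ) ^ (-j) < D ∧ D ≤ 4 * 2 ^ (-j)).card : ℝ) ≤ 1 := by
    exact_mod_cast h
  nlinarith

/-- A telescoping sum over an order convex set of scales. -/
theorem norm_sum_filter_telescope_le {V : ℤ → Cm m} {P : ℤ → Prop} [DecidablePred P] {β : ℝ}
    (hβ : 0 ≤ β) (hconv : ∀ j₁ j j₂, j₁ ≤ j → j ≤ j₂ → P j₁ → P j₂ → P j)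
    (h1 : ∀ j, P j → ‖V j‖ ≤ β) (h2 : ∀ j, P j → ‖V (j + 1)‖ ≤ β) (a b : ℤ) :
    ‖∑ j ∈ (Finset.Ico a b).filter P, (V (j + 1) - V j)‖ ≤ 2 * β := by
  rcases ((Finset.Ico a b).filter P).eq_empty_or_nonempty with h0 | h0
  · rw [h0, Finset.sum_empty, norm_zero]
    positivity
  set j₁ := ((Finset.Ico a b).filter P).min' h0
  set j₂ := ((Finset.Ico a b).filter P).max' h0
  have m1 := mem_filter.1 (Finset.min'_mem _ h0)
  have m2 := mem_filter.1 (Finset.max'_mem _ h0)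
  have e : (Finset.Ico a b).filter P = Finset.Icc j₁ j₂ := by
    ext j
    rw [Finset.mem_Icc]
    constructor
    · exact fun hj => ⟨Finset.min'_le _ _ hj, Finset.le_max' _ _ hj⟩
    · rintro ⟨h3, h4⟩
      refine mem_filter.2 ⟨Finset.mem_Ico.2 ⟨?_, ?_⟩, hconv _ _ _ h3 h4 m1.2 m2.2⟩
      · exact (Finset.mem_Ico.1 m1.1).1.trans h3
      · exact h4.trans_lt (Finset.mem_Ico.1 m2.1).2
  have hle : j₁ ≤ j₂ := Finset.min'_le_max' _ h0
  rw [e, sum_Icc_telescope V (by omega)]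
  refine (norm_sub_le _ _).trans ?_
  have := h2 j₂ m2.2
  have := h1 j₁ m1.2
  linarith

/-- The product of a function with a weight of the partition of unity. -/
def piece (M : Rn n → ℝ≥0∞) (i : Ix n) (j : ℤ) (F : Rn n → Cm m)
    (y : Rn n) : Cm m := (wt M i y * slab M j i.1 y) • F y

theorem lt_levelDist_of_slab_ne_zero
    (hne : LowLevels M) {j k : ℤ}
    (h : slab M j k y ≠ 0) :
    3 * 2 ^ (-j) < levelDist M k y ∧ levelDist M (k + 1) y ≤ 3 * 2 ^ (-j) := by
  have h1 := levelDist_succ_le hne (show k ≤ k + 1 by omega) y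
  by_contra hcon
  rw [not_and_or, not_lt, not_le] at hcon
  rcases hcon with hcon | hcon
  · exact h (by rw [slab, if_neg (by linarith), if_neg (by linarith), sub_self])
  · exact h (by rw [slab, if_pos (by linarith), if_pos (by linarith), sub_self])

/-- The shell gives `2 ^ l * D < 4`, which together with `D > 3 * 2 ^ (-j)` excludes `l ≥ j + 1`.
Pieces therefore occur only at scales no coarser than their cube, and convolution at radius `2 ^
(-j)` stays in a multiple of the cube. -/
theorem le_of_wt_ne_zero {i : Ix n} (h : wt M i y ≠ 0)
    (hd : 3 * 2 ^ (-j) < levelDist M i.1 y) : i.2.1 ≤ j := by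
  have h1 := (of_wt_ne_zero h).1.2
  by_contra hlt
  have h2 : (2 : ℝ) ^ (1 : ℤ) ≤ 2 ^ (i.2.1 + -j) := zpow_le_zpow_right₀ one_le_two (by omega)
  rw [zpow_add₀ two_ne_zero, zpow_one] at h2
  have h3 := mul_lt_mul_of_pos_left hd (two_zpow_pos i.2.1)
  linarith

/-- Where a convolution of a piece does not vanish. -/
theorem of_conv_piece_ne_zero (hn : 1 ≤ n)
    (hne : LowLevels M)
    (hr : ∀ z, 2 ^ (-j) < ‖z‖ → ρ z = 0) {i : Ix n} {F : Rn n → Cm m}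
    (h : conv ρ (piece M i j F) x ≠ 0) : i.2.1 ≤ j ∧ ‖x - ctr i.2.1 i.2.2‖ ≤ 2 * 2 ^ (-i.2.1) := by
  have : ∃ y, ρ y • piece M i j F (x - y) ≠ 0 := by
    by_contra! hcon
    exact h (by simp only [conv, hcon, integral_zero])
  obtain ⟨y, hy⟩ := this
  obtain ⟨h1, h2⟩ := smul_ne_zero_iff.1 hy
  obtain ⟨h3, h4⟩ := mul_ne_zero_iff.1 (smul_ne_zero_iff.1 h2).1
  have hl := le_of_wt_ne_zero h3 (lt_levelDist_of_slab_ne_zero hne h4).1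
  refine ⟨hl, ?_⟩
  have h5 : ‖y‖ ≤ 2 ^ (-j) := not_lt.1 fun hlt => h1 (hr y hlt)
  have h6 : (2 : ℝ) ^ (-j) ≤ 2 ^ (-i.2.1) := zpow_le_zpow_right₀ one_le_two (by omega)
  have h7 := norm_sub_ctr_le hn h3
  calc ‖x - ctr i.2.1 i.2.2‖ = ‖(x - y - ctr i.2.1 i.2.2) + y‖ := by congr 1; abel
    _ ≤ _ := (norm_add_le _ _).trans (by linarith)

/-- Within distance `5 * 2 ^ (-j)` there is a point where `M ≤ 2 ^ (k + 1)`, and the hypothesis is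
used at that point. Slabs give distance `3 * 2 ^ (-j)` and a convolution adds `2 ^ (-j)`; this
explains the constants `4` and `5`. -/
theorem norm_le_of_levelDist_le (hne : LowLevels M) (hB : 0 ≤ B) {j k : ℤ} {v : Cm m}
    (h : ∀ x, ‖x - y‖ ≤ 5 * 2 ^ (-j) → ‖v‖ₑ ≤ ofReal B * M x)
    (hd : levelDist M (k + 1) y ≤ 4 * 2 ^ (-j)) : ‖v‖ ≤ 2 * B * 2 ^ k := by
  have hj := two_zpow_pos (-j)
  have hk := two_zpow_pos k
  obtain ⟨x, h1, h2⟩ := exists_le_of_levelDist_lt hne (show _ < 5 * (2 : ℝ) ^ (-j) by linarith)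
  have h3 := (h x h1.le).trans (mul_le_mul_right h2 (ofReal B))
  rw [← ofReal_mul hB, ← ofReal_norm, ENNReal.ofReal_le_ofReal_iff (by positivity),
    zpow_add_one₀ two_ne_zero] at h3
  linarith

theorem norm_piece_le (hne : LowLevels M) (hB : 0 ≤ B) {F : Rn n → Cm m}
    (h : ∀ x y, ‖x - y‖ ≤ 5 * 2 ^ (-j) → ‖F y‖ₑ ≤ ofReal B * M x)
    (i : Ix n) (y : Rn n) : ‖piece M i j F y‖ ≤ 2 * B * 2 ^ i.1 := by
  have hk := two_zpow_pos i.1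
  by_cases hs : slab M j i.1 y = 0
  · rw [piece, hs, mul_zero, zero_smul, norm_zero]
    positivity
  have hj := two_zpow_pos (-j)
  have h1 := norm_le_of_levelDist_le hne hB (fun x hx => h x y hx) (k := i.1)
    (by linarith [(lt_levelDist_of_slab_ne_zero hne hs).2])
  rw [piece, norm_smul, norm_mul, norm_eq_abs, norm_eq_abs]
  have h2 := abs_wt_le_one (M := M) i y
  have h3 := abs_slab_le_one (M := M) j i.1 y
  calc _ ≤ 1 * 1 * ‖F y‖ := by gcongr
    _ ≤ _ := by linarith

/-- Sums of convolutions of pieces with kernels of decreasing size. -/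
theorem norm_sum_zpow_conv_piece_le (hn : 1 ≤ n)
    (hne : LowLevels M) (hB : 0 ≤ B)
    {F : ℤ → Rn n → Cm m}
    (hF : ∀ j x y, ‖x - y‖ ≤ 5 * 2 ^ (-j) → ‖F j y‖ₑ ≤ ofReal B * M x)
    {ρ : ℤ → Rn n → ℝ} {K : ℝ} (hρ : ∀ j, Integrable (ρ j)) (hK : ∀ j, ∫ y, |ρ j y| ≤ K)
    (hr : ∀ j z, 2 ^ (-j) < ‖z‖ → ρ j z = 0) (i : Ix n) (S : Finset ℤ) (x : Rn n) :
    ‖∑ j ∈ S, (2 : ℝ) ^ (-j) • conv (ρ j) (piece M i j (F j)) x‖ ≤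
      4 * K * B * 2 ^ i.1 * 2 ^ (-i.2.1) := by
  have hk := two_zpow_pos i.1
  have hK0 : 0 ≤ K := (integral_nonneg fun y => abs_nonneg _).trans (hK 0)
  calc _ ≤ ∑ j ∈ S, (if i.2.1 ≤ j then (2 : ℝ) ^ (i.2.1 - j) else 0) *
        (2 * K * B * 2 ^ i.1 * 2 ^ (-i.2.1)) := by
        refine (norm_sum_le _ _).trans (sum_le_sum fun j _ => ?_)
        rw [norm_smul, norm_of_nonneg (two_zpow_pos _).le]
        split_ifs with hj
        · have h1 : ‖conv (ρ j) (piece M i j (F j)) x‖ ≤ K * (2 * B * 2 ^ i.1) :=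
            (norm_conv_le (hρ j) (hr j) fun y _ => norm_piece_le hne hB (hF j) i _).trans (by
              gcongr
              exact hK j)
          calc _ ≤ (2 : ℝ) ^ (-j) * (K * (2 * B * 2 ^ i.1)) := by
                gcongr
            _ = _ := by
                rw [zpow_sub₀ two_ne_zero, zpow_neg, zpow_neg]
                have := (two_zpow_pos i.2.1).ne'
                field_simp
        · rw [zero_mul]
          have : conv (ρ j) (piece M i j (F j)) x = 0 := by
            by_contra hcon
            exact hj (of_conv_piece_ne_zero hn hne (hr j) hcon).1
          rw [this, norm_zero, mul_zero]
    _ ≤ 2 * (2 * K * B * 2 ^ i.1 * 2 ^ (-i.2.1)) := by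
        rw [← sum_mul]
        gcongr
        exact sum_half_zpow_le S _
    _ = _ := by ring

theorem abs_levelDist_sub_sub_le {r : ℝ} (hy : ‖y‖ ≤ r) (k : ℤ) (x : Rn n) :
    |levelDist M k (x - y) - levelDist M k x| ≤ r :=
  (abs_levelDist_sub_le k _ _).trans (by simpa using hy)

theorem conv_piece_sub_eq (hρ : Continuous ρ) (hρc : HasCompactSupport ρ) {r : ℝ}
    (hr : ∀ z, r < ‖z‖ → ρ z = 0) {F : Rn n → Cm m} (hF : Continuous F)
    {i : Ix n}
    (hslab : ∀ y, ‖y‖ ≤ r → slab M j i.1 (x - y) = 1) :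
    conv ρ (piece M i j F) x - wt M i x • conv ρ F x =
      conv ρ (fun y => (wt M i y - wt M i x) • F y) x := by
  have e1 : conv ρ (piece M i j F) x = ∫ y, ρ y • (wt M i (x - y) • F (x - y)) := by
    unfold conv
    congr 1
    ext1 y
    by_cases hy : ‖y‖ ≤ r
    · rw [piece, hslab y hy, mul_one]
    · rw [hr y (not_le.1 hy), zero_smul, zero_smul]
  have e2 : wt M i x • conv ρ F x = ∫ y, ρ y • (wt M i x • F (x - y)) := by
    unfold conv
    rw [← integral_smul]
    congr 1
    ext1 y
    rw [smul_comm]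
  have i1 := integrable_conv hρ hρc
    (f := fun y => wt M i y • F y) ((continuous_wt i).smul hF).locallyIntegrable x
  have i2 := integrable_conv hρ hρc
    (f := fun y => wt M i x • F y) (hF.const_smul (wt M i x)).locallyIntegrable x
  rw [e1, e2, ← integral_sub i1 i2, conv]
  congr 1
  ext1 y
  rw [sub_smul, smul_sub]

/-- The conditions on the two distances make the slab equal to `1` on the whole convolution ball.
The weight then comes out of the convolution up to its oscillation over a distance `2 ^ (-j)`, which
is of order `2 ^ (l - j)`; for `l > j` the weight vanishes on the ball. -/
theorem norm_conv_piece_sub_le (hne : LowLevels M) (hB : 0 ≤ B) {F : Rn n → Cm m} (hFc : Continuous F)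
    (hF : ∀ x y, ‖x - y‖ ≤ 5 * 2 ^ (-j) → ‖F y‖ₑ ≤ ofReal B * M x)
    {K : ℝ} (hρ : Continuous ρ) (hρc : HasCompactSupport ρ) (hK : ∫ y, |ρ y| ≤ K)
    (hr : ∀ z, 2 ^ (-j) < ‖z‖ → ρ z = 0) (i : Ix n)
    (h1 : 4 * 2 ^ (-j) < levelDist M i.1 x) (h2 : levelDist M (i.1 + 1) x ≤ 2 * 2 ^ (-j)) :
    ‖conv ρ (piece M i j F) x - wt M i x • conv ρ F x‖ ≤
      (if i.2.1 ≤ j then (2 : ℝ) ^ (i.2.1 - j) else 0) *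
        (K * (2 + 8 * n ^ 2) * (2 * B * 2 ^ i.1)) := by
  have hj := two_zpow_pos (-j)
  have hk := two_zpow_pos i.1
  have hl := two_zpow_pos i.2.1
  have hρi : Integrable ρ := hρ.integrable_of_hasCompactSupport hρc
  have hslab : ∀ y, ‖y‖ ≤ 2 ^ (-j) → slab M j i.1 (x - y) = 1 := by
    intro y hy
    have h3 := abs_le.1 (abs_levelDist_sub_sub_le (M := M) hy i.1 x)
    have h4 := abs_le.1 (abs_levelDist_sub_sub_le (M := M) hy (i.1 + 1) x)
    rw [slab, if_pos (by linarith [h3.1]), if_neg (by linarith [h4.2]), sub_zero]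
  rw [conv_piece_sub_eq hρ hρc hr hFc hslab]
  split_ifs with hij
  · have h3 : ∀ y, ‖y‖ ≤ 2 ^ (-j) → ‖(wt M i (x - y) - wt M i x) • F (x - y)‖ ≤
        (2 + 8 * n ^ 2) * 2 ^ i.2.1 * 2 ^ (-j) * (2 * B * 2 ^ i.1) := by
      intro y hy
      have h4 := abs_le.1 (abs_levelDist_sub_sub_le (M := M) hy (i.1 + 1) x)
      have h5 : ‖F (x - y)‖ ≤ 2 * B * 2 ^ i.1 :=
        norm_le_of_levelDist_le hne hB (k := i.1) (y := x - y) (fun z hz => hF z (x - y) hz)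
          (by linarith [h4.2])
      have h6 := abs_wt_sub_le (M := M) i (x - y) x
      have e : x - y - x = -y := by abel
      rw [e, norm_neg] at h6
      have h7 : 0 ≤ (2 + 8 * (n : ℝ) ^ 2) * 2 ^ i.2.1 := mul_nonneg (by positivity) hl.le
      have h8 := h6.trans (mul_le_mul_of_nonneg_left hy h7)
      rw [norm_smul, norm_eq_abs]
      exact mul_le_mul h8 h5 (norm_nonneg _) (mul_nonneg h7 hj.le)
    refine (norm_conv_le (f := fun y => (wt M i y - wt M i x) • F y) hρi hr h3).trans ?_
    calc _ ≤ K * ((2 + 8 * n ^ 2) * 2 ^ i.2.1 * 2 ^ (-j) * (2 * B * 2 ^ i.1)) := by gcongr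
      _ = _ := by
          rw [zpow_sub₀ two_ne_zero, zpow_neg]
          ring
  · have hz : ∀ y, ‖y‖ ≤ 2 ^ (-j) → wt M i (x - y) = 0 := by
      intro y hy
      by_contra hw
      have h3 := abs_le.1 (abs_levelDist_sub_sub_le (M := M) hy i.1 x)
      exact hij (le_of_wt_ne_zero hw (by linarith [h3.1]))
    have h0 := hz 0 (by simpa using hj.le)
    rw [sub_zero] at h0
    have h3 : ∀ y, ‖y‖ ≤ 2 ^ (-j) → ‖(wt M i (x - y) - wt M i x) • F (x - y)‖ ≤ 0 := by
      intro y hy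
      rw [hz y hy, h0, sub_zero, zero_smul, norm_zero]
    refine (norm_conv_le (f := fun y => (wt M i y - wt M i x) • F y) hρi hr h3).trans ?_
    rw [mul_zero, zero_mul]

/-- Unless one of the two distances is comparable with `2 ^ (-j)`, the slab vanishes on the whole
convolution ball. The transitional scales get the trivial bound; there is at most one for each
distance. -/
theorem norm_conv_piece_le_of_not_full
    (hne : LowLevels M) (hB : 0 ≤ B) {F : Rn n → Cm m}
    (hF : ∀ x y, ‖x - y‖ ≤ 5 * 2 ^ (-j) → ‖F y‖ₑ ≤ ofReal B * M x)
    {K : ℝ} (hρ : Integrable ρ) (hK : ∫ y, |ρ y| ≤ K)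
    (hr : ∀ z, 2 ^ (-j) < ‖z‖ → ρ z = 0) (i : Ix n)
    (hf : ¬(4 * 2 ^ (-j) < levelDist M i.1 x ∧ levelDist M (i.1 + 1) x ≤ 2 * 2 ^ (-j))) :
    ‖conv ρ (piece M i j F) x‖ ≤
      (if 2 * 2 ^ (-j) < levelDist M i.1 x ∧ levelDist M i.1 x ≤ 4 * 2 ^ (-j) then
        K * (2 * B * 2 ^ i.1) else 0) +
      (if 2 * 2 ^ (-j) < levelDist M (i.1 + 1) x ∧ levelDist M (i.1 + 1) x ≤ 4 * 2 ^ (-j) then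
        K * (2 * B * 2 ^ i.1) else 0) := by
  have hj := two_zpow_pos (-j)
  have hk := two_zpow_pos i.1
  have hK0 : 0 ≤ K := (integral_nonneg fun y => abs_nonneg _).trans hK
  have hc : 0 ≤ K * (2 * B * 2 ^ i.1) := by positivity
  have n1 : ∀ P : Prop, [Decidable P] → 0 ≤ (if P then K * (2 * B * 2 ^ i.1) else 0) := by
    intro P _
    split_ifs <;> [exact hc; exact le_rfl]
  have hzero : (∀ y, ‖y‖ ≤ 2 ^ (-j) → slab M j i.1 (x - y) = 0) → conv ρ (piece M i j F) x = 0 := by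
    intro hs
    have h0 : ∀ y, ‖y‖ ≤ 2 ^ (-j) → ‖piece M i j F (x - y)‖ ≤ 0 := fun y hy => by
      rw [piece, hs y hy, mul_zero, zero_smul, norm_zero]
    have := norm_conv_le hρ hr h0
    rw [mul_zero] at this
    exact norm_le_zero_iff.1 this
  by_cases h1 : levelDist M i.1 x ≤ 2 * 2 ^ (-j)
  · rw [hzero, norm_zero]
    · exact add_nonneg (n1 _) (n1 _)
    · intro y hy
      by_contra hs
      have h2 := abs_le.1 (abs_levelDist_sub_sub_le (M := M) hy i.1 x)
      linarith [(lt_levelDist_of_slab_ne_zero hne hs).1, h2.2]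
  by_cases h2 : 4 * 2 ^ (-j) < levelDist M (i.1 + 1) x
  · rw [hzero, norm_zero]
    · exact add_nonneg (n1 _) (n1 _)
    · intro y hy
      by_contra hs
      have h2 := abs_le.1 (abs_levelDist_sub_sub_le (M := M) hy (i.1 + 1) x)
      linarith [(lt_levelDist_of_slab_ne_zero hne hs).2, h2.1]
  have h3 : ‖conv ρ (piece M i j F) x‖ ≤ K * (2 * B * 2 ^ i.1) :=
    (norm_conv_le hρ hr fun y _ => norm_piece_le hne hB hF i _).trans (by gcongr)
  rw [not_le] at h1
  rw [not_lt] at h2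
  by_cases h4 : levelDist M i.1 x ≤ 4 * 2 ^ (-j)
  · rw [if_pos (show _ ∧ _ from ⟨h1, h4⟩)]
    exact h3.trans (le_add_of_nonneg_right (n1 _))
  · have h5 : 2 * 2 ^ (-j) < levelDist M (i.1 + 1) x := by
      by_contra h5
      exact hf ⟨not_le.1 h4, not_lt.1 h5⟩
    rw [if_pos (show 2 * 2 ^ (-j) < levelDist M (i.1 + 1) x ∧
      levelDist M (i.1 + 1) x ≤ 4 * 2 ^ (-j) from ⟨h5, h2⟩)]
    exact h3.trans (le_add_of_nonneg_left (n1 _))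

/-- Sums of convolutions of pieces with kernels whose convolutions with the whole function
telescope. -/
theorem norm_sum_conv_piece_le
    (hne : LowLevels M) (hB : 0 ≤ B)
    {F V : ℤ → Rn n → Cm m} (hFc : ∀ j, Continuous (F j))
    (hF : ∀ j x y, ‖x - y‖ ≤ 5 * 2 ^ (-j) → ‖F j y‖ₑ ≤ ofReal B * M x)
    (hV : ∀ j x y, ‖x - y‖ ≤ 5 * 2 ^ (-j) → ‖V j y‖ₑ ≤ ofReal B * M x)
    {ρ : ℤ → Rn n → ℝ} {K : ℝ} (hρ : ∀ j, Continuous (ρ j)) (hK : ∀ j, ∫ y, |ρ j y| ≤ K)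
    (hr : ∀ j z, 2 ^ (-j) < ‖z‖ → ρ j z = 0)
    (hFV : ∀ j x, conv (ρ j) (F j) x = V (j + 1) x - V j x)
    (i : Ix n) (a b : ℤ) (x : Rn n) :
    ‖∑ j ∈ Finset.Ico a b, conv (ρ j) (piece M i j (F j)) x‖ ≤
      (4 + 4 * K + 4 * K * (2 + 8 * n ^ 2)) * B * 2 ^ i.1 := by
  classical
  have hk := two_zpow_pos i.1
  have hl := two_zpow_pos i.2.1
  have hK0 : 0 ≤ K := (integral_nonneg fun y => abs_nonneg _).trans (hK 0)
  have hρc : ∀ j, HasCompactSupport (ρ j) := fun j =>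
    HasCompactSupport.intro (isCompact_closedBall (0 : Rn n) (2 ^ (-j))) fun z hz =>
      hr j z (by simpa using hz)
  have hρi : ∀ j, Integrable (ρ j) := fun j => (hρ j).integrable_of_hasCompactSupport (hρc j)
  set β := 2 * B * 2 ^ i.1 with hβ
  have hβ0 : 0 ≤ β := by positivity
  set D := levelDist M i.1 x
  set D' := levelDist M (i.1 + 1) x
  set L : ℝ := 2 + 8 * n ^ 2
  -- At these scales the slab is `1` on the ball of radius `2 ^ (-j)` about `x`. They form an order
  -- convex set, so the main terms `wt M i x • (V (j + 1) x - V j x)` telescope over them.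
  let full : ℤ → Prop := fun j => 4 * 2 ^ (-j) < D ∧ D' ≤ 2 * 2 ^ (-j)
  have main : ∀ j, ‖conv (ρ j) (piece M i j (F j)) x -
      (if full j then wt M i x • (V (j + 1) x - V j x) else 0)‖ ≤
      (if 2 * 2 ^ (-j) < D ∧ D ≤ 4 * 2 ^ (-j) then K * β else 0) +
      (if 2 * 2 ^ (-j) < D' ∧ D' ≤ 4 * 2 ^ (-j) then K * β else 0) +
      (if i.2.1 ≤ j then (2 : ℝ) ^ (i.2.1 - j) else 0) * (K * L * β) := by
    intro j
    have hc : 0 ≤ K * β := by positivity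
    have n1 : ∀ P : Prop, [Decidable P] → 0 ≤ (if P then K * β else 0) := by
      intro P _
      split_ifs <;> [exact hc; exact le_rfl]
    have n3 : 0 ≤ (if i.2.1 ≤ j then (2 : ℝ) ^ (i.2.1 - j) else 0) * (K * L * β) := by
      split_ifs
      · have := two_zpow_pos (i.2.1 - j)
        positivity
      · rw [zero_mul]
    by_cases hf : full j
    · rw [if_pos hf, ← hFV]
      exact (norm_conv_piece_sub_le hne hB (hFc j) (hF j) (hρ j) (hρc j) (hK j) (hr j) i
        hf.1 hf.2).trans (le_add_of_nonneg_left (add_nonneg (n1 _) (n1 _)))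
    · rw [if_neg hf, sub_zero]
      exact (norm_conv_piece_le_of_not_full hne hB (hF j) (hρi j) (hK j) (hr j) i hf).trans
        (le_add_of_nonneg_right n3)
  have htel : ‖∑ j ∈ (Finset.Ico a b).filter full, (V (j + 1) x - V j x)‖ ≤ 2 * β := by
    refine norm_sum_filter_telescope_le (V := fun j => V j x) hβ0 (fun j₁ j j₂ h1 h2 hf1 hf2 => ?_)
      (fun j hf => ?_) (fun j hf => ?_) a b
    · have h3 : (2 : ℝ) ^ (-j) ≤ 2 ^ (-j₁) := zpow_le_zpow_right₀ one_le_two (by omega)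
      have h4 : (2 : ℝ) ^ (-j₂) ≤ 2 ^ (-j) := zpow_le_zpow_right₀ one_le_two (by omega)
      exact ⟨by linarith [hf1.1], by linarith [hf2.2]⟩
    · have hj := two_zpow_pos (-j)
      exact norm_le_of_levelDist_le hne hB (fun z hz => hV j z _ hz) (by
        have := hf.2
        change D' ≤ _
        linarith)
    -- At scale `j + 1` the admissible distance is `4 * 2 ^ (-(j + 1)) = 2 * 2 ^ (-j)`, exactly the
    -- bound contained in `full`.
    · refine norm_le_of_levelDist_le hne hB (fun z hz => hV (j + 1) z _ hz) ?_
      have := hf.2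
      change D' ≤ _
      rw [neg_add, ← sub_eq_add_neg, zpow_sub_one₀ two_ne_zero]
      linarith
  have hsplit : ∑ j ∈ Finset.Ico a b, conv (ρ j) (piece M i j (F j)) x =
      ∑ j ∈ Finset.Ico a b, (conv (ρ j) (piece M i j (F j)) x -
        (if full j then wt M i x • (V (j + 1) x - V j x) else 0)) +
      wt M i x • ∑ j ∈ (Finset.Ico a b).filter full, (V (j + 1) x - V j x) := by
    rw [Finset.sum_sub_distrib, smul_sum, sum_filter]
    abel
  rw [hsplit]
  refine (norm_add_le _ _).trans ?_
  have b1 : ‖∑ j ∈ Finset.Ico a b, (conv (ρ j) (piece M i j (F j)) x -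
        (if full j then wt M i x • (V (j + 1) x - V j x) else 0))‖ ≤
      K * β + K * β + 2 * (K * L * β) := by
    refine (norm_sum_le _ _).trans ((sum_le_sum fun j _ => main j).trans ?_)
    rw [sum_add_distrib, sum_add_distrib, ← sum_mul]
    gcongr
    · exact sum_dyadic_window_le _ _ (by positivity)
    · exact sum_dyadic_window_le _ _ (by positivity)
    · exact sum_half_zpow_le _ _
  have b2 : ‖wt M i x • ∑ j ∈ (Finset.Ico a b).filter full, (V (j + 1) x - V j x)‖ ≤ 2 * β := by
    rw [norm_smul, norm_eq_abs]
    calc _ ≤ 1 * (2 * β) := by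
          gcongr
          exact abs_wt_le_one i x
      _ = _ := one_mul _
  calc _ ≤ K * β + K * β + 2 * (K * L * β) + 2 * β := by linarith
    _ = _ := by rw [hβ]; ring

/-! ### Kernels of the reproducing formula -/

section Parametric

variable {X : Type} [NormedAddCommGroup X] [NormedSpace ℝ X] [FiniteDimensional ℝ X]

theorem hasFDerivAt_intervalIntegral_of_contDiff {E : Type} [NormedAddCommGroup E] [NormedSpace ℝ E]
    [CompleteSpace E] {g : ℝ × X → E} (hg : ContDiff ℝ 1 g) (a b : ℝ) (x : X) :
    HasFDerivAt (fun x => ∫ τ in a..b, g (τ, x))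
      (∫ τ in a..b, (fderiv ℝ g (τ, x)).comp (inr ℝ ℝ X)) x := by
  have hD : Continuous fun p : ℝ × X => (fderiv ℝ g p).comp (inr ℝ ℝ X) :=
    (hg.continuous_fderiv (by simp)).clm_comp continuous_const
  have : ProperSpace X := FiniteDimensional.proper_real X
  obtain ⟨C, hC⟩ := (isCompact_uIcc (a := a) (b := b)).prod (isCompact_closedBall x 1)
    |>.exists_bound_of_continuousOn hD.continuousOn
  have h1 : ∀ y : X, Continuous fun τ : ℝ => (τ, y) := fun y => by fun_prop
  refine intervalIntegral.hasFDerivAt_integral_of_dominated_of_fderiv_le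
    (F := fun y τ => g (τ, y)) (bound := fun _ => C)
    (F' := fun y τ => (fderiv ℝ g (τ, y)).comp (inr ℝ ℝ X))
    (Metric.ball_mem_nhds x one_pos)
    (Eventually.of_forall fun y => (hg.continuous.comp (h1 y)).aestronglyMeasurable)
    ((hg.continuous.comp (h1 x)).intervalIntegrable _ _) (hD.comp (h1 x)).aestronglyMeasurable
    (ae_of_all _ fun τ hτ y hy => hC (τ, y) ⟨Set.uIoc_subset_uIcc hτ, ball_subset_closedBall hy⟩)
    intervalIntegrable_const (ae_of_all _ fun τ _ y _ => ?_)
  have h2 : HasFDerivAt (fun y : X => (τ, y)) (inr ℝ ℝ X) y := hasFDerivAt_prodMk_right τ y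
  exact ((hg.differentiable (by simp) (τ, y)).hasFDerivAt).comp y h2

/-- Differentiation under the integral, iterated. The induction runs over all target spaces at once,
because the derivative of the integrand takes values in a space of linear maps. -/
theorem contDiff_intervalIntegral (k : ℕ) : ∀ {E : Type} [NormedAddCommGroup E] [NormedSpace ℝ E]
    [CompleteSpace E] {g : ℝ × X → E}, ContDiff ℝ ∞ g → ∀ a b : ℝ,
    ContDiff ℝ k (fun x => ∫ τ in a..b, g (τ, x)) := by
  induction k with
  | zero =>
    intro E _ _ _ g hg a b
    exact contDiff_zero.2 (continuous_iff_continuousAt.2 fun x =>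
      (hasFDerivAt_intervalIntegral_of_contDiff (hg.of_le (by simp)) a b x).continuousAt)
  | succ k ih =>
    intro E _ _ _ g hg a b
    have h := fun x => hasFDerivAt_intervalIntegral_of_contDiff (hg.of_le (by simp)) a b x
    rw [show ((k + 1 : ℕ) : WithTop ℕ∞) = k + 1 by norm_cast, contDiff_succ_iff_fderiv]
    refine ⟨fun x => (h x).differentiableAt, by simp, ?_⟩
    have e : fderiv ℝ (fun x => ∫ τ in a..b, g (τ, x)) = fun x =>
        ∫ τ in a..b, (fderiv ℝ g (τ, x)).comp (inr ℝ ℝ X) :=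
      funext fun x => (h x).fderiv
    rw [e]
    exact ih (g := fun p => (fderiv ℝ g p).comp (inr ℝ ℝ X))
      ((hg.fderiv_right (by simp)).clm_comp contDiff_const) a b

end Parametric

/-- A mollifier supported in the unit ball. -/
def eta (n : ℕ) : Rn n → ℝ :=
  (⟨1 / 2, 1, by norm_num, by norm_num⟩ : ContDiffBump (0 : Rn n)).normed volume

theorem contDiff_eta : ContDiff ℝ ∞ (eta n) := ContDiffBump.contDiff_normed _

theorem hasCompactSupport_eta : HasCompactSupport (eta n) := ContDiffBump.hasCompactSupport_normed _

theorem integral_eta : ∫ x, eta n x = 1 := ContDiffBump.integral_normed _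

theorem eta_eq_zero {z : Rn n} (h : 1 ≤ ‖z‖) : eta n z = 0 := by
  by_contra hz
  have : z ∈ Function.support (eta n) := hz
  rw [eta, ContDiffBump.support_normed_eq, mem_ball_zero_iff] at this
  exact absurd h (not_le.2 this)

/-- A vector field with divergence `dilate 1 (eta n) - eta n` is `x ↦ radial x • x`. -/
def radial (n : ℕ) (x : Rn n) : ℝ := ∫ τ in (1 : ℝ)..2, τ ^ (n - 1) * eta n (τ • x)

theorem contDiff_radial_aux : ContDiff ℝ ∞ fun p : ℝ × Rn n => p.1 ^ (n - 1) * eta n (p.1 • p.2) :=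
  (contDiff_fst.pow _).mul (contDiff_eta.comp (contDiff_fst.smul contDiff_snd))

theorem contDiff_radial : ContDiff ℝ ∞ (radial n) :=
  contDiff_infty.2 fun k => contDiff_intervalIntegral k contDiff_radial_aux 1 2

theorem radial_eq_zero {z : Rn n} (h : 1 ≤ ‖z‖) : radial n z = 0 := by
  unfold radial
  rw [intervalIntegral.integral_congr (g := fun _ => (0 : ℝ)), intervalIntegral.integral_zero]
  intro τ hτ
  rw [Set.uIcc_of_le one_le_two] at hτ
  simp only
  rw [eta_eq_zero, mul_zero]
  rw [norm_smul, norm_of_nonneg (by linarith [hτ.1])]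
  nlinarith [hτ.1]

/-- The left-hand side is the divergence of `x ↦ radial x • x`. Under the integral it becomes the
`τ`-derivative of `τ ^ n * eta (τ • x)`, so the fundamental theorem of calculus on `[1, 2]` applies.
-/
theorem radial_add_fderiv (hn : 1 ≤ n) (x : Rn n) :
    n * radial n x + fderiv ℝ (radial n) x x = 2 ^ n * eta n ((2 : ℝ) • x) - eta n x := by
  have hd := hasFDerivAt_intervalIntegral_of_contDiff
    (contDiff_radial_aux (n := n).of_le (by simp)) 1 2 x
  have hD : Continuous fun τ : ℝ => (fderiv ℝ (fun p : ℝ × Rn n => p.1 ^ (n - 1) * eta n (p.1 • p.2))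
      (τ, x)).comp (inr ℝ ℝ (Rn n)) :=
    ((contDiff_radial_aux.continuous_fderiv (by simp)).clm_comp continuous_const).comp
      (f := fun τ : ℝ => (τ, x)) (by fun_prop)
  have e1 : fderiv ℝ (radial n) x x = ∫ τ in (1 : ℝ)..2, τ ^ n * fderiv ℝ (eta n) (τ • x) x := by
    change fderiv ℝ (fun x => ∫ τ in (1 : ℝ)..2, τ ^ (n - 1) * eta n (τ • x)) x x = _
    rw [hd.fderiv, ContinuousLinearMap.intervalIntegral_apply (hD.intervalIntegrable _ _)]
    refine intervalIntegral.integral_congr fun τ _ => ?_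
    have h1 : HasFDerivAt (fun y : Rn n => τ ^ (n - 1) * eta n (τ • y))
        (τ ^ (n - 1) • ((fderiv ℝ (eta n) (τ • x)).comp (τ • ContinuousLinearMap.id ℝ (Rn n)))) x :=
      (((contDiff_eta.differentiable (by simp) (τ • x)).hasFDerivAt).comp x
        ((hasFDerivAt_id x).const_smul τ)).const_mul _
    have h2 : HasFDerivAt (fun y : Rn n => τ ^ (n - 1) * eta n (τ • y))
        ((fderiv ℝ (fun p : ℝ × Rn n => p.1 ^ (n - 1) * eta n (p.1 • p.2)) (τ, x)).comp
          (inr ℝ ℝ (Rn n))) x :=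
      ((contDiff_radial_aux.differentiable (by simp) (τ, x)).hasFDerivAt).comp x
        (hasFDerivAt_prodMk_right τ x)
    simp only
    rw [h2.unique h1]
    simp only [smul_apply, ContinuousLinearMap.comp_apply,
      ContinuousLinearMap.id_apply, map_smul, smul_eq_mul]
    obtain ⟨k, rfl⟩ : ∃ k, n = k + 1 := ⟨n - 1, by omega⟩
    rw [Nat.add_sub_cancel, pow_succ]
    ring
  have hder : ∀ τ : ℝ, HasDerivAt (fun τ : ℝ => τ ^ n * eta n (τ • x))
      (n * τ ^ (n - 1) * eta n (τ • x) + τ ^ n * fderiv ℝ (eta n) (τ • x) x) τ := by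
    intro τ
    refine (hasDerivAt_pow n τ).mul ?_
    have := ((contDiff_eta (n := n)).differentiable (by simp) (τ • x)).hasFDerivAt.comp_hasDerivAt τ
      ((hasDerivAt_id τ).smul_const x)
    exact this.congr_deriv (by simp)
  have c1 : Continuous fun τ : ℝ => τ ^ (n - 1) * eta n (τ • x) := by
    have := contDiff_eta (n := n).continuous
    fun_prop
  have c2 : Continuous fun τ : ℝ => τ ^ n * fderiv ℝ (eta n) (τ • x) x := by
    have := (contDiff_eta (n := n)).continuous_fderiv (by simp)
    exact (continuous_pow n).mul ((this.comp (by fun_prop)).clm_apply continuous_const)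
  have hftc := intervalIntegral.integral_eq_sub_of_hasDerivAt (a := 1) (b := 2)
    (fun τ _ => hder τ) (Continuous.intervalIntegrable (by
      simp_rw [mul_assoc]
      exact (continuous_const.mul c1).add c2) _ _)
  have c3 : Continuous fun τ : ℝ => (n : ℝ) * (τ ^ (n - 1) * eta n (τ • x)) :=
    continuous_const.mul c1
  rw [e1, radial, ← intervalIntegral.integral_const_mul, ← intervalIntegral.integral_add
    (c3.intervalIntegrable _ _) (c2.intervalIntegrable _ _)]
  simp only [one_pow, one_smul, one_mul] at hftc
  rw [← hftc]
  simp_rw [mul_assoc]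

/-- Vector field with divergence `dilate 1 (eta n) - eta n`. -/
def kap (q : Fin n) (x : Rn n) : ℝ := x q * radial n x

theorem contDiff_kap (q : Fin n) : ContDiff ℝ ∞ (kap q) :=
  (contDiff_piLp_apply (p := 2)).mul contDiff_radial

theorem kap_eq_zero {q : Fin n} {z : Rn n} (h : 1 ≤ ‖z‖) : kap q z = 0 := by
  rw [kap, radial_eq_zero h, mul_zero]

theorem hasCompactSupport_of_eq_zero (h : ∀ z, 1 ≤ ‖z‖ → φ z = 0) : HasCompactSupport φ :=
  HasCompactSupport.intro (isCompact_closedBall (0 : Rn n) 1) fun z hz =>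
    h z (by simpa using (not_le.1 fun hle => hz (by simpa using hle)).le)

theorem hasCompactSupport_kap (q : Fin n) : HasCompactSupport (kap q) :=
  hasCompactSupport_of_eq_zero fun _ => kap_eq_zero

/-- The kernel of the difference of consecutive averages. -/
def psi (n : ℕ) (x : Rn n) : ℝ := dilate 1 (eta n) x - eta n x

/-- The kernel of the sum of consecutive averages. -/
def theta (n : ℕ) (x : Rn n) : ℝ := dilate 1 (eta n) x + eta n x

theorem sum_fderiv_kap (hn : 1 ≤ n) (x : Rn n) :
    ∑ q, fderiv ℝ (kap q) x (single q 1) = psi n x := by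
  have h1 : ∀ q : Fin n, fderiv ℝ (kap q) x (single q 1) =
      radial n x + x q * fderiv ℝ (radial n) x (single q 1) := by
    intro q
    have h2 : HasFDerivAt (fun x : Rn n => x q) (proj q : Rn n →L[ℝ] ℝ) x :=
      (proj q : Rn n →L[ℝ] ℝ).hasFDerivAt
    have h3 := h2.fun_mul ((contDiff_radial.differentiable (by simp)) x).hasFDerivAt
    change fderiv ℝ (fun x => x q * radial n x) x _ = _
    rw [h3.fderiv]
    simp
    ring
  simp_rw [h1]
  rw [sum_add_distrib, sum_const, Finset.card_univ, Fintype.card_fin, nsmul_eq_mul]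
  have h4 : ∑ q, x q * fderiv ℝ (radial n) x (single q 1) = fderiv ℝ (radial n) x x := by
    have key : ∀ L : Rn n →L[ℝ] ℝ, ∑ q, x q * L (single q 1) = L x := by
      intro L
      have : x = ∑ j, x j • single j (1 : ℝ) := by
        ext i
        simp [Finset.sum_apply, Pi.single_apply]
      conv_rhs => rw [this, map_sum]
      simp
    exact key _
  rw [h4, radial_add_fderiv hn, psi, dilate]
  simp

theorem dilate_eq_zero (h : ∀ z, 1 ≤ ‖z‖ → φ z = 0) (j : ℤ) (z : Rn n)
    (hz : 2 ^ (-j) < ‖z‖) : dilate j φ z = 0 := by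
  rw [dilate, h, mul_zero]
  rw [norm_smul, norm_of_nonneg (two_zpow_pos j).le]
  rw [zpow_neg, inv_lt_iff_one_lt_mul₀ (two_zpow_pos j), mul_comm] at hz
  exact hz.le

theorem integral_abs_dilate (j : ℤ) (φ : Rn n → ℝ) : ∫ y, |dilate j φ y| = ∫ y, |φ y| := by
  have := integral_dilate_smul j (fun y => |φ y|) fun _ : Rn n => (1 : ℝ)
  simpa [dilate, abs_mul, abs_of_pos (two_zpow_pos j)] using this

theorem fderiv_dilate (hs : ContDiff ℝ ∞ φ) (j : ℤ) (x v : Rn n) :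
    fderiv ℝ (dilate j φ) x v = 2 ^ j * dilate j (fun y => fderiv ℝ φ y v) x := by
  have h : HasFDerivAt (dilate j φ) (((2 : ℝ) ^ j) ^ n •
      (fderiv ℝ φ ((2 : ℝ) ^ j • x)).comp ((2 : ℝ) ^ j • ContinuousLinearMap.id ℝ (Rn n))) x :=
    (((hs.differentiable (by simp) _).hasFDerivAt).comp x
      ((hasFDerivAt_id x).const_smul ((2 : ℝ) ^ j))).const_mul _
  rw [h.fderiv]
  simp [dilate]
  ring

theorem conv_dilate (j : ℤ) (φ φ' : Rn n → ℝ) :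
    conv (dilate j φ) (dilate j φ') = dilate j (conv φ φ') := by
  ext x
  rw [conv, integral_dilate_smul j φ fun y => dilate j φ' (x - y), dilate, conv,
    ← integral_const_mul]
  refine integral_congr_ae (ae_of_all _ fun v => ?_)
  simp only [dilate, smul_eq_mul, smul_sub, smul_smul]
  rw [← zpow_add₀ two_ne_zero, add_neg_cancel, zpow_zero, one_smul]
  ring

theorem dilate_dilate (j k : ℤ) (φ : Rn n → ℝ) : dilate j (dilate k φ) = dilate (j + k) φ := by
  ext x
  simp only [dilate, smul_smul]
  rw [← zpow_add₀ two_ne_zero, add_comm k j, zpow_add₀ two_ne_zero]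
  ring

theorem conv_comm_real (a b : Rn n → ℝ) : conv a b = conv b a := by
  ext x
  rw [conv_eq_integral_sub, conv]
  exact integral_congr_ae (ae_of_all _ fun y => mul_comm _ _)

theorem contDiff_psi : ContDiff ℝ ∞ (psi n) := (contDiff_dilate contDiff_eta 1).sub contDiff_eta

theorem contDiff_theta : ContDiff ℝ ∞ (theta n) := (contDiff_dilate contDiff_eta 1).add contDiff_eta

theorem dilate_one_eta_eq_zero {z : Rn n} (h : 1 ≤ ‖z‖) : dilate 1 (eta n) z = 0 :=
  dilate_eq_zero (fun _ => eta_eq_zero) 1 z (lt_of_lt_of_le (by norm_num) h)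

theorem psi_eq_zero {z : Rn n} (h : 1 ≤ ‖z‖) : psi n z = 0 := by
  rw [psi, dilate_one_eta_eq_zero h, eta_eq_zero h, sub_zero]

theorem theta_eq_zero {z : Rn n} (h : 1 ≤ ‖z‖) : theta n z = 0 := by
  rw [theta, dilate_one_eta_eq_zero h, eta_eq_zero h, add_zero]

theorem hasCompactSupport_psi : HasCompactSupport (psi n) :=
  hasCompactSupport_of_eq_zero fun _ => psi_eq_zero

theorem hasCompactSupport_theta : HasCompactSupport (theta n) :=
  hasCompactSupport_of_eq_zero fun _ => theta_eq_zero

theorem integral_dilate (j : ℤ) (φ : Rn n → ℝ) : ∫ y, dilate j φ y = ∫ y, φ y := by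
  simpa using integral_dilate_smul j φ fun _ : Rn n => (1 : ℝ)

theorem integral_psi : ∫ y, psi n y = 0 := by
  simp only [psi]
  rw [integral_sub ((contDiff_dilate contDiff_eta 1).continuous.integrable_of_hasCompactSupport
    (hasCompactSupport_dilate hasCompactSupport_eta 1))
    (contDiff_eta.continuous.integrable_of_hasCompactSupport hasCompactSupport_eta),
    integral_dilate, sub_self]

/-- The mollifier whose dyadic dilates telescope. -/
def phi (n : ℕ) : Rn n → ℝ := conv (eta n) (eta n)

theorem contDiff_phi : ContDiff ℝ ∞ (phi n) :=
  contDiff_conv contDiff_eta hasCompactSupport_eta contDiff_eta.continuous.locallyIntegrable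

theorem hasCompactSupport_phi : HasCompactSupport (phi n) :=
  hasCompactSupport_conv hasCompactSupport_eta hasCompactSupport_eta

theorem integral_conv {E : Type*} [NormedAddCommGroup E] [NormedSpace ℝ E] [CompleteSpace E]
    {f : Rn n → E} (hρ : Integrable ρ) (hf : Integrable f) :
    ∫ x, conv ρ f x = (∫ x, ρ x) • ∫ x, f x := by
  rw [conv_eq]
  exact integral_convolution (L := lsmul ℝ ℝ) hρ hf

theorem integral_phi : ∫ x, phi n x = 1 := by
  have h : Integrable (eta n) :=
    contDiff_eta.continuous.integrable_of_hasCompactSupport hasCompactSupport_eta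
  rw [phi, integral_conv h h, integral_eta, one_smul]

/-- Convolution is commutative, so this is `(a - b) * (a + b) = a * a - b * b` with `a` the dilate
of `b = eta`. -/
theorem conv_psi_theta (x : Rn n) : conv (psi n) (theta n) x = dilate 1 (phi n) x - phi n x := by
  have ca := contDiff_dilate (contDiff_eta (n := n)) 1
  have ha := hasCompactSupport_dilate (hasCompactSupport_eta (n := n)) 1
  have cb := contDiff_eta (n := n)
  have hb := hasCompactSupport_eta (n := n)
  have i := fun (u v : Rn n → ℝ) (hu : ContDiff ℝ ∞ u) (hu' : HasCompactSupport u)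
    (hv : ContDiff ℝ ∞ v) => integrable_conv (f := v) hu.continuous hu'
      hv.continuous.locallyIntegrable x
  have e := congrFun (conv_comm_real (dilate 1 (eta n)) (eta n)) x
  rw [phi, ← conv_dilate]
  have : conv (psi n) (theta n) x = (conv (dilate 1 (eta n)) (dilate 1 (eta n)) x +
      conv (dilate 1 (eta n)) (eta n) x) - (conv (eta n) (dilate 1 (eta n)) x +
        conv (eta n) (eta n) x) := by
    simp only [conv]
    rw [← integral_add (i _ _ ca ha ca) (i _ _ ca ha cb), ← integral_add (i _ _ cb hb ca)
      (i _ _ cb hb cb)]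
    refine Eq.trans (integral_congr_ae (ae_of_all _ fun y => ?_)) (integral_sub
      ((i _ _ ca ha ca).add (i _ _ ca ha cb)) ((i _ _ cb hb ca).add (i _ _ cb hb cb)))
    simp only [psi, theta, smul_eq_mul]
    ring
  rw [this, e]
  ring

theorem conv_dilate_psi_theta (j : ℤ) (x : Rn n) : conv (dilate j (psi n)) (dilate j (theta n)) x =
    dilate (j + 1) (phi n) x - dilate j (phi n) x := by
  rw [conv_dilate, ← dilate_dilate]
  simp only [dilate]
  rw [conv_psi_theta]
  simp only [dilate]
  ring

/-- Partial derivative. -/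
def pd (q : Fin n) (φ : Rn n → ℝ) (x : Rn n) : ℝ := fderiv ℝ φ x (single q 1)

theorem contDiff_pd (h : ContDiff ℝ ∞ φ) (q : Fin n) : ContDiff ℝ ∞ (pd q φ) :=
  (h.fderiv_right (by simp)).clm_apply contDiff_const

theorem hasCompactSupport_pd (h : HasCompactSupport φ) (q : Fin n) : HasCompactSupport (pd q φ) :=
  h.fderiv_apply (𝕜 := ℝ) _

/-- The only issue is the sphere `‖z‖ = 1`. The set where the derivative is nonzero is open and
contained in the closed unit ball, hence in the open one. -/
theorem pd_eq_zero (h : ContDiff ℝ ∞ φ) (h0 : ∀ z, 1 ≤ ‖z‖ → φ z = 0) (q : Fin n)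
    (z : Rn n) (hz : 1 ≤ ‖z‖) : pd q φ z = 0 := by
  have hs : tsupport (pd q φ) ⊆ closedBall 0 1 :=
    (tsupport_fderiv_apply_subset ℝ _).trans (closure_minimal (fun y hy => by
      rw [mem_closedBall_zero_iff]
      exact (not_le.1 fun hle => hy (h0 y hle)).le) isClosed_closedBall)
  have hop : IsOpen {y | pd q φ y ≠ 0} :=
    isOpen_ne_fun (contDiff_pd h q).continuous continuous_const
  by_contra hne
  have hsub : {y | pd q φ y ≠ 0} ⊆ interior (closedBall (0 : Rn n) 1) :=
    interior_maximal ((subset_tsupport _).trans hs) hop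
  have := hsub hne
  rw [interior_closedBall _ one_ne_zero, mem_ball_zero_iff] at this
  linarith

theorem pd_dilate (hs : ContDiff ℝ ∞ φ) (j : ℤ) (q : Fin n) :
    pd q (dilate j φ) = fun x => 2 ^ j * dilate j (pd q φ) x :=
  funext fun x => fderiv_dilate hs j x _

theorem conv_pd_comm {a b : Rn n → ℝ} (ha : ContDiff ℝ ∞ a) (ha' : HasCompactSupport a)
    (hb : ContDiff ℝ ∞ b) (hb' : HasCompactSupport b) (q : Fin n) :
    conv (pd q a) b = pd q (conv a b) ∧ conv a (pd q b) = pd q (conv a b) := by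
  refine ⟨funext fun x => (fderiv_conv_apply ha ha' hb.continuous.locallyIntegrable x _).symm,
    funext fun x => ?_⟩
  rw [conv_comm_real a, conv_comm_real a]
  exact (fderiv_conv_apply hb hb' ha.continuous.locallyIntegrable x _).symm

/-! ### Divergence free fields and uniqueness from boundary distributions -/

theorem fderiv_apply_comm {X : Type*} [NormedAddCommGroup X] [NormedSpace ℝ X] {h : X → ℝ}
    (hs : ContDiff ℝ ∞ h) (x v w : X) :
    fderiv ℝ (fun z => fderiv ℝ h z v) x w = fderiv ℝ (fun z => fderiv ℝ h z w) x v := by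
  have hf : ContDiff ℝ ∞ (fderiv ℝ h) := hs.fderiv_right (by simp)
  have hd := hf.differentiable (by simp) x
  rw [fderiv_clm_apply hd (differentiableAt_const v), fderiv_clm_apply hd (differentiableAt_const w)]
  simp only [fderiv_fun_const, Pi.zero_apply, ContinuousLinearMap.comp_zero, zero_add,
    ContinuousLinearMap.flip_apply]
  refine (hs.contDiffAt.isSymmSndFDerivAt ?_).eq _ _
  rw [minSmoothness_of_isRCLikeNormedField]
  exact show ((2 : ℕ∞) : WithTop ℕ∞) ≤ ((⊤ : ℕ∞) : WithTop ℕ∞) from WithTop.coe_le_coe.2 le_top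

/-- A weak gradient is weakly curl free: test it with derivatives of `φ` and use the symmetry of
second derivatives. -/
theorem IsEnergy.integral_mul_fderiv_comm
    (h : IsEnergy u G) {φ : Pt n → ℝ} (hφ : ContDiff ℝ ∞ φ) (hc : HasCompactSupport φ)
    (hs : tsupport φ ⊆ upper n) (i k : Fin (n + 1)) (α : Fin m) :
    ∫ z in upper n, G z i α * (fderiv ℝ φ z (dir k) : ℂ) =
      ∫ z in upper n, G z k α * (fderiv ℝ φ z (dir i) : ℂ) := by
  have hf : ContDiff ℝ ∞ (fderiv ℝ φ) := hφ.fderiv_right (by simp)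
  have hsm : ∀ k, ContDiff ℝ ∞ fun z => fderiv ℝ φ z (dir k) := fun k => hf.clm_apply contDiff_const
  have key : ∀ i k : Fin (n + 1),
      ∫ z in upper n, u z α * (fderiv ℝ (fun z => fderiv ℝ φ z (dir k)) z (dir i) : ℂ) =
        -∫ z in upper n, G z i α * (fderiv ℝ φ z (dir k) : ℂ) := fun i k =>
    h.weakGrad i α _ (hsm k)
      (hc.fderiv_apply (𝕜 := ℝ) _) ((tsupport_fderiv_apply_subset ℝ _).trans hs)
  rw [← neg_inj, ← key, ← key]
  simp only [fderiv_apply_comm hφ _ (dir i)]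

theorem IsEnergy.integral_mul_conj_fderiv_comm
    (h : IsEnergy u G) {φ : Pt n → ℂ} (hφ : ContDiff ℝ ∞ φ) (hc : HasCompactSupport φ)
    (hs : tsupport φ ⊆ upper n) (i k : Fin (n + 1)) (α : Fin m) :
    ∫ z in upper n, G z i α * (starRingEnd ℂ) (fderiv ℝ φ z (dir k)) =
      ∫ z in upper n, G z k α * (starRingEnd ℂ) (fderiv ℝ φ z (dir i)) := by
  have part : ∀ L : ℂ →L[ℝ] ℝ, ContDiff ℝ ∞ (fun z => L (φ z)) ∧
      HasCompactSupport (fun z => L (φ z)) ∧ tsupport (fun z => L (φ z)) ⊆ upper n ∧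
      ∀ z v, fderiv ℝ (fun z => L (φ z)) z v = L (fderiv ℝ φ z v) := fun L =>
    ⟨L.contDiff.comp hφ, hc.comp_left (map_zero L),
      (closure_mono (Function.support_comp_subset (map_zero L) φ)).trans hs, fun z v => by
        rw [show (fun z => L (φ z)) = L ∘ φ from rfl,
          (L.hasFDerivAt.comp z (hφ.differentiable (by simp) z).hasFDerivAt).fderiv]
        rfl⟩
  have hint : ∀ (L : ℂ →L[ℝ] ℝ) (i k : Fin (n + 1)), Integrable (fun z => G z i α *
      ((L (fderiv ℝ φ z (dir k)) : ℝ) : ℂ)) (upperMeasure n) := fun L i k => by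
    have h1 : Continuous fun z => ((L (fderiv ℝ φ z (dir k)) : ℝ) : ℂ) :=
      continuous_ofReal.comp (L.continuous.comp (continuous_fderiv_apply hφ _))
    have h2 : HasCompactSupport fun z => ((L (fderiv ℝ φ z (dir k)) : ℝ) : ℂ) :=
      (hc.fderiv_apply (𝕜 := ℝ) (dir k)).comp_left (g := fun w => ((L w : ℝ) : ℂ)) (by simp)
    have h3 : MemLp (fun z => ((L (fderiv ℝ φ z (dir k)) : ℝ) : ℂ)) 2 (upperMeasure n) :=
      h1.memLp_of_hasCompactSupport h2
    exact (h.gradL2 i α).integrable_mul h3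
  have split : ∀ i k : Fin (n + 1),
      ∫ z in upper n, G z i α * (starRingEnd ℂ) (fderiv ℝ φ z (dir k)) =
        (∫ z in upper n, G z i α * ((Complex.reCLM (fderiv ℝ φ z (dir k)) : ℝ) : ℂ)) -
        (∫ z in upper n, G z i α * ((Complex.imCLM (fderiv ℝ φ z (dir k)) : ℝ) : ℂ)) *
          Complex.I := by
    intro i k
    rw [← integral_mul_const, ← integral_sub (hint _ i k) ((hint _ i k).mul_const _)]
    refine integral_congr_ae (ae_of_all _ fun z => ?_)
    simp only [Complex.reCLM_apply, Complex.imCLM_apply]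
    rw [mul_assoc, ← mul_sub]
    congr 1
    apply Complex.ext <;> simp
  have comm : ∀ L : ℂ →L[ℝ] ℝ, ∫ z in upper n, G z i α * ((L (fderiv ℝ φ z (dir k)) : ℝ) : ℂ) =
      ∫ z in upper n, G z k α * ((L (fderiv ℝ φ z (dir i)) : ℝ) : ℂ) := fun L => by
    obtain ⟨h1, h2, h3, h4⟩ := part L
    simp_rw [← h4]
    exact h.integral_mul_fderiv_comm h1 h2 h3 i k α
  rw [split, split, comm, comm]

/-- A gradient is curl free, which says precisely that its rotations are divergence free; tested on
gradients supported inside the half-space, this is orthogonality. -/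
theorem inner_rot_eq_zero {F v : L2up n m} (hF : F ∈ energySpace n m univ) (q : Fin n)
    (hv : v ∈ energySpace n m (upper n)) : ⟪rot q F, v⟫_ℂ = 0 := by
  refine inner_eq_zero_of_mem_energySpace hv fun X hX => ?_
  obtain ⟨g, h1, h2, h3, h4⟩ := hX
  obtain ⟨u, f, hu, -⟩ := exists_energy_of_mem hF
  rw [← inner_conj_symm, map_eq_zero, L2.inner_def]
  have hint : ∀ i α, Integrable (fun z => rot q F z (i, α) * (starRingEnd ℂ) (grad g z i α))
      (upperMeasure n) := fun i α =>
    ((Lp.memLp (rot q F)).eval_piLp (i, α)).integrable_mul (memLp_grad h1 h2 i α).star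
  have e : ∫ z, ⟪X z, rot q F z⟫_ℂ ∂(upperMeasure n) = ∑ α, ∑ i, ∫ z in upper n,
      rot q F z (i, α) * (starRingEnd ℂ) (grad g z i α) := by
    rw [sum_congr rfl fun α _ => (integral_finsetSum _ fun i _ => hint i α).symm,
      ← integral_finsetSum _ fun α _ => integrable_finsetSum _ fun i _ => hint i α]
    refine integral_congr_ae (h4.mono fun z hz => ?_)
    simp only [hz]
    rw [PiLp.inner_apply, Fintype.sum_prod_type, sum_comm]
    rfl
  rw [e]
  refine sum_eq_zero fun α _ => ?_
  rw [sum_rot_bd F q α fun i z => (starRingEnd ℂ) (grad g z i α), sub_eq_zero]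
  exact hu.integral_mul_conj_fderiv_comm (contDiff_comp_apply h1 α)
    (h2.comp_left (g := fun w : Cm m => w α) rfl)
    ((closure_mono (Function.support_comp_subset (g := fun w : Cm m => w α) rfl g)).trans h3) _ _ α

theorem isTrace_of_contDiff (hg : ContDiff ℝ ∞ g) (hc : HasCompactSupport g) :
    IsTrace g fun x => g (0, x) := by
  refine ⟨fun K hK => memLp_restrict_of_continuous (hg.continuous.comp (by fun_prop)) hK,
    fun K hK => ?_⟩
  obtain ⟨C, hC⟩ := (hg.of_le (by simp)).lipschitzWith_of_hasCompactSupport hc one_ne_zero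
  have hfin : volume K ^ (2⁻¹ : ℝ) ≠ ⊤ :=
    (ENNReal.rpow_lt_top_of_nonneg (by norm_num) hK.measure_lt_top.ne).ne
  have hlim : Tendsto (fun t : ℝ => volume K ^ (2⁻¹ : ℝ) * ofReal (C * |t|)) (𝓝 0) (𝓝 0) := by
    have h1 : Tendsto (fun t : ℝ => ofReal (C * |t|)) (𝓝 0) (𝓝 0) := by
      have : Continuous fun t : ℝ => ofReal (C * |t|) :=
        ENNReal.continuous_ofReal.comp (by fun_prop)
      simpa using this.tendsto 0
    simpa using ENNReal.Tendsto.const_mul h1 (Or.inr hfin)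
  refine tendsto_of_tendsto_of_tendsto_of_le_of_le tendsto_const_nhds
    (hlim.mono_left (inf_le_left.trans nhdsWithin_le_nhds)) (fun _ => zero_le) fun t => ?_
  refine (eLpNorm_le_of_ae_bound (C := C * |t|) (ae_of_all _ fun x => ?_)).trans (by simp)
  have := hC.dist_le_mul (t, x) (0, x)
  rwa [dist_eq_norm, Prod.dist_eq, dist_self, Real.dist_eq, sub_zero,
    max_eq_left (abs_nonneg t)] at this

/-- For a field orthogonal to gradients with zero trace, the pairing with a gradient depends only on
the trace and may be computed with the lift. There it is a value of the boundary distribution. -/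
theorem inner_eq_zero_of_surf_eq_zero {X : L2up n m}
    (h0 : ∀ v ∈ energySpace n m (upper n), ⟪X, v⟫_ℂ = 0) (hs : surf X = 0) :
    ∀ v ∈ energySpace n m univ, ⟪v, X⟫_ℂ = 0 := by
  intro v hv
  rw [← inner_conj_symm, map_eq_zero]
  refine inner_eq_zero_of_mem_energySpace hv fun Y hY => ?_
  obtain ⟨g, h1, h2, -, h4⟩ := hY
  have hcs : ∀ α, HasCompactSupport fun x : Rn n => (starRingEnd ℂ) (g (0, x) α) := fun α => by
    refine HasCompactSupport.intro (K := Prod.snd '' tsupport g) (h2.isCompact.image continuous_snd)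
      fun x hx => ?_
    rw [image_eq_zero_of_notMem_tsupport fun hx' => hx ⟨_, hx', rfl⟩]
    simp
  have hsm : ∀ α, ContDiff ℝ ∞ fun x : Rn n => (starRingEnd ℂ) (g (0, x) α) := fun α =>
    Complex.conjCLE.contDiff.comp ((contDiff_comp_apply h1 α).comp
      (contDiff_const.prodMk contDiff_id))
  set ψ : Fin m → 𝓢(Rn n, ℂ) := fun α => (hcs α).toSchwartzMap (hsm α)
  have hb : ⟪X, bcls ψ⟫_ℂ = 0 := by
    rw [← inner_conj_symm, map_eq_zero, inner_bcls, hs]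
    simp
  have hE := isEnergy_of_contDiff h1 h4
  have hE' := hE.sub (isEnergy_lift ψ)
  have hmem : Y - bcls ψ ∈ energySpace n m (upper n) := by
    refine mem_energySpace_upper (hE'.congr (F := Y - bcls ψ) ?_) ((isTrace_of_contDiff h1 h2).sub
      (isTrace_lift ψ) hE.aestronglyMeasurable (isEnergy_lift ψ).aestronglyMeasurable)
      (ae_of_all _ fun x => ?_)
    · filter_upwards [Lp.coeFn_sub Y (bcls ψ)] with z hz
      rw [hz]
      rfl
    · ext α
      simp [ψ]
  have := h0 _ hmem
  rwa [inner_sub_right, hb, sub_zero] at this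

theorem inner_havg_eq_zero {W : L2up n m} (h : ∀ v ∈ energySpace n m (upper n), ⟪W, v⟫_ℂ = 0)
    (hφ : Continuous φ) (hφc : HasCompactSupport φ) :
    ∀ v ∈ energySpace n m (upper n), ⟪havg φ W, v⟫_ℂ = 0 := by
  intro v hv
  rw [← inner_conj_symm, map_eq_zero]
  have e := map_havg (innerSL ℂ v) hφ hφc W
  rw [innerSL_apply_apply] at e
  rw [e]
  refine integral_eq_zero_of_ae (ae_of_all _ fun y => ?_)
  have h1 : ⟪v, translate y W⟫_ℂ = ⟪translate (-y) v, W⟫_ℂ := by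
    rw [← (translate y).inner_map_map (translate (-y) v), translate_neg_translate]
  have h2 := h _ (translate_mem_energySpace hv (y := -y) fun z hz => hz)
  simp only [innerSL_apply_apply, h1, Pi.zero_apply]
  rw [← inner_conj_symm, h2, map_zero, smul_zero]

/-! ### From pieces to atoms and back to the whole data -/

theorem reg_add (F F' : L2up n m) : reg (F + F') = reg F + reg F' := by
  ext ψ k
  change (reg (F + F') ψ) (k.1, k.2) = (reg F ψ) (k.1, k.2) + (reg F' ψ) (k.1, k.2)
  rw [reg_apply, map_add, surf_add]
  rfl

theorem reg_smul (c : ℂ) (F : L2up n m) : reg (c • F) = c • reg F := by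
  ext ψ k
  change (reg (c • F) ψ) (k.1, k.2) = c * (reg F ψ) (k.1, k.2)
  rw [reg_apply, map_smul, surf_smul]
  rfl

theorem continuous_surf_apply (ψ : 𝓢(Rn n, ℂ)) : Continuous fun W : L2up n m => surf W ψ := by
  refine (continuous_toLp 2 _).comp (continuous_pi fun α => ?_)
  exact continuous_const.inner continuous_id

theorem continuous_reg_apply (ψ : 𝓢(Rn n, ℂ)) : Continuous fun W : L2up n m => reg W ψ := by
  refine (continuous_toLp 2 _).comp (continuous_pi fun k => ?_)
  exact (continuous_apply k.2).comp ((PiLp.continuous_ofLp 2 _).comp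
    ((continuous_surf_apply ψ).comp (rot k.1).continuous))

/-- Two limits are taken. For a bounded range of scales only finitely many operators `W j` occur, so
the `L²` convergence of the pieces at each scale suffices, without any uniformity in `j`. Exchanging
the finite sums groups all scales of one Whitney cube into a single field, which is estimated by
`hD`; then the range of scales grows. Lower semicontinuity of the quasi-norm serves both limits. -/
theorem hardyPow_le_of_piece (hn : 1 ≤ n) (hp : 0 < p) (hp1 : p ≤ 1) {C : ℝ≥0}
    (hC : ∀ s : Finset (Ix n), (∀ i ∈ s, ∃ y, wt M i y ≠ 0) →
      ∑ i ∈ s, ofReal (2 ^ i.1) ^ p * ofReal (2 ^ (-i.2.1)) ^ n ≤ C * ∫⁻ x, M x ^ p) (hB : 0 ≤ B)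
    (hM : ∫⁻ x, M x ^ p ≠ ⊤) {F : ℤ → Rn n → Cm m}
    (hF : ∀ j x y, ‖x - y‖ ≤ 5 * 2 ^ (-j) → ‖F j y‖ₑ ≤ ofReal B * M x)
    (hL : ∀ j, MemLp (F j) 2 volume) (W : ℤ → L2bd n m →L[ℂ] L2up n m)
    (Y : L2up n m →+ 𝓢'(Rn n, E)) (hY : ∀ ψ, Continuous fun X => Y X ψ) {D : ℝ≥0∞}
    (f : Ix n → ℤ → L2bd n m)
    (hf : ∀ i j, f i j = (memLp_piece (M := M) (hL j) i j).toLp _)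
    (hD : ∀ i, (∃ y, wt M i y ≠ 0) → ∀ a b : ℤ, hardyPow p (Y (∑ j ∈ Finset.Ico a b, W j (f i j))) ≤
      D * (ofReal (2 ^ i.1) ^ p * ofReal (2 ^ (-i.2.1)) ^ n))
    (hT : ∀ ψ, Tendsto (fun J : ℕ => Y (∑ j ∈ Finset.Ico (-J : ℤ) J, W j ((hL j).toLp _)) ψ)
      atTop (𝓝 (T ψ))) :
    hardyPow p T ≤ D * (C * ∫⁻ x, M x ^ p) := by
  classical
  refine hardyPow_le_of_tendsto hp hT fun J => ?_
  have hlim : ∀ j, Tendsto (fun N : ℕ => ∑ i ∈ box n N, f i j) atTop (𝓝 ((hL j).toLp _)) :=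
    fun j => by
      simp_rw [hf]
      exact tendsto_sum_piece hn hp hM (hL j) hB (hF j)
  have e : ∀ N j, ∑ i ∈ box n N, f i j = ∑ i ∈ (box n N).filter fun i => ∃ y, wt M i y ≠ 0, f i j :=
    fun N j => (Finset.sum_filter_of_ne fun i _ hne => by
      by_contra hcon
      push Not at hcon
      refine hne ?_
      rw [hf, Lp.eq_zero_iff_ae_eq_zero]
      refine (MemLp.coeFn_toLp _).trans (ae_of_all _ fun y => ?_)
      simp [hcon y]).symm
  refine hardyPow_le_of_tendsto hp (T := fun N => ∑ i ∈ (box n N).filter fun i => ∃ y, wt M i y ≠ 0,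
    Y (∑ j ∈ Finset.Ico (-J : ℤ) J, W j (f i j))) (fun ψ => ?_) fun N => ?_
  · refine (((hY ψ).tendsto _).comp (tendsto_finsetSum (Finset.Ico (-J : ℤ) J) fun j _ =>
      ((W j).continuous.tendsto _).comp (hlim j))).congr fun N => ?_
    simp only [Function.comp_apply]
    rw [sum_congr rfl fun j _ => by rw [e, map_sum], sum_comm, map_sum]
  · refine (hardyPow_sum_le hp hp1 _ _).trans ((sum_le_sum fun i hi =>
      hD i (mem_filter.1 hi).2 _ _).trans ?_)
    rw [← mul_sum]
    gcongr
    exact hC _ fun i hi => (mem_filter.1 hi).2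

/-- Factor which turns a function of height `β` on a ball of radius `r` into an atom. -/
def atomScale (n : ℕ) (p β r : ℝ) : ℝ :=
  β * (volume (ball (0 : Rn n) 1)).toReal ^ (1 / 2 : ℝ) * r ^ (n / p : ℝ)

theorem volume_unit_ball_pos : 0 < (volume (ball (0 : Rn n) 1)).toReal :=
  ENNReal.toReal_pos (measure_ball_pos _ _ one_pos).ne' measure_ball_lt_top.ne

theorem atomScale_pos {p β r : ℝ} (hβ : 0 < β) (hr : 0 < r) : 0 < atomScale n p β r := by
  have := volume_unit_ball_pos (n := n)
  unfold atomScale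
  positivity

/-- The norm of a bounded function on the ball is at most its height times the square root of the
volume, and `atomScale` is the quotient of this by the size allowed for atoms. The parameter `s` is
`1` for atoms and the radius for primitives of gradient atoms. -/
theorem eLpNorm_smul_le_of_atomScale
    {p β r s : ℝ} (hβ : 0 < β) (hr : 0 < r) {x₀ : Rn n} {a : Rn n → E}
    (ha : ∀ x, ‖a x‖ ≤ s * β) (h0 : ∀ x, a x ≠ 0 → x ∈ ball x₀ r) {c : ℂ}
    (hc : ‖c‖ = (atomScale n p β r)⁻¹) : eLpNorm (c • a) 2 volume ≤
      ofReal (s * r ^ (-(n * (1 / p - 1 / 2)) : ℝ)) := by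
  have hV := volume_unit_ball_pos (n := n)
  have h1 : eLpNorm a 2 volume ≤ ofReal
      ((r ^ n * (volume (ball (0 : Rn n) 1)).toReal) ^ (1 / 2 : ℝ) * (s * β)) := by
    rw [← eLpNorm_restrict_eq_of_support_subset (s := ball x₀ r) h0]
    refine (eLpNorm_le_of_ae_bound (ae_of_all _ ha)).trans (le_of_eq ?_)
    rw [Measure.restrict_apply_univ, Measure.addHaar_ball_of_pos _ _ hr, finrank_euclideanSpace_fin,
      ofReal_mul (p := _ ^ (1 / 2 : ℝ)) (by positivity),
      ← ENNReal.ofReal_rpow_of_nonneg (by positivity) (by norm_num),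
      ofReal_mul (p := r ^ n) (by positivity),
      ofReal_toReal measure_ball_lt_top.ne]
    norm_num
  rw [eLpNorm_const_smul, ← ofReal_norm, hc]
  refine (mul_le_mul_right h1 _).trans (le_of_eq ?_)
  rw [← ofReal_mul (inv_nonneg.2 (atomScale_pos hβ hr).le)]
  congr 1
  rw [Real.mul_rpow (by positivity) hV.le, ← Real.rpow_natCast, ← Real.rpow_mul hr.le, atomScale,
    show (-(n * (1 / p - 1 / 2)) : ℝ) = n * (1 / 2) - n / p by ring, Real.rpow_sub hr]
  have := Real.rpow_pos_of_pos hV (1 / 2)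
  field_simp

/-- By homogeneity the cost of an atom of height `C₀ * 2 ^ k` on a ball of radius `4 * 2 ^ (-l)` is
the summand of `exists_sum_whitney_le` up to a fixed factor. The radius is twice the distance `2 * 2
^ (-l)` within which the pieces live. -/
theorem ofReal_atomScale_rpow (hp : 0 < p) {C₀ : ℝ} (hC : 0 < C₀) (k l : ℤ) :
    ofReal (atomScale n p (C₀ * 2 ^ k) (4 * 2 ^ (-l))) ^ p =
      ofReal (atomScale n p C₀ 4) ^ p * (ofReal (2 ^ k) ^ p * ofReal (2 ^ (-l)) ^ n) := by
  have hV := volume_unit_ball_pos (n := n)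
  have hk := two_zpow_pos k
  have hl := two_zpow_pos (-l)
  rw [← ENNReal.rpow_natCast, ofReal_rpow_of_pos hk, ofReal_rpow_of_pos hl,
    ofReal_rpow_of_pos (atomScale_pos hC (by norm_num)),
    ofReal_rpow_of_pos (atomScale_pos (by positivity) (by positivity)),
    ← ofReal_mul (by positivity), ← ofReal_mul
      (Real.rpow_nonneg (atomScale_pos hC (by norm_num)).le _)]
  congr 1
  have e : (((2 : ℝ) ^ (-l)) ^ (n / p : ℝ)) ^ p = ((2 : ℝ) ^ (-l)) ^ (n : ℝ) := by
    rw [← Real.rpow_mul hl.le, div_mul_cancel₀ _ hp.ne']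
  rw [← e, ← Real.mul_rpow hk.le (by positivity), ← Real.mul_rpow
    (atomScale_pos hC (by norm_num)).le (by positivity), atomScale, atomScale,
    Real.mul_rpow (by norm_num) hl.le]
  congr 1
  ring

theorem hardyPow_le_of_hardyNorm_smul_le (hp : 0 < p) {C : ℝ≥0∞} {c : ℂ} {s : ℝ} (hs : 0 < s)
    (hc : ‖c‖ = s⁻¹) (h : hardyNorm p (c • T) ≤ C) :
    hardyPow p T ≤ ofReal s ^ p * C ^ p := by
  have hc0 : c ≠ 0 := norm_ne_zero_iff.1 (by rw [hc]; positivity)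
  have := hardyPow_smul_le hp c⁻¹ (c • T)
  rw [smul_smul, inv_mul_cancel₀ hc0, one_smul, ← ofReal_norm, norm_inv, hc,
    inv_inv] at this
  exact this.trans (by gcongr; exact hardyPow_le_of_hardyNorm_le hp h)

theorem integrable_piece (hn : 1 ≤ n) {F : Rn n → Cm m} (hF : MemLp F 2 volume)
    (i : Ix n) (j : ℤ) : Integrable (piece M i j F) := by
  have h1 : MemLp (piece M i j F) 2 volume := memLp_piece hF i j
  have hfin : IsFiniteMeasure (volume.restrict (closedBall (ctr i.2.1 i.2.2 : Rn n)
    (2 ^ (-i.2.1)))) := isFiniteMeasure_restrict.2 measure_closedBall_lt_top.ne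
  rw [← integrableOn_iff_integrable_of_support_subset
    (s := closedBall (ctr i.2.1 i.2.2) (2 ^ (-i.2.1)))]
  · exact (h1.restrict _).integrable one_le_two
  · intro y hy
    rw [mem_closedBall_iff_norm]
    exact norm_sub_ctr_le (M := M) hn fun h0 => hy (by simp [piece, h0])

/-- Sum over scales of the convolved pieces of one index. -/
def pieceSum (M : Rn n → ℝ≥0∞) (i : Ix n) (ρ : ℤ → Rn n → ℝ)
    (F : ℤ → Rn n → Cm m) (S : Finset ℤ) (x : Rn n) : Cm m := ∑ j ∈ S, conv (ρ j) (piece M i j (F j)) x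

section PieceSum

variable {ρ : ℤ → Rn n → ℝ} {F : ℤ → Rn n → Cm m}

theorem contDiff_pieceSum (hn : 1 ≤ n) (hρ : ∀ j, ContDiff ℝ ∞ (ρ j))
    (hρc : ∀ j, HasCompactSupport (ρ j)) (hL : ∀ j, MemLp (F j) 2 volume)
    (i : Ix n) (S : Finset ℤ) : ContDiff ℝ ∞ (pieceSum M i ρ F S) :=
  ContDiff.sum fun j _ => contDiff_conv (hρ j) (hρc j) (integrable_piece hn (hL j) i j).locallyIntegrable

theorem integral_pieceSum (hn : 1 ≤ n) (hρ : ∀ j, ContDiff ℝ ∞ (ρ j))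
    (hρc : ∀ j, HasCompactSupport (ρ j)) (h0 : ∀ j, ∫ x, ρ j x = 0)
    (hL : ∀ j, MemLp (F j) 2 volume) (i : Ix n) (S : Finset ℤ) :
    ∫ x, pieceSum M i ρ F S x = 0 := by
  have hi := fun j => (hρ j).continuous.integrable_of_hasCompactSupport (μ := volume) (hρc j)
  have hp := fun j => integrable_piece (M := M) hn (hL j) i j
  simp only [pieceSum]
  rw [integral_finsetSum]
  · refine sum_eq_zero fun j _ => ?_
    rw [integral_conv (hi j) (hp j), h0, zero_smul]
  · intro j _
    rw [conv_eq]
    exact (hi j).integrable_convolution (L := lsmul ℝ ℝ) (hp j)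

theorem norm_sub_ctr_le_of_pieceSum_ne_zero (hn : 1 ≤ n)
    (hne : LowLevels M)
    (hr : ∀ j z, 2 ^ (-j) < ‖z‖ → ρ j z = 0) {i : Ix n} {S : Finset ℤ}
    (h : pieceSum M i ρ F S x ≠ 0) : ‖x - ctr i.2.1 i.2.2‖ ≤ 2 * 2 ^ (-i.2.1) := by
  obtain ⟨j, -, hj⟩ := Finset.exists_ne_zero_of_sum_ne_zero h
  exact (of_conv_piece_ne_zero hn hne (hr j) hj).2

theorem tsupport_subset_ball {E : Type*} [Zero E] {a : Rn n → E} {x₀ : Rn n} {s r : ℝ} (hsr : s < r)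
    (h : ∀ x, a x ≠ 0 → ‖x - x₀‖ ≤ s) : tsupport a ⊆ ball x₀ r :=
  (closure_minimal (fun x hx => mem_closedBall_iff_norm.2 (h x hx)) isClosed_closedBall).trans
    (Metric.closedBall_subset_ball hsr)

end PieceSum

theorem isFunction_of_forall_tst {F : Type*} [NormedAddCommGroup F] [NormedSpace ℂ F]
    {T : 𝓢'(Rn n, F)} {a : Rn n → F} (ha : ContDiff ℝ ∞ a) (hc : HasCompactSupport a)
    (h : ∀ g : Rn n → ℝ, HasCompactSupport g → ContDiff ℝ ∞ g → T (tst g) = ∫ x, g x • a x) :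
    IsFunction T a := by
  have ht := (hc.toSchwartzMap ha).hasTemperateGrowth
  have key : ∀ ψ, ht.toTemperedDistribution volume ψ = ∫ x, ψ x • a x := fun _ => rfl
  have e : T = ht.toTemperedDistribution volume := eq_of_forall_tst fun g hg hg' => by
    rw [h g hg hg']
    refine Eq.trans (integral_congr_ae (ae_of_all _ fun x => ?_)) (key _).symm
    simp [tst_apply hg hg']
  intro ψ
  rw [e]
  exact key ψ

/-- `surf` as an additive map. -/
def surfHom : L2up n m →+ 𝓢'(Rn n, Cm m) where
  toFun := surf
  map_zero' := by simpa using surf_sub (0 : L2up n m) 0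
  map_add' := surf_add

/-- `reg` as an additive map. -/
def regHom : L2up n m →+ 𝓢'(Rn n, Cnm n m) where
  toFun := reg
  map_zero' := by simpa using reg_sub (0 : L2up n m) 0
  map_add' := reg_add

theorem surf_sum {ι : Type*} (s : Finset ι) (W : ι → L2up n m) :
    surf (∑ i ∈ s, W i) = ∑ i ∈ s, surf (W i) :=
  map_sum surfHom W s

theorem sum_apply_schwartz {F ι : Type*} [NormedAddCommGroup F] [NormedSpace ℂ F] (s : Finset ι)
    (T : ι → 𝓢'(Rn n, F)) (ψ : 𝓢(Rn n, ℂ)) : (∑ i ∈ s, T i) ψ = ∑ i ∈ s, T i ψ :=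
  sum_apply _ _ _

theorem surf_rot_bext_tst (hc : HasCompactSupport θ) (hs : ContDiff ℝ ∞ θ)
    (f : L2bd n m) {g : Rn n → ℝ} (hg : HasCompactSupport g) (hg' : ContDiff ℝ ∞ g) (q : Fin n) :
    surf (rot q (bext hc hs f)) (tst g) = ∫ x, g x • conv (pd q θ) f x := by
  ext α
  rw [← reg_apply, reg_bext_tst hc hs f hg hg']
  have hint : Integrable fun x => g x • conv (pd q θ) f x :=
    integrable_smul_of_compactSupport hg hg'.continuous (contDiff_conv (contDiff_pd hs q)
      (hasCompactSupport_pd hc q) ((Lp.memLp f).locallyIntegrable one_le_two)).continuous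
  exact (proj α : Cm m →L[ℂ] ℂ).integral_comp_comm hint

/-- Bounded operators preserve weak convergence, so the reproducing formula may be applied before
any solution operator `L`. -/
theorem tendsto_surf_havg (hn : 1 ≤ n) (L : L2up n m →L[ℂ] L2up n m) (F : L2up n m)
    (ψ : 𝓢(Rn n, ℂ)) : Tendsto (fun N : ℕ => surf (L (havg (fun y => dilate N (phi n) y -
      dilate (-N) (phi n) y) F)) ψ) atTop (𝓝 (surf (L F) ψ)) :=
  ((continuous_toLp 2 fun _ : Fin m => ℂ).tendsto _).comp (tendsto_pi_nhds.2 fun α =>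
    tendsto_havg_sub hn contDiff_phi.continuous hasCompactSupport_phi integral_phi
      ((innerSL ℂ (bcls (Pi.single α ψ))).comp L) F)

theorem tendsto_reg_havg (hn : 1 ≤ n) (L : L2up n m →L[ℂ] L2up n m) (F : L2up n m)
    (ψ : 𝓢(Rn n, ℂ)) : Tendsto (fun N : ℕ => reg (L (havg (fun y => dilate N (phi n) y -
      dilate (-N) (phi n) y) F)) ψ) atTop (𝓝 (reg (L F) ψ)) :=
  ((continuous_toLp 2 fun _ : Fin n × Fin m => ℂ).tendsto _).comp (tendsto_pi_nhds.2 fun k =>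
    (tendsto_pi_nhds.1 (((PiLp.continuous_ofLp 2 fun _ : Fin m => ℂ).tendsto _).comp
      (tendsto_surf_havg hn ((rot k.1).comp L) F ψ)) k.2))

theorem hasCompactSupport_phi_sub (N : ℕ) :
    HasCompactSupport fun y => dilate N (phi n) y - dilate (-N) (phi n) y :=
  (hasCompactSupport_dilate hasCompactSupport_phi _).sub
    (hasCompactSupport_dilate hasCompactSupport_phi _)

theorem contDiff_phi_sub (N : ℕ) :
    ContDiff ℝ ∞ fun y => dilate N (phi n) y - dilate (-N) (phi n) y :=
  (contDiff_dilate contDiff_phi _).sub (contDiff_dilate contDiff_phi _)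

/-- If the convolutions of `F j` telescope to averages of the surface distribution of `W`, then so
do the sums of their surface distributions. -/
theorem surf_havg_tst_eq_sum {W : L2up n m} {ρ : ℤ → Rn n → ℝ} (hρ : ∀ j, ContDiff ℝ ∞ (ρ j))
    (hρc : ∀ j, HasCompactSupport (ρ j)) {F : ℤ → Rn n → Cm m} (hF : ∀ j, Continuous (F j))
    (hFV : ∀ j x, conv (ρ j) (F j) x = smear W (dilate (j + 1) (phi n)) x -
      smear W (dilate j (phi n)) x) (N : ℕ) {g : Rn n → ℝ} (hg : HasCompactSupport g)
    (hg' : ContDiff ℝ ∞ g) :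
    surf (havg (fun y => dilate N (phi n) y - dilate (-N) (phi n) y) W) (tst g) =
      ∑ j ∈ Finset.Ico (-N : ℤ) N, ∫ x, g x • conv (ρ j) (F j) x := by
  rw [surf_havg W (hasCompactSupport_phi_sub N) (contDiff_phi_sub N) hg hg', ← integral_finsetSum]
  · refine integral_congr_ae (ae_of_all _ fun x => ?_)
    simp only
    rw [← smul_sum, sum_congr rfl fun j _ => hFV j x,
      sum_Ico_telescope (fun j => smear W (dilate j (phi n)) x) (by omega),
      smear_sub_kernel W (hasCompactSupport_dilate hasCompactSupport_phi _)
        (contDiff_dilate contDiff_phi _) (hasCompactSupport_dilate hasCompactSupport_phi _)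
        (contDiff_dilate contDiff_phi _)]
  · intro j _
    exact integrable_smul_of_compactSupport hg hg'.continuous (contDiff_conv (hρ j) (hρc j)
      (hF j).locallyIntegrable).continuous

theorem integral_smul_conv_eq {ρ g : Rn n → ℝ} {f f' : Rn n → Cm m} (h : f =ᵐ[volume] f') :
    ∫ x, g x • conv ρ f x = ∫ x, g x • conv ρ f' x := by rw [conv_congr_ae h]

/-! ### Part (ii): Neumann data controls regularity data -/

/-- Field with square integrable coefficients, divergence free inside the half-space, whose surface
distribution is `conv (dilate j (psi n)) f`. -/
def divExt (j : ℤ) : L2bd n m →L[ℂ] L2up n m :=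
  ((2 ^ (-j) : ℝ) : ℂ) • ∑ q, (rot q).comp (bext
    (hasCompactSupport_dilate (hasCompactSupport_kap q) j) (contDiff_dilate (contDiff_kap q) j))

theorem divExt_apply (j : ℤ) (f : L2bd n m) : divExt j f = ((2 ^ (-j) : ℝ) : ℂ) • ∑ q, rot q (bext
    (hasCompactSupport_dilate (hasCompactSupport_kap q) j) (contDiff_dilate (contDiff_kap q) j) f) := by
  simp [divExt]

theorem inner_divExt (j : ℤ) (f : L2bd n m) {v : L2up n m} (hv : v ∈ energySpace n m (upper n)) :
    ⟪divExt j f, v⟫_ℂ = 0 := by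
  rw [divExt_apply, inner_smul_left, sum_inner, sum_eq_zero fun q _ =>
    inner_rot_eq_zero (bext_mem_energySpace _ _ f) q hv, mul_zero]

/-- The boundary distribution of the q-th rotated field is convolution with the q-th derivative of
the dilate of `kap q`. Summed over `q` this is the dilated divergence of `kap`, that is `psi`; the
factor `2 ^ (-j)` cancels the one from differentiating a dilate. -/
theorem surf_divExt_tst (hn : 1 ≤ n) (j : ℤ) (f : L2bd n m) {g : Rn n → ℝ}
    (hg : HasCompactSupport g) (hg' : ContDiff ℝ ∞ g) :
    surf (divExt j f) (tst g) = ∫ x, g x • conv (dilate j (psi n)) f x := by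
  have hloc := (Lp.memLp f).locallyIntegrable one_le_two
  have hk : ∀ q : Fin n, HasCompactSupport (pd q (dilate j (kap q))) := fun q =>
    hasCompactSupport_pd (hasCompactSupport_dilate (hasCompactSupport_kap q) j) q
  have hk' : ∀ q : Fin n, ContDiff ℝ ∞ (pd q (dilate j (kap q))) := fun q =>
    contDiff_pd (contDiff_dilate (contDiff_kap q) j) q
  rw [divExt_apply, surf_smul, surf_sum]
  change ((2 ^ (-j) : ℝ) : ℂ) • (∑ q, surf _) (tst g) = _
  rw [sum_apply_schwartz, sum_congr rfl fun q _ => surf_rot_bext_tst _ _ f hg hg' q,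
    ← integral_finsetSum, Complex.coe_smul, ← integral_smul]
  · refine integral_congr_ae (ae_of_all _ fun x => ?_)
    simp only
    rw [← smul_sum, smul_comm]
    congr 1
    simp only [conv]
    rw [← integral_finsetSum _ fun q _ => integrable_conv (hk' q).continuous (hk q) hloc x,
      ← integral_smul]
    refine integral_congr_ae (ae_of_all _ fun y => ?_)
    simp only
    rw [← Finset.sum_smul, smul_smul]
    congr 1
    simp only [pd_dilate (contDiff_kap _)]
    rw [← mul_sum, ← mul_assoc, ← zpow_add₀ two_ne_zero, neg_add_cancel, zpow_zero, one_mul]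
    simp only [dilate]
    rw [← mul_sum, ← sum_fderiv_kap hn]
    rfl
  · intro q _
    exact integrable_smul_of_compactSupport hg hg'.continuous
      (contDiff_conv (hk' q) (hk q) hloc).continuous

theorem inner_eq_zero_comm {X : L2up n m} {U : Set (Pt n)}
    (h : ∀ v ∈ energySpace n m U, ⟪X, v⟫_ℂ = 0) {v : L2up n m} (hv : v ∈ energySpace n m U) :
    ⟪v, X⟫_ℂ = 0 := by
  rw [← inner_conj_symm, h v hv, map_zero]

/-- `R` and `T` are the regularity data and the Neumann data of an energy solution. -/
def IsDataPair (A : Coeff n m) (R : 𝓢'(Rn n, Cnm n m)) (T : 𝓢'(Rn n, Cm m)) : Prop :=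
  ∃ u G, IsEnergySolution A u G ∧ IsRegularityData u R ∧ IsConormal A G T

/-- Since `X` is orthogonal to gradients with zero trace, `S X` belongs to an energy solution. As
the equation for `S X` also holds against the lifts, its Neumann data is the boundary distribution
of `X`, that is `a`. Scaling `a` to an atom brings in the hypothesis. -/
theorem hardyPow_reg_le_of_atom (hp : 0 < p)
    (hA : IsBoundedCoeff A Λ) {C : ℝ≥0}
    (hyp : ∀ R T, IsDataPair A R T → (∃ a, IsSmoothAtom p a ∧ IsFunction T a) → hardyNorm p R ≤ C)
    {S : L2up n m →L[ℂ] L2up n m} (hS : ∀ X, S X ∈ energySpace n m univ)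
    (hS' : ∀ X, ∀ v ∈ energySpace n m univ, ⟪v, coeffOp A hA (S X)⟫_ℂ = -⟪v, X⟫_ℂ)
    {X : L2up n m} (hX : ∀ v ∈ energySpace n m (upper n), ⟪X, v⟫_ℂ = 0) {a : Rn n → Cm m}
    (ha : ContDiff ℝ ∞ a) {β r : ℝ} (hβ : 0 < β) (hr : 0 < r) (hb : ∀ x, ‖a x‖ ≤ β) {x₀ : Rn n}
    (h0 : ∀ x, a x ≠ 0 → ‖x - x₀‖ ≤ r / 2) (hint : ∫ x, a x = 0)
    (hs : ∀ g : Rn n → ℝ, HasCompactSupport g → ContDiff ℝ ∞ g → surf X (tst g) = ∫ x, g x • a x) :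
    hardyPow p (reg (S X)) ≤ ofReal (atomScale n p β r) ^ p * (C : ℝ≥0∞) ^ p := by
  have hpos := atomScale_pos (n := n) (p := p) hβ hr
  set c : ℂ := (((atomScale n p β r)⁻¹ : ℝ) : ℂ)
  have hc : ‖c‖ = (atomScale n p β r)⁻¹ := by
    rw [Complex.norm_real, norm_of_nonneg (inv_nonneg.2 hpos.le)]
  have hsupp : ∀ x, (c • a) x ≠ 0 → ‖x - x₀‖ ≤ r / 2 := fun x hx =>
    h0 x fun h => hx (by rw [Pi.smul_apply, h, smul_zero])
  have hts := tsupport_subset_ball (half_lt_self hr) hsupp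
  obtain ⟨u, f, hu, hf⟩ := exists_energy_of_mem (hS (c • X))
  have hE0 : ∀ v ∈ energySpace n m (upper n), ⟪v, coeffOp A hA (S (c • X))⟫_ℂ = 0 := fun v hv => by
    rw [hS' _ v (energySpace_mono (Set.subset_univ _) hv), inner_smul_right,
      inner_eq_zero_comm hX hv, mul_zero, neg_zero]
  have hcon := isConormal_neg_surf hA (ae_eq_vec (S (c • X))) hE0
  have e : -surf (coeffOp A hA (S (c • X))) = surf (c • X) := by
    rw [← surf_neg]
    ext ψ α
    rw [surf_apply, surf_apply, inner_neg_right, hS' _ _ (bcls_mem_energySpace _), neg_neg]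
  rw [e] at hcon
  have hcs : HasCompactSupport (c • a) :=
    (isCompact_closedBall x₀ r).of_isClosed_subset (isClosed_tsupport _)
      (hts.trans ball_subset_closedBall)
  refine hardyPow_le_of_hardyNorm_smul_le hp hpos hc ?_
  rw [← reg_smul, ← map_smul]
  refine hyp _ _ ⟨u, _, isEnergySolution_of_inner hA hu hE0, isRegularityData_reg hu hf, hcon⟩
    ⟨c • a, ⟨ha.const_smul c, x₀, r, hr, hts, ?_, ?_⟩,
      isFunction_of_forall_tst (ha.const_smul c) hcs fun g hg hg' => ?_⟩
  · simpa using eLpNorm_smul_le_of_atomScale (p := p) (s := 1) hβ hr (a := a) (x₀ := x₀)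
      (by simpa using hb) (fun x hx => mem_ball_iff_norm.2 ((h0 x hx).trans_lt (half_lt_self hr))) hc
  · simp only [Pi.smul_apply]
    rw [integral_smul, hint, smul_zero]
  · rw [surf_smul]
    change c • surf X (tst g) = _
    rw [hs g hg hg', ← integral_smul]
    simp only [Pi.smul_apply, smul_comm c]

theorem exists_smear_le (hc : HasCompactSupport φ) (hs : ContDiff ℝ ∞ φ) :
    ∃ K : ℝ, 0 < K ∧ ∀ (W : L2up n m) (j : ℤ) (x y : Rn n), ‖x - y‖ ≤ 5 * 2 ^ (-j) →
      ‖smear W (dilate j φ) y‖ₑ ≤ ofReal K * grandMax (surf W) x := by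
  obtain ⟨K, hK, h⟩ := exists_enorm_tst_dilate_le hc hs
  exact ⟨K, hK, fun W => h _ (surf W)⟩

theorem integral_smul_pieceSum (hn : 1 ≤ n) {ρ : ℤ → Rn n → ℝ}
    {F : ℤ → Rn n → Cm m} (hρ : ∀ j, ContDiff ℝ ∞ (ρ j)) (hρc : ∀ j, HasCompactSupport (ρ j))
    (hL : ∀ j, MemLp (F j) 2 volume) (i : Ix n) (S : Finset ℤ) {g : Rn n → ℝ}
    (hg : HasCompactSupport g) (hg' : ContDiff ℝ ∞ g) :
    ∫ x, g x • pieceSum M i ρ F S x = ∑ j ∈ S, ∫ x, g x •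
      conv (ρ j) ((memLp_piece (M := M) (hL j) i j).toLp _ : L2bd n m) x := by
  simp only [pieceSum, smul_sum]
  rw [integral_finsetSum]
  · exact sum_congr rfl fun j _ => integral_smul_conv_eq (MemLp.coeFn_toLp _).symm
  · intro j _
    exact integrable_smul_of_compactSupport hg hg'.continuous (contDiff_conv (hρ j) (hρc j)
      (integrable_piece hn (hL j) i j).locallyIntegrable).continuous

/-- The field `W = -AF` is decomposed rather than the solution: the pieces of its boundary
distribution are lifted by `divExt`, and the solution operator on all of V is applied to them.
Finiteness of the quasi-norm of `T` is what makes the level sets and the `L²` bounds available. -/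
theorem exists_regularity_le (hn : 1 ≤ n) (hp : 0 < p) (hp1 : p ≤ 1) {lam : ℝ}
    (hlam : 0 < lam) (C : ℝ≥0) :
    ∃ K : ℝ≥0, ∀ (A : Coeff n m) (Λ : ℝ), IsBoundedCoeff A Λ → StrongGarding A lam →
      (∀ R T, IsDataPair A R T → (∃ a, IsSmoothAtom p a ∧ IsFunction T a) → hardyNorm p R ≤ C) →
      ∀ R T, IsDataPair A R T → hardyPow p T ≠ ⊤ → hardyPow p R ≤ K * hardyPow p T := by
  obtain ⟨Kθ, hKθ, hθ⟩ := exists_smear_le (m := m) (hasCompactSupport_theta (n := n)) contDiff_theta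
  obtain ⟨Kφ, hKφ, hφ⟩ := exists_smear_le (m := m) (hasCompactSupport_phi (n := n)) contDiff_phi
  obtain ⟨Cw, hCw⟩ := exists_sum_whitney_le hn hp
  set B := Kθ + Kφ with hB
  set κ : ℝ := ∫ y, |psi n y|
  have hκ : 0 ≤ κ := integral_nonneg fun y => abs_nonneg _
  -- The height of the atoms from `norm_sum_conv_piece_le`, without the factor `2 ^ k`, for the
  -- kernels `dilate j (psi n)`, whose `L¹` norms all equal `κ`.
  set C₀ : ℝ := (4 + 4 * κ + 4 * κ * (2 + 8 * n ^ 2)) * B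
  have hC₀ : 0 < C₀ := by positivity
  refine ⟨(ofReal (atomScale n p C₀ 4) ^ p * (C : ℝ≥0∞) ^ p).toNNReal * Cw,
    fun A Λ hA hG hyp R T ⟨u, G, hu, hR, hT⟩ hfin => ?_⟩
  have hco := coercive_of_garding hA (U := univ) (lam := lam) fun g h1 h2 _ => hG g h1 h2
  obtain ⟨S₀, hS₀, hS₀'⟩ := exists_solution_operator (energySpace n m univ)
    (isClosed_energySpace _) (coeffOp A hA) hlam hco
  set S : L2up n m →L[ℂ] L2up n m := -S₀
  have hS : ∀ X, S X ∈ energySpace n m univ := fun X => Submodule.neg_mem _ (hS₀ X)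
  have hS' : ∀ X, ∀ v ∈ energySpace n m univ, ⟪v, coeffOp A hA (S X)⟫_ℂ = -⟪v, X⟫_ℂ :=
    fun X v hv => by rw [show S X = -S₀ X from rfl, map_neg, inner_neg_right, hS₀' X v hv]
  obtain ⟨F, hF⟩ : ∃ F : L2up n m, F =ᵐ[upperMeasure n] fun z => vec (G z) :=
    ⟨hu.1.cls, hu.1.coeFn_cls⟩
  have hE := hu.1.congr hF
  have hFV := mem_energySpace_univ hE
  set W : L2up n m := -coeffOp A hA F
  have hTW : T = surf W := by rw [surf_neg, hT.eq_neg_surf hA hF]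
  have hW0 : ∀ v ∈ energySpace n m (upper n), ⟪W, v⟫_ℂ = 0 := fun v hv => by
    rw [← inner_conj_symm, inner_neg_right, hu.inner_eq_zero hA hF v hv, neg_zero, map_zero]
  -- Only the pairings of `X` with V enter the equation for `S X`, so differences orthogonal to V
  -- are invisible to `S`.
  have huniq : ∀ {X X' : L2up n m}, (∀ v ∈ energySpace n m univ, ⟪v, X - X'⟫_ℂ = 0) →
      S X = S X' := fun {X X'} h => by
    refine eq_of_coercive hlam hco (Submodule.sub_mem _ (hS X) (hS X')) fun v hv => ?_
    rw [hS' X v hv, hS' X' v hv, ← sub_eq_zero, ← h v hv, inner_sub_right, neg_sub_neg,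
      ← neg_sub, ← inner_sub_right, h v hv, neg_zero]
  have hSW : S W = F := eq_of_coercive hlam hco (Submodule.sub_mem _ (hS W) hFV) fun v hv => by
    rw [hS' W v hv, inner_neg_right, neg_neg]
  rw [hR.eq_reg hE, ← hSW, hTW]
  rw [hTW] at hfin
  set M := grandMax (surf W)
  have hne := nonempty_level hn hp hfin
  have hle : ∀ {K : ℝ} {a : ℝ≥0∞} {x : Rn n}, K ≤ B → a ≤ ofReal K * M x →
      a ≤ ofReal B * M x := fun hK h => h.trans (by gcongr)
  set Fj : ℤ → Rn n → Cm m := fun j => smear W (dilate j (theta n))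
  have hFj : ∀ j x y, ‖x - y‖ ≤ 5 * 2 ^ (-j) → ‖Fj j y‖ₑ ≤ ofReal B * M x :=
    fun j x y h => hle (by simp [hB, hKφ.le]) (hθ W j x y h)
  have hVj : ∀ j x y, ‖x - y‖ ≤ 5 * 2 ^ (-j) → ‖smear W (dilate j (phi n)) y‖ₑ ≤ ofReal B * M x :=
    fun j x y h => hle (by simp [hB, hKθ.le]) (hφ W j x y h)
  have hFc : ∀ j, Continuous (Fj j) := fun j => continuous_smear W
    (hasCompactSupport_dilate hasCompactSupport_theta j) (contDiff_dilate contDiff_theta j)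
  have hL : ∀ j, MemLp (Fj j) 2 volume := fun j =>
    memLp_two_of_le hp hp1 hfin (hFc j) (by have := two_zpow_pos (-j); positivity) (hFj j)
  have hρ : ∀ j, ContDiff ℝ ∞ (dilate j (psi n)) := fun j => contDiff_dilate contDiff_psi j
  have hρc : ∀ j, HasCompactSupport (dilate j (psi n)) := fun j =>
    hasCompactSupport_dilate hasCompactSupport_psi j
  have hr : ∀ j z, 2 ^ (-j) < ‖z‖ → dilate j (psi n) z = 0 := dilate_eq_zero fun _ => psi_eq_zero
  have hFV : ∀ j x, conv (dilate j (psi n)) (Fj j) x =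
      smear W (dilate (j + 1) (phi n)) x - smear W (dilate j (phi n)) x := fun j x => by
    rw [conv_smear W (hρ j).continuous (hρc j) (hasCompactSupport_dilate hasCompactSupport_theta j)
      (contDiff_dilate contDiff_theta j), ← smear_sub_kernel W
      (hasCompactSupport_dilate hasCompactSupport_phi _) (contDiff_dilate contDiff_phi _)
      (hasCompactSupport_dilate hasCompactSupport_phi _) (contDiff_dilate contDiff_phi _),
      funext (conv_dilate_psi_theta (n := n) j)]
  rw [ENNReal.coe_mul, ENNReal.coe_toNNReal (by finiteness), mul_assoc]
  refine hardyPow_le_of_piece hn hp hp1 (hCw M) (by positivity) hfin hFj hL divExt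
    (regHom.comp (S : L2up n m →+ L2up n m)) (fun ψ => (continuous_reg_apply ψ).comp S.continuous)
    _ (fun i j => rfl) (fun i _ a b => ?_) fun ψ => ?_
  · rw [mul_right_comm, ← ofReal_atomScale_rpow hp hC₀]
    have h2 := two_zpow_pos (-i.2.1)
    have h3 := two_zpow_pos i.1
    refine hardyPow_reg_le_of_atom hp hA hyp hS hS' (fun v hv => ?_)
      (contDiff_pieceSum (M := M) hn hρ hρc hL i (Finset.Ico a b)) (by positivity) (by positivity)
      (fun x => norm_sum_conv_piece_le hne (by positivity) hFc hFj hVj (fun j => (hρ j).continuous)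
        (fun j => (integral_abs_dilate j _).le) hr hFV i a b x)
      (fun x hx => (norm_sub_ctr_le_of_pieceSum_ne_zero hn hne hr hx).trans (by linarith))
      (integral_pieceSum hn hρ hρc (fun j => by rw [integral_dilate, integral_psi]) hL i _)
      fun g hg hg' => ?_
    · rw [sum_inner, sum_eq_zero fun j _ => inner_divExt j _ hv]
    · rw [surf_sum, sum_apply_schwartz, integral_smul_pieceSum hn hρ hρc hL i _ hg hg']
      exact sum_congr rfl fun j _ => surf_divExt_tst hn j _ hg hg'
  · refine (tendsto_reg_havg hn S W ψ).congr fun N => ?_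
    change _ = reg (S _) ψ
    congr 2
    -- The averaged field and the sum of lifted convolutions may differ inside, but both are
    -- orthogonal to gradients with zero trace and have the same boundary distribution. Hence `S`
    -- identifies them.
    refine (huniq (inner_eq_zero_of_surf_eq_zero (fun v hv => ?_) ?_)).symm
    · rw [inner_sub_left, sum_inner, sum_eq_zero fun j _ => inner_divExt j _ hv,
        inner_havg_eq_zero hW0 (contDiff_phi_sub N).continuous (hasCompactSupport_phi_sub N) v hv,
        sub_zero]
    · rw [surf_sub, sub_eq_zero]
      refine eq_of_forall_tst fun g hg hg' => ?_
      rw [surf_havg_tst_eq_sum hρ hρc hFc hFV N hg hg', surf_sum, sum_apply_schwartz]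
      refine sum_congr rfl fun j _ => ?_
      rw [surf_divExt_tst hn j _ hg hg']
      exact integral_smul_conv_eq (MemLp.coeFn_toLp _)

/-! ### Part (i): regularity data controls Neumann data -/

theorem reg_eq_zero_of_mem (hF : F ∈ energySpace n m (upper n)) : reg F = 0 := by
  refine eq_of_forall_tst fun g hg hg' => ?_
  refine closure_minimal (s := (testGrads n m (upper n) : Set (L2up n m)))
    (t := {F | reg F (tst g) = 0}) (fun X hX => ?_)
    (isClosed_eq (continuous_reg_apply _) continuous_const) hF
  obtain ⟨h, h1, h2, h3, h4⟩ := hX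
  ext k
  have h0 : ∀ x, h (0, x) = 0 := fun x =>
    image_eq_zero_of_notMem_tsupport fun hx => lt_irrefl (0 : ℝ) (h3 hx)
  rw [show k = (k.1, k.2) from rfl, reg_tst (isEnergy_of_contDiff h1 h4)
    (isTrace_of_contDiff h1 h2) hg hg']
  simp [h0]

theorem tanGrad_smul {b : Rn n → Cm m} (hb : ContDiff ℝ ∞ b) (c : ℂ) :
    tanGrad (c • b) = c • tanGrad b := by
  ext x k
  change fderiv ℝ (fun y => c • b y k.2) x _ = c • fderiv ℝ (fun y => b y k.2) x _
  rw [fderiv_fun_const_smul ((contDiff_comp_apply hb k.2).differentiable (by simp) x)]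
  rfl

theorem contDiff_tanGrad {b : Rn n → Cm m} (hb : ContDiff ℝ ∞ b) : ContDiff ℝ ∞ (tanGrad b) := by
  rw [contDiff_piLp]
  intro k
  have : ContDiff ℝ ∞ (fderiv ℝ fun y => b y k.2) :=
    (contDiff_comp_apply hb k.2).fderiv_right (by simp)
  exact this.clm_apply contDiff_const

theorem tsupport_tanGrad_subset (b : Rn n → Cm m) : tsupport (tanGrad b) ⊆ tsupport b := by
  refine closure_minimal (fun x hx => ?_) (isClosed_tsupport b)
  by_contra hcon
  refine hx ?_
  ext k
  have : fderiv ℝ (fun y => b y k.2) x = 0 := by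
    refine Function.notMem_support.1 fun h => hcon ?_
    exact (closure_mono (Function.support_comp_subset (g := fun w : Cm m => w k.2) rfl b))
      (support_fderiv_subset ℝ h)
  simp [tanGrad, this]

/-- The field `D` already solves the equation and has the gradient of `b` as regularity data; only
the scaling to an atom is missing. The primitive must be of size `r * β`, to match the second
normalization of gradient atoms. -/
theorem hardyPow_surf_le_of_atom (hp : 0 < p)
    (hA : IsBoundedCoeff A Λ) {C : ℝ≥0}
    (hyp : ∀ R T, IsDataPair A R T → (∃ a, IsSmoothGradAtom p a ∧ IsFunction R a) → hardyNorm p T ≤ C)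
    {D : L2up n m} (hD : D ∈ energySpace n m univ)
    (hD0 : ∀ v ∈ energySpace n m (upper n), ⟪v, coeffOp A hA D⟫_ℂ = 0) {b : Rn n → Cm m}
    (hb : ContDiff ℝ ∞ b) {β r : ℝ} (hβ : 0 < β) (hr : 0 < r) (hb0 : ∀ x, ‖b x‖ ≤ r * β)
    (hb1 : ∀ x, ‖tanGrad b x‖ ≤ β) {x₀ : Rn n} (h0 : ∀ x, b x ≠ 0 → ‖x - x₀‖ ≤ r / 2)
    (hs : ∀ g : Rn n → ℝ, HasCompactSupport g → ContDiff ℝ ∞ g →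
      reg D (tst g) = ∫ x, g x • tanGrad b x) :
    hardyPow p (surf (-coeffOp A hA D)) ≤ ofReal (atomScale n p β r) ^ p * (C : ℝ≥0∞) ^ p := by
  have hpos := atomScale_pos (n := n) (p := p) hβ hr
  set c : ℂ := (((atomScale n p β r)⁻¹ : ℝ) : ℂ)
  have hc : ‖c‖ = (atomScale n p β r)⁻¹ := by
    rw [Complex.norm_real, norm_of_nonneg (inv_nonneg.2 hpos.le)]
  have hts := tsupport_subset_ball (half_lt_self hr) h0
  have hta := (tsupport_tanGrad_subset b).trans hts
  have hcs : ∀ {E : Type} [NormedAddCommGroup E] [NormedSpace ℂ E] {f : Rn n → E},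
      tsupport f ⊆ ball x₀ r → tsupport (c • f) ⊆ ball x₀ r := fun h =>
    (closure_mono (Function.support_const_smul_subset c _)).trans h
  have hD' := Submodule.smul_mem _ c hD
  have hD0' : ∀ v ∈ energySpace n m (upper n), ⟪v, coeffOp A hA (c • D)⟫_ℂ = 0 := fun v hv => by
    rw [map_smul, inner_smul_right, hD0 v hv, mul_zero]
  obtain ⟨u, f, hu, hf⟩ := exists_energy_of_mem hD'
  refine hardyPow_le_of_hardyNorm_smul_le hp hpos hc ?_
  rw [← surf_smul, smul_neg, ← map_smul, surf_neg]
  refine hyp _ _ ⟨u, _, isEnergySolution_of_inner hA hu hD0', isRegularityData_reg hu hf,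
    isConormal_neg_surf hA (ae_eq_vec (c • D)) hD0'⟩ ⟨c • tanGrad b, ⟨c • b, hb.const_smul c,
      (tanGrad_smul hb c).symm, x₀, r, hr, hcs hta, hcs hts, ?_, ?_⟩,
      isFunction_of_forall_tst ((contDiff_tanGrad hb).const_smul c) ((isCompact_closedBall x₀ r
        ).of_isClosed_subset (isClosed_tsupport _) ((hcs hta).trans ball_subset_closedBall))
        fun g hg hg' => ?_⟩
  · simpa using eLpNorm_smul_le_of_atomScale (p := p) (s := 1) hβ hr (a := tanGrad b) (x₀ := x₀)
      (by simpa using hb1) (fun x hx => hta (subset_tsupport _ hx)) hc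
  · refine (eLpNorm_smul_le_of_atomScale (p := p) (s := r) hβ hr hb0
      (fun x hx => hts (subset_tsupport _ hx)) hc).trans_eq ?_
    rw [sub_eq_add_neg (1 : ℝ), Real.rpow_add hr, Real.rpow_one]
  · rw [reg_smul]
    change c • reg D (tst g) = _
    rw [hs g hg hg', ← integral_smul]
    simp only [Pi.smul_apply, smul_comm c]

theorem dilate_pd (hs : ContDiff ℝ ∞ φ) (j : ℤ) (q : Fin n) :
    dilate j (pd q φ) = pd q fun x => 2 ^ (-j) * dilate j φ x := by
  ext x
  have h := (contDiff_dilate hs j).differentiable (by simp) x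
  rw [pd, fderiv_const_mul h, smul_apply, fderiv_dilate hs, smul_eq_mul,
    ← mul_assoc, ← zpow_add₀ two_ne_zero, neg_add_cancel, zpow_zero, one_mul]
  rfl

theorem tst_sum {ι : Type*} (s : Finset ι) {a : ι → Rn n → ℝ} (hc : ∀ i, HasCompactSupport (a i))
    (hs : ∀ i, ContDiff ℝ ∞ (a i)) : tst (fun x => ∑ i ∈ s, a i x) = ∑ i ∈ s, tst (a i) := by
  have hs' : ContDiff ℝ ∞ fun x => ∑ i ∈ s, a i x := ContDiff.sum fun i _ => hs i
  have hc' : HasCompactSupport fun x => ∑ i ∈ s, a i x := by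
    have := HasCompactSupport.finset_sum (s := s) fun i _ => hc i
    simpa [Finset.sum_fn] using this
  ext x
  rw [tst_apply hc' hs', sum_apply]
  push_cast
  exact sum_congr rfl fun i _ => (tst_apply (hc i) (hs i) x).symm

theorem smear_sum_kernel (W : L2up n m) {ι : Type*} (s : Finset ι) {a : ι → Rn n → ℝ}
    (hc : ∀ i, HasCompactSupport (a i)) (hs : ∀ i, ContDiff ℝ ∞ (a i)) (x : Rn n) :
    smear W (fun y => ∑ i ∈ s, a i y) x = ∑ i ∈ s, smear W (a i) x := by
  unfold smear
  rw [tst_sum s (fun i => hasCompactSupport_sub_comp (hc i) x)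
    (fun i => contDiff_sub_comp (hs i) x), map_sum]

/-- Regularity data is a gradient, hence curl free: both sides pair the trace with the same second
derivative of `h`. -/
theorem smear_rot_pd_comm (hF : F ∈ energySpace n m univ)
    (hc : HasCompactSupport h) (hs : ContDiff ℝ ∞ h) (s q : Fin n) (x : Rn n) :
    smear (rot s F) (pd q h) x = smear (rot q F) (pd s h) x := by
  obtain ⟨u, f, hu, hf⟩ := exists_energy_of_mem hF
  have e : ∀ s q α, smear (rot s F) (pd q h) x α =
      -∫ y, f y α * ((-(pd s (pd q h) (x - y)) : ℝ) : ℂ) := fun s q α => by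
    rw [smear, ← reg_apply, reg_tst hu hf (hasCompactSupport_sub_comp (hasCompactSupport_pd hc q) x)
      (contDiff_sub_comp (contDiff_pd hs q) x)]
    congr 2 with y
    have := ((contDiff_pd hs q).differentiable (by simp) (x - y)).hasFDerivAt.comp y
      ((hasFDerivAt_id y).const_sub x)
    rw [show (fun y => pd q h (x - y)) = pd q h ∘ fun y => x - y from rfl, this.fderiv]
    simp [pd]
  ext α
  rw [e, e]
  congr 2 with y
  rw [show pd s (pd q h) (x - y) = pd q (pd s h) (x - y) from fderiv_apply_comm hs _ _ _]

theorem enorm_surf_rot_le (F : L2up n m) (q : Fin n) (ψ : 𝓢(Rn n, ℂ)) :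
    ‖surf (rot q F) ψ‖ₑ ≤ ‖reg F ψ‖ₑ := by
  rw [← ofReal_norm, ← ofReal_norm]
  refine ofReal_le_ofReal ?_
  rw [EuclideanSpace.norm_eq, EuclideanSpace.norm_eq, Fintype.sum_prod_type]
  refine Real.sqrt_le_sqrt ?_
  exact single_le_sum (f := fun q => ∑ α, ‖reg F ψ (q, α)‖ ^ 2)
    (fun q _ => sum_nonneg fun α _ => sq_nonneg _) (Finset.mem_univ q)

theorem rot_havg (hφ : Continuous φ) (hφc : HasCompactSupport φ) (q : Fin n)
    (F : L2up n m) : rot q (havg φ F) = havg φ (rot q F) := by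
  rw [map_havg (rot q) hφ hφc, havg]
  refine integral_congr_ae (ae_of_all _ fun y => congrArg (φ y • ·) (Lp.ext ?_))
  filter_upwards [coeFn_coeffOp (isBoundedCoeff_rotCoeff q) (translate y F), coeFn_translate y F,
    coeFn_translate_of (y := y) (coeFn_coeffOp (isBoundedCoeff_rotCoeff q) F)] with z h1 h2 h3
  refine h1.trans (Eq.trans ?_ h3.symm)
  rw [h2]
  rfl

/-- The dilates of `theta n`, scaled so that their gradients are dilates of the gradient. -/
def thetaDil (n : ℕ) (j : ℤ) (x : Rn n) : ℝ := 2 ^ (-j) * dilate j (theta n) x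

theorem contDiff_thetaDil (j : ℤ) : ContDiff ℝ ∞ (thetaDil n j) :=
  contDiff_const.mul (contDiff_dilate contDiff_theta j)

theorem hasCompactSupport_thetaDil (j : ℤ) : HasCompactSupport (thetaDil n j) :=
  (hasCompactSupport_dilate hasCompactSupport_theta j).mul_left

theorem pd_thetaDil (j : ℤ) (q : Fin n) : pd q (thetaDil n j) = dilate j (pd q (theta n)) :=
  (dilate_pd contDiff_theta j q).symm

/-- The sum of the components of the smeared tangential gradient against the field `kap`. -/
def fluxSmear (F : L2up n m) (j : ℤ) (x : Rn n) : Cm m := ∑ s, smear (rot s F) (dilate j (kap s)) x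

theorem continuous_fluxSmear (F : L2up n m) (j : ℤ) : Continuous (fluxSmear F j) :=
  continuous_finsetSum _ fun s _ => continuous_smear _
    (hasCompactSupport_dilate (hasCompactSupport_kap s) j) (contDiff_dilate (contDiff_kap s) j)

/-- Write `R_s` for the s-th component of the regularity data. Curl freeness turns `∂_q (theta *
kap_s) * R_s` into `∂_s (theta * kap_s) * R_q`. Summing over `s` produces the divergence of `kap`,
hence `psi * theta * R_q`, which telescopes. The left-hand side nevertheless has the form of a
gradient in `q`, so pieces cut from `fluxSmear` remain gradients. -/
theorem conv_fluxSmear (hn : 1 ≤ n) (hF : F ∈ energySpace n m univ) (q : Fin n)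
    (j : ℤ) (x : Rn n) : conv (dilate j (pd q (theta n))) (fluxSmear F j) x =
      smear (rot q F) (dilate (j + 1) (phi n)) x - smear (rot q F) (dilate j (phi n)) x := by
  have hkc := fun s : Fin n => hasCompactSupport_kap s
  have hks := fun s : Fin n => contDiff_kap s
  have hθc := hasCompactSupport_theta (n := n)
  have hθs := contDiff_theta (n := n)
  have hd := contDiff_dilate (contDiff_pd hθs q) j
  have hdc := hasCompactSupport_dilate (hasCompactSupport_pd hθc q) j
  have hcs := fun s : Fin n => contDiff_conv hθs hθc (hks s).continuous.locallyIntegrable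
  have hcc := fun s : Fin n => hasCompactSupport_conv hθc (hkc s)
  have h1 : ∀ s, conv (dilate j (pd q (theta n))) (smear (rot s F) (dilate j (kap s))) x =
      smear (rot q F) (dilate j (pd s (conv (theta n) (kap s)))) x := fun s => by
    rw [conv_smear _ hd.continuous hdc (hasCompactSupport_dilate (hkc s) j)
      (contDiff_dilate (hks s) j), conv_dilate, (conv_pd_comm hθs hθc (hks s) (hkc s) q).1,
      dilate_pd (hcs s), dilate_pd (hcs s)]
    exact smear_rot_pd_comm hF (hasCompactSupport_dilate (hcc s) j).mul_left
      (contDiff_const.mul (contDiff_dilate (hcs s) j)) s q x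
  have h2 : conv (dilate j (pd q (theta n))) (fluxSmear F j) x =
      ∑ s, conv (dilate j (pd q (theta n))) (smear (rot s F) (dilate j (kap s))) x := by
    simp only [conv, fluxSmear, smul_sum]
    exact integral_finsetSum _ fun s _ => integrable_conv (f := smear (rot s F) (dilate j (kap s)))
      hd.continuous hdc (continuous_smear _ (hasCompactSupport_dilate (hkc s) j)
        (contDiff_dilate (hks s) j)).locallyIntegrable x
  rw [h2, sum_congr rfl fun s _ => h1 s, ← smear_sum_kernel (rot q F) _
    (fun s => hasCompactSupport_dilate (hasCompactSupport_pd (hcc s) s) j)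
    (fun s => contDiff_dilate (contDiff_pd (hcs s) s) j), ← smear_sub_kernel _
      (hasCompactSupport_dilate hasCompactSupport_phi _) (contDiff_dilate contDiff_phi _)
      (hasCompactSupport_dilate hasCompactSupport_phi _) (contDiff_dilate contDiff_phi _)]
  congr 1
  ext y
  rw [← conv_dilate_psi_theta, conv_dilate, conv_comm_real]
  simp only [dilate]
  rw [← mul_sum]
  congr 1
  rw [sum_congr rfl fun s _ => congrFun (conv_pd_comm hθs hθc (hks s) (hkc s) s).2.symm _]
  simp only [conv]
  rw [← integral_finsetSum _ fun s _ => integrable_conv (f := pd s (kap s)) hθs.continuous hθc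
    (contDiff_pd (hks s) s).continuous.locallyIntegrable _]
  refine integral_congr_ae (ae_of_all _ fun z => ?_)
  simp only [smul_eq_mul]
  rw [← mul_sum, ← sum_fderiv_kap hn]
  rfl

theorem exists_fluxSmear_le : ∃ K : ℝ, 0 < K ∧ ∀ (F : L2up n m) (j : ℤ) (x y : Rn n),
    ‖x - y‖ ≤ 5 * 2 ^ (-j) → ‖fluxSmear F j y‖ₑ ≤ ofReal K * grandMax (reg F) x := by
  choose K hK h using fun s : Fin n =>
    exists_smear_le (m := m) (hasCompactSupport_kap s) (contDiff_kap s)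
  refine ⟨∑ s, K s + 1, by have := sum_nonneg fun s (_ : s ∈ Finset.univ) => (hK s).le
                           linarith, fun F j x y hxy => ?_⟩
  calc ‖fluxSmear F j y‖ₑ ≤ ∑ s, ‖smear (rot s F) (dilate j (kap s)) y‖ₑ := enorm_sum_le _ _
    _ ≤ ∑ s, ofReal (K s) * grandMax (reg F) x := sum_le_sum fun s _ =>
        (h s (rot s F) j x y hxy).trans (by gcongr; exact grandMax_mono (enorm_surf_rot_le F s) x)
    _ = ofReal (∑ s, K s) * grandMax (reg F) x := by
        rw [← sum_mul, ENNReal.ofReal_sum_of_nonneg fun s _ => (hK s).le]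
    _ ≤ _ := by gcongr; linarith

theorem tanGrad_pieceSum_apply (hn : 1 ≤ n) {F : ℤ → Rn n → Cm m}
    (hL : ∀ j, MemLp (F j) 2 volume) (i : Ix n) (S : Finset ℤ) (x : Rn n)
    (k : Fin n × Fin m) : tanGrad (pieceSum M i (thetaDil n) F S) x k =
      pieceSum M i (fun j => dilate j (pd k.1 (theta n))) F S x k.2 := by
  have hloc := fun j => (integrable_piece (M := M) hn (hL j) i j).locallyIntegrable
  have hc := fun j => contDiff_conv (contDiff_thetaDil j) (hasCompactSupport_thetaDil j) (hloc j)
  have hb : ContDiff ℝ ∞ (pieceSum M i (thetaDil n) F S) := ContDiff.sum fun j _ => hc j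
  change fderiv ℝ (fun y => pieceSum M i (thetaDil n) F S y k.2) x _ = _
  rw [fderiv_comp_apply (hb.differentiable (by simp) x)]
  refine congrArg (fun v : Cm m => v k.2) ?_
  change fderiv ℝ (fun y => ∑ j ∈ S, conv (thetaDil n j) (piece M i j (F j)) y) x _ = _
  rw [fderiv_fun_sum fun j _ => (hc j).differentiable (by simp) x, sum_apply]
  refine sum_congr rfl fun j _ => ?_
  rw [fderiv_conv_apply (contDiff_thetaDil j) (hasCompactSupport_thetaDil j) (hloc j)]
  exact congrArg (fun ρ => conv ρ (piece M i j (F j)) x) (pd_thetaDil j k.1)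

theorem reg_tst_eq_of_surf_rot {X : L2up n m} {a : Rn n → Cnm n m} {g : Rn n → ℝ}
    (hg : Integrable fun x => g x • a x) {c : Fin n → Rn n → Cm m}
    (hc : ∀ q, Integrable fun x => g x • c q x) (hac : ∀ x k, a x k = c k.1 x k.2)
    (h : ∀ q, surf (rot q X) (tst g) = ∫ x, g x • c q x) : reg X (tst g) = ∫ x, g x • a x := by
  ext k
  rw [show k = (k.1, k.2) from rfl, reg_apply, h]
  have e1 := (proj k.2 : Cm m →L[ℂ] ℂ).integral_comp_comm (hc k.1)
  have e2 := (proj k : Cnm n m →L[ℂ] ℂ).integral_comp_comm hg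
  refine e1.symm.trans (Eq.trans (integral_congr_ae (ae_of_all _ fun x => ?_)) e2)
  change g x • c k.1 x k.2 = g x • a x k
  rw [hac]

/-- The kernels carry the factor `2 ^ (-j)` and only scales `j ≥ l` contribute, so the geometric
series gives a primitive of size `2 ^ (-l)` times the height, as gradient atoms require. -/
theorem norm_pieceSum_thetaDil_le (hn : 1 ≤ n)
    (hne : LowLevels M) (hB : 0 ≤ B)
    {F : ℤ → Rn n → Cm m}
    (hF : ∀ j x y, ‖x - y‖ ≤ 5 * 2 ^ (-j) → ‖F j y‖ₑ ≤ ofReal B * M x)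
    (i : Ix n) (S : Finset ℤ) (x : Rn n) :
    ‖pieceSum M i (thetaDil n) F S x‖ ≤ 4 * (∫ y, |theta n y|) * B * 2 ^ i.1 * 2 ^ (-i.2.1) := by
  have e : pieceSum M i (thetaDil n) F S x =
      ∑ j ∈ S, (2 : ℝ) ^ (-j) • conv (dilate j (theta n)) (piece M i j (F j)) x := by
    refine sum_congr rfl fun j _ => ?_
    simp only [conv, thetaDil]
    rw [← integral_smul]
    simp only [mul_smul]
  rw [e]
  exact norm_sum_zpow_conv_piece_le hn hne hB hF (fun j => (contDiff_dilate contDiff_theta j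
    ).continuous.integrable_of_hasCompactSupport (hasCompactSupport_dilate hasCompactSupport_theta j))
    (fun j => (integral_abs_dilate j _).le) (dilate_eq_zero fun _ => theta_eq_zero) i S x

/-- Field with tangential gradient `conv (dilate j (∇ theta)) f` at the boundary. -/
def gradExt (j : ℤ) : L2bd n m →L[ℂ] L2up n m :=
  bext (hasCompactSupport_thetaDil j) (contDiff_thetaDil j)

theorem surf_rot_gradExt_tst (j : ℤ) (f : L2bd n m) {g : Rn n → ℝ} (hg : HasCompactSupport g)
    (hg' : ContDiff ℝ ∞ g) (q : Fin n) : surf (rot q (gradExt j f)) (tst g) =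
      ∫ x, g x • conv (dilate j (pd q (theta n))) f x := by
  rw [← pd_thetaDil]
  exact surf_rot_bext_tst _ _ f hg hg' q

/-- Coercivity holds only on gradients with zero trace, so an arbitrary extension of the boundary
data is corrected by such a gradient to become a solution. The pieces are extended by `gradExt` and
corrected; their sum is compared with the corrected average of the given field through the
regularity data, which determines the corrected field. -/
theorem exists_neumann_le (hn : 1 ≤ n) (hp : 0 < p) (hp1 : p ≤ 1) {lam : ℝ}
    (hlam : 0 < lam) (C : ℝ≥0) :
    ∃ K : ℝ≥0, ∀ (A : Coeff n m) (Λ : ℝ), IsBoundedCoeff A Λ → Garding A lam →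
      (∀ R T, IsDataPair A R T → (∃ a, IsSmoothGradAtom p a ∧ IsFunction R a) → hardyNorm p T ≤ C) →
      ∀ R T, IsDataPair A R T → hardyPow p R ≠ ⊤ → hardyPow p T ≤ K * hardyPow p R := by
  obtain ⟨Kκ, hKκ, hfl⟩ := exists_fluxSmear_le (n := n) (m := m)
  obtain ⟨Kφ, hKφ, hφ⟩ := exists_smear_le (m := m) (hasCompactSupport_phi (n := n)) contDiff_phi
  obtain ⟨Cw, hCw⟩ := exists_sum_whitney_le hn hp
  set B := Kκ + Kφ with hB
  set κ : ℝ := ∑ q, ∫ y, |pd q (theta n) y|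
  set κ' : ℝ := ∫ y, |theta n y|
  have hκq : ∀ q : Fin n, 0 ≤ ∫ y, |pd q (theta n) y| := fun q => integral_nonneg fun y => abs_nonneg _
  have hκ : 0 ≤ κ := sum_nonneg fun q _ => hκq q
  have hκ' : 0 ≤ κ' := integral_nonneg fun y => abs_nonneg _
  set C₁ : ℝ := (4 + 4 * κ + 4 * κ * (2 + 8 * n ^ 2)) * B
  -- One height serves both normalizations: `n * m * C₁` bounds the gradient by the sum of its
  -- entries, `κ' * B` bounds the primitive, and `1` ensures positivity.
  set C₀ : ℝ := n * m * C₁ + κ' * B + 1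
  have hC₀ : 0 < C₀ := by positivity
  refine ⟨(ofReal (atomScale n p C₀ 4) ^ p * (C : ℝ≥0∞) ^ p).toNNReal * Cw,
    fun A Λ hA hG hyp R T ⟨u, G, hu, hR, hT⟩ hfin => ?_⟩
  have hco := coercive_of_garding hA (U := upper n) (lam := lam) hG
  obtain ⟨S₀, hS₀, hS₀'⟩ := exists_solution_operator (energySpace n m (upper n))
    (isClosed_energySpace _) (coeffOp A hA) hlam hco
  have hmono : ∀ {v : L2up n m}, v ∈ energySpace n m (upper n) → v ∈ energySpace n m univ :=
    fun h => energySpace_mono (Set.subset_univ _) h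
  -- On V, `P` replaces a field by the energy solution with the same regularity data: a gradient
  -- with zero trace is subtracted so that the equation holds.
  set P : L2up n m →L[ℂ] L2up n m := ContinuousLinearMap.id ℂ _ - S₀.comp (coeffOp A hA)
  have hP : ∀ X, P X = X - S₀ (coeffOp A hA X) := fun X => rfl
  have hPV : ∀ {X}, X ∈ energySpace n m univ → P X ∈ energySpace n m univ := fun hX =>
    Submodule.sub_mem _ hX (hmono (hS₀ _))
  have hP0 : ∀ X, ∀ v ∈ energySpace n m (upper n), ⟪v, coeffOp A hA (P X)⟫_ℂ = 0 := fun X v hv => by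
    rw [hP, map_sub, inner_sub_right, hS₀' _ v hv, sub_self]
  have hPreg : ∀ X, reg (P X) = reg X := fun X => by
    rw [hP, reg_sub, reg_eq_zero_of_mem (hS₀ _), sub_zero]
  -- Fields in V with equal regularity data differ by a limit of test gradients supported inside,
  -- and the correction removes exactly such differences by uniqueness in the coercive problem.
  have hPeq : ∀ {X X'}, X ∈ energySpace n m univ → X' ∈ energySpace n m univ →
      reg X = reg X' → P X = P X' := fun {X X'} hX hX' h => by
    rw [← sub_eq_zero, ← map_sub, hP, sub_eq_zero]
    have := mem_energySpace_upper_of_reg_eq_zero (Submodule.sub_mem _ hX hX')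
      (by rw [reg_sub, h, sub_self])
    exact eq_of_coercive hlam hco (Submodule.sub_mem _ this (hS₀ _)) fun v hv => (hS₀' _ v hv).symm
  obtain ⟨F, hF⟩ : ∃ F : L2up n m, F =ᵐ[upperMeasure n] fun z => vec (G z) :=
    ⟨hu.1.cls, hu.1.coeFn_cls⟩
  have hE := hu.1.congr hF
  have hFV := mem_energySpace_univ hE
  have hPF : P F = F := by
    rw [hP, sub_eq_self]
    refine eq_of_coercive hlam hco (Submodule.sub_mem _ (hS₀ _) (Submodule.zero_mem _)) fun v hv => ?_
    rw [hS₀' _ v hv, hu.inner_eq_zero hA hF v hv, map_zero, inner_zero_right]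
  set L : L2up n m →L[ℂ] L2up n m := -(coeffOp A hA).comp P
  have hL' : ∀ X, L X = -coeffOp A hA (P X) := fun X => rfl
  have hTL : T = surf (L F) := by rw [hL', hPF, surf_neg, hT.eq_neg_surf hA hF]
  have hRF := hR.eq_reg hE
  rw [hTL, hRF]
  rw [hRF] at hfin
  set M := grandMax (reg F)
  have hne := nonempty_level hn hp hfin
  have hB0 : 0 ≤ B := by positivity
  have hFj : ∀ j x y, ‖x - y‖ ≤ 5 * 2 ^ (-j) → ‖fluxSmear F j y‖ₑ ≤ ofReal B * M x :=
    fun j x y h => (hfl F j x y h).trans (by gcongr; simp [hB, hKφ.le])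
  have hVj : ∀ q j x y, ‖x - y‖ ≤ 5 * 2 ^ (-j) →
      ‖smear (rot q F) (dilate j (phi n)) y‖ₑ ≤ ofReal B * M x := fun q j x y h =>
    (hφ _ j x y h).trans (mul_le_mul' (ofReal_le_ofReal (by simp [hB, hKκ.le]))
      (grandMax_mono (enorm_surf_rot_le F q) x))
  have hFc := continuous_fluxSmear F
  have hL : ∀ j, MemLp (fluxSmear F j) 2 volume := fun j =>
    memLp_two_of_le hp hp1 hfin (hFc j) (by have := two_zpow_pos (-j); positivity) (hFj j)
  have hρ : ∀ q j, ContDiff ℝ ∞ (dilate j (pd q (theta n))) := fun q j =>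
    contDiff_dilate (contDiff_pd contDiff_theta q) j
  have hρc : ∀ q j, HasCompactSupport (dilate j (pd q (theta n))) := fun q j =>
    hasCompactSupport_dilate (hasCompactSupport_pd hasCompactSupport_theta q) j
  have hr : ∀ j z, 2 ^ (-j) < ‖z‖ → thetaDil n j z = 0 := fun j z hz => by
    rw [thetaDil, dilate_eq_zero (fun _ => theta_eq_zero) j z hz, mul_zero]
  have hb : ∀ i S, ContDiff ℝ ∞ (pieceSum M i (thetaDil n) (fluxSmear F) S) := fun i S =>
    contDiff_pieceSum hn contDiff_thetaDil hasCompactSupport_thetaDil hL i S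
  rw [ENNReal.coe_mul, ENNReal.coe_toNNReal (by finiteness), mul_assoc]
  refine hardyPow_le_of_piece hn hp hp1 (hCw M) hB0 hfin hFj hL gradExt
    (surfHom.comp (L : L2up n m →+ L2up n m))
    (fun ψ => (continuous_surf_apply ψ).comp L.continuous)
    _ (fun i j => rfl) (fun i _ a b => ?_) fun ψ => ?_
  · rw [mul_right_comm, ← ofReal_atomScale_rpow hp hC₀]
    have h2 := two_zpow_pos (-i.2.1)
    have h3 := two_zpow_pos i.1
    refine hardyPow_surf_le_of_atom hp hA hyp (hPV (Submodule.sum_mem _ fun j _ =>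
      bext_mem_energySpace _ _ _)) (hP0 _) (hb i (Finset.Ico a b)) (by positivity) (by positivity)
      (fun x => (norm_pieceSum_thetaDil_le hn hne hB0 hFj i _ x).trans ?_) (fun x => ?_)
      (fun x hx => (norm_sub_ctr_le_of_pieceSum_ne_zero hn hne hr hx).trans (by linarith))
      fun g hg hg' => ?_
    · have : κ' * B ≤ C₀ := by
        have : 0 ≤ n * m * C₁ := by positivity
        linarith
      calc 4 * κ' * B * 2 ^ i.1 * 2 ^ (-i.2.1) = 4 * 2 ^ (-i.2.1) * (κ' * B * 2 ^ i.1) := by ring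
        _ ≤ _ := by gcongr
    · have hq : ∀ q, ‖pieceSum M i (fun j => dilate j (pd q (theta n))) (fluxSmear F)
          (Finset.Ico a b) x‖ ≤ C₁ * 2 ^ i.1 := fun q =>
        norm_sum_conv_piece_le hne hB0 hFc hFj (hVj q) (fun j => (hρ q j).continuous)
          (fun j => (integral_abs_dilate j _).le.trans
            (single_le_sum (fun q _ => hκq q) (Finset.mem_univ q)))
          (fun j => dilate_eq_zero (pd_eq_zero contDiff_theta (fun _ => theta_eq_zero) q) j)
          (conv_fluxSmear hn hFV q) i a b x
      calc _ ≤ ∑ k : Fin n × Fin m, ‖tanGrad (pieceSum M i (thetaDil n) (fluxSmear F)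
            (Finset.Ico a b)) x k‖ := norm_le_sum_apply _
        _ ≤ ∑ k : Fin n × Fin m, C₁ * 2 ^ i.1 := sum_le_sum fun k _ => by
            rw [tanGrad_pieceSum_apply hn hL]
            exact (norm_apply_le _ _).trans (hq k.1)
        _ = n * m * C₁ * 2 ^ i.1 := by simp [mul_assoc]
        _ ≤ C₀ * 2 ^ i.1 := by
            gcongr
            have : 0 ≤ κ' * B := by positivity
            linarith
    · rw [hPreg]
      refine reg_tst_eq_of_surf_rot (integrable_smul_of_compactSupport hg hg'.continuous
        (contDiff_tanGrad (hb i _)).continuous)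
        (fun q => integrable_smul_of_compactSupport hg hg'.continuous (contDiff_pieceSum hn (hρ q) (hρc q) hL i _).continuous)
        (tanGrad_pieceSum_apply hn hL i _) fun q => ?_
      rw [map_sum, surf_sum, sum_apply_schwartz, integral_smul_pieceSum hn (hρ q) (hρc q) hL i _ hg hg']
      exact sum_congr rfl fun j _ => surf_rot_gradExt_tst j _ hg hg' q
  · refine (tendsto_surf_havg hn L F ψ).congr fun N => ?_
    have hX : ∑ j ∈ Finset.Ico (-N : ℤ) N, gradExt j ((hL j).toLp _) ∈ energySpace n m univ :=
      Submodule.sum_mem _ fun j _ => bext_mem_energySpace _ _ _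
    -- The averaged field and the sum of the extensions are different fields in V with the same
    -- regularity data. They therefore have the same corrected solution and the same Neumann data.
    refine congrArg (fun X => surf (-coeffOp A hA X) ψ) (hPeq (havg_mem_energySpace
      (contDiff_phi_sub N).continuous (hasCompactSupport_phi_sub N) hFV) hX ?_)
    refine eq_of_forall_tst fun g hg hg' => ?_
    ext k
    rw [show k = (k.1, k.2) from rfl, reg_apply, reg_apply, rot_havg (contDiff_phi_sub N).continuous
      (hasCompactSupport_phi_sub N), surf_havg_tst_eq_sum (hρ k.1) (hρc k.1) hFc
      (conv_fluxSmear hn hFV k.1) N hg hg', map_sum, surf_sum, sum_apply_schwartz]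
    refine congrArg (fun v : Cm m => v k.2) (sum_congr rfl fun j _ => ?_)
    rw [surf_rot_gradExt_tst j _ hg hg' k.1]
    exact integral_smul_conv_eq (MemLp.coeFn_toLp _).symm

/-! ### From powers to quasi-norms, and the theorem -/

theorem hardyNorm_le_of_hardyPow {E' : Type*} [NormedAddCommGroup E'] [NormedSpace ℂ E']
    (hp : 0 < p) {R : 𝓢'(Rn n, E')} {K : ℝ≥0} (h : hardyPow p R ≠ ⊤ → hardyPow p T ≤ K * hardyPow p R) :
    hardyNorm p T ≤ (((K + 1) ^ (1 / p) : ℝ≥0) : ℝ≥0∞) * hardyNorm p R := by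
  refine hardyNorm_le_of_hardyPow_le hp ?_
  -- For infinite data the claim must be trivially true, which needs a nonzero constant because `0 *
  -- ∞ = 0`; hence `K + 1` in place of `K`.
  by_cases hR : hardyPow p R = ⊤
  · rw [hR, ENNReal.mul_top (by simp)]
    exact le_top
  · exact (h hR).trans (by gcongr; simp)

end

end HalfSpace

open HalfSpace
theorem mainTheorem12 (n m : ℕ) (hn : 1 ≤ n) (p : ℝ)
    (hp : (n : ℝ) / (n + 1) < p) (hp1 : p ≤ 1)
    (Λ lam : ℝ) (hlam : 0 < lam) (C : ℝ≥0) :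
    (∃ C' : ℝ≥0, ∀ A : Coeff n m, IsBoundedCoeff A Λ → Garding A lam →
      (∀ (u : Pt n → Cm m) (G : Pt n → Grad n m) (R : 𝓢'(Rn n, Cnm n m)) (T : 𝓢'(Rn n, Cm m)),
        IsEnergySolution A u G → IsRegularityData u R → IsConormal A G T →
        (∃ a, IsSmoothGradAtom p a ∧ IsFunction R a) →
        hardyNorm p T ≤ C) →
      ∀ (u : Pt n → Cm m) (G : Pt n → Grad n m) (R : 𝓢'(Rn n, Cnm n m)) (T : 𝓢'(Rn n, Cm m)),
        IsEnergySolution A u G → IsRegularityData u R → IsConormal A G T →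
        hardyNorm p T ≤ C' * hardyNorm p R) ∧
    (∃ C' : ℝ≥0, ∀ A : Coeff n m, IsBoundedCoeff A Λ → StrongGarding A lam →
      (∀ (u : Pt n → Cm m) (G : Pt n → Grad n m) (R : 𝓢'(Rn n, Cnm n m)) (T : 𝓢'(Rn n, Cm m)),
        IsEnergySolution A u G → IsRegularityData u R → IsConormal A G T →
        (∃ a, IsSmoothAtom p a ∧ IsFunction T a) →
        hardyNorm p R ≤ C) →
      ∀ (u : Pt n → Cm m) (G : Pt n → Grad n m) (R : 𝓢'(Rn n, Cnm n m)) (T : 𝓢'(Rn n, Cm m)),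
        IsEnergySolution A u G → IsRegularityData u R → IsConormal A G T →
        hardyNorm p R ≤ C' * hardyNorm p T) := by
  have hp0 : 0 < p := lt_of_le_of_lt (by positivity) hp
  obtain ⟨K, hK⟩ := exists_neumann_le (n := n) (m := m) hn hp0 hp1 hlam C
  obtain ⟨K', hK'⟩ := exists_regularity_le (n := n) (m := m) hn hp0 hp1 hlam C
  refine ⟨⟨(K + 1) ^ (1 / p), fun A hA hG hyp u G R T hu hR hT => ?_⟩,
    ⟨(K' + 1) ^ (1 / p), fun A hA hG hyp u G R T hu hR hT => ?_⟩⟩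
  · exact hardyNorm_le_of_hardyPow (T := T) (R := R) hp0 (hK A Λ hA hG
      (fun R T ⟨u, G, h, h', h''⟩ => hyp u G R T h h' h'') R T ⟨u, G, hu, hR, hT⟩)
  · exact hardyNorm_le_of_hardyPow (T := R) (R := T) hp0 (hK' A Λ hA hG
      (fun R T ⟨u, G, h, h', h''⟩ => hyp u G R T h h' h'') R T ⟨u, G, hu, hR, hT⟩)
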